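/- **Theorem 4.1.** For $\alpha\in\mathbb R$ let $L_2^\alpha$ be the space of (measurable, complex-valued) functions $f$ on $\mathbb R$ with $(1+x_+)^\alpha f\in L_2(\mathbb R)$, $x_+=\max(x,0)$, with norm $\|f\|_{L_2^\alpha}=\|(1+x_+)^\alpha f\|_{L_2}$. For $\epsilon>0$ let $\rho_{3/4,\epsilon}$ be any strictly increasing function in $C^\infty(\mathbb R)$ with $\rho_{3/4,\epsilon}(x)=e^{2\epsilon x}$ for $x\le -1$, $\rho_{3/4,\epsilon}(x)=(1+x)^{3/2}$ for $x\ge 0$, and $\rho_{3/4,\epsilon}'>0$ on $(-1,0)$. Let $a,b,\lambda,\beta\in\mathbb R$, let $d\in L_\infty(\mathbb R)$ be real-valued, and let $T>0$. Consider the problem $$ i u_t + a u_{xx} + i b u_x + i u_{xxx} + \lambda |u|u + i\beta(|u|u)_x + i d(x)u = 0,\qquad u(0,x)=u_0(x),\quad x\in\mathbb R. \tag{1}$$ A function $u\in L_\infty(0,T;L_2(\mathbb R))$ is called a weak solution of (1) on $(0,T)\times\mathbb R$ if for every $\phi\in C^1([0,T];L_2(\mathbb R))\cap C([0,T];H^3(\mathbb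 R))$ with $\phi|_{t=T}=0$ $$\int_0^T\!\!\int_{\mathbb R}\bigl(iu\phi_t - a u\phi_{xx} + i b u\phi_x + i u\phi_{xxx} - \lambda|u|u\phi + i\beta|u|u\phi_x - i d(x)u\phi\bigr)\,dx\,dt + i\int_{\mathbb R}u_0\,\phi|_{t=0}\,dx=0 .$$ Then for all $M>0$ and $\epsilon>0$ there is a constant $c=c(T,M,\epsilon)$, which depends besides on nothing but the equation (that is, on $a,b,\lambda,\beta,d$), such that the following holds. If $u_0,\widetilde u_0\in L_2^{3/4}$ and $u,\widetilde u\in L_\infty(0,T;L_2^{3/4})$ are weak solutions of (1) with the initial functions $u_0$ and $\widetilde u_0$ respectively, and $\|u\|_{L_\infty(0,T;L_2^{3/4})}\le M$, $\|\widetilde u\|_{L_\infty(0,T;L_2^{3/4})}\le M$, then $$\operatorname*{ess\,sup}_{t\in(0,T)}\int_{\mathbb R}|u(t,x)-\widetilde u(t,x)|^2\rho_{3/4,\epsilon}(x)\,dx\ \le\ c\int_{\mathbb R}|u_0(x)-\widetilde u_0(x)|^2\rho_{3/4,\epsilon}(x)\,dx .$$ In particular, for every $u_0\in L_2^{3/4}$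 a weak solution of (1) is unique in $L_\infty(0,T;L_2^{3/4})$: any two weak solutions in this space with the initial function $u_0$ coincide almost everywhere on $(0,T)\times\mathbb R$. -/

import Mathlib

open MeasureTheory Set
open scoped ENNReal NNReal ContDiff

noncomputable section

namespace HNLS

/-- The restriction of Lebesgue measure to the time interval `(0, T)`. -/
def timeMeasure (T : ℝ) : Measure ℝ := volume.restrict (Ioo 0 T)

/-- Lebesgue measure on the strip `(0, T) × ℝ`. -/
def stripMeasure (T : ℝ) : Measure (ℝ × ℝ) := (timeMeasure T).prod volume

/-- The function `(1 + x₊) ^ α * f x`, where `x₊ = max x 0`. -/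
def weighted (α : ℝ) (f : ℝ → ℂ) (x : ℝ) : ℂ := (((1 + max x 0) ^ α : ℝ) : ℂ) * f x

/-- The norm of `f` in the space `L₂^α` of functions with `(1 + x₊) ^ α * f ∈ L₂(ℝ)`. -/
def weightedNorm (α : ℝ) (f : ℝ → ℂ) : ℝ≥0∞ := eLpNorm (weighted α f) 2 volume

/-- `f` belongs to the space `L₂^α`. -/
def MemL2 (α : ℝ) (f : ℝ → ℂ) : Prop := MemLp (weighted α f) 2 volume

/-- The norm of `u` in `L_∞(0, T; L₂^α)`. -/
def linftyNorm (T α : ℝ) (u : ℝ → ℝ → ℂ) : ℝ≥0∞ :=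
  essSup (fun t => weightedNorm α (u t)) (timeMeasure T)

/-- `u = u(t, x)` belongs to `L_∞(0, T; L₂^α)`. -/
def MemLinftyL2 (T α : ℝ) (u : ℝ → ℝ → ℂ) : Prop :=
  AEStronglyMeasurable (Function.uncurry u) (stripMeasure T) ∧ linftyNorm T α u < ⊤

/-- `g` is the weak derivative of `f` on the real line. -/
def IsWeakDeriv (f g : ℝ → ℂ) : Prop :=
  ∀ η : ℝ → ℝ, ContDiff ℝ ∞ η → HasCompactSupport η →
    ∫ x, ((deriv η x : ℝ) : ℂ) * f x = -∫ x, ((η x : ℝ) : ℂ) * g x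

/-- `φ` is a test function from `C¹([0, T]; L₂) ∩ C([0, T]; H³)` that vanishes at `t = T`;
`φt` is its time derivative and `φ₁, φ₂, φ₃` are its first three weak space derivatives.
Continuity into `H³` is continuity into `L₂` of the function and of these derivatives. -/
structure IsTestFunction (T : ℝ) (φ φt φ₁ φ₂ φ₃ : ℝ → Lp ℂ 2 (volume : Measure ℝ)) : Prop where
  hasDeriv : ∀ t ∈ Icc 0 T, HasDerivWithinAt φ (φt t) (Icc 0 T) t
  continuousOn_deriv : ContinuousOn φt (Icc 0 T)
  weakDeriv₁ : ∀ t ∈ Icc 0 T, IsWeakDeriv (φ t) (φ₁ t)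
  weakDeriv₂ : ∀ t ∈ Icc 0 T, IsWeakDeriv (φ₁ t) (φ₂ t)
  weakDeriv₃ : ∀ t ∈ Icc 0 T, IsWeakDeriv (φ₂ t) (φ₃ t)
  continuousOn₁ : ContinuousOn φ₁ (Icc 0 T)
  continuousOn₂ : ContinuousOn φ₂ (Icc 0 T)
  continuousOn₃ : ContinuousOn φ₃ (Icc 0 T)
  terminal : φ T = 0

/-- `u` is a weak solution on `(0, T) × ℝ` of the initial value problem
`i u_t + a u_xx + i b u_x + i u_xxx + lam |u| u + i β (|u| u)_x + i d(x) u = 0`, `u(0, x) = u₀(x)`.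
The integral over the strip is written as an iterated integral; for `u` in `L_∞(0, T; L₂)` and
`d` in `L_∞` all the integrals converge absolutely, because `H³` embeds in `C²_b`. -/
def IsWeakSolution (a b lam β : ℝ) (d : ℝ → ℝ) (u₀ : ℝ → ℂ) (T : ℝ) (u : ℝ → ℝ → ℂ) : Prop :=
  MemLinftyL2 T 0 u ∧
  ∀ φ φt φ₁ φ₂ φ₃ : ℝ → Lp ℂ 2 (volume : Measure ℝ), IsTestFunction T φ φt φ₁ φ₂ φ₃ →
    (∫ t in Ioo 0 T, ∫ x,
      (Complex.I * u t x * φt t x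
        - (a : ℂ) * u t x * φ₂ t x
        + Complex.I * (b : ℂ) * u t x * φ₁ t x
        + Complex.I * u t x * φ₃ t x
        - (lam : ℂ) * ((‖u t x‖ : ℝ) : ℂ) * u t x * φ t x
        + Complex.I * (β : ℂ) * ((‖u t x‖ : ℝ) : ℂ) * u t x * φ₁ t x
        - Complex.I * ((d x : ℝ) : ℂ) * u t x * φ t x))
      + Complex.I * ∫ x, u₀ x * φ 0 x = 0

/-- `ρ` is an admissible choice of the weight `ρ_{α,ε}`, for `α > 0` and `ε > 0`. -/
structure IsWeight (α ε : ℝ) (ρ : ℝ → ℝ) : Prop where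
  contDiff : ContDiff ℝ ∞ ρ
  strictMono : StrictMono ρ
  eq_left : ∀ x ≤ -1, ρ x = Real.exp (2 * ε * x)
  eq_right : ∀ x, 0 ≤ x → ρ x = (1 + x) ^ (2 * α)
  deriv_pos : ∀ x ∈ Ioo (-1 : ℝ) 0, 0 < deriv ρ x

/-- The weighted integral `∫ |f(x)|² ρ(x) dx` of a nonnegative function, as an element of
`[0, ∞]`. -/
def weightedMass (ρ : ℝ → ℝ) (f : ℝ → ℂ) : ℝ≥0∞ := ∫⁻ x, ENNReal.ofReal (‖f x‖ ^ 2 * ρ x)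

end HNLS

end

/-!
The proof is by duality. The difference `w = u - v` of two weak solutions solves a linear equation
in which the nonlinearity appears as `Q w`, where `Q = (|u|u - |v|v) / (u - v)` satisfies
`|Q| ≤ |u| + |v|`, so that `Q` is bounded in `L₂^(3/4)` uniformly in time. Let `φ` solve the
backward dual problem

`φ_t = -φ_xxx - i a φ_xx - b φ_x - Q (β φ_x + i λ φ) + θ(t) G(x)`, `φ(T) = 0`,

with `θ ≥ 0` and a test function `G`. If `φ` is admissible in the weak formulation, then the
pairing of `w` with `θ G` equals the contribution of the damping `d` minus `∫ (u₀ - v₀) φ(0)`.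
Hence an estimate of `φ(t)` in `L₂` with a weight `κ`, by `∫_t^T θ` times the norm of `G` with the
same weight, bounds the tested norm of `w` in `L₂` with the weight `1 / κ`. A Grönwall argument
absorbs the damping, and `1 / κ` is comparable to `ρ`.

*The weight.* For `κ = 1 / (e^(c x) + δ) + ℓ^(-3/2)`, with `ℓ` a smooth version of `1 + x₊`, `c = 2ε`
and `δ = 0`, the function `1 / κ` is comparable to `ρ_(3/4, ε)`. As `κ` decreases, the third
derivative in the equation produces the smoothing term `∫ |φ_x|² n` with `n = -κ'` in the energy
identity. The coefficient term `Q φ_x φ κ` is closed by `κ ≲ n ℓ` and an interpolation inequality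
for `sup |φ|² n ℓ^(1/2)`: the loss in `ℓ` is exactly the weight `ℓ^(3/4)` available for `Q`. The
same energy method for `φ_x` bounds `β φ_x + i λ φ` in `L₂(0, T; L_∞)` with a weight
(`IsDualSolution.exists_bounds`).

*The regularization.* The dual problem is solved with `Q` replaced by a continuous compactly
supported coefficient `q` and `q (β φ_x + i λ φ)` replaced by its convolution with a mollifier `j`.
On the Fourier side this is a linear ordinary differential equation in `L₂` with a bounded
operator, once the dispersive group is factored out (`exists_dualSolution`). The number `δ > 0`
keeps `κ` bounded, so that all energy identities are between finite quantities; where `e^(c x) ≥ δ`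
the weight still satisfies `κ ≲ n ℓ`, and the support of `q` lies there for small `δ`. The a priori
bounds do not depend on `q`, `j` and `δ`, which allows to pass to the limit in the tested identity
(`exists_tested_le`). `ae_sqrt_integral_le_of_tested` turns its outcome into a pointwise bound in
time by a countable norming family of test functions.
-/

open Filter Topology FourierTransform SchwartzMap BoundedContinuousFunction

noncomputable section

namespace HNLS

section

/-! ### Multiplication operators and the Fourier transform on `L₂` -/

/-- The space `L₂(ℝ)` of complex-valued functions. -/
abbrev L2 := Lp ℂ 2 (volume : Measure ℝ)

lemma memLp_mul_boundedContinuous (m : ℝ →ᵇ ℂ) {f : ℝ → ℂ} (hf : MemLp f 2 volume) :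
    MemLp (fun x => m x * f x) 2 volume := by
  refine MemLp.of_le_mul (c := ‖m‖) hf (m.continuous.aestronglyMeasurable.mul hf.1) ?_
  filter_upwards with x
  rw [norm_mul]
  gcongr
  exact m.norm_coe_le_norm x

/-- Multiplication by a bounded continuous function, as a bounded operator on `L₂(ℝ)` that depends
linearly and continuously on the function. -/
def mulL2 : (ℝ →ᵇ ℂ) →L[ℂ] L2 →L[ℂ] L2 :=
  LinearMap.mkContinuous₂
    (LinearMap.mk₂ ℂ (fun (m : ℝ →ᵇ ℂ) (f : L2) =>
        (memLp_mul_boundedContinuous m (Lp.memLp f)).toLp (fun x => m x * f x))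
      (fun m m' f => by
        rw [← MemLp.toLp_add]
        exact MemLp.toLp_congr _ _ (by filter_upwards with x; simp [add_mul]))
      (fun c m f => by
        rw [← MemLp.toLp_const_smul]
        exact MemLp.toLp_congr _ _ (by filter_upwards with x; simp [mul_assoc]))
      (fun m f f' => by
        rw [← MemLp.toLp_add]
        refine MemLp.toLp_congr _ _ ?_
        filter_upwards [Lp.coeFn_add f f'] with x hx
        rw [hx, Pi.add_apply, Pi.add_apply, mul_add])
      (fun c m f => by
        rw [← MemLp.toLp_const_smul]
        refine MemLp.toLp_congr _ _ ?_
        filter_upwards [Lp.coeFn_smul c f] with x hx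
        rw [hx, Pi.smul_apply, Pi.smul_apply, mul_smul_comm])) 1
    (fun m f => by
      rw [one_mul]
      refine Lp.norm_le_mul_norm_of_ae_le_mul ?_
      simp only [LinearMap.mk₂_apply]
      filter_upwards [(memLp_mul_boundedContinuous m (Lp.memLp f)).coeFn_toLp] with x hx
      rw [hx, norm_mul]
      gcongr
      exact m.norm_coe_le_norm x)

lemma coeFn_mulL2 (m : ℝ →ᵇ ℂ) (f : L2) : mulL2 m f =ᵐ[volume] fun x => m x * f x :=
  (memLp_mul_boundedContinuous m (Lp.memLp f)).coeFn_toLp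

lemma mulL2_toLp (m : ℝ →ᵇ ℂ) {f : ℝ → ℂ} (hf : MemLp f 2 volume) :
    mulL2 m (hf.toLp f) = (memLp_mul_boundedContinuous m hf).toLp (fun x => m x * f x) := by
  refine Lp.ext ?_
  filter_upwards [coeFn_mulL2 m (hf.toLp f), hf.coeFn_toLp,
    (memLp_mul_boundedContinuous m hf).coeFn_toLp] with x h1 h2 h3
  rw [h1, h2, h3]

lemma mulL2_mulL2 (m m' : ℝ →ᵇ ℂ) (f : L2) : mulL2 m (mulL2 m' f) = mulL2 (m * m') f := by
  refine Lp.ext ?_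
  filter_upwards [coeFn_mulL2 m (mulL2 m' f), coeFn_mulL2 m' f, coeFn_mulL2 (m * m') f]
    with x h1 h2 h3
  rw [h1, h2, h3, BoundedContinuousFunction.mul_apply, mul_assoc]

/-- A locally integrable function that represents the same tempered distribution as an element of
`L₂` is equal to it almost everywhere. -/
lemma ae_eq_of_forall_schwartz (f : L2) {g : ℝ → ℂ} (hg : LocallyIntegrable g volume)
    (h : ∀ η : 𝓢(ℝ, ℂ), ∫ x, η x * f x = ∫ x, η x * g x) : f =ᵐ[volume] g := by
  have hf : LocallyIntegrable f volume := (Lp.memLp f).locallyIntegrable (by norm_num)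
  refine ae_eq_of_integral_contDiff_smul_eq hf hg fun η hη hc => ?_
  have hc' : HasCompactSupport (fun x => ((η x : ℝ) : ℂ)) := hc.comp_left (g := fun y : ℝ => (y : ℂ)) (by simp)
  have hη' : ContDiff ℝ ∞ (fun x => ((η x : ℝ) : ℂ)) := Complex.ofRealCLM.contDiff.comp hη
  simpa using h (hc'.toSchwartzMap hη')

lemma integral_fourier_mul_eq_flip {f g : ℝ → ℂ} (hf : Integrable f) (hg : Integrable g) :
    ∫ x, 𝓕 f x * g x = ∫ x, f x * 𝓕 g x := by
  have := VectorFourier.integral_fourierIntegral_smul_eq_flip (μ := volume) (ν := volume)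
    (L := innerₗ ℝ) (f := f) (g := g)
    Real.continuous_fourierChar (by exact continuous_inner) hf hg
  simp only [smul_eq_mul, flip_innerₗ] at this
  exact this

/-- For `f ∈ L₁ ∩ L₂` the Fourier transform of `L₂` theory is given by the Fourier integral. -/
lemma coeFn_fourier_toLp {f : ℝ → ℂ} (hf : Integrable f) (hf2 : MemLp f 2 volume) :
    (𝓕 (hf2.toLp f) : L2) =ᵐ[volume] 𝓕 f := by
  refine ae_eq_of_forall_schwartz _ (VectorFourier.fourierIntegral_continuous
    Real.continuous_fourierChar (by exact continuous_inner) hf).locallyIntegrable fun η => ?_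
  have h1 := congrArg (fun T : 𝓢'(ℝ, ℂ) => T η)
    (Lp.fourier_toTemperedDistribution_eq (hf2.toLp f))
  simp only [TemperedDistribution.fourier_apply, Lp.toTemperedDistribution_apply,
    smul_eq_mul] at h1
  rw [← h1]
  have h2 := integral_fourier_mul_eq_flip η.integrable hf
  rw [← h2]
  refine integral_congr_ae ?_
  filter_upwards [hf2.coeFn_toLp] with x hx
  rw [hx, SchwartzMap.fourier_coe]

lemma coeFn_fourierInv_toLp {f : ℝ → ℂ} (hf : Integrable f) (hf2 : MemLp f 2 volume) :
    (𝓕⁻ (hf2.toLp f) : L2) =ᵐ[volume] 𝓕⁻ f := by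
  have hneg : (fun x => 𝓕 f (-x)) = 𝓕⁻ f := by
    ext x; rw [Real.fourierInv_eq_fourier_neg]
  refine ae_eq_of_forall_schwartz _ ?_ fun η => ?_
  · rw [← hneg]
    exact ((VectorFourier.fourierIntegral_continuous
      Real.continuous_fourierChar (by exact continuous_inner) hf).comp continuous_neg).locallyIntegrable
  have h1 := congrArg (fun T : 𝓢'(ℝ, ℂ) => T η)
    (Lp.fourierInv_toTemperedDistribution_eq (hf2.toLp f))
  simp only [TemperedDistribution.fourierInv_apply, Lp.toTemperedDistribution_apply,
    smul_eq_mul] at h1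
  rw [← h1]
  have h2 := integral_fourier_mul_eq_flip (η.integrable.comp_neg) hf
  have h3 : ∫ x, η x * 𝓕⁻ f x = ∫ x, η (-x) * 𝓕 f x := by
    rw [← hneg, ← integral_neg_eq_self (fun x => η (-x) * 𝓕 f x)]
    simp
  rw [h3, ← h2]
  refine integral_congr_ae ?_
  filter_upwards [hf2.coeFn_toLp] with x hx
  rw [hx, SchwartzMap.fourierInv_coe, Real.fourierInv_eq_fourier_neg]
  congr 1
  simp only [Real.fourier_eq]
  rw [← integral_neg_eq_self]
  simp

/-- The function with Fourier transform `n * h`, for `n, h ∈ L₂`. -/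
def synth (n : ℝ → ℂ) (h : L2) : ℝ → ℂ := 𝓕⁻ (fun ξ => n ξ * h ξ)

lemma integrable_mul_coeFn {n : ℝ → ℂ} (hn : MemLp n 2 volume) (h : L2) :
    Integrable (fun ξ => n ξ * h ξ) :=
  hn.integrable_mul (Lp.memLp h)

lemma coeFn_fourierInv_mulL2 {n : ℝ →ᵇ ℂ} (hn : MemLp n 2 volume) (h : L2) :
    (𝓕⁻ (mulL2 n h) : L2) =ᵐ[volume] synth n h :=
  coeFn_fourierInv_toLp (integrable_mul_coeFn hn h) (memLp_mul_boundedContinuous n (Lp.memLp h))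

lemma memLp_synth {n : ℝ →ᵇ ℂ} (hn : MemLp n 2 volume) (h : L2) : MemLp (synth n h) 2 volume :=
  (memLp_congr_ae (coeFn_fourierInv_mulL2 hn h)).1 (Lp.memLp _)

lemma synth_eq_fourier_neg (n : ℝ → ℂ) (h : L2) :
    synth n h = fun x => 𝓕 (fun ξ => n ξ * h ξ) (-x) := by
  ext x; rw [synth, Real.fourierInv_eq_fourier_neg]

lemma continuous_synth {n : ℝ → ℂ} (hn : MemLp n 2 volume) (h : L2) : Continuous (synth n h) := by
  rw [synth_eq_fourier_neg]
  exact (VectorFourier.fourierIntegral_continuous Real.continuous_fourierChar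
    (by exact continuous_inner) (integrable_mul_coeFn hn h)).comp continuous_neg

lemma hasDerivAt_synth {n n' : ℝ → ℂ} (hn : MemLp n 2 volume) (hn' : MemLp n' 2 volume)
    (hnn' : ∀ ξ : ℝ, n' ξ = (2 * Real.pi * Complex.I * ξ) * n ξ) (h : L2) (x : ℝ) :
    HasDerivAt (synth n h) (synth n' h x) x := by
  have h1 : Integrable (fun ξ : ℝ => ξ • (n ξ * h ξ)) := by
    refine ((integrable_mul_coeFn hn' h).const_mul (1 / (2 * Real.pi * Complex.I))).congr ?_
    filter_upwards with ξ
    rw [hnn', Complex.real_smul]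
    have : (Real.pi : ℂ) ≠ 0 := by exact_mod_cast Real.pi_ne_zero
    field_simp
  have h2 := Real.hasDerivAt_fourier (integrable_mul_coeFn hn h) h1 (-x)
  have h3 := h2.scomp x (hasDerivAt_neg x)
  rw [synth_eq_fourier_neg, synth_eq_fourier_neg]
  refine h3.congr_deriv ?_
  rw [neg_one_smul]
  simp only [Real.fourier_eq]
  rw [← integral_neg]
  congr 1
  ext ξ
  rw [hnn', ← smul_neg]
  congr 1
  simp only [smul_eq_mul]
  ring

lemma norm_synth_sub_le {n : ℝ → ℂ} (hn : MemLp n 2 volume) (h h' : L2) (x : ℝ) :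
    ‖synth n h x - synth n h' x‖ ≤ ‖hn.toLp n‖ * ‖h - h'‖ := by
  have key : ∀ f : ℝ → ℂ, ∀ y : ℝ, ‖𝓕 f y‖ ≤ ∫ ξ, ‖f ξ‖ := fun f y =>
    VectorFourier.norm_fourierIntegral_le_integral_norm _ _ _ _ _
  rw [synth_eq_fourier_neg, synth_eq_fourier_neg]
  have h1 : 𝓕 (fun ξ => n ξ * h ξ) (-x) - 𝓕 (fun ξ => n ξ * h' ξ) (-x)
      = 𝓕 (fun ξ => n ξ * (h - h' : L2) ξ) (-x) := by
    simp only [Real.fourier_eq]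
    rw [← integral_sub]
    · refine integral_congr_ae ?_
      filter_upwards [Lp.coeFn_sub h h'] with ξ hξ
      rw [hξ, ← smul_sub, Pi.sub_apply, mul_sub]
    · exact (Real.fourierIntegral_convergent_iff _).2 (integrable_mul_coeFn hn h)
    · exact (Real.fourierIntegral_convergent_iff _).2 (integrable_mul_coeFn hn h')
  simp only [h1]
  refine (key _ _).trans ?_
  have h2 := integral_mul_norm_le_Lp_mul_Lq (μ := volume) (f := n) (g := (h - h' : L2))
    (p := 2) (q := 2) ⟨by norm_num, by norm_num, by norm_num⟩ (by simpa using hn)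
    (by simpa using Lp.memLp (h - h'))
  have h3 : ∀ f : ℝ → ℂ, ∀ hf : MemLp f 2 volume,
      (∫ ξ, ‖f ξ‖ ^ (2 : ℝ)) ^ (1 / (2 : ℝ)) = ‖hf.toLp f‖ := by
    intro f hf
    rw [Lp.norm_toLp, hf.eLpNorm_eq_integral_rpow_norm (by norm_num) (by norm_num)]
    rw [ENNReal.toReal_ofReal (by positivity)]
    norm_num
  rw [h3 n hn, h3 _ (Lp.memLp (h - h')), Lp.toLp_coeFn] at h2
  simpa only [norm_mul] using h2

lemma lipschitzWith_synth {n : ℝ → ℂ} (hn : MemLp n 2 volume) (x : ℝ) :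
    LipschitzWith ‖hn.toLp n‖₊ fun h : L2 => synth n h x := by
  refine LipschitzWith.of_dist_le_mul fun h h' => ?_
  rw [dist_eq_norm, dist_eq_norm, coe_nnnorm]
  exact norm_synth_sub_le hn h h' x

lemma continuous_uncurry_synth {n : ℝ → ℂ} (hn : MemLp n 2 volume) {H : ℝ → L2}
    (hH : Continuous H) : Continuous (Function.uncurry fun t x => synth n (H t) x) := by
  have h1 : Continuous (Function.uncurry fun (h : L2) x => synth n h x) := by
    apply continuous_prod_of_continuous_lipschitzWith _ ‖hn.toLp n‖₊
    · exact fun h => continuous_synth hn h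
    · exact fun x => lipschitzWith_synth hn x
  have h2 : Continuous (fun p : ℝ × ℝ => (H p.1, p.2)) := by fun_prop
  have h3 := Continuous.comp h1 h2
  exact h3

/-- Convolution with a Schwartz kernel is the Fourier multiplier given by its transform. -/
lemma coeFn_fourierInv_mulL2_fourier (j : 𝓢(ℝ, ℂ)) {f : ℝ → ℂ} (hf : Integrable f)
    (hf2 : MemLp f 2 volume) :
    (𝓕⁻ (mulL2 (𝓕 j).toBoundedContinuousFunction (𝓕 (hf2.toLp f) : L2)) : L2)
      =ᵐ[volume] fun x => ∫ y, j (x - y) * f y := by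
  set g : ℝ → ℂ := fun ξ => (𝓕 j : 𝓢(ℝ, ℂ)) ξ * 𝓕 f ξ with hg
  have hf' : MemLp (𝓕 f) 2 volume := (memLp_congr_ae (coeFn_fourier_toLp hf hf2)).1 (Lp.memLp _)
  have hg1 : Integrable g := ((𝓕 j : 𝓢(ℝ, ℂ)).memLp 2 volume).integrable_mul hf'
  have hg2 : MemLp g 2 volume :=
    memLp_mul_boundedContinuous (𝓕 j : 𝓢(ℝ, ℂ)).toBoundedContinuousFunction hf'
  have h1 : mulL2 (𝓕 j).toBoundedContinuousFunction (𝓕 (hf2.toLp f) : L2) = hg2.toLp g := by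
    refine Lp.ext ?_
    filter_upwards [coeFn_mulL2 (𝓕 j).toBoundedContinuousFunction (𝓕 (hf2.toLp f) : L2),
      coeFn_fourier_toLp hf hf2, hg2.coeFn_toLp] with ξ h2 h3 h4
    rw [h2, h3, h4]
    rfl
  have hconv : (fun x => ∫ y, j (x - y) * f y)
      = convolution (j : ℝ → ℂ) f (ContinuousLinearMap.mul ℂ ℂ) volume := by
    ext x
    rw [convolution_mul_swap]
  have hgc : g = 𝓕 (convolution (j : ℝ → ℂ) f (ContinuousLinearMap.mul ℂ ℂ) volume) := by
    ext ξ
    rw [Real.fourier_mul_convolution_eq j.integrable hf ξ, hg, SchwartzMap.fourier_coe]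
  rw [h1, hconv]
  refine (coeFn_fourierInv_toLp hg1 hg2).trans (Filter.EventuallyEq.of_eq ?_)
  rw [hgc]
  refine Continuous.fourierInv_fourier_eq ?_ (j.integrable.integrable_convolution _ hf) ?_
  · refine BddAbove.continuous_convolution_left_of_integrable _ ?_ j.continuous hf
    refine ⟨‖j.toBoundedContinuousFunction‖, ?_⟩
    rintro _ ⟨x, rfl⟩
    exact j.toBoundedContinuousFunction.norm_coe_le_norm x
  · rw [← hgc]; exact hg1

end

section

/-! ### Linear evolution equations with norm-continuous coefficients -/

lemma integral_exp_mul_sub {μ : ℝ} (hμ : 0 < μ) (T τ : ℝ) :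
    ∫ s in τ..T, Real.exp (μ * (T - s)) = (Real.exp (μ * (T - τ)) - 1) / μ := by
  have h : ∀ s ∈ uIcc τ T, HasDerivAt (fun s => -(Real.exp (μ * (T - s)) / μ))
      (Real.exp (μ * (T - s))) s := by
    intro s _
    have h1 : HasDerivAt (fun s : ℝ => μ * (T - s)) (-μ) s := by
      simpa using ((hasDerivAt_id s).const_sub T).const_mul μ
    have h2 := (h1.exp.div_const μ).neg
    refine h2.congr_deriv ?_
    rw [mul_neg, neg_div, neg_neg, mul_div_cancel_right₀ _ hμ.ne']
  rw [intervalIntegral.integral_eq_sub_of_hasDerivAt h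
    (Continuous.intervalIntegrable (by fun_prop) _ _)]
  simp only [sub_self, mul_zero, Real.exp_zero]
  ring

/-- The terminal value problem `Ψ' = K(t) Ψ + Γ(t)`, `Ψ(T) = 0` in a Banach space is solvable on
`[0, T]`. The Picard map is a contraction for the norm `sup e ^ (-μ (T - t)) ‖Ψ(t)‖`. -/
theorem exists_linear_evolution {𝕜 E : Type*} [NontriviallyNormedField 𝕜] [NormedAddCommGroup E]
    [NormedSpace 𝕜 E] [NormedSpace ℝ E] [CompleteSpace E] {K : ℝ → E →L[𝕜] E} {Γ : ℝ → E} (hK : Continuous K) (hΓ : Continuous Γ)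
    {T : ℝ} (hT : 0 ≤ T) :
    ∃ Ψ : ℝ → E, Continuous Ψ ∧ Ψ T = 0 ∧
      ∀ t ∈ Icc 0 T, HasDerivAt Ψ (K t (Ψ t) + Γ t) t := by
  obtain ⟨k, hk⟩ := (isCompact_Icc (a := (0 : ℝ)) (b := T)).exists_bound_of_continuousOn
    hK.continuousOn
  set k' : ℝ := max k 1 with hk'
  have hk'pos : 0 < k' := by positivity
  have hkk : ∀ s ∈ Icc 0 T, ‖K s‖ ≤ k' := fun s hs => (hk s hs).trans (le_max_left _ _)
  set μ : ℝ := 2 * k' with hμ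
  have hμpos : 0 < μ := by positivity
  set cl : ℝ → ℝ := fun t => max 0 (min t T) with hcl
  have hclc : Continuous cl := by fun_prop
  have hclm : ∀ t, cl t ∈ Icc 0 T := fun t =>
    ⟨le_max_left _ _, max_le hT (min_le_right _ _)⟩
  have hcl_id : ∀ t ∈ Icc 0 T, cl t = t := fun t ht => by
    rw [hcl]; simp only; rw [min_eq_left ht.2, max_eq_right ht.1]
  let f : (ℝ →ᵇ E) → ℝ → E := fun χ s => K s (Real.exp (μ * (T - s)) • χ s) + Γ s
  have hf : ∀ χ, Continuous (f χ) := fun χ =>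
    (hK.clm_apply ((by fun_prop : Continuous fun s => Real.exp (μ * (T - s))).smul
      χ.continuous)).add hΓ
  let g : (ℝ →ᵇ E) → ℝ → E := fun χ t => ∫ s in T..t, f χ s
  have hg : ∀ χ t, HasDerivAt (g χ) (f χ t) t := fun χ t =>
    intervalIntegral.integral_hasDerivAt_right ((hf χ).intervalIntegrable _ _)
      ((hf χ).stronglyMeasurableAtFilter _ _) (hf χ).continuousAt
  have hgc : ∀ χ, Continuous (g χ) := fun χ =>
    continuous_iff_continuousAt.2 fun t => (hg χ t).continuousAt
  have hFc : ∀ χ, Continuous fun t => Real.exp (-(μ * (T - cl t))) • g χ (cl t) := fun χ =>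
    (by fun_prop : Continuous fun t => Real.exp (-(μ * (T - cl t)))).smul ((hgc χ).comp hclc)
  have hFb : ∀ χ, ∃ C, ∀ t, ‖Real.exp (-(μ * (T - cl t))) • g χ (cl t)‖ ≤ C := by
    intro χ
    obtain ⟨C, hC⟩ := (isCompact_Icc (a := (0 : ℝ)) (b := T)).exists_bound_of_continuousOn
      (f := fun t => Real.exp (-(μ * (T - t))) • g χ t)
      (((by fun_prop : Continuous fun t => Real.exp (-(μ * (T - t)))).smul (hgc χ)).continuousOn)
    exact ⟨C, fun t => hC _ (hclm t)⟩
  let F : (ℝ →ᵇ E) → (ℝ →ᵇ E) := fun χ =>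
    BoundedContinuousFunction.ofNormedAddCommGroup _ (hFc χ) (hFb χ).choose (hFb χ).choose_spec
  have hF : ∀ χ t, F χ t = Real.exp (-(μ * (T - cl t))) • g χ (cl t) := fun χ t => rfl
  have hcontr : ContractingWith (1 / 2) F := by
    refine ⟨by rw [← NNReal.coe_lt_coe]; norm_num, LipschitzWith.of_dist_le_mul fun χ χ' => ?_⟩
    rw [BoundedContinuousFunction.dist_le (by positivity)]
    intro t
    rw [hF, hF, dist_eq_norm, ← smul_sub, norm_smul, Real.norm_eq_abs, abs_of_pos (Real.exp_pos _)]
    set τ := cl t with hτ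
    have hτm := hclm t
    have h1 : g χ τ - g χ' τ = -∫ s in τ..T, (f χ s - f χ' s) := by
      simp only [g]
      rw [← intervalIntegral.integral_sub ((hf χ).intervalIntegrable _ _)
        ((hf χ').intervalIntegrable _ _), intervalIntegral.integral_symm]
    have h2 : ‖∫ s in τ..T, (f χ s - f χ' s)‖
        ≤ ∫ s in τ..T, k' * dist χ χ' * Real.exp (μ * (T - s)) := by
      refine intervalIntegral.norm_integral_le_of_norm_le hτm.2 ?_
        (Continuous.intervalIntegrable (by fun_prop) _ _)
      filter_upwards with s hs
      have hs' : s ∈ Icc 0 T := ⟨hτm.1.trans hs.1.le, hs.2⟩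
      have : f χ s - f χ' s = K s (Real.exp (μ * (T - s)) • (χ s - χ' s)) := by
        simp only [f]
        rw [add_sub_add_right_eq_sub, ← map_sub, smul_sub]
      rw [this]
      refine ((K s).le_opNorm _).trans ?_
      rw [norm_smul, Real.norm_eq_abs, abs_of_pos (Real.exp_pos _)]
      calc ‖K s‖ * (Real.exp (μ * (T - s)) * ‖χ s - χ' s‖)
          ≤ k' * (Real.exp (μ * (T - s)) * dist χ χ') := by
            gcongr
            · exact hkk s hs'
            · rw [← dist_eq_norm]; exact BoundedContinuousFunction.dist_coe_le_dist s
        _ = _ := by ring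
    rw [h1, norm_neg]
    rw [intervalIntegral.integral_const_mul, integral_exp_mul_sub hμpos] at h2
    calc Real.exp (-(μ * (T - τ))) * ‖∫ s in τ..T, (f χ s - f χ' s)‖
        ≤ Real.exp (-(μ * (T - τ))) *
          (k' * dist χ χ' * ((Real.exp (μ * (T - τ)) - 1) / μ)) := by gcongr
      _ ≤ Real.exp (-(μ * (T - τ))) * (k' * dist χ χ' * (Real.exp (μ * (T - τ)) / μ)) := by
          gcongr; linarith
      _ = (Real.exp (-(μ * (T - τ))) * Real.exp (μ * (T - τ))) * (k' / μ) * dist χ χ' := by ring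
      _ = (1 / 2) * dist χ χ' := by
          rw [← Real.exp_add, neg_add_cancel, Real.exp_zero, hμ]
          field_simp
      _ = _ := by norm_num
  obtain ⟨χ, hχ⟩ : ∃ χ, F χ = χ := ⟨_, hcontr.fixedPoint_isFixedPt⟩
  refine ⟨g χ, hgc χ, by simp [g], fun t ht => ?_⟩
  have h1 : Real.exp (μ * (T - t)) • χ t = g χ t := by
    have h2 : χ t = Real.exp (-(μ * (T - cl t))) • g χ (cl t) := by
      rw [← hF, hχ]
    rw [h2, hcl_id t ht, smul_smul, ← Real.exp_add, add_neg_cancel, Real.exp_zero, one_smul]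
  have h3 := hg χ t
  simp only [f] at h3
  rwa [h1] at h3

end

section

/-! ### Symbols of the linear equation -/

lemma abs_le_sqrt_one_add_sq (ξ : ℝ) : |ξ| ≤ √(1 + ξ ^ 2) :=
  Real.abs_le_sqrt (by linarith)

lemma abs_pow_le_one_add_sq_pow (ξ : ℝ) {k m : ℕ} (h : k ≤ 2 * m) :
    |ξ| ^ k ≤ (1 + ξ ^ 2) ^ m := by
  have h1 : 1 ≤ √(1 + ξ ^ 2) := Real.one_le_sqrt.2 (by nlinarith [sq_nonneg ξ])
  calc |ξ| ^ k ≤ √(1 + ξ ^ 2) ^ k := by gcongr; exact abs_le_sqrt_one_add_sq ξ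
    _ ≤ √(1 + ξ ^ 2) ^ (2 * m) := pow_le_pow_right₀ h1 h
    _ = (1 + ξ ^ 2) ^ m := by rw [pow_mul, Real.sq_sqrt (by positivity)]

/-- The symbol `(2πiξ) ^ k (1 + ξ²)⁻³`. -/
def symFun (k : ℕ) (ξ : ℝ) : ℂ :=
  (2 * Real.pi * Complex.I * ξ) ^ k * (((1 + ξ ^ 2) ^ 3)⁻¹ : ℝ)

lemma continuous_symFun (k : ℕ) : Continuous (symFun k) := by
  unfold symFun
  refine Continuous.mul (by fun_prop) (Complex.continuous_ofReal.comp ?_)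
  exact Continuous.inv₀ (by fun_prop) fun ξ => by positivity

lemma norm_symFun (k : ℕ) (ξ : ℝ) :
    ‖symFun k ξ‖ = (2 * Real.pi) ^ k * (|ξ| ^ k * ((1 + ξ ^ 2) ^ 3)⁻¹) := by
  rw [symFun, norm_mul, norm_pow, Complex.norm_real]
  have h1 : ‖(2 * Real.pi * Complex.I * ξ : ℂ)‖ = 2 * Real.pi * |ξ| := by
    simp [abs_of_pos Real.pi_pos]
  have h2 : |((1 + ξ ^ 2) ^ 3)⁻¹| = ((1 + ξ ^ 2) ^ 3)⁻¹ := abs_of_pos (by positivity)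
  rw [h1, Real.norm_eq_abs, h2, mul_pow, mul_assoc]

lemma norm_symFun_le {k : ℕ} (hk : k ≤ 5) (ξ : ℝ) : ‖symFun k ξ‖ ≤ (2 * Real.pi) ^ k := by
  rw [norm_symFun]
  refine mul_le_of_le_one_right (by positivity) ?_
  rw [← div_eq_mul_inv]
  exact div_le_one_of_le₀ (abs_pow_le_one_add_sq_pow ξ (by omega)) (by positivity)

lemma symFun_succ (k : ℕ) (ξ : ℝ) :
    symFun (k + 1) ξ = (2 * Real.pi * Complex.I * ξ) * symFun k ξ := by
  rw [symFun, symFun]; ring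

/-- The symbol `(2πiξ) ^ k (1 + ξ²)⁻³`, bounded for `k ≤ 5`. -/
def sym (k : ℕ) (hk : k ≤ 5) : ℝ →ᵇ ℂ :=
  BoundedContinuousFunction.ofNormedAddCommGroup (symFun k) (continuous_symFun k) _
    (norm_symFun_le hk)

lemma coe_sym (k : ℕ) (hk : k ≤ 5) : ⇑(sym k hk) = symFun k := rfl

lemma memLp_symFun {k : ℕ} (hk : k ≤ 5) : MemLp (symFun k) 2 volume := by
  rw [memLp_two_iff_integrable_sq_norm (continuous_symFun k).aestronglyMeasurable]
  refine ((integrable_inv_one_add_sq).const_mul ((2 * Real.pi) ^ (2 * k))).mono'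
    ((continuous_symFun k).norm.pow 2).aestronglyMeasurable ?_
  filter_upwards with ξ
  rw [Real.norm_eq_abs, abs_of_nonneg (by positivity), norm_symFun, mul_pow, ← pow_mul,
    mul_comm k 2]
  gcongr
  have h := abs_pow_le_one_add_sq_pow ξ (k := k * 2) (m := 5) (by omega)
  rw [mul_pow, ← pow_mul]
  calc |ξ| ^ (k * 2) * ((1 + ξ ^ 2) ^ 3)⁻¹ ^ 2
      ≤ (1 + ξ ^ 2) ^ 5 * ((1 + ξ ^ 2) ^ 3)⁻¹ ^ 2 := by gcongr
    _ = (1 + ξ ^ 2)⁻¹ := by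
      have : (1 + ξ ^ 2) ≠ 0 := by positivity
      field_simp

/-- The dispersion relation: `-∂³ - i a ∂² - b ∂` has the symbol `i p(ξ)`. -/
def dispersion (a b ξ : ℝ) : ℝ := (2 * Real.pi * ξ) ^ 3 + a * (2 * Real.pi * ξ) ^ 2 - b * (2 * Real.pi * ξ)

lemma abs_dispersion_le (a b : ℝ) : ∃ C, 0 ≤ C ∧ ∀ ξ,
    |dispersion a b ξ| * ((1 + ξ ^ 2) ^ 3)⁻¹ ≤ C ∧
    |dispersion a b ξ| ^ 2 * ((1 + ξ ^ 2) ^ 3)⁻¹ ≤ C ^ 2 := by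
  refine ⟨(2 * Real.pi) ^ 3 + |a| * (2 * Real.pi) ^ 2 + |b| * (2 * Real.pi), by positivity,
    fun ξ => ?_⟩
  set w := √(1 + ξ ^ 2) with hw
  have hw1 : 1 ≤ w := Real.one_le_sqrt.2 (by nlinarith [sq_nonneg ξ])
  have hw2 : w ^ 2 = 1 + ξ ^ 2 := Real.sq_sqrt (by positivity)
  have hξ : |ξ| ≤ w := abs_le_sqrt_one_add_sq ξ
  have hw12 : w ^ 1 ≤ w ^ 3 := pow_le_pow_right₀ hw1 (by norm_num)
  have hw23 : w ^ 2 ≤ w ^ 3 := pow_le_pow_right₀ hw1 (by norm_num)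
  have hp := Real.pi_pos
  have h1 : |dispersion a b ξ| ≤
      ((2 * Real.pi) ^ 3 + |a| * (2 * Real.pi) ^ 2 + |b| * (2 * Real.pi)) * w ^ 3 := by
    calc |dispersion a b ξ| ≤ |(2 * Real.pi * ξ) ^ 3| + |a * (2 * Real.pi * ξ) ^ 2|
          + |b * (2 * Real.pi * ξ)| := by
            refine (abs_sub _ _).trans ?_
            gcongr
            exact abs_add_le _ _
      _ = (2 * Real.pi) ^ 3 * |ξ| ^ 3 + |a| * (2 * Real.pi) ^ 2 * |ξ| ^ 2
          + |b| * (2 * Real.pi) * |ξ| ^ 1 := by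
            simp only [abs_mul, abs_pow, abs_of_pos hp, Nat.abs_ofNat]; ring
      _ ≤ (2 * Real.pi) ^ 3 * w ^ 3 + |a| * (2 * Real.pi) ^ 2 * w ^ 3
          + |b| * (2 * Real.pi) * w ^ 3 := by
            gcongr
            · exact (pow_le_pow_left₀ (abs_nonneg _) hξ 2).trans hw23
            · exact (pow_le_pow_left₀ (abs_nonneg _) hξ 1).trans hw12
      _ = _ := by ring
  set C := (2 * Real.pi) ^ 3 + |a| * (2 * Real.pi) ^ 2 + |b| * (2 * Real.pi)
  have hC : 0 ≤ C := by positivity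
  rw [← hw2, ← div_eq_mul_inv, ← div_eq_mul_inv, div_le_iff₀ (by positivity),
    div_le_iff₀ (by positivity)]
  constructor
  · refine h1.trans ?_
    rw [← pow_mul]
    exact mul_le_mul_of_nonneg_left (pow_le_pow_right₀ hw1 (by norm_num)) hC
  · calc |dispersion a b ξ| ^ 2 ≤ (C * w ^ 3) ^ 2 := by gcongr
      _ = _ := by ring

/-- The function `e ^ (i t p(ξ)) (1 + ξ²)⁻³`. -/
def phaseFun (a b t ξ : ℝ) : ℂ :=
  Complex.exp (Complex.I * ((t * dispersion a b ξ : ℝ) : ℂ)) * (((1 + ξ ^ 2) ^ 3)⁻¹ : ℝ)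

lemma continuous_dispersion (a b : ℝ) : Continuous (dispersion a b) := by
  unfold dispersion; fun_prop

lemma continuous_inv_one_add_sq_pow :
    Continuous fun ξ : ℝ => ((((1 + ξ ^ 2) ^ 3)⁻¹ : ℝ) : ℂ) :=
  Complex.continuous_ofReal.comp (Continuous.inv₀ (by fun_prop) fun ξ => by positivity)

lemma continuous_phaseFun (a b t : ℝ) : Continuous (phaseFun a b t) := by
  have := continuous_dispersion a b
  exact Continuous.mul (by fun_prop) continuous_inv_one_add_sq_pow

lemma norm_exp_I_mul (s : ℝ) : ‖Complex.exp (Complex.I * (s : ℂ))‖ = 1 := by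
  rw [mul_comm]; exact Complex.norm_exp_ofReal_mul_I s

lemma norm_phaseFun (a b t ξ : ℝ) : ‖phaseFun a b t ξ‖ = ((1 + ξ ^ 2) ^ 3)⁻¹ := by
  rw [phaseFun, norm_mul, norm_exp_I_mul, one_mul, Complex.norm_real, Real.norm_eq_abs,
    abs_of_pos (by positivity)]

/-- The function `e ^ (i t p(ξ)) (1 + ξ²)⁻³` as a bounded continuous function. -/
def phase (a b t : ℝ) : ℝ →ᵇ ℂ :=
  BoundedContinuousFunction.ofNormedAddCommGroup (phaseFun a b t) (continuous_phaseFun a b t) 1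
    (fun ξ => by
      rw [norm_phaseFun]
      exact inv_le_one_of_one_le₀ (one_le_pow₀ (by nlinarith [sq_nonneg ξ])))

lemma coe_phase (a b t : ℝ) : ⇑(phase a b t) = phaseFun a b t := rfl

/-- The time derivative `i p(ξ) e ^ (i t p(ξ)) (1 + ξ²)⁻³` of `phase`. -/
def phaseDeriv (a b t : ℝ) : ℝ →ᵇ ℂ :=
  BoundedContinuousFunction.ofNormedAddCommGroup
    (fun ξ => Complex.I * dispersion a b ξ * phaseFun a b t ξ)
    (by
      have h1 := continuous_dispersion a b
      have h2 := continuous_phaseFun a b t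
      fun_prop)
    (abs_dispersion_le a b).choose
    (fun ξ => by
      rw [norm_mul, norm_phaseFun, norm_mul, Complex.norm_I, one_mul, Complex.norm_real]
      exact ((abs_dispersion_le a b).choose_spec.2 ξ).1)

lemma phaseDeriv_apply (a b t ξ : ℝ) :
    phaseDeriv a b t ξ = Complex.I * dispersion a b ξ * phaseFun a b t ξ := rfl

lemma norm_exp_sub_one_sub_le (s p : ℝ) :
    ‖Complex.exp (Complex.I * ((s * p : ℝ) : ℂ)) - 1 - Complex.I * ((s * p : ℝ) : ℂ)‖
      ≤ s ^ 2 * p ^ 2 := by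
  set f : ℝ → ℂ := fun x => Complex.exp (Complex.I * (x : ℂ)) - Complex.I * (x : ℂ) with hf
  have hd : ∀ x : ℝ, HasDerivAt f (Complex.I * (Complex.exp (Complex.I * (x : ℂ)) - 1)) x := by
    intro x
    have h1 : HasDerivAt (fun x : ℝ => Complex.I * (x : ℂ)) Complex.I x := by
      simpa using (Complex.ofRealCLM.hasDerivAt (x := x)).const_mul Complex.I
    exact (h1.cexp.sub h1).congr_deriv (by ring)
  have h := Convex.norm_image_sub_le_of_norm_hasDerivWithin_le (f := f) (C := |s * p|)
    (s := uIcc 0 (s * p)) (x := 0) (y := s * p) (fun x _ => (hd x).hasDerivWithinAt)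
    (fun x hx => by
      rw [norm_mul, Complex.norm_I, one_mul]
      refine Real.norm_exp_I_mul_ofReal_sub_one_le.trans ?_
      rw [Real.norm_eq_abs]
      simpa using abs_sub_left_of_mem_uIcc hx) (convex_uIcc _ _) left_mem_uIcc right_mem_uIcc
  have h2 : f (s * p) - f 0 = Complex.exp (Complex.I * ((s * p : ℝ) : ℂ)) - 1
      - Complex.I * ((s * p : ℝ) : ℂ) := by simp [hf]; ring
  rw [h2, sub_zero, Real.norm_eq_abs, ← abs_mul, ← sq, abs_of_nonneg (by positivity)] at h
  linarith [mul_pow s p 2]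

lemma hasDerivAt_phase (a b t : ℝ) : HasDerivAt (phase a b) (phaseDeriv a b t) t := by
  obtain ⟨C, hC, hp⟩ := abs_dispersion_le a b
  rw [hasDerivAt_iff_isLittleO]
  have h1 : ∀ s : ℝ, ‖phase a b s - phase a b t - (s - t) • phaseDeriv a b t‖
      ≤ C ^ 2 * (s - t) ^ 2 := by
    intro s
    rw [BoundedContinuousFunction.norm_le (by positivity)]
    intro ξ
    have : (phase a b s - phase a b t - (s - t) • phaseDeriv a b t) ξ
        = phaseFun a b t ξ * (Complex.exp (Complex.I * (((s - t) * dispersion a b ξ : ℝ) : ℂ)) - 1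
          - Complex.I * (((s - t) * dispersion a b ξ : ℝ) : ℂ)) := by
      simp only [BoundedContinuousFunction.sub_apply, BoundedContinuousFunction.smul_apply,
        phaseDeriv_apply, coe_phase, Complex.real_smul]
      have : phaseFun a b s ξ = phaseFun a b t ξ *
          Complex.exp (Complex.I * (((s - t) * dispersion a b ξ : ℝ) : ℂ)) := by
        rw [phaseFun, phaseFun, mul_right_comm, ← Complex.exp_add]
        congr 2
        push_cast; ring
      rw [this]
      push_cast; ring
    rw [this, norm_mul, norm_phaseFun]
    calc ((1 + ξ ^ 2) ^ 3)⁻¹ * _ ≤ ((1 + ξ ^ 2) ^ 3)⁻¹ * ((s - t) ^ 2 * dispersion a b ξ ^ 2) := by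
          gcongr
          exact norm_exp_sub_one_sub_le _ _
      _ = (|dispersion a b ξ| ^ 2 * ((1 + ξ ^ 2) ^ 3)⁻¹) * (s - t) ^ 2 := by rw [sq_abs]; ring
      _ ≤ C ^ 2 * (s - t) ^ 2 := by gcongr; exact (hp ξ).2
  refine Asymptotics.IsBigO.trans_isLittleO (g := fun s => (s - t) ^ 2) ?_ ?_
  · refine Asymptotics.IsBigO.of_bound (C ^ 2) (Eventually.of_forall fun s => ?_)
    rw [Real.norm_eq_abs, abs_of_nonneg (by positivity : (0 : ℝ) ≤ (s - t) ^ 2)]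
    exact h1 s
  · have h2 : (fun s : ℝ => (s - t) ^ 2) = fun s => (s - t) * (s - t) := by ext; ring
    rw [h2]
    have h3 : (fun s : ℝ => s - t) =o[𝓝 t] fun _ => (1 : ℝ) := by
      rw [Asymptotics.isLittleO_one_iff]
      have : ContinuousAt (fun s : ℝ => s - t) t := by fun_prop
      simpa [ContinuousAt] using this
    simpa using h3.mul_isBigO (Asymptotics.isBigO_refl (fun s : ℝ => s - t) (𝓝 t))

lemma continuous_phase (a b : ℝ) : Continuous (phase a b) :=
  continuous_iff_continuousAt.2 fun t => (hasDerivAt_phase a b t).continuousAt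

/-- The function `(1 + x²)⁹ f` for a Schwartz function `f`. -/
def schwartzWeight (f : 𝓢(ℝ, ℂ)) : 𝓢(ℝ, ℂ) :=
  SchwartzMap.smulLeftCLM ℂ (fun x : ℝ => ((1 + x ^ 2 : ℝ) : ℂ) ^ 9) f

lemma schwartzWeight_apply (f : 𝓢(ℝ, ℂ)) (x : ℝ) :
    schwartzWeight f x = ((1 + x ^ 2 : ℝ) : ℂ) ^ 9 * f x :=
  SchwartzMap.smulLeftCLM_apply_apply (by fun_prop) f x

lemma phaseFun_mul_phaseFun_neg (a b t ξ : ℝ) :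
    phaseFun a b t ξ * phaseFun a b (-t) ξ = ((((1 + ξ ^ 2) ^ 6)⁻¹ : ℝ) : ℂ) := by
  have : Complex.exp (Complex.I * ((t * dispersion a b ξ : ℝ) : ℂ)) *
      Complex.exp (Complex.I * ((-t * dispersion a b ξ : ℝ) : ℂ)) = 1 := by
    rw [← Complex.exp_add, ← Complex.exp_zero]
    congr 1
    push_cast; ring
  calc _ = (Complex.exp (Complex.I * ((t * dispersion a b ξ : ℝ) : ℂ)) *
      Complex.exp (Complex.I * ((-t * dispersion a b ξ : ℝ) : ℂ))) *
      ((((1 + ξ ^ 2) ^ 3)⁻¹ : ℝ) * (((1 + ξ ^ 2) ^ 3)⁻¹ : ℝ) : ℂ) := by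
        rw [phaseFun, phaseFun]; ring
    _ = _ := by
        rw [this, one_mul, ← Complex.ofReal_mul]
        congr 1
        rw [← mul_inv]; ring

end

section

/-! ### Solvability of the regularized dual problem -/

/-- The convolution `j * f`. -/
def conv (j f : ℝ → ℂ) (x : ℝ) : ℂ := ∫ y, j (x - y) * f y

/-- The `k`-th derivative of a Schwartz function. -/
def schwartzDeriv (k : ℕ) (f : 𝓢(ℝ, ℂ)) : 𝓢(ℝ, ℂ) := (SchwartzMap.derivCLM ℂ ℂ)^[k] f

lemma schwartzDeriv_succ (k : ℕ) (f : 𝓢(ℝ, ℂ)) :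
    schwartzDeriv (k + 1) f = SchwartzMap.derivCLM ℂ ℂ (schwartzDeriv k f) :=
  Function.iterate_succ_apply' _ _ _

lemma hasDerivAt_schwartzDeriv (k : ℕ) (f : 𝓢(ℝ, ℂ)) (x : ℝ) :
    HasDerivAt (schwartzDeriv k f) (schwartzDeriv (k + 1) f x) x := by
  rw [schwartzDeriv_succ, SchwartzMap.derivCLM_apply]
  exact (schwartzDeriv k f).differentiableAt.hasDerivAt

lemma fourier_schwartzDeriv (k : ℕ) (f : 𝓢(ℝ, ℂ)) (ξ : ℝ) :
    (𝓕 (schwartzDeriv k f) : 𝓢(ℝ, ℂ)) ξ = (2 * Real.pi * Complex.I * ξ) ^ k * (𝓕 f : 𝓢(ℝ, ℂ)) ξ := by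
  induction k with
  | zero => simp [schwartzDeriv]
  | succ k ih =>
    have h1 : ⇑(schwartzDeriv (k + 1) f) = deriv (schwartzDeriv k f) := by
      ext x; rw [schwartzDeriv_succ, SchwartzMap.derivCLM_apply]
    have h2 := Real.fourier_deriv (schwartzDeriv k f).integrable
      (schwartzDeriv k f).differentiable (h1 ▸ (schwartzDeriv (k + 1) f).integrable)
    rw [SchwartzMap.fourier_coe, h1, h2]
    simp only
    rw [← SchwartzMap.fourier_coe, ih, smul_eq_mul]
    ring

/-- The function `β φ_x + i λ φ`, through which the nonlinearity acts on a test function. -/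
def zeta (lam β : ℝ) (φ : ℕ → ℝ → ℝ → ℂ) (t x : ℝ) : ℂ :=
  β * φ 1 t x + Complex.I * lam * φ 0 t x

/-- The family `φ k` consists of a solution `φ 0` and its space derivatives of the dual problem
`φ_t = -φ_xxx - i a φ_xx - b φ_x - j * (q (β φ_x + i λ φ)) + θ(t) G(x)`, `φ(T) = 0`;
`Φ k` is `φ k` as a curve in `L₂`, and `Φt k` is the time derivative of this curve. -/
structure IsDualSolution (a b lam β T : ℝ) (q : ℝ → ℝ →ᵇ ℂ) (j G : 𝓢(ℝ, ℂ)) (θ : ℝ → ℝ)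
    (φ : ℕ → ℝ → ℝ → ℂ) (Φ Φt : ℕ → ℝ → L2) : Prop where
  hasDerivAt_space : ∀ k ≤ 4, ∀ t x, HasDerivAt (φ k t) (φ (k + 1) t x) x
  memLp : ∀ k ≤ 5, ∀ t, MemLp (φ k t) 2 volume
  continuous : ∀ k ≤ 5, Continuous (Function.uncurry (φ k))
  coeFn : ∀ k ≤ 5, ∀ t, Φ k t =ᵐ[volume] φ k t
  continuous_curve : ∀ k ≤ 5, Continuous (Φ k)
  hasDerivAt_time : ∀ k ≤ 2, ∀ t ∈ Icc 0 T, HasDerivAt (Φ k) (Φt k t) t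
  continuous_deriv : ∀ k ≤ 2, Continuous (Φt k)
  deriv_eq : ∀ k ≤ 2, ∀ t, Φt k t =ᵐ[volume] fun x =>
    -φ (k + 3) t x - Complex.I * a * φ (k + 2) t x - b * φ (k + 1) t x
      - conv (schwartzDeriv k j) (fun y => q t y * zeta lam β φ t y) x
      + θ t * schwartzDeriv k G x
  terminal : ∀ k ≤ 5, Φ k T = 0

lemma symFun_mul_dispersion (a b : ℝ) (k : ℕ) (ξ : ℝ) :
    symFun k ξ * (Complex.I * dispersion a b ξ) =
      -symFun (k + 3) ξ - Complex.I * a * symFun (k + 2) ξ - b * symFun (k + 1) ξ := by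
  simp only [symFun, dispersion]
  push_cast
  have hI : Complex.I ^ 2 = -1 := Complex.I_sq
  have hI3 : Complex.I ^ 3 = -Complex.I := by rw [pow_succ, hI]; ring
  simp only [pow_add, mul_pow, hI, hI3]
  ring

lemma symFun_mul_phases (a b : ℝ) (k : ℕ) (t : ℝ) (f : 𝓢(ℝ, ℂ)) (ξ : ℝ) :
    symFun k ξ * (phaseFun a b t ξ * (phaseFun a b (-t) ξ * schwartzWeight (𝓕 f) ξ))
      = (𝓕 (schwartzDeriv k f) : 𝓢(ℝ, ℂ)) ξ := by
  rw [fourier_schwartzDeriv, schwartzWeight_apply, ← mul_assoc (phaseFun a b t ξ),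
    phaseFun_mul_phaseFun_neg, symFun]
  have h : ((1 + ξ ^ 2 : ℝ) : ℂ) ≠ 0 := by
    exact_mod_cast (by positivity : (1 + ξ ^ 2 : ℝ) ≠ 0)
  rw [Complex.ofReal_inv, Complex.ofReal_inv, Complex.ofReal_pow, Complex.ofReal_pow]
  field_simp

lemma continuous_linearCombination {f g h e : ℝ → L2} (hf : Continuous f) (hg : Continuous g)
    (hh : Continuous h) (he : Continuous e) (c d : ℂ) :
    Continuous fun t => -f t - c • g t - d • h t + e t := by
  fun_prop

lemma mulL2_sym_phaseDeriv (a b t : ℝ) {k : ℕ} (hk : k ≤ 2) (f : L2) :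
    mulL2 (sym k (by omega)) (mulL2 (phaseDeriv a b t) f) =
      -mulL2 (sym (k + 3) (by omega)) (mulL2 (phase a b t) f)
        - (Complex.I * a) • mulL2 (sym (k + 2) (by omega)) (mulL2 (phase a b t) f)
        - (b : ℂ) • mulL2 (sym (k + 1) (by omega)) (mulL2 (phase a b t) f) := by
  have h : sym k (by omega) * phaseDeriv a b t = -(sym (k + 3) (by omega) * phase a b t)
      - (Complex.I * a) • (sym (k + 2) (by omega) * phase a b t)
      - (b : ℂ) • (sym (k + 1) (by omega) * phase a b t) := by
    ext ξ
    simp only [BoundedContinuousFunction.mul_apply, BoundedContinuousFunction.sub_apply,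
      BoundedContinuousFunction.neg_apply, BoundedContinuousFunction.smul_apply, coe_sym,
      phaseDeriv_apply, coe_phase, smul_eq_mul]
    rw [← mul_assoc, symFun_mul_dispersion]
    ring
  simp only [mulL2_mulL2, h, map_sub, map_neg, map_smul, _root_.sub_apply, _root_.neg_apply,
    _root_.smul_apply]

lemma fourierInv_sym_phase_source (a b t : ℝ) {k : ℕ} (hk : k ≤ 5) (G : 𝓢(ℝ, ℂ)) :
    (𝓕⁻ (mulL2 (sym k hk) (mulL2 (phase a b t) (mulL2 (phase a b (-t))
      ((schwartzWeight (𝓕 G)).toLp 2)))) : L2) = (schwartzDeriv k G).toLp 2 := by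
  have : mulL2 (sym k hk) (mulL2 (phase a b t) (mulL2 (phase a b (-t))
      ((schwartzWeight (𝓕 G)).toLp 2))) = (𝓕 (schwartzDeriv k G)).toLp 2 := by
    simp only [mulL2_mulL2]
    refine Lp.ext ?_
    filter_upwards [coeFn_mulL2 (sym k hk * (phase a b t * phase a b (-t)))
      ((schwartzWeight (𝓕 G)).toLp 2),
      (schwartzWeight (𝓕 G)).coeFn_toLp 2, (𝓕 (schwartzDeriv k G)).coeFn_toLp 2]
      with ξ h1 h2 h3
    rw [h1, h2, h3, ← symFun_mul_phases a b k t G ξ]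
    simp only [BoundedContinuousFunction.mul_apply, coe_sym, coe_phase]
    ring
  rw [this, SchwartzMap.toLp_fourierInv_eq, fourierInv_fourier_eq]

lemma mulL2_sym_phase_conv (a b t : ℝ) {k : ℕ} (hk : k ≤ 5) (j : 𝓢(ℝ, ℂ)) (f : L2) :
    mulL2 (sym k hk) (mulL2 (phase a b t)
      (mulL2 (phase a b (-t) * (schwartzWeight (𝓕 j)).toBoundedContinuousFunction) f))
      = mulL2 (𝓕 (schwartzDeriv k j)).toBoundedContinuousFunction f := by
  simp only [mulL2_mulL2]
  congr 2
  ext ξ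
  exact symFun_mul_phases a b k t j ξ

/-- The regularized dual problem, whose coefficient term is smoothing, is solved on the Fourier side:
for `Ψ = (1 + ξ²)⁶ e ^ (-i t p(ξ)) φ̂` it becomes a linear evolution equation in `L₂` with bounded,
norm-continuous coefficients. -/
lemma exists_dualSolution (a b lam β : ℝ) {T : ℝ} (hT : 0 ≤ T) {q : ℝ → ℝ →ᵇ ℂ}
    (hq : Continuous q) (hqL : ∀ t, MemLp (q t) 2 volume) (j G : 𝓢(ℝ, ℂ)) {θ : ℝ → ℝ}
    (hθ : Continuous θ) :
    ∃ φ Φ Φt, IsDualSolution a b lam β T q j G θ φ Φ Φt := by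
  -- The factor `(1 + ξ²)⁻³` makes `sym k`, `k ≤ 5`, square integrable, and another one in `phase` makes
  -- it differentiable in time in the supremum norm. The power `9` in `schwartzWeight` compensates
  -- for these two and for the third one in `phase a b (-t)`.
  set P : ℝ →ᵇ ℂ := (schwartzWeight (𝓕 j)).toBoundedContinuousFunction with hP
  set hG : L2 := (schwartzWeight (𝓕 G)).toLp 2 with hhG
  set FT : L2 →L[ℂ] L2 := fourierCLM ℂ L2 with hFT
  set FI : L2 →L[ℂ] L2 := fourierInvCLM ℂ L2 with hFI
  set Z : ℝ →ᵇ ℂ := (β : ℂ) • sym 1 (by norm_num) + (Complex.I * lam) • sym 0 (by norm_num) with hZ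
  -- `N t Ψ` is the Fourier transform of `q (β φ_x + i λ φ)`.
  set N : ℝ → L2 →L[ℂ] L2 := fun t => FT ∘L mulL2 (q t) ∘L FI ∘L mulL2 (Z * phase a b t) with hN
  set K : ℝ → L2 →L[ℂ] L2 := fun t => -(mulL2 (phase a b (-t) * P) ∘L N t) with hK
  set Γ : ℝ → L2 := fun t => (θ t : ℂ) • mulL2 (phase a b (-t)) hG with hΓ
  have hph := continuous_phase a b
  have hphn : Continuous fun t : ℝ => phase a b (-t) := hph.comp continuous_neg
  have hNc : Continuous N := by
    refine continuous_const.clm_comp ((mulL2.continuous.comp hq).clm_comp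
      (continuous_const.clm_comp (mulL2.continuous.comp (continuous_const.mul hph))))
  have hKc : Continuous K :=
    ((mulL2.continuous.comp (hphn.mul continuous_const)).clm_comp hNc).neg
  have hΓc : Continuous Γ :=
    (Complex.continuous_ofReal.comp hθ).smul
      ((mulL2.continuous.comp hphn).clm_apply continuous_const)
  obtain ⟨Ψ, hΨc, hΨT, hΨ⟩ := exists_linear_evolution hKc hΓc hT
  set H : ℝ → L2 := fun t => mulL2 (phase a b t) (Ψ t) with hH
  have hHc : Continuous H := (mulL2.continuous.comp hph).clm_apply hΨc
  obtain ⟨Φ, hΦk⟩ : ∃ Φ : ℕ → ℝ → L2, ∀ k (h : k ≤ 5) t, Φ k t = FI (mulL2 (sym k h) (H t)) :=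
    ⟨fun k t => if h : k ≤ 5 then FI (mulL2 (sym k h) (H t)) else 0, fun k h t => by
      simp only [dif_pos h]⟩
  obtain ⟨φ, hφ⟩ : ∃ φ : ℕ → ℝ → ℝ → ℂ, ∀ k t, φ k t = synth (symFun k) (H t) :=
    ⟨_, fun k t => rfl⟩
  have hcoe : ∀ k ≤ 5, ∀ t, Φ k t =ᵐ[volume] φ k t := fun k h t => by
    rw [hΦk k h, hφ]
    exact coeFn_fourierInv_mulL2 (n := sym k h) (memLp_symFun h) (H t)
  have hmem : ∀ k ≤ 5, ∀ t, MemLp (φ k t) 2 volume := fun k h t => by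
    rw [hφ]
    exact memLp_synth (n := sym k h) (memLp_symFun h) (H t)
  have hΦc : ∀ k ≤ 5, Continuous (Φ k) := fun k h => by
    have : Φ k = fun t => FI (mulL2 (sym k h) (H t)) := funext fun t => hΦk k h t
    rw [this]
    exact FI.continuous.comp ((mulL2 (sym k h)).continuous.comp hHc)
  set R : ℝ → L2 := fun t => K t (Ψ t) + Γ t with hR
  have hRc : Continuous R := (hKc.clm_apply hΨc).add hΓc
  obtain ⟨Ξ, hΞk⟩ : ∃ Ξ : ℕ → ℝ → L2, ∀ k (h : k ≤ 5) t, Ξ k t =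
      FI (mulL2 (sym k h) (mulL2 (phase a b t) (R t))) :=
    ⟨fun k t => if h : k ≤ 5 then FI (mulL2 (sym k h) (mulL2 (phase a b t) (R t))) else 0,
      fun k h t => by simp only [dif_pos h]⟩
  have hΞc : ∀ k ≤ 5, Continuous (Ξ k) := fun k h => by
    have : Ξ k = fun t => FI (mulL2 (sym k h) (mulL2 (phase a b t) (R t))) :=
      funext fun t => hΞk k h t
    rw [this]
    exact FI.continuous.comp ((mulL2 (sym k h)).continuous.comp
      ((mulL2.continuous.comp hph).clm_apply hRc))
  have hHT : H T = 0 := by simp [hH, hΨT]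
  have hHd : ∀ t ∈ Icc 0 T, HasDerivAt H (mulL2 (phaseDeriv a b t) (Ψ t)
        + mulL2 (phase a b t) (R t)) t := by
    intro t ht
    have h2 : HasDerivAt (fun t => mulL2 (phase a b t)) (mulL2 (phaseDeriv a b t)) t :=
      ((mulL2.restrictScalars ℝ).hasFDerivAt.comp_hasDerivAt t (hasDerivAt_phase a b t))
    have h3 : HasDerivAt (fun t => (mulL2 (phase a b t)).restrictScalars ℝ)
        ((mulL2 (phaseDeriv a b t)).restrictScalars ℝ) t :=
      ((ContinuousLinearMap.restrictScalarsL ℂ L2 L2 ℝ ℝ).hasFDerivAt.comp_hasDerivAt t h2)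
    exact h3.clm_apply (hΨ t ht)
  have hΞ1 : ∀ k ≤ 5, ∀ t, ∀ hqz2 : MemLp (fun y => q t y * zeta lam β φ t y) 2 volume,
      Ξ k t = -𝓕⁻ (mulL2 (𝓕 (schwartzDeriv k j)).toBoundedContinuousFunction
          (𝓕 (hqz2.toLp _) : L2)) + (θ t : ℂ) • (schwartzDeriv k G).toLp 2 volume := by
    intro k hk5 t hqz2
    have hz : MemLp (zeta lam β φ t) 2 volume :=
      ((hmem 1 (by norm_num) t).const_mul _).add ((hmem 0 (by norm_num) t).const_mul _)
    have e : FI (mulL2 Z (H t)) = (β : ℂ) • Φ 1 t + (Complex.I * lam) • Φ 0 t := by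
      rw [hΦk 1 (by norm_num), hΦk 0 (by norm_num), hZ]
      simp only [map_add, map_smul, _root_.add_apply, _root_.smul_apply]
    have hZ1 : FI (mulL2 (Z * phase a b t) (Ψ t)) = hz.toLp (zeta lam β φ t) := by
      rw [← mulL2_mulL2]
      have e' : FI (mulL2 Z (mulL2 (phase a b t) (Ψ t))) = FI (mulL2 Z (H t)) := rfl
      rw [e', e]
      refine Lp.ext ?_
      filter_upwards [Lp.coeFn_add ((β : ℂ) • Φ 1 t) ((Complex.I * lam) • Φ 0 t),
        Lp.coeFn_smul (β : ℂ) (Φ 1 t), Lp.coeFn_smul (Complex.I * lam) (Φ 0 t),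
        hcoe 1 (by norm_num) t, hcoe 0 (by norm_num) t, hz.coeFn_toLp] with x h1 h2 h3 h4 h5 h6
      rw [h1, Pi.add_apply, h2, h3, h6, Pi.smul_apply, Pi.smul_apply, h4, h5]
      rfl
    have hN1 : N t (Ψ t) = 𝓕 (hqz2.toLp (fun y => q t y * zeta lam β φ t y)) := by
      have : N t (Ψ t) = FT (mulL2 (q t) (FI (mulL2 (Z * phase a b t) (Ψ t)))) := rfl
      rw [this, hZ1, mulL2_toLp, hFT, fourierCLM_apply]
    have hR1 : R t = -mulL2 (phase a b (-t) * P) (𝓕 (hqz2.toLp _) : L2)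
        + (θ t : ℂ) • mulL2 (phase a b (-t)) hG := by
      rw [← hN1]; rfl
    rw [hΞk k hk5, hR1]
    simp only [map_add, map_neg, map_smul]
    rw [hP, mulL2_sym_phase_conv, hFI, fourierInvCLM_apply, fourierInvCLM_apply, hhG,
      fourierInv_sym_phase_source]
  refine ⟨φ, Φ, fun k t => -Φ (k + 3) t - (Complex.I * a) • Φ (k + 2) t - (b : ℂ) • Φ (k + 1) t
    + Ξ k t, ?_, hmem, ?_, hcoe, hΦc, ?_, ?_, ?_, ?_⟩
  · intro k hk t x
    rw [hφ, hφ]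
    exact hasDerivAt_synth (memLp_symFun (by omega)) (memLp_symFun (by omega)) (symFun_succ k)
      (H t) x
  · intro k hk
    rw [show φ k = fun t x => synth (symFun k) (H t) x from funext fun t => hφ k t]
    exact continuous_uncurry_synth (memLp_symFun hk) hHc
  · intro k hk t ht
    have h4 : HasDerivAt (Φ k) (FI (mulL2 (sym k (by omega)) (mulL2 (phaseDeriv a b t) (Ψ t)
        + mulL2 (phase a b t) (R t)))) t := by
      have : Φ k = fun t => FI (mulL2 (sym k (by omega)) (H t)) :=
        funext fun t => hΦk k (by omega) t
      rw [this]
      exact (((FI ∘L mulL2 (sym k (by omega))).restrictScalars ℝ).hasFDerivAt.comp_hasDerivAt t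
        (hHd t ht))
    refine h4.congr_deriv ?_
    rw [map_add, map_add, hΞk k (by omega), hΦk (k + 3) (by omega), hΦk (k + 2) (by omega),
      hΦk (k + 1) (by omega), mulL2_sym_phaseDeriv a b t hk (Ψ t)]
    simp only [map_sub, map_neg, map_smul]
    rfl
  · intro k hk
    have h1 := hΦc (k + 3) (by omega)
    have h2 := hΦc (k + 2) (by omega)
    have h3 := hΦc (k + 1) (by omega)
    have h4 := hΞc k (by omega)
    exact continuous_linearCombination h1 h2 h3 h4 _ _
  · intro k hk t
    have hz : MemLp (zeta lam β φ t) 2 volume :=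
      ((hmem 1 (by norm_num) t).const_mul _).add ((hmem 0 (by norm_num) t).const_mul _)
    have hqz2 : MemLp (fun y => q t y * zeta lam β φ t y) 2 volume :=
      memLp_mul_boundedContinuous (q t) hz
    have hqz1 : Integrable (fun y => q t y * zeta lam β φ t y) := (hqL t).integrable_mul hz
    rw [hΞ1 k (by omega) t hqz2]
    set A : L2 := 𝓕⁻ (mulL2 (𝓕 (schwartzDeriv k j)).toBoundedContinuousFunction
          (𝓕 (hqz2.toLp _) : L2))
    set B : L2 := (schwartzDeriv k G).toLp 2
    filter_upwards [Lp.coeFn_add (-Φ (k + 3) t - (Complex.I * a) • Φ (k + 2) t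
        - (b : ℂ) • Φ (k + 1) t) (-A + (θ t : ℂ) • B),
      Lp.coeFn_add (-A) ((θ t : ℂ) • B), Lp.coeFn_neg A,
      coeFn_fourierInv_mulL2_fourier (schwartzDeriv k j) hqz1 hqz2,
      Lp.coeFn_smul (θ t : ℂ) B, (schwartzDeriv k G).coeFn_toLp 2,
      Lp.coeFn_sub (-Φ (k + 3) t - (Complex.I * a) • Φ (k + 2) t) ((b : ℂ) • Φ (k + 1) t),
      Lp.coeFn_sub (-Φ (k + 3) t) ((Complex.I * a) • Φ (k + 2) t),
      Lp.coeFn_neg (Φ (k + 3) t), Lp.coeFn_smul (Complex.I * a) (Φ (k + 2) t),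
      Lp.coeFn_smul (b : ℂ) (Φ (k + 1) t), hcoe (k + 3) (by omega) t, hcoe (k + 2) (by omega) t,
      hcoe (k + 1) (by omega) t] with x h1 h2 h3 h4 h5 h6 h7 h8 h9 h10 h11 h12 h13 h14
    rw [h1, Pi.add_apply, h2, Pi.add_apply, h3, Pi.neg_apply, h4, h5, Pi.smul_apply, h6, h7,
      Pi.sub_apply, h8, Pi.sub_apply, h9, Pi.neg_apply, h10, Pi.smul_apply, h11, Pi.smul_apply,
      h12, h13, h14]
    simp only [conv, smul_eq_mul]
    ring
  · intro k hk
    rw [hΦk k hk, hHT, map_zero, map_zero]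

end

section

/-! ### Weighted energy identities on the line -/

/-- A decreasing bounded weight `κ` with `κ' = -n`, `n' = n1`, `n1' = n2`, together with a function
`ℓ` that is comparable to `1 + x₊` in the applications. The bounds hold with the constant `C`; the
bound `B` of the weight itself does not enter the estimates. -/
structure EnergyWeight (C : ℝ) (κ n n1 n2 ℓ ℓ1 : ℝ → ℝ) : Prop where
  hasDerivAt_κ : ∀ x, HasDerivAt κ (-n x) x
  hasDerivAt_n : ∀ x, HasDerivAt n (n1 x) x
  hasDerivAt_n1 : ∀ x, HasDerivAt n1 (n2 x) x
  hasDerivAt_ℓ : ∀ x, HasDerivAt ℓ (ℓ1 x) x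
  continuous_n2 : Continuous n2
  continuous_ℓ1 : Continuous ℓ1
  pos_n : ∀ x, 0 < n x
  pos_κ : ∀ x, 0 < κ x
  bounded : ∃ B, ∀ x, κ x ≤ B
  one_le : 1 ≤ C
  n1_le : ∀ x, |n1 x| ≤ C * n x
  n2_le : ∀ x, |n2 x| ≤ C * n x
  n_mul_le : ∀ x, n x * ℓ x ≤ C * κ x
  one_le_ℓ : ∀ x, 1 ≤ ℓ x
  ℓ1_le : ∀ x, |ℓ1 x| ≤ 1

lemma integrable_mul_mul_of_bounded {f g k : ℝ → ℝ} (hf : MemLp f 2 volume)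
    (hg : MemLp g 2 volume) (hk : Continuous k) {B : ℝ} (hB : ∀ x, |k x| ≤ B) :
    Integrable (fun x => f x * g x * k x) :=
  (hf.integrable_mul hg).mul_bdd (c := B) hk.aestronglyMeasurable
    (Eventually.of_forall fun x => by simpa using hB x)

lemma integral_mul_le_sqrt_mul_sqrt {α : Type*} [MeasurableSpace α] {μ : Measure α} {f g : α → ℝ}
    (hf : MemLp f 2 μ) (hg : MemLp g 2 μ) :
    ∫ x, |f x| * |g x| ∂μ ≤ √(∫ x, f x ^ 2 ∂μ) * √(∫ x, g x ^ 2 ∂μ) := by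
  have h := integral_mul_norm_le_Lp_mul_Lq (μ := μ) (f := f) (g := g)
    (p := 2) (q := 2) ⟨by norm_num, by norm_num, by norm_num⟩ (by simpa using hf)
    (by simpa using hg)
  simpa [Real.sqrt_eq_rpow] using h

lemma le_integral_of_hasDerivAt_le {F F' H : ℝ → ℝ} (hF : ∀ x, HasDerivAt F (F' x) x)
    (hFi : Integrable F) (hF'm : Continuous F') (hH : Integrable H)
    (h : ∀ x, |F' x| ≤ H x) (x : ℝ) : F x ≤ ∫ y, H y := by
  have hF' : Integrable F' := hH.mono' hF'm.aestronglyMeasurable (Eventually.of_forall h)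
  have h0 : Tendsto F atBot (𝓝 0) := tendsto_zero_of_hasDerivAt_of_integrableOn_Iic (a := x)
    (fun y _ => hF y) hF'.integrableOn hFi.integrableOn
  have h1 := integral_Iic_of_hasDerivAt_of_tendsto' (a := x) (fun y _ => hF y) hF'.integrableOn h0
  have h2 : F x = ∫ y in Iic x, F' y := by rw [h1, sub_zero]
  rw [h2]
  calc ∫ y in Iic x, F' y ≤ ∫ y in Iic x, H y :=
        integral_mono hF'.integrableOn hH.integrableOn fun y => (le_abs_self _).trans (h y)
    _ ≤ ∫ y, H y := setIntegral_le_integral hH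
        (Eventually.of_forall fun y => (abs_nonneg _).trans (h y))

variable {C : ℝ} {κ n n1 n2 ℓ ℓ1 : ℝ → ℝ}

namespace EnergyWeight

lemma continuous_κ (W : EnergyWeight C κ n n1 n2 ℓ ℓ1) : Continuous κ :=
  continuous_iff_continuousAt.2 fun x => (W.hasDerivAt_κ x).continuousAt

lemma continuous_n (W : EnergyWeight C κ n n1 n2 ℓ ℓ1) : Continuous n :=
  continuous_iff_continuousAt.2 fun x => (W.hasDerivAt_n x).continuousAt

lemma continuous_n1 (W : EnergyWeight C κ n n1 n2 ℓ ℓ1) : Continuous n1 :=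
  continuous_iff_continuousAt.2 fun x => (W.hasDerivAt_n1 x).continuousAt

lemma continuous_ℓ (W : EnergyWeight C κ n n1 n2 ℓ ℓ1) : Continuous ℓ :=
  continuous_iff_continuousAt.2 fun x => (W.hasDerivAt_ℓ x).continuousAt

lemma pos_C (W : EnergyWeight C κ n n1 n2 ℓ ℓ1) : 0 < C := zero_lt_one.trans_le W.one_le

lemma n_le (W : EnergyWeight C κ n n1 n2 ℓ ℓ1) (x : ℝ) : n x ≤ C * κ x :=
  (le_mul_of_one_le_right (W.pos_n x).le (W.one_le_ℓ x)).trans (W.n_mul_le x)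

lemma exists_bound (W : EnergyWeight C κ n n1 n2 ℓ ℓ1) : ∃ B, 0 ≤ B ∧ (∀ x, |κ x| ≤ B) ∧
    (∀ x, |n x| ≤ B) ∧ (∀ x, |n1 x| ≤ B) ∧ (∀ x, |n2 x| ≤ B) ∧ (∀ x, |n x * √(ℓ x)| ≤ B) := by
  obtain ⟨B, hB⟩ := W.bounded
  have hC := W.one_le
  have hC0 := W.pos_C
  have hB0 : 0 ≤ B := (W.pos_κ 0).le.trans (hB 0)
  have hn : ∀ x, n x ≤ C * B := fun x =>
    (W.n_le x).trans (mul_le_mul_of_nonneg_left (hB x) hC0.le)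
  refine ⟨C * (C * B), by positivity, fun x => ?_, fun x => ?_, fun x => ?_, fun x => ?_,
    fun x => ?_⟩
  · rw [abs_of_pos (W.pos_κ x)]
    calc κ x ≤ B := hB x
      _ ≤ C * B := le_mul_of_one_le_left hB0 hC
      _ ≤ C * (C * B) := le_mul_of_one_le_left (by positivity) hC
  · rw [abs_of_pos (W.pos_n x)]
    exact (hn x).trans (le_mul_of_one_le_left (by positivity) hC)
  · exact (W.n1_le x).trans (mul_le_mul_of_nonneg_left (hn x) hC0.le)
  · exact (W.n2_le x).trans (mul_le_mul_of_nonneg_left (hn x) hC0.le)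
  · have hl := W.one_le_ℓ x
    rw [abs_of_nonneg (mul_nonneg (W.pos_n x).le (Real.sqrt_nonneg _))]
    calc n x * √(ℓ x) ≤ n x * ℓ x := by
          gcongr
          · exact (W.pos_n x).le
          · rw [Real.sqrt_le_left (by linarith)]; nlinarith
      _ ≤ C * κ x := W.n_mul_le x
      _ ≤ C * B := by gcongr; exact hB x
      _ ≤ C * (C * B) := le_mul_of_one_le_left (by positivity) hC

end EnergyWeight

lemma hasDerivAt_re {f : ℝ → ℂ} {f' : ℂ} {x : ℝ} (h : HasDerivAt f f' x) :
    HasDerivAt (fun x => (f x).re) f'.re x :=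
  Complex.reCLM.hasFDerivAt.comp_hasDerivAt x h

lemma hasDerivAt_im {f : ℝ → ℂ} {f' : ℂ} {x : ℝ} (h : HasDerivAt f f' x) :
    HasDerivAt (fun x => (f x).im) f'.im x :=
  Complex.imCLM.hasFDerivAt.comp_hasDerivAt x h

lemma memLp_re {f : ℝ → ℂ} (h : MemLp f 2 volume) : MemLp (fun x => (f x).re) 2 volume := h.re
lemma memLp_im {f : ℝ → ℂ} (h : MemLp f 2 volume) : MemLp (fun x => (f x).im) 2 volume := h.im

lemma integrable_norm_sq_mul {f : ℝ → ℂ} (hf : MemLp f 2 volume) {k : ℝ → ℝ} (hk : Continuous k)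
    {B : ℝ} (hB : ∀ x, |k x| ≤ B) : Integrable (fun x => ‖f x‖ ^ 2 * k x) := by
  have := integrable_mul_mul_of_bounded hf.norm hf.norm hk hB
  simpa only [sq] using this

lemma integrable_re_mul_conj_mul {f g : ℝ → ℂ} (hf : MemLp f 2 volume) (hg : MemLp g 2 volume)
    {k : ℝ → ℝ} (hk : Continuous k) {B : ℝ} (hB : ∀ x, |k x| ≤ B) :
    Integrable (fun x => (f x * starRingEnd ℂ (g x)).re * k x) := by
  have h1 := integrable_mul_mul_of_bounded (memLp_re hf) (memLp_re hg) hk hB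
  have h2 := integrable_mul_mul_of_bounded (memLp_im hf) (memLp_im hg) hk hB
  refine (h1.add h2).congr (Eventually.of_forall fun x => ?_)
  simp only [Pi.add_apply, Complex.mul_re, Complex.conj_re, Complex.conj_im]
  ring

/-- The local smoothing effect: the antisymmetric linear part produces the positive term
`∫ |f'|² n`, `n = -κ'`. All other terms form a total derivative up to `∫ |f|² κ`. -/
lemma integral_linear_energy_ge (W : EnergyWeight C κ n n1 n2 ℓ ℓ1) (a b : ℝ)
    {f0 f1 f2 f3 : ℝ → ℂ} (h0 : ∀ x, HasDerivAt f0 (f1 x) x) (h1 : ∀ x, HasDerivAt f1 (f2 x) x)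
    (h2 : ∀ x, HasDerivAt f2 (f3 x) x) (m0 : MemLp f0 2 volume) (m1 : MemLp f1 2 volume)
    (m2 : MemLp f2 2 volume) (m3 : MemLp f3 2 volume) :
    (∫ x, ‖f1 x‖ ^ 2 * n x) - (C ^ 2 + a ^ 2 * C + |b| * C) * ∫ x, ‖f0 x‖ ^ 2 * κ x ≤
      ∫ x, ((-f3 x - Complex.I * a * f2 x - b * f1 x) * starRingEnd ℂ (f0 x)).re * κ x := by
  obtain ⟨B, hB0, hκ, hn, hn1, hn2, -⟩ := W.exists_bound
  have cκ := W.continuous_κ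
  have cn := W.continuous_n
  have cn1 := W.continuous_n1
  have cn2 := W.continuous_n2
  have mx0 := memLp_re m0
  have my0 := memLp_im m0
  have mx1 := memLp_re m1
  have my1 := memLp_im m1
  have mx2 := memLp_re m2
  have my2 := memLp_im m2
  have mx3 := memLp_re m3
  have my3 := memLp_im m3
  set G : ℝ → ℝ := fun x =>
    ((f2 x).re * (f0 x).re * κ x + (f2 x).im * (f0 x).im * κ x)
    - (1 / 2) * ((f1 x).re * (f1 x).re * κ x + (f1 x).im * (f1 x).im * κ x)
    + ((f1 x).re * (f0 x).re * n x + (f1 x).im * (f0 x).im * n x)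
    - (1 / 2) * ((f0 x).re * (f0 x).re * n1 x + (f0 x).im * (f0 x).im * n1 x)
    + a * ((f1 x).re * (f0 x).im * κ x - (f1 x).im * (f0 x).re * κ x)
    + (b / 2) * ((f0 x).re * (f0 x).re * κ x + (f0 x).im * (f0 x).im * κ x) with hG
  set D : ℝ → ℝ := fun x =>
    ((f3 x).re * (f0 x).re * κ x + (f3 x).im * (f0 x).im * κ x)
    + (3 / 2) * ((f1 x).re * (f1 x).re * n x + (f1 x).im * (f1 x).im * n x)
    - (1 / 2) * ((f0 x).re * (f0 x).re * n2 x + (f0 x).im * (f0 x).im * n2 x)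
    + a * ((f2 x).re * (f0 x).im * κ x - (f2 x).im * (f0 x).re * κ x)
    - a * ((f1 x).re * (f0 x).im * n x - (f1 x).im * (f0 x).re * n x)
    + b * ((f1 x).re * (f0 x).re * κ x + (f1 x).im * (f0 x).im * κ x)
    - (b / 2) * ((f0 x).re * (f0 x).re * n x + (f0 x).im * (f0 x).im * n x) with hD
  have hGD : ∀ x, HasDerivAt G (D x) x := by
    intro x
    have x0 := hasDerivAt_re (h0 x)
    have y0 := hasDerivAt_im (h0 x)
    have x1 := hasDerivAt_re (h1 x)
    have y1 := hasDerivAt_im (h1 x)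
    have x2 := hasDerivAt_re (h2 x)
    have y2 := hasDerivAt_im (h2 x)
    have k0 := W.hasDerivAt_κ x
    have k1 := W.hasDerivAt_n x
    have k2 := W.hasDerivAt_n1 x
    refine (((((((x2.mul x0).mul k0).add ((y2.mul y0).mul k0)).sub
      ((((x1.mul x1).mul k0).add ((y1.mul y1).mul k0)).const_mul (1 / 2))).add
      (((x1.mul x0).mul k1).add ((y1.mul y0).mul k1))).sub
      ((((x0.mul x0).mul k2).add ((y0.mul y0).mul k2)).const_mul (1 / 2))).add
      ((((x1.mul y0).mul k0).sub ((y1.mul x0).mul k0)).const_mul a)).add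
      ((((x0.mul x0).mul k0).add ((y0.mul y0).mul k0)).const_mul (b / 2)) |>.congr_deriv ?_
    simp only [hD, Pi.mul_apply]
    ring
  have iP : ∀ {f g : ℝ → ℝ}, MemLp f 2 volume → MemLp g 2 volume →
      Integrable (fun x => f x * g x * κ x) ∧ Integrable (fun x => f x * g x * n x) ∧
      Integrable (fun x => f x * g x * n1 x) ∧ Integrable (fun x => f x * g x * n2 x) :=
    fun hf hg => ⟨integrable_mul_mul_of_bounded hf hg cκ hκ,
      integrable_mul_mul_of_bounded hf hg cn hn, integrable_mul_mul_of_bounded hf hg cn1 hn1,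
      integrable_mul_mul_of_bounded hf hg cn2 hn2⟩
  have iG : Integrable G :=
    ((((((iP mx2 mx0).1.add (iP my2 my0).1).sub
      (((iP mx1 mx1).1.add (iP my1 my1).1).const_mul _)).add
      ((iP mx1 mx0).2.1.add (iP my1 my0).2.1)).sub
      (((iP mx0 mx0).2.2.1.add (iP my0 my0).2.2.1).const_mul _)).add
      (((iP mx1 my0).1.sub (iP my1 mx0).1).const_mul _)).add
      (((iP mx0 mx0).1.add (iP my0 my0).1).const_mul _)
  have iD : Integrable D :=
    (((((((iP mx3 mx0).1.add (iP my3 my0).1).add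
      (((iP mx1 mx1).2.1.add (iP my1 my1).2.1).const_mul _)).sub
      (((iP mx0 mx0).2.2.2.add (iP my0 my0).2.2.2).const_mul _)).add
      (((iP mx2 my0).1.sub (iP my2 mx0).1).const_mul _)).sub
      (((iP mx1 my0).2.1.sub (iP my1 mx0).2.1).const_mul _)).add
      (((iP mx1 mx0).1.add (iP my1 my0).1).const_mul _)).sub
      (((iP mx0 mx0).2.1.add (iP my0 my0).2.1).const_mul _)
  have hzero : ∫ x, D x = 0 := integral_eq_zero_of_hasDerivAt_of_integrable hGD iD iG
  have mL : MemLp (fun x => -f3 x - Complex.I * a * f2 x - b * f1 x) 2 volume :=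
    (m3.neg.sub (m2.const_mul _)).sub (m1.const_mul _)
  have iL := integrable_re_mul_conj_mul mL m0 cκ hκ
  have iS := integrable_norm_sq_mul m1 cn hn
  have iE := integrable_norm_sq_mul m0 cκ hκ
  rw [← integral_const_mul, ← integral_sub iS (iE.const_mul _)]
  have : ∫ x, ((-f3 x - Complex.I * a * f2 x - b * f1 x) * starRingEnd ℂ (f0 x)).re * κ x
      = ∫ x, (((-f3 x - Complex.I * a * f2 x - b * f1 x) * starRingEnd ℂ (f0 x)).re * κ x
        + D x) := by
    rw [integral_add iL iD, hzero, add_zero]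
  rw [this]
  refine integral_mono (iS.sub (iE.const_mul _)) (iL.add iD) fun x => ?_
  have hnp := W.pos_n x
  have hkp := W.pos_κ x
  have e1 : ‖f1 x‖ ^ 2 = (f1 x).re ^ 2 + (f1 x).im ^ 2 := by
    rw [Complex.sq_norm, Complex.normSq_apply]; ring
  have e0 : ‖f0 x‖ ^ 2 = (f0 x).re ^ 2 + (f0 x).im ^ 2 := by
    rw [Complex.sq_norm, Complex.normSq_apply]; ring
  have hCpos := W.pos_C
  have b1 : n x ≤ C * κ x := W.n_le x
  have b2 : |n2 x| ≤ C ^ 2 * κ x := (W.n2_le x).trans (by rw [sq, mul_assoc]; gcongr)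
  have b3 : n2 x ≤ C ^ 2 * κ x := (le_abs_self _).trans b2
  have b4 : b * n x ≤ |b| * C * κ x := by
    calc b * n x ≤ |b| * n x := by gcongr; exact le_abs_self b
      _ ≤ |b| * (C * κ x) := by gcongr
      _ = _ := by ring
  have b5 : a ^ 2 * n x ≤ a ^ 2 * C * κ x := by
    rw [mul_assoc]; gcongr
  simp only [e1, e0, hD, Complex.mul_re, Complex.sub_re, Complex.neg_re,
    Complex.sub_im, Complex.neg_im, Complex.mul_im, Complex.I_re, Complex.I_im,
    Complex.ofReal_re, Complex.ofReal_im, Complex.conj_re, Complex.conj_im]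
  set X0 := (f0 x).re
  set Y0 := (f0 x).im
  set X1 := (f1 x).re
  set Y1 := (f1 x).im
  have c1 : 0 ≤ (X0 ^ 2 + Y0 ^ 2) * (C ^ 2 * κ x - n2 x) :=
    mul_nonneg (by positivity) (by linarith)
  have c2 : 0 ≤ (X0 ^ 2 + Y0 ^ 2) * (|b| * C * κ x - b * n x) :=
    mul_nonneg (by positivity) (by linarith)
  have c3 : 0 ≤ (X0 ^ 2 + Y0 ^ 2) * (a ^ 2 * C * κ x - a ^ 2 * n x) :=
    mul_nonneg (by positivity) (by linarith)
  have c4 : 0 ≤ n x * ((X1 - a * Y0) ^ 2 + (Y1 + a * X0) ^ 2) := by positivity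
  have c5 : 0 ≤ (X0 ^ 2 + Y0 ^ 2) * (C ^ 2 * κ x) := by positivity
  have c6 : 0 ≤ (X0 ^ 2 + Y0 ^ 2) * (|b| * C * κ x) := by positivity
  have c7 : 0 ≤ (X0 ^ 2 + Y0 ^ 2) * (a ^ 2 * C * κ x) := by positivity
  linarith [c1, c2, c3, c4, c5, c6, c7]

end

section

variable {C : ℝ} {κ n n1 n2 ℓ ℓ1 : ℝ → ℝ}

lemma memLp_norm_mul_sqrt {f : ℝ → ℂ} (hf : MemLp f 2 volume) {k : ℝ → ℝ} (hk : Continuous k)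
    {B : ℝ} (hB : ∀ x, |k x| ≤ B) : MemLp (fun x => ‖f x‖ * √(k x)) 2 volume := by
  refine MemLp.of_le_mul (c := √B) hf.norm
    (hf.1.norm.mul (hk.sqrt).aestronglyMeasurable) (Eventually.of_forall fun x => ?_)
  rw [norm_mul, norm_norm, Real.norm_eq_abs, abs_of_nonneg (Real.sqrt_nonneg _), mul_comm]
  gcongr
  exact (le_abs_self _).trans (hB x)

lemma sq_norm_mul_sqrt (f : ℝ → ℂ) {k : ℝ → ℝ} {x : ℝ} (hk : 0 ≤ k x) :
    (‖f x‖ * √(k x)) ^ 2 = ‖f x‖ ^ 2 * k x := by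
  rw [mul_pow, Real.sq_sqrt hk]

/-- The interpolation inequality `sup |f|² n ℓ^(1/2) ≤ C (‖f κ^(1/2)‖ ‖f' n^(1/2)‖ + ‖f κ^(1/2)‖²)`.
The weight on the left is the one that the coefficient term of the equation requires. -/
lemma sq_norm_mul_weight_le (W : EnergyWeight C κ n n1 n2 ℓ ℓ1) {f0 f1 : ℝ → ℂ}
    (h0 : ∀ x, HasDerivAt f0 (f1 x) x) (m0 : MemLp f0 2 volume) (m1 : MemLp f1 2 volume)
    (c1 : Continuous f1) (x : ℝ) :
    ‖f0 x‖ ^ 2 * (n x * √(ℓ x)) ≤ 2 * C * (C + 1) *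
      (√(∫ y, ‖f0 y‖ ^ 2 * κ y) * √(∫ y, ‖f1 y‖ ^ 2 * n y) + ∫ y, ‖f0 y‖ ^ 2 * κ y) := by
  obtain ⟨B, hB0, hκ, hn, hn1, hn2, hnl⟩ := W.exists_bound
  have hC := W.one_le
  have cκ := W.continuous_κ
  have cn := W.continuous_n
  have cℓ := W.continuous_ℓ
  have c0 : Continuous f0 := continuous_iff_continuousAt.2 fun x => (h0 x).continuousAt
  set F : ℝ → ℝ := fun x => ‖f0 x‖ ^ 2 * (n x * √(ℓ x)) with hF
  set F' : ℝ → ℝ := fun x => 2 * (inner ℝ (f0 x) (f1 x)) * (n x * √(ℓ x)) +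
    ‖f0 x‖ ^ 2 * (n1 x * √(ℓ x) + n x * (ℓ1 x / (2 * √(ℓ x)))) with hF'
  have hFd : ∀ x, HasDerivAt F (F' x) x := fun x => by
    have h1 := (h0 x).norm_sq
    have hl : ℓ x ≠ 0 := by linarith [W.one_le_ℓ x]
    exact h1.mul ((W.hasDerivAt_n x).mul ((W.hasDerivAt_ℓ x).sqrt hl))
  have hFi : Integrable F := integrable_norm_sq_mul m0 (cn.mul cℓ.sqrt) hnl
  have hF'c : Continuous F' := by
    have hl : ∀ x, 2 * √(ℓ x) ≠ 0 := fun x => by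
      have := W.one_le_ℓ x
      have : 0 < √(ℓ x) := Real.sqrt_pos.2 (by linarith)
      positivity
    have := W.continuous_n1
    have := W.continuous_ℓ1
    have hdiv : Continuous fun x => ℓ1 x / (2 * √(ℓ x)) :=
      this.div (continuous_const.mul cℓ.sqrt) hl
    fun_prop
  set g0 : ℝ → ℝ := fun x => ‖f0 x‖ * √(κ x) with hg0
  set g1 : ℝ → ℝ := fun x => ‖f1 x‖ * √(n x) with hg1
  have mg0 : MemLp g0 2 volume := memLp_norm_mul_sqrt m0 cκ hκ
  have mg1 : MemLp g1 2 volume := memLp_norm_mul_sqrt m1 cn hn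
  have iE := integrable_norm_sq_mul m0 cκ hκ
  set H : ℝ → ℝ := fun x => 2 * C * (|g0 x| * |g1 x|) + 2 * C * (C + 1) * (‖f0 x‖ ^ 2 * κ x) with hH
  have iH1 : Integrable (fun x => |g0 x| * |g1 x|) := by
    exact mg0.norm.integrable_mul mg1.norm
  have hHi : Integrable H := (iH1.const_mul _).add (iE.const_mul _)
  have hle : ∀ x, |F' x| ≤ H x := by
    intro x
    have hnp := W.pos_n x
    have hkp := W.pos_κ x
    have hl1 := W.one_le_ℓ x
    have hsl : 1 ≤ √(ℓ x) := Real.one_le_sqrt.2 hl1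
    have hsl2 : √(ℓ x) * √(ℓ x) = ℓ x := Real.mul_self_sqrt (by linarith)
    have hsl3 : √(ℓ x) ≤ ℓ x := by nlinarith
    have hnk := W.n_mul_le x
    have a1 : n x * √(ℓ x) ≤ C * (√(κ x) * √(n x)) := by
      have : n x * √(ℓ x) = √(n x) * √(n x * ℓ x) := by
        rw [Real.sqrt_mul hnp.le, ← mul_assoc, Real.mul_self_sqrt hnp.le]
      rw [this]
      calc √(n x) * √(n x * ℓ x) ≤ √(n x) * √(C ^ 2 * κ x) := by
            refine mul_le_mul_of_nonneg_left (Real.sqrt_le_sqrt (hnk.trans ?_)) (Real.sqrt_nonneg _)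
            gcongr
            nlinarith
        _ = C * (√(κ x) * √(n x)) := by
            rw [Real.sqrt_mul (by positivity), Real.sqrt_sq (by linarith)]; ring
    have a2 : |n1 x * √(ℓ x) + n x * (ℓ1 x / (2 * √(ℓ x)))| ≤ 2 * C * (C + 1) * κ x := by
      have b1 : |n1 x * √(ℓ x)| ≤ C * (C * κ x) := by
        rw [abs_mul, abs_of_nonneg (Real.sqrt_nonneg _)]
        calc |n1 x| * √(ℓ x) ≤ (C * n x) * ℓ x := by
              have := W.n1_le x
              gcongr
          _ = C * (n x * ℓ x) := by ring
          _ ≤ _ := by gcongr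
      have b2 : |n x * (ℓ1 x / (2 * √(ℓ x)))| ≤ C * κ x := by
        rw [abs_mul, abs_of_pos hnp, abs_div, abs_of_pos (by positivity : 0 < 2 * √(ℓ x))]
        have : |ℓ1 x| / (2 * √(ℓ x)) ≤ 1 := by
          rw [div_le_one (by positivity)]
          linarith [W.ℓ1_le x]
        calc n x * (|ℓ1 x| / (2 * √(ℓ x))) ≤ n x * 1 := by gcongr
          _ ≤ C * κ x := by rw [mul_one]; exact W.n_le x
      refine (abs_add_le _ _).trans ?_
      have : 0 ≤ C * (C * κ x) := by positivity
      have : 0 ≤ C * κ x := by positivity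
      nlinarith
    have a3 : |inner ℝ (f0 x) (f1 x)| ≤ ‖f0 x‖ * ‖f1 x‖ := abs_real_inner_le_norm _ _
    have e0 : |g0 x| = ‖f0 x‖ * √(κ x) := abs_of_nonneg (by positivity)
    have e1 : |g1 x| = ‖f1 x‖ * √(n x) := abs_of_nonneg (by positivity)
    simp only [hF', hH, e0, e1]
    refine (abs_add_le _ _).trans (add_le_add ?_ ?_)
    · rw [abs_mul, abs_mul, abs_of_nonneg (by positivity : 0 ≤ n x * √(ℓ x)), abs_two]
      calc 2 * |inner ℝ (f0 x) (f1 x)| * (n x * √(ℓ x))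
          ≤ 2 * (‖f0 x‖ * ‖f1 x‖) * (C * (√(κ x) * √(n x))) := by gcongr
        _ = _ := by ring
    · rw [abs_mul, abs_of_nonneg (by positivity : 0 ≤ ‖f0 x‖ ^ 2)]
      calc _ ≤ ‖f0 x‖ ^ 2 * (2 * C * (C + 1) * κ x) := by gcongr
        _ = _ := by ring
  have key := le_integral_of_hasDerivAt_le hFd hFi hF'c hHi hle x
  have hCS := integral_mul_le_sqrt_mul_sqrt mg0 mg1
  simp only [hg0, hg1] at hCS
  simp_rw [fun x => sq_norm_mul_sqrt f0 (W.pos_κ x).le, fun x => sq_norm_mul_sqrt f1 (W.pos_n x).le] at hCS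
  rw [hH, integral_add (iH1.const_mul _) (iE.const_mul _), integral_const_mul,
    integral_const_mul] at key
  refine key.trans ?_
  set E := ∫ y, ‖f0 y‖ ^ 2 * κ y
  set S := ∫ y, ‖f1 y‖ ^ 2 * n y
  have hES : 0 ≤ √E * √S := by positivity
  calc 2 * C * (∫ x, |g0 x| * |g1 x|) + 2 * C * (C + 1) * E
      ≤ 2 * C * (√E * √S) + 2 * C * (C + 1) * E := by gcongr
    _ ≤ _ := by nlinarith [mul_nonneg (by positivity : 0 ≤ C * C) hES]

end

section

/-! ### Weighted estimates of the regularized coefficient term -/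

variable {C : ℝ} {κ n n1 n2 ℓ ℓ1 : ℝ → ℝ}

/-- A positive function whose logarithm is `C`-Lipschitz. -/
lemma le_exp_mul_of_abs_deriv_le {f f' : ℝ → ℝ} (hf : ∀ x, HasDerivAt f (f' x) x)
    (h : ∀ x, |f' x| ≤ C * f x) (x y : ℝ) : f x ≤ Real.exp (C * |x - y|) * f y := by
  rcases le_total y x with hxy | hxy
  · have hd : ∀ z, HasDerivAt (fun z => f z * Real.exp (-(C * z)))
        (f' z * Real.exp (-(C * z)) + f z * (Real.exp (-(C * z)) * (-(C * 1)))) z := fun z =>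
      (hf z).mul ((((hasDerivAt_id z).const_mul C).neg).exp)
    have hanti : Antitone (fun z => f z * Real.exp (-(C * z))) :=
      antitone_of_hasDerivAt_nonpos hd fun z => by
        have h1 := (le_abs_self _).trans (h z)
        have h2 := Real.exp_pos (-(C * z))
        simp only [Pi.zero_apply]
        nlinarith
    have h1 := hanti hxy
    simp only at h1
    rw [abs_of_nonneg (sub_nonneg.2 hxy)]
    have e : Real.exp (C * (x - y)) = Real.exp (C * x) * Real.exp (-(C * y)) := by
      rw [← Real.exp_add]; ring_nf
    have e2 : Real.exp (-(C * x)) * Real.exp (C * x) = 1 := by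
      rw [← Real.exp_add, neg_add_cancel, Real.exp_zero]
    calc f x = (f x * Real.exp (-(C * x))) * Real.exp (C * x) := by rw [mul_assoc, e2, mul_one]
      _ ≤ (f y * Real.exp (-(C * y))) * Real.exp (C * x) := by gcongr
      _ = _ := by rw [e]; ring
  · have hd : ∀ z, HasDerivAt (fun z => f z * Real.exp (C * z))
        (f' z * Real.exp (C * z) + f z * (Real.exp (C * z) * (C * 1))) z := fun z =>
      (hf z).mul ((((hasDerivAt_id z).const_mul C)).exp)
    have hmono : Monotone (fun z => f z * Real.exp (C * z)) :=
      monotone_of_hasDerivAt_nonneg hd fun z => by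
        have h1 := (neg_abs_le _).trans' (neg_le_neg (h z))
        have h2 := Real.exp_pos (C * z)
        simp only [Pi.zero_apply]
        nlinarith
    have h1 := hmono hxy
    simp only at h1
    rw [abs_of_nonpos (sub_nonpos.2 hxy)]
    have e : Real.exp (C * -(x - y)) = Real.exp (-(C * x)) * Real.exp (C * y) := by
      rw [← Real.exp_add]; ring_nf
    have e2 : Real.exp (C * x) * Real.exp (-(C * x)) = 1 := by
      rw [← Real.exp_add, add_neg_cancel, Real.exp_zero]
    calc f x = (f x * Real.exp (C * x)) * Real.exp (-(C * x)) := by rw [mul_assoc, e2, mul_one]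
      _ ≤ (f y * Real.exp (C * y)) * Real.exp (-(C * x)) := by gcongr
      _ = _ := by rw [e]; ring

/-- The weight `(n ℓ^(1/2))^(1/2)` of the sup-norm estimates. -/
def supWeight (n ℓ : ℝ → ℝ) (x : ℝ) : ℝ := √(n x * √(ℓ x))

/-- The weight `ℓ^(3/4)` of the coefficients. -/
def coeffWeight (ℓ : ℝ → ℝ) (x : ℝ) : ℝ := √(ℓ x) * √√(ℓ x)

namespace EnergyWeight

lemma pos_ℓ (W : EnergyWeight C κ n n1 n2 ℓ ℓ1) (x : ℝ) : 0 < ℓ x :=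
  zero_lt_one.trans_le (W.one_le_ℓ x)

lemma n_le_exp (W : EnergyWeight C κ n n1 n2 ℓ ℓ1) {x y : ℝ} (h : |x - y| ≤ 1) :
    n x ≤ Real.exp C * n y := by
  refine (le_exp_mul_of_abs_deriv_le W.hasDerivAt_n W.n1_le x y).trans ?_
  have := W.pos_n y
  have := W.pos_C
  gcongr
  nlinarith

lemma ℓ_le_exp (W : EnergyWeight C κ n n1 n2 ℓ ℓ1) {x y : ℝ} (h : |x - y| ≤ 1) :
    ℓ x ≤ Real.exp C * ℓ y := by
  have h1 : ∀ x, |ℓ1 x| ≤ C * ℓ x := fun x =>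
    (W.ℓ1_le x).trans (one_le_mul_of_one_le_of_one_le W.one_le (W.one_le_ℓ x))
  refine (le_exp_mul_of_abs_deriv_le W.hasDerivAt_ℓ h1 x y).trans ?_
  have := W.pos_ℓ y
  have := W.pos_C
  gcongr
  nlinarith

lemma n_mul_ℓ_eq (W : EnergyWeight C κ n n1 n2 ℓ ℓ1) (x : ℝ) :
    n x * ℓ x = supWeight n ℓ x * √(n x) * coeffWeight ℓ x := by
  have h1 := (W.pos_n x).le
  have h2 := (W.pos_ℓ x).le
  rw [supWeight, coeffWeight, Real.sqrt_mul h1]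
  calc n x * ℓ x = (√(n x) * √(n x)) * (√(ℓ x) * √(ℓ x)) := by
        rw [Real.mul_self_sqrt h1, Real.mul_self_sqrt h2]
    _ = (√(n x) * √(n x)) * (√(ℓ x) * (√√(ℓ x) * √√(ℓ x))) := by
        rw [Real.mul_self_sqrt (Real.sqrt_nonneg _)]
    _ = _ := by ring

lemma supWeight_le (W : EnergyWeight C κ n n1 n2 ℓ ℓ1) {x y : ℝ} (h : |x - y| ≤ 1) :
    supWeight n ℓ x ≤ Real.exp C * supWeight n ℓ y := by
  have h1 := W.n_le_exp h
  have h2 := W.ℓ_le_exp h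
  have p1 := W.pos_n y
  have p2 := W.pos_ℓ y
  have hE : 1 ≤ Real.exp C := Real.one_le_exp W.pos_C.le
  rw [supWeight, supWeight]
  have h3 : √(ℓ x) ≤ Real.exp C * √(ℓ y) := by
    calc √(ℓ x) ≤ √(Real.exp C ^ 2 * ℓ y) := Real.sqrt_le_sqrt (h2.trans (by gcongr; nlinarith))
      _ = _ := by rw [Real.sqrt_mul (by positivity), Real.sqrt_sq (by positivity)]
  calc √(n x * √(ℓ x)) ≤ √((Real.exp C * n y) * (Real.exp C * √(ℓ y))) := by
        apply Real.sqrt_le_sqrt; gcongr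
    _ = √(Real.exp C ^ 2 * (n y * √(ℓ y))) := by ring_nf
    _ = _ := by rw [Real.sqrt_mul (by positivity), Real.sqrt_sq (by positivity)]

lemma sqrt_n_le (W : EnergyWeight C κ n n1 n2 ℓ ℓ1) {x y : ℝ} (h : |x - y| ≤ 1) :
    √(n x) ≤ Real.exp C * √(n y) := by
  have h1 := W.n_le_exp h
  have p1 := W.pos_n y
  have hE : 1 ≤ Real.exp C := Real.one_le_exp W.pos_C.le
  calc √(n x) ≤ √(Real.exp C ^ 2 * n y) := Real.sqrt_le_sqrt (h1.trans (by gcongr; nlinarith))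
    _ = _ := by rw [Real.sqrt_mul (by positivity), Real.sqrt_sq (by positivity)]

lemma coeffWeight_le (W : EnergyWeight C κ n n1 n2 ℓ ℓ1) {x y : ℝ} (h : |x - y| ≤ 1) :
    coeffWeight ℓ x ≤ Real.exp C ^ 2 * coeffWeight ℓ y := by
  have h2 := W.ℓ_le_exp h
  have p2 := W.pos_ℓ y
  have hE : 1 ≤ Real.exp C := Real.one_le_exp W.pos_C.le
  have h3 : √(ℓ x) ≤ Real.exp C * √(ℓ y) := by
    calc √(ℓ x) ≤ √(Real.exp C ^ 2 * ℓ y) := Real.sqrt_le_sqrt (h2.trans (by gcongr; nlinarith))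
      _ = _ := by rw [Real.sqrt_mul (by positivity), Real.sqrt_sq (by positivity)]
  have h4 : √√(ℓ x) ≤ Real.exp C * √√(ℓ y) := by
    calc √√(ℓ x) ≤ √(Real.exp C ^ 2 * √(ℓ y)) :=
          Real.sqrt_le_sqrt (h3.trans (by gcongr; nlinarith))
      _ = _ := by rw [Real.sqrt_mul (by positivity), Real.sqrt_sq (by positivity)]
  rw [coeffWeight, coeffWeight]
  calc √(ℓ x) * √√(ℓ x) ≤ (Real.exp C * √(ℓ y)) * (Real.exp C * √√(ℓ y)) := by gcongr
    _ = _ := by ring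

lemma κ_le_left (W : EnergyWeight C κ n n1 n2 ℓ ℓ1) {x y : ℝ} (h : |x - y| ≤ 1)
    (hx : κ x ≤ C * (n x * ℓ x)) :
    κ x ≤ C * Real.exp C ^ 3 * (supWeight n ℓ x * (√(n y) * coeffWeight ℓ y)) := by
  have p := W.pos_C
  have hs : 0 ≤ supWeight n ℓ x := Real.sqrt_nonneg _
  have hc : 0 ≤ coeffWeight ℓ x := mul_nonneg (Real.sqrt_nonneg _) (Real.sqrt_nonneg _)
  rw [W.n_mul_ℓ_eq] at hx
  calc κ x ≤ C * (supWeight n ℓ x * √(n x) * coeffWeight ℓ x) := hx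
    _ ≤ C * (supWeight n ℓ x * (Real.exp C * √(n y)) * (Real.exp C ^ 2 * coeffWeight ℓ y)) := by
        gcongr
        · exact W.sqrt_n_le h
        · exact W.coeffWeight_le h
    _ = _ := by ring

lemma κ_le_right (W : EnergyWeight C κ n n1 n2 ℓ ℓ1) {x y : ℝ} (h : |x - y| ≤ 1)
    (hx : κ x ≤ C * (n x * ℓ x)) :
    κ x ≤ C * Real.exp C ^ 3 * (supWeight n ℓ y * (coeffWeight ℓ y * √(n x))) := by
  have p := W.pos_C
  have hs : 0 ≤ supWeight n ℓ y := Real.sqrt_nonneg _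
  have hc : 0 ≤ coeffWeight ℓ x := mul_nonneg (Real.sqrt_nonneg _) (Real.sqrt_nonneg _)
  rw [W.n_mul_ℓ_eq] at hx
  calc κ x ≤ C * (supWeight n ℓ x * √(n x) * coeffWeight ℓ x) := hx
    _ ≤ C * ((Real.exp C * supWeight n ℓ y) * √(n x) * (Real.exp C ^ 2 * coeffWeight ℓ y)) := by
        gcongr
        · exact W.supWeight_le h
        · exact W.coeffWeight_le h
    _ = _ := by ring

end EnergyWeight

lemma lintegral_lintegral_kernel_eq {J h : ℝ → ℝ≥0∞} (hJ : Measurable J) (hh : Measurable h) :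
    ∫⁻ x, ∫⁻ y, J (x - y) * h y = (∫⁻ z, J z) * ∫⁻ y, h y := by
  rw [lintegral_lintegral_swap (by fun_prop), ← lintegral_const_mul _ hh]
  refine lintegral_congr fun y => ?_
  rw [lintegral_mul_const _ (by fun_prop), lintegral_sub_right_eq_self]

lemma lintegral_lintegral_kernel_le {J p r : ℝ → ℝ≥0∞} (hJ : Measurable J) (hp : Measurable p)
    (hr : Measurable r) :
    ∫⁻ x, ∫⁻ y, J (x - y) * (p y * r x) ≤
      (∫⁻ z, J z) * ((∫⁻ y, p y ^ 2) ^ (1 / 2 : ℝ) * (∫⁻ x, r x ^ 2) ^ (1 / 2 : ℝ)) := by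
  have h1 : ∀ x, ∫⁻ y, J (x - y) * (p y * r x) = ∫⁻ z, J z * (p (x - z) * r x) := fun x => by
    rw [← lintegral_sub_left_eq_self (fun y => J (x - y) * (p y * r x)) x]
    simp
  simp_rw [h1]
  rw [lintegral_lintegral_swap (by fun_prop), ← lintegral_mul_const _ hJ]
  refine lintegral_mono fun z => ?_
  rw [lintegral_const_mul _ (by fun_prop)]
  gcongr
  have h2 := ENNReal.lintegral_mul_le_Lp_mul_Lq volume (p := 2) (q := 2)
    ⟨by norm_num, by norm_num, by norm_num⟩ (f := fun x => p (x - z)) (g := r)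
    (by fun_prop) (by fun_prop)
  simp only [Pi.mul_apply, ENNReal.rpow_ofNat] at h2
  rwa [lintegral_sub_right_eq_self (fun x => p x ^ 2) z] at h2

lemma lintegral_ofReal_sq {f : ℝ → ℝ} (hf : MemLp f 2 volume) :
    (∫⁻ x, ENNReal.ofReal |f x| ^ 2) ^ (1 / 2 : ℝ) = ENNReal.ofReal (√(∫ x, f x ^ 2)) := by
  have h1 : ∫⁻ x, ENNReal.ofReal |f x| ^ 2 = ENNReal.ofReal (∫ x, f x ^ 2) := by
    rw [ofReal_integral_eq_lintegral_ofReal hf.integrable_sq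
      (Eventually.of_forall fun x => by positivity)]
    refine lintegral_congr fun x => ?_
    rw [← ENNReal.ofReal_pow (abs_nonneg _), sq_abs]
  rw [h1, ENNReal.ofReal_rpow_of_nonneg (integral_nonneg fun x => by positivity) (by norm_num),
    Real.sqrt_eq_rpow]

/-- A pairing with a convolution, estimated in absolute value. -/
lemma enorm_integral_conv_le (j f g : ℝ → ℂ) (k : ℝ → ℝ) :
    ‖∫ x, (conv j f x * starRingEnd ℂ (g x)).re * k x‖ₑ ≤
      ∫⁻ x, ∫⁻ y, ‖j (x - y)‖ₑ * (‖f y‖ₑ * (‖g x‖ₑ * ‖k x‖ₑ)) := by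
  refine (enorm_integral_le_lintegral_enorm _).trans (lintegral_mono fun x => ?_)
  have h1 : ‖(conv j f x * starRingEnd ℂ (g x)).re‖ₑ ≤ ‖conv j f x‖ₑ * ‖g x‖ₑ := by
    rw [← ofReal_norm, ← ofReal_norm, ← ofReal_norm, ← ENNReal.ofReal_mul (norm_nonneg _)]
    refine ENNReal.ofReal_le_ofReal ?_
    refine (Complex.abs_re_le_norm _).trans ?_
    rw [norm_mul, RCLike.norm_conj]
  have h2 : ‖conv j f x‖ₑ ≤ ∫⁻ y, ‖j (x - y)‖ₑ * ‖f y‖ₑ := by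
    refine (enorm_integral_le_lintegral_enorm _).trans (le_of_eq ?_)
    simp_rw [enorm_mul]
  rw [enorm_mul]
  calc _ ≤ ((∫⁻ y, ‖j (x - y)‖ₑ * ‖f y‖ₑ) * ‖g x‖ₑ) * ‖k x‖ₑ := by gcongr; exact h1.trans (by gcongr)
    _ = (∫⁻ y, ‖j (x - y)‖ₑ * ‖f y‖ₑ) * (‖g x‖ₑ * ‖k x‖ₑ) := mul_assoc _ _ _
    _ ≤ ∫⁻ y, (‖j (x - y)‖ₑ * ‖f y‖ₑ) * (‖g x‖ₑ * ‖k x‖ₑ) := lintegral_mul_const_le _ _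
    _ = _ := lintegral_congr fun y => by ring

/-- A kernel of the mollifier: it has mass at most one and is supported in `[-1, 1]`. -/
structure IsMollifier (j : ℝ → ℂ) : Prop where
  continuous : Continuous j
  support : ∀ x, 1 < |x| → j x = 0
  mass : ∫⁻ x, ‖j x‖ₑ ≤ 1

/-- A coefficient of size `M` in `L₂^(3/4)`, supported where the weight `κ` is comparable to
`n ℓ`. -/
structure IsCoeff (C M : ℝ) (κ n ℓ : ℝ → ℝ) (q : ℝ → ℂ) : Prop where
  continuous : Continuous q
  memLp : MemLp (fun x => ‖q x‖ * coeffWeight ℓ x) 2 volume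
  le : ∫ x, (‖q x‖ * coeffWeight ℓ x) ^ 2 ≤ M ^ 2
  support : ∀ x y, |x - y| ≤ 1 → q y ≠ 0 → κ x ≤ C * (n x * ℓ x)

lemma enorm_le_of_norm_le {z : ℂ} {r : ℝ} (h : ‖z‖ ≤ r) : ‖z‖ₑ ≤ ENNReal.ofReal r := by
  rw [← ofReal_norm]; exact ENNReal.ofReal_le_ofReal h

lemma abs_le_of_enorm_le {r s : ℝ} (hs : 0 ≤ s) (h : ‖r‖ₑ ≤ ENNReal.ofReal s) : |r| ≤ s := by
  rw [← ofReal_norm, ENNReal.ofReal_le_ofReal_iff hs] at h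
  exact h

/-- The coefficient term in the `L₂` energy. -/
lemma abs_integral_conv_coeff_le (W : EnergyWeight C κ n n1 n2 ℓ ℓ1) {M : ℝ} (hM : 0 ≤ M)
    {j q z f : ℝ → ℂ} (hj : IsMollifier j) (hq : IsCoeff C M κ n ℓ q) (hz : Continuous z)
    (hz2 : MemLp z 2 volume) {A : ℝ} (hA : 0 ≤ A)
    (hf : ∀ x, supWeight n ℓ x * ‖f x‖ ≤ A) :
    |∫ x, (conv j (fun y => q y * z y) x * starRingEnd ℂ (f x)).re * κ x| ≤
      C * Real.exp C ^ 3 * A * M * √(∫ x, ‖z x‖ ^ 2 * n x) := by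
  obtain ⟨B, hB0, hκ, hn, -⟩ := W.exists_bound
  have hC := W.pos_C
  have cn := W.continuous_n
  have cℓ := W.continuous_ℓ
  have cq := hq.continuous
  have cj := hj.continuous
  have cc : Continuous (coeffWeight ℓ) := cℓ.sqrt.mul cℓ.sqrt.sqrt
  set p : ℝ → ℝ := fun y => ‖q y‖ * coeffWeight ℓ y with hp
  set r : ℝ → ℝ := fun y => ‖z y‖ * √(n y) with hr
  have mr : MemLp r 2 volume := memLp_norm_mul_sqrt hz2 cn hn
  set K := C * Real.exp C ^ 3 * A with hK
  have hK0 : 0 ≤ K := by positivity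
  refine abs_le_of_enorm_le (by positivity) ((enorm_integral_conv_le _ _ _ _).trans ?_)
  have hpt : ∀ x y, ‖j (x - y)‖ₑ * (‖q y * z y‖ₑ * (‖f x‖ₑ * ‖κ x‖ₑ)) ≤
      ‖j (x - y)‖ₑ * ENNReal.ofReal (K * (p y * r y)) := by
    intro x y
    by_cases hxy : 1 < |x - y|
    · rw [hj.support _ hxy]; simp
    by_cases hqy : q y = 0
    · simp [hqy]
    have hxy' := not_lt.1 hxy
    gcongr
    rw [← ofReal_norm, ← ofReal_norm, ← ofReal_norm, ← ENNReal.ofReal_mul (norm_nonneg _),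
      ← ENNReal.ofReal_mul (norm_nonneg _)]
    refine ENNReal.ofReal_le_ofReal ?_
    rw [Real.norm_eq_abs, abs_of_pos (W.pos_κ x), norm_mul]
    have h1 := W.κ_le_left hxy' (hq.support x y hxy' hqy)
    have hcw : 0 ≤ coeffWeight ℓ y := mul_nonneg (Real.sqrt_nonneg _) (Real.sqrt_nonneg _)
    calc ‖q y‖ * ‖z y‖ * (‖f x‖ * κ x)
        ≤ ‖q y‖ * ‖z y‖ * (‖f x‖ *
          (C * Real.exp C ^ 3 * (supWeight n ℓ x * (√(n y) * coeffWeight ℓ y)))) := by gcongr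
      _ = C * Real.exp C ^ 3 * (supWeight n ℓ x * ‖f x‖) * (p y * r y) := by
          simp only [hp, hr]; ring
      _ ≤ C * Real.exp C ^ 3 * A * (p y * r y) := by
          gcongr
          exact hf x
  refine (lintegral_mono fun x => lintegral_mono fun y => hpt x y).trans ?_
  rw [lintegral_lintegral_kernel_eq (J := fun z => ‖j z‖ₑ)
    (h := fun y => ENNReal.ofReal (K * (p y * r y))) (by fun_prop)
    (by
      have : Continuous (fun y => K * (p y * r y)) := by fun_prop
      exact this.measurable.ennreal_ofReal)]
  have hpn : ∀ y, 0 ≤ p y := fun y =>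
    mul_nonneg (norm_nonneg _) (mul_nonneg (Real.sqrt_nonneg _) (Real.sqrt_nonneg _))
  have hrn : ∀ y, 0 ≤ r y := fun y => mul_nonneg (norm_nonneg _) (Real.sqrt_nonneg _)
  have hint : Integrable (fun y => p y * r y) := hq.memLp.integrable_mul mr
  rw [← ofReal_integral_eq_lintegral_ofReal (hint.const_mul K)
    (Eventually.of_forall fun y => mul_nonneg hK0 (mul_nonneg (hpn y) (hrn y))), integral_const_mul]
  calc (∫⁻ z, ‖j z‖ₑ) * ENNReal.ofReal (K * ∫ y, p y * r y)
      ≤ 1 * ENNReal.ofReal (K * ∫ y, p y * r y) := by gcongr; exact hj.mass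
    _ ≤ _ := by
      rw [one_mul]
      refine ENNReal.ofReal_le_ofReal ?_
      rw [mul_assoc K]
      gcongr
      have h2 := integral_mul_le_sqrt_mul_sqrt hq.memLp mr
      have h3 : ∀ y, |‖q y‖ * coeffWeight ℓ y| * |r y| = p y * r y := fun y => by
        rw [abs_of_nonneg (hpn y), abs_of_nonneg (hrn y)]
      simp_rw [h3] at h2
      refine h2.trans ?_
      have h4 : ∀ y, r y ^ 2 = ‖z y‖ ^ 2 * n y := fun y => sq_norm_mul_sqrt z (W.pos_n y).le
      simp_rw [h4]
      gcongr
      exact (Real.sqrt_le_sqrt hq.le).trans (by rw [Real.sqrt_sq hM])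

/-- The coefficient term in the energy of the derivative. -/
lemma abs_integral_conv_coeff_le' (W : EnergyWeight C κ n n1 n2 ℓ ℓ1) {M : ℝ} (hM : 0 ≤ M)
    {j q z g : ℝ → ℂ} (hj : IsMollifier j) (hq : IsCoeff C M κ n ℓ q) (hg : Continuous g)
    (hg2 : MemLp g 2 volume) {A : ℝ} (hA : 0 ≤ A)
    (hz : ∀ x, supWeight n ℓ x * ‖z x‖ ≤ A) {k : ℝ → ℝ} {L : ℝ} (hL : 0 ≤ L)
    (hk : ∀ x, |k x| ≤ L * κ x) :
    |∫ x, (conv j (fun y => q y * z y) x * starRingEnd ℂ (g x)).re * k x| ≤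
      L * (C * Real.exp C ^ 3) * A * M * √(∫ x, ‖g x‖ ^ 2 * n x) := by
  obtain ⟨B, hB0, hκ, hn, -⟩ := W.exists_bound
  have hC := W.pos_C
  have cn := W.continuous_n
  have cℓ := W.continuous_ℓ
  have cq := hq.continuous
  have cj := hj.continuous
  have cc : Continuous (coeffWeight ℓ) := cℓ.sqrt.mul cℓ.sqrt.sqrt
  set p : ℝ → ℝ := fun y => ‖q y‖ * coeffWeight ℓ y with hp
  set r : ℝ → ℝ := fun y => ‖g y‖ * √(n y) with hr
  have mr : MemLp r 2 volume := memLp_norm_mul_sqrt hg2 cn hn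
  set K := L * (C * Real.exp C ^ 3) * A with hK
  have hK0 : 0 ≤ K := by positivity
  have hpn : ∀ y, 0 ≤ p y := fun y =>
    mul_nonneg (norm_nonneg _) (mul_nonneg (Real.sqrt_nonneg _) (Real.sqrt_nonneg _))
  have hrn : ∀ y, 0 ≤ r y := fun y => mul_nonneg (norm_nonneg _) (Real.sqrt_nonneg _)
  refine abs_le_of_enorm_le (by positivity) ((enorm_integral_conv_le _ _ _ _).trans ?_)
  have hpt : ∀ x y, ‖j (x - y)‖ₑ * (‖q y * z y‖ₑ * (‖g x‖ₑ * ‖k x‖ₑ)) ≤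
      ENNReal.ofReal K * (‖j (x - y)‖ₑ * (ENNReal.ofReal |p y| * ENNReal.ofReal |r x|)) := by
    intro x y
    rw [mul_left_comm (ENNReal.ofReal K)]
    by_cases hxy : 1 < |x - y|
    · rw [hj.support _ hxy]; simp
    by_cases hqy : q y = 0
    · simp [hqy]
    have hxy' := not_lt.1 hxy
    refine mul_le_mul' le_rfl ?_
    rw [abs_of_nonneg (hpn y), abs_of_nonneg (hrn x)]
    rw [← ofReal_norm, ← ofReal_norm, ← ofReal_norm, ← ENNReal.ofReal_mul (norm_nonneg _),
      ← ENNReal.ofReal_mul (norm_nonneg _), ← ENNReal.ofReal_mul (hpn y),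
      ← ENNReal.ofReal_mul hK0]
    refine ENNReal.ofReal_le_ofReal ?_
    rw [Real.norm_eq_abs, norm_mul]
    have h1 := W.κ_le_right hxy' (hq.support x y hxy' hqy)
    have hcw : 0 ≤ coeffWeight ℓ y := mul_nonneg (Real.sqrt_nonneg _) (Real.sqrt_nonneg _)
    calc ‖q y‖ * ‖z y‖ * (‖g x‖ * |k x|)
        ≤ ‖q y‖ * ‖z y‖ * (‖g x‖ * (L * (C * Real.exp C ^ 3 *
          (supWeight n ℓ y * (coeffWeight ℓ y * √(n x)))))) := by
            gcongr
            exact (hk x).trans (by gcongr)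
      _ = L * (C * Real.exp C ^ 3) * (supWeight n ℓ y * ‖z y‖) * (p y * r x) := by
          simp only [hp, hr]; ring
      _ ≤ L * (C * Real.exp C ^ 3) * A * (p y * r x) := by
          have := mul_nonneg (hpn y) (hrn x)
          gcongr
          exact hz y
  refine (lintegral_mono fun x => lintegral_mono fun y => hpt x y).trans ?_
  have mp : Measurable fun y => ENNReal.ofReal |p y| := by
    have : Continuous p := by fun_prop
    exact this.abs.measurable.ennreal_ofReal
  have mr' : Measurable fun y => ENNReal.ofReal |r y| := by
    have : Continuous r := by fun_prop
    exact this.abs.measurable.ennreal_ofReal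
  have mj : Measurable fun z => ‖j z‖ₑ := by fun_prop
  have e1 : ∀ x, ∫⁻ y, ENNReal.ofReal K *
      (‖j (x - y)‖ₑ * (ENNReal.ofReal |p y| * ENNReal.ofReal |r x|)) =
      ENNReal.ofReal K * ∫⁻ y, ‖j (x - y)‖ₑ * (ENNReal.ofReal |p y| * ENNReal.ofReal |r x|) :=
    fun x => lintegral_const_mul' _ _ ENNReal.ofReal_ne_top
  simp_rw [e1]
  rw [lintegral_const_mul' _ _ ENNReal.ofReal_ne_top]
  have h2 := lintegral_lintegral_kernel_le mj mp mr'
  rw [lintegral_ofReal_sq hq.memLp, lintegral_ofReal_sq mr] at h2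
  have h4 : ∀ y, r y ^ 2 = ‖g y‖ ^ 2 * n y := fun y => sq_norm_mul_sqrt g (W.pos_n y).le
  simp_rw [h4] at h2
  calc _ ≤ ENNReal.ofReal K * (1 * (ENNReal.ofReal M * ENNReal.ofReal (√(∫ x, ‖g x‖ ^ 2 * n x)))) := by
        gcongr
        refine h2.trans ?_
        gcongr
        · exact hj.mass
        · exact (Real.sqrt_le_sqrt hq.le).trans (by rw [Real.sqrt_sq hM])
    _ = _ := by
        rw [one_mul, ← ENNReal.ofReal_mul hM, ← ENNReal.ofReal_mul hK0, ← mul_assoc]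

end

section

/-! ### Energy inequalities for the regularized dual problem -/

/-- The weighted energy `∫ |f|² κ`. -/
def energy (κ : ℝ → ℝ) (f : ℝ → ℂ) : ℝ := ∫ x, ‖f x‖ ^ 2 * κ x

lemma energy_nonneg {κ : ℝ → ℝ} (h : ∀ x, 0 ≤ κ x) (f : ℝ → ℂ) : 0 ≤ energy κ f :=
  integral_nonneg fun x => mul_nonneg (by positivity) (h x)

lemma energy_congr {κ : ℝ → ℝ} {f g : ℝ → ℂ} (h : f =ᵐ[volume] g) : energy κ f = energy κ g :=
  integral_congr_ae (h.mono fun x hx => by simp only [hx])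

lemma exists_boundedContinuous_ofReal {k : ℝ → ℝ} (hk : Continuous k) {B : ℝ}
    (hB : ∀ x, |k x| ≤ B) : ∃ kb : ℝ →ᵇ ℂ, ∀ x, kb x = (k x : ℂ) :=
  ⟨BoundedContinuousFunction.ofNormedAddCommGroup (fun x => (k x : ℂ))
    (Complex.continuous_ofReal.comp hk) B (fun x => by
      rw [Complex.norm_real]; exact hB x), fun _ => rfl⟩

lemma inner_mulL2 {k : ℝ → ℝ} {kb : ℝ →ᵇ ℂ} (h : ∀ x, kb x = (k x : ℂ)) (f g : L2) :
    (inner ℂ f (mulL2 kb g)).re = ∫ x, (g x * starRingEnd ℂ (f x)).re * k x := by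
  rw [L2.inner_def]
  have h1 : Integrable (fun x => inner ℂ (f x) ((mulL2 kb g : L2) x)) := L2.integrable_inner _ _
  have h2 : (∫ x, inner ℂ (f x) ((mulL2 kb g : L2) x)).re
      = ∫ x, (inner ℂ (f x) ((mulL2 kb g : L2) x)).re := (integral_re h1).symm
  rw [h2]
  refine integral_congr_ae ?_
  filter_upwards [coeFn_mulL2 kb g] with x hx
  rw [hx, h, RCLike.inner_apply, mul_assoc, Complex.re_ofReal_mul, mul_comm]

lemma energy_eq_inner {k : ℝ → ℝ} {kb : ℝ →ᵇ ℂ} (h : ∀ x, kb x = (k x : ℂ)) (f : L2) :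
    energy k f = (inner ℂ f (mulL2 kb f)).re := by
  rw [inner_mulL2 h, energy]
  congr 1
  ext x
  rw [Complex.mul_conj, Complex.ofReal_re, Complex.sq_norm]

lemma hasDerivAt_energy {k : ℝ → ℝ} (hk : Continuous k) {B : ℝ} (hB : ∀ x, |k x| ≤ B)
    {Φ : ℝ → L2} {Φ' : L2} {t : ℝ} (hΦ : HasDerivAt Φ Φ' t) :
    HasDerivAt (fun s => energy k (Φ s))
      (2 * ∫ x, (Φ' x * starRingEnd ℂ (Φ t x)).re * k x) t := by
  obtain ⟨kb, hkb⟩ := exists_boundedContinuous_ofReal hk hB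
  have h1 : HasDerivAt (fun s => mulL2 kb (Φ s)) (mulL2 kb Φ') t :=
    ((mulL2 kb).restrictScalars ℝ).hasFDerivAt.comp_hasDerivAt t hΦ
  have h2 := hasDerivAt_re (hΦ.inner ℂ h1)
  simp_rw [energy_eq_inner hkb]
  refine h2.congr_deriv ?_
  rw [Complex.add_re, inner_mulL2 hkb, inner_mulL2 hkb, two_mul]
  congr 1
  congr 1
  ext x
  simp only [Complex.mul_re, Complex.conj_re, Complex.conj_im]
  ring

lemma continuous_energy {k : ℝ → ℝ} (hk : Continuous k) {B : ℝ} (hB : ∀ x, |k x| ≤ B)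
    {Φ : ℝ → L2} (hΦ : Continuous Φ) : Continuous fun s => energy k (Φ s) := by
  obtain ⟨kb, hkb⟩ := exists_boundedContinuous_ofReal hk hB
  simp_rw [energy_eq_inner hkb]
  exact Complex.continuous_re.comp (hΦ.inner ((mulL2 kb).continuous.comp hΦ))

/-- Weighted Cauchy–Schwarz inequality. -/
lemma abs_integral_re_mul_conj_le {k : ℝ → ℝ} (hk : Continuous k) (hk0 : ∀ x, 0 ≤ k x) {B : ℝ}
    (hB : ∀ x, |k x| ≤ B) {f g : ℝ → ℂ} (hf : MemLp f 2 volume) (hg : MemLp g 2 volume) :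
    |∫ x, (f x * starRingEnd ℂ (g x)).re * k x| ≤ √(energy k f) * √(energy k g) := by
  have h := integral_mul_le_sqrt_mul_sqrt (memLp_norm_mul_sqrt hf hk hB)
    (memLp_norm_mul_sqrt hg hk hB)
  simp_rw [fun x => sq_norm_mul_sqrt f (hk0 x), fun x => sq_norm_mul_sqrt g (hk0 x)] at h
  refine le_trans ?_ h
  refine (abs_integral_le_integral_abs).trans (integral_mono_of_nonneg
    (Eventually.of_forall fun x => abs_nonneg _) ?_ (Eventually.of_forall fun x => ?_))
  · exact (memLp_norm_mul_sqrt hf hk hB).norm.integrable_mul (memLp_norm_mul_sqrt hg hk hB).norm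
  · simp only
    rw [abs_mul, abs_of_nonneg (hk0 x), abs_of_nonneg (by positivity : 0 ≤ ‖f x‖ * √(k x)),
      abs_of_nonneg (by positivity : 0 ≤ ‖g x‖ * √(k x))]
    have : |(f x * starRingEnd ℂ (g x)).re| ≤ ‖f x‖ * ‖g x‖ := by
      refine (Complex.abs_re_le_norm _).trans ?_
      rw [norm_mul, RCLike.norm_conj]
    calc |(f x * starRingEnd ℂ (g x)).re| * k x ≤ ‖f x‖ * ‖g x‖ * k x := by
          gcongr
          exact hk0 x
      _ = ‖f x‖ * ‖g x‖ * (√(k x) * √(k x)) := by rw [Real.mul_self_sqrt (hk0 x)]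
      _ = _ := by ring

lemma mul_sqrt_mul_le {K e s : ℝ} (he : 0 ≤ e) (hs : 0 ≤ s) :
    K * √(e * s + e ^ 2) * (s + e) ≤ s ^ 2 / 2 + (1 / 4 + 2 * K ^ 2 + 4 * K ^ 4) * e ^ 2 := by
  have hX : √(e * s + e ^ 2) ^ 2 = e * s + e ^ 2 := Real.sq_sqrt (by positivity)
  set X := √(e * s + e ^ 2)
  have h1 : K * X * (s + e) ≤ (s + e) ^ 2 / 8 + 2 * K ^ 2 * X ^ 2 := by
    nlinarith [sq_nonneg ((s + e) - 4 * (K * X))]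
  have h2 : 2 * K ^ 2 * (e * s) ≤ s ^ 2 / 4 + 4 * K ^ 4 * e ^ 2 := by
    nlinarith [sq_nonneg (s - 4 * K ^ 2 * e)]
  have h3 : (s + e) ^ 2 ≤ 2 * s ^ 2 + 2 * e ^ 2 := by nlinarith [sq_nonneg (s - e)]
  rw [hX] at h1
  nlinarith

variable {C : ℝ} {κ n n1 n2 ℓ ℓ1 : ℝ → ℝ} {a b lam β T M : ℝ} {q : ℝ → ℝ →ᵇ ℂ} {j G : 𝓢(ℝ, ℂ)}
  {θ : ℝ → ℝ} {φ : ℕ → ℝ → ℝ → ℂ} {Φ Φt : ℕ → ℝ → L2}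

namespace EnergyWeight

lemma energy_n_le (W : EnergyWeight C κ n n1 n2 ℓ ℓ1) {f : ℝ → ℂ} (hf : MemLp f 2 volume) :
    energy n f ≤ C * energy κ f := by
  obtain ⟨B, hB0, hκ, hn, -⟩ := W.exists_bound
  rw [energy, energy, ← integral_const_mul]
  refine integral_mono (integrable_norm_sq_mul hf W.continuous_n hn)
    ((integrable_norm_sq_mul hf W.continuous_κ hκ).const_mul C) fun x => ?_
  have := W.n_le x
  calc ‖f x‖ ^ 2 * n x ≤ ‖f x‖ ^ 2 * (C * κ x) := by gcongr
    _ = _ := by ring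

lemma supWeight_mul_norm_le (W : EnergyWeight C κ n n1 n2 ℓ ℓ1) {f0 f1 : ℝ → ℂ}
    (h0 : ∀ x, HasDerivAt f0 (f1 x) x) (m0 : MemLp f0 2 volume) (m1 : MemLp f1 2 volume)
    (c1 : Continuous f1) (x : ℝ) :
    supWeight n ℓ x * ‖f0 x‖ ≤ 2 * C * (C + 1) *
      √(√(energy κ f0) * √(energy n f1) + √(energy κ f0) ^ 2) := by
  have h := sq_norm_mul_weight_le W h0 m0 m1 c1 x
  have hE : 0 ≤ energy κ f0 := energy_nonneg (fun x => (W.pos_κ x).le) f0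
  have hC := W.one_le
  rw [Real.sq_sqrt hE]
  have h1 : supWeight n ℓ x * ‖f0 x‖ = √(‖f0 x‖ ^ 2 * (n x * √(ℓ x))) := by
    rw [Real.sqrt_mul (by positivity), Real.sqrt_sq (norm_nonneg _), mul_comm]; rfl
  rw [h1]
  have hc : 1 ≤ 2 * C * (C + 1) := by nlinarith
  calc √(‖f0 x‖ ^ 2 * (n x * √(ℓ x))) ≤ √((2 * C * (C + 1)) ^ 2 *
        (√(energy κ f0) * √(energy n f1) + energy κ f0)) := by
        refine Real.sqrt_le_sqrt (h.trans ?_)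
        change _ * (√(energy κ f0) * √(energy n f1) + energy κ f0) ≤ _
        gcongr
        nlinarith
    _ = _ := by rw [Real.sqrt_mul (by positivity), Real.sqrt_sq (by positivity)]

end EnergyWeight

namespace IsDualSolution

lemma continuous_slice (S : IsDualSolution a b lam β T q j G θ φ Φ Φt) {k : ℕ} (hk : k ≤ 5)
    (t : ℝ) : Continuous (φ k t) :=
  (S.continuous k hk).comp (Continuous.prodMk_right t)

lemma memLp_zeta (S : IsDualSolution a b lam β T q j G θ φ Φ Φt) (t : ℝ) :
    MemLp (zeta lam β φ t) 2 volume :=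
  ((S.memLp 1 (by norm_num) t).const_mul _).add ((S.memLp 0 (by norm_num) t).const_mul _)

lemma continuous_zeta (S : IsDualSolution a b lam β T q j G θ φ Φ Φt) :
    Continuous (Function.uncurry (zeta lam β φ)) := by
  have h0 := S.continuous 0 (by norm_num)
  have h1 := S.continuous 1 (by norm_num)
  exact (continuous_const.mul h1).add (continuous_const.mul h0)

lemma continuous_zeta_slice (S : IsDualSolution a b lam β T q j G θ φ Φ Φt) (t : ℝ) :
    Continuous (zeta lam β φ t) :=
  S.continuous_zeta.comp (Continuous.prodMk_right t)

lemma energy_zeta_le (S : IsDualSolution a b lam β T q j G θ φ Φ Φt)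
    (W : EnergyWeight C κ n n1 n2 ℓ ℓ1) (t : ℝ) :
    √(energy n (zeta lam β φ t)) ≤ (2 * (|β| + |lam| * C)) *
      (√(energy n (φ 1 t)) + √(energy κ (φ 0 t))) := by
  obtain ⟨B, hB0, hκ, hn, -⟩ := W.exists_bound
  have hC := W.one_le
  have m0 := S.memLp 0 (by norm_num) t
  have m1 := S.memLp 1 (by norm_num) t
  have hE : 0 ≤ energy κ (φ 0 t) := energy_nonneg (fun x => (W.pos_κ x).le) _
  have hS : 0 ≤ energy n (φ 1 t) := energy_nonneg (fun x => (W.pos_n x).le) _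
  have h1 : energy n (zeta lam β φ t) ≤ 2 * β ^ 2 * energy n (φ 1 t)
      + 2 * lam ^ 2 * energy n (φ 0 t) := by
    rw [energy, energy, energy, ← integral_const_mul, ← integral_const_mul, ← integral_add
      ((integrable_norm_sq_mul m1 W.continuous_n hn).const_mul _)
      ((integrable_norm_sq_mul m0 W.continuous_n hn).const_mul _)]
    refine integral_mono (integrable_norm_sq_mul (S.memLp_zeta t) W.continuous_n hn)
      (((integrable_norm_sq_mul m1 W.continuous_n hn).const_mul _).add
      ((integrable_norm_sq_mul m0 W.continuous_n hn).const_mul _)) fun x => ?_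
    have hnx := (W.pos_n x).le
    have h2 : ‖zeta lam β φ t x‖ ≤ |β| * ‖φ 1 t x‖ + |lam| * ‖φ 0 t x‖ := by
      refine (norm_add_le _ _).trans ?_
      simp
    have h3 : ‖zeta lam β φ t x‖ ^ 2 ≤ 2 * β ^ 2 * ‖φ 1 t x‖ ^ 2 + 2 * lam ^ 2 * ‖φ 0 t x‖ ^ 2 := by
      calc ‖zeta lam β φ t x‖ ^ 2 ≤ (|β| * ‖φ 1 t x‖ + |lam| * ‖φ 0 t x‖) ^ 2 := by gcongr
        _ ≤ 2 * (|β| * ‖φ 1 t x‖) ^ 2 + 2 * (|lam| * ‖φ 0 t x‖) ^ 2 := by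
            nlinarith [sq_nonneg (|β| * ‖φ 1 t x‖ - |lam| * ‖φ 0 t x‖)]
        _ = _ := by rw [mul_pow, mul_pow, sq_abs, sq_abs]; ring
    calc ‖zeta lam β φ t x‖ ^ 2 * n x
        ≤ (2 * β ^ 2 * ‖φ 1 t x‖ ^ 2 + 2 * lam ^ 2 * ‖φ 0 t x‖ ^ 2) * n x := by gcongr
      _ = _ := by ring
  have h4 := W.energy_n_le m0
  have h5 : energy n (zeta lam β φ t) ≤ ((2 * (|β| + |lam| * C)) *
      (√(energy n (φ 1 t)) + √(energy κ (φ 0 t)))) ^ 2 := by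
    have e1 := Real.sq_sqrt hE
    have e2 := Real.sq_sqrt hS
    set s := √(energy n (φ 1 t))
    set e := √(energy κ (φ 0 t))
    have hs : 0 ≤ s := Real.sqrt_nonneg _
    have he : 0 ≤ e := Real.sqrt_nonneg _
    rw [← e1] at h4
    rw [← e2] at h1
    have hb : β ^ 2 = |β| ^ 2 := (sq_abs β).symm
    have hl : lam ^ 2 = |lam| ^ 2 := (sq_abs lam).symm
    rw [hb, hl] at h1
    have hβ := abs_nonneg β
    have hlam := abs_nonneg lam
    calc energy n (zeta lam β φ t) ≤ 2 * |β| ^ 2 * s ^ 2 + 2 * |lam| ^ 2 * (C * e ^ 2) := by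
          refine h1.trans ?_
          gcongr
      _ ≤ 2 * |β| ^ 2 * s ^ 2 + 2 * |lam| ^ 2 * (C ^ 2 * e ^ 2) := by
          gcongr
          nlinarith
      _ ≤ 4 * (|β| * s + |lam| * C * e) ^ 2 := by
          nlinarith [mul_nonneg (mul_nonneg hβ hs) (mul_nonneg (mul_nonneg hlam (by linarith : 0 ≤ C)) he),
            sq_nonneg (|β| * s), sq_nonneg (|lam| * C * e)]
      _ ≤ 4 * ((|β| + |lam| * C) * (s + e)) ^ 2 := by
          have : |β| * s + |lam| * C * e ≤ (|β| + |lam| * C) * (s + e) := by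
            nlinarith [mul_nonneg hβ he, mul_nonneg (mul_nonneg hlam (by linarith : 0 ≤ C)) hs]
          gcongr
      _ = _ := by ring
  exact Real.sqrt_le_iff.2 ⟨by positivity, h5⟩

lemma memLp_conv (S : IsDualSolution a b lam β T q j G θ φ Φ Φt) {k : ℕ} (hk : k ≤ 2) (t : ℝ) :
    MemLp (conv (schwartzDeriv k j) (fun y => q t y * zeta lam β φ t y)) 2 volume := by
  have h := ((((S.memLp (k + 3) (by omega) t).neg.sub ((S.memLp (k + 2) (by omega) t).const_mul
    (Complex.I * a))).sub ((S.memLp (k + 1) (by omega) t).const_mul (b : ℂ))).add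
    (((schwartzDeriv k G).memLp 2 volume).const_mul (θ t : ℂ))).sub (Lp.memLp (Φt k t))
  refine (memLp_congr_ae ?_).1 h
  filter_upwards [S.deriv_eq k hk t] with x hx
  simp only [Pi.sub_apply, Pi.add_apply, Pi.neg_apply, hx]
  ring

/-- The time derivative of the weighted energy of `φ k`. -/
lemma hasDerivAt_energy (S : IsDualSolution a b lam β T q j G θ φ Φ Φt)
    (W : EnergyWeight C κ n n1 n2 ℓ ℓ1) {k : ℕ} (hk : k ≤ 2) {t : ℝ} (ht : t ∈ Icc 0 T) :
    HasDerivAt (fun s => energy κ (φ k s))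
      (2 * (∫ x, ((-φ (k + 3) t x - Complex.I * a * φ (k + 2) t x - b * φ (k + 1) t x)
          * starRingEnd ℂ (φ k t x)).re * κ x)
        - 2 * (∫ x, (conv (schwartzDeriv k j) (fun y => q t y * zeta lam β φ t y) x
          * starRingEnd ℂ (φ k t x)).re * κ x)
        + 2 * θ t * ∫ x, (schwartzDeriv k G x * starRingEnd ℂ (φ k t x)).re * κ x) t := by
  obtain ⟨B, hB0, hκ, hn, -⟩ := W.exists_bound
  have h := HNLS.hasDerivAt_energy W.continuous_κ hκ (S.hasDerivAt_time k hk t ht)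
  have e : (fun s => energy κ (φ k s)) = fun s => energy κ (Φ k s) :=
    funext fun s => energy_congr (S.coeFn k (by omega) s).symm
  rw [e]
  refine h.congr_deriv ?_
  have mk := S.memLp k (by omega) t
  have mL : MemLp (fun x => -φ (k + 3) t x - Complex.I * a * φ (k + 2) t x - b * φ (k + 1) t x)
      2 volume :=
    ((S.memLp (k + 3) (by omega) t).neg.sub ((S.memLp (k + 2) (by omega) t).const_mul _)).sub
      ((S.memLp (k + 1) (by omega) t).const_mul _)
  have i1 := integrable_re_mul_conj_mul mL mk W.continuous_κ hκ
  have i2 := integrable_re_mul_conj_mul (S.memLp_conv hk t) mk W.continuous_κ hκ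
  have i3 := integrable_re_mul_conj_mul ((schwartzDeriv k G).memLp 2 volume) mk W.continuous_κ hκ
  have : ∫ x, (Φt k t x * starRingEnd ℂ (Φ k t x)).re * κ x =
      ∫ x, ((((-φ (k + 3) t x - Complex.I * a * φ (k + 2) t x - b * φ (k + 1) t x)
          * starRingEnd ℂ (φ k t x)).re * κ x
        - (conv (schwartzDeriv k j) (fun y => q t y * zeta lam β φ t y) x
          * starRingEnd ℂ (φ k t x)).re * κ x)
        + θ t * ((schwartzDeriv k G x * starRingEnd ℂ (φ k t x)).re * κ x)) := by
    refine integral_congr_ae ?_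
    filter_upwards [S.deriv_eq k hk t, S.coeFn k (by omega) t] with x h1 h2
    rw [h1, h2, add_mul, sub_mul, Complex.add_re, Complex.sub_re, mul_assoc (θ t : ℂ),
      Complex.re_ofReal_mul]
    ring
  have i12 : Integrable (fun x => ((-φ (k + 3) t x - Complex.I * a * φ (k + 2) t x
      - b * φ (k + 1) t x) * starRingEnd ℂ (φ k t x)).re * κ x
      - (conv (schwartzDeriv k j) (fun y => q t y * zeta lam β φ t y) x
          * starRingEnd ℂ (φ k t x)).re * κ x) := i1.sub i2
  rw [this, integral_add i12 (i3.const_mul (θ t)), integral_sub i1 i2, integral_const_mul]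
  ring

lemma continuous_energy (S : IsDualSolution a b lam β T q j G θ φ Φ Φt) {k : ℕ} (hk : k ≤ 5)
    {w : ℝ → ℝ} (hw : Continuous w) {B : ℝ} (hB : ∀ x, |w x| ≤ B) :
    Continuous fun s => energy w (φ k s) := by
  have e : (fun s => energy w (φ k s)) = fun s => energy w (Φ k s) :=
    funext fun s => energy_congr (S.coeFn k hk s).symm
  rw [e]
  exact HNLS.continuous_energy hw hB (S.continuous_curve k hk)

lemma energy_terminal (S : IsDualSolution a b lam β T q j G θ φ Φ Φt) {k : ℕ} (hk : k ≤ 5)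
    (w : ℝ → ℝ) : energy w (φ k T) = 0 := by
  rw [← energy_congr (S.coeFn k hk T), S.terminal k hk, energy_congr (Lp.coeFn_zero ℂ 2 volume)]
  simp [energy]

end IsDualSolution

end

section

/-! ### Backward Grönwall inequalities -/

/-- A Grönwall inequality backward in time, with a dissipation term `s`. -/
lemma add_integral_le_of_hasDerivAt_ge {K T : ℝ} (hK : 0 ≤ K) {e e' s h : ℝ → ℝ}
    (he : ∀ t ∈ Icc 0 T, HasDerivAt e (e' t) t) (hs : Continuous s)
    (hs0 : ∀ t, 0 ≤ s t) (hh : Continuous h) (hh0 : ∀ t, 0 ≤ h t)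
    (hd : ∀ t ∈ Icc 0 T, s t - K * e t - h t ≤ e' t) (heT : e T = 0) {t : ℝ} (ht : t ∈ Icc 0 T) :
    e t + ∫ r in t..T, s r ≤ Real.exp (K * T) * ∫ r in t..T, h r := by
  have hF : ∀ r ∈ Icc 0 T, HasDerivAt (fun r => Real.exp (K * (r - t)) * e r)
      (Real.exp (K * (r - t)) * (K * 1) * e r + Real.exp (K * (r - t)) * e' r) r := fun r hr =>
    ((((hasDerivAt_id r).sub_const t).const_mul K).exp).mul (he r hr)
  have hsub : Icc t T ⊆ Icc 0 T := Icc_subset_Icc_left ht.1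
  have hint : Continuous fun r => s r - Real.exp (K * T) * h r := by fun_prop
  have key := intervalIntegral.integral_le_sub_of_hasDeriv_right_of_le ht.2
    (fun r hr => (hF r (hsub hr)).continuousAt.continuousWithinAt)
    (fun r hr => (hF r (hsub (Ioo_subset_Icc_self hr))).hasDerivWithinAt)
    (hint.integrableOn_Icc) (fun r hr => by
      have hr' := hsub (Ioo_subset_Icc_self hr)
      have h1 := hd r hr'
      have e1 : 1 ≤ Real.exp (K * (r - t)) :=
        Real.one_le_exp (mul_nonneg hK (by linarith [hr.1]))
      have e2 : Real.exp (K * (r - t)) ≤ Real.exp (K * T) :=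
        Real.exp_le_exp.2 (mul_le_mul_of_nonneg_left (by linarith [hr.2, ht.1]) hK)
      calc s r - Real.exp (K * T) * h r
          ≤ Real.exp (K * (r - t)) * s r - Real.exp (K * (r - t)) * h r := by
            have := mul_le_mul_of_nonneg_right e1 (hs0 r)
            have := mul_le_mul_of_nonneg_right e2 (hh0 r)
            linarith
        _ = Real.exp (K * (r - t)) * (K * 1) * e r
            + Real.exp (K * (r - t)) * (s r - K * e r - h r) := by ring
        _ ≤ _ := by gcongr)
  rw [intervalIntegral.integral_sub (hs.intervalIntegrable _ _)
    ((hh.const_mul _).intervalIntegrable _ _), intervalIntegral.integral_const_mul] at key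
  simp only [heT, mul_zero, sub_self, Real.exp_zero, one_mul, zero_sub] at key
  linarith

/-- A Grönwall inequality backward in time, with a source that is paired with the square root of
the energy. -/
lemma sqrt_le_of_hasDerivAt_ge {K T : ℝ} (hK : 0 ≤ K) {e e' s g : ℝ → ℝ}
    (he : ∀ t ∈ Icc 0 T, HasDerivAt e (e' t) t) (hec : Continuous e) (he0 : ∀ t, 0 ≤ e t)
    (hs : Continuous s) (hs0 : ∀ t, 0 ≤ s t) (hg : Continuous g) (hg0 : ∀ t, 0 ≤ g t)
    (hd : ∀ t ∈ Icc 0 T, s t - K * e t - g t * √(e t) ≤ e' t) (heT : e T = 0) {t : ℝ}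
    (ht : t ∈ Icc 0 T) :
    √(e t) ≤ Real.exp (K * T) * ∫ r in t..T, g r := by
  obtain ⟨t', ht', hmax⟩ := isCompact_Icc.exists_isMaxOn (nonempty_Icc.2 ht.2)
    (Real.continuous_sqrt.comp hec).continuousOn
  have hmax' : ∀ r ∈ Icc t T, √(e r) ≤ √(e t') := fun r hr => hmax hr
  have ht0 : t' ∈ Icc 0 T := ⟨ht.1.trans ht'.1, ht'.2⟩
  have h1 : e t' + ∫ r in t'..T, s r ≤ Real.exp (K * T) * ∫ r in t'..T, g r * √(e r) :=
    add_integral_le_of_hasDerivAt_ge hK he hs hs0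
    (hg.mul (Real.continuous_sqrt.comp hec)) (fun r => mul_nonneg (hg0 r) (Real.sqrt_nonneg _))
    hd heT ht0
  have h2 : 0 ≤ ∫ r in t'..T, s r := intervalIntegral.integral_nonneg ht'.2 fun r _ => hs0 r
  have h3 : ∫ r in t'..T, g r * √(e r) ≤ ∫ r in t'..T, g r * √(e t') :=
    intervalIntegral.integral_mono_on ht'.2
      ((hg.mul (Real.continuous_sqrt.comp hec)).intervalIntegrable _ _)
      ((hg.mul continuous_const).intervalIntegrable _ _) fun r hr =>
      mul_le_mul_of_nonneg_left (hmax' r ⟨ht'.1.trans hr.1, hr.2⟩) (hg0 r)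
  rw [intervalIntegral.integral_mul_const] at h3
  have h4 : ∫ r in t'..T, g r ≤ ∫ r in t..T, g r := by
    rw [← intervalIntegral.integral_add_adjacent_intervals (hg.intervalIntegrable t t')
      (hg.intervalIntegrable t' T)]
    linarith [intervalIntegral.integral_nonneg (μ := volume) ht'.1 fun r _ => hg0 r]
  refine (hmax' t ⟨le_rfl, ht.2⟩).trans ?_
  have hm := Real.sqrt_nonneg (e t')
  have h5 : √(e t') * √(e t') ≤ (Real.exp (K * T) * ∫ r in t..T, g r) * √(e t') := by
    rw [Real.mul_self_sqrt (he0 t')]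
    calc e t' ≤ Real.exp (K * T) * ∫ r in t'..T, g r * √(e r) := by
          linarith
      _ ≤ Real.exp (K * T) * ((∫ r in t..T, g r) * √(e t')) := by
          gcongr
          exact h3.trans (mul_le_mul_of_nonneg_right h4 hm)
      _ = _ := by ring
  rcases hm.eq_or_lt with h0 | h0
  · rw [← h0]
    exact mul_nonneg (Real.exp_pos _).le (intervalIntegral.integral_nonneg ht.2 fun r _ => hg0 r)
  · exact le_of_mul_le_mul_right h5 h0

/-! ### Estimates of the solutions of the regularized dual problem -/

lemma hasDerivAt_conv {j : 𝓢(ℝ, ℂ)} (hj : HasCompactSupport j) {f : ℝ → ℂ}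
    (hf : LocallyIntegrable f) (x : ℝ) :
    HasDerivAt (conv (schwartzDeriv 0 j) f) (conv (schwartzDeriv 1 j) f x) x := by
  have h := hj.hasDerivAt_convolution_left (ContinuousLinearMap.mul ℝ ℂ)
    (j.smooth 1) hf x
  have e0 : conv (schwartzDeriv 0 j) f
      = MeasureTheory.convolution j f (ContinuousLinearMap.mul ℝ ℂ) volume := by
    ext y
    rw [convolution_eq_swap]
    rfl
  have e1 : conv (schwartzDeriv 1 j) f x
      = MeasureTheory.convolution (deriv j) f (ContinuousLinearMap.mul ℝ ℂ) volume x := by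
    rw [convolution_eq_swap]
    have : ⇑(schwartzDeriv 1 j) = deriv j := by
      ext y; rw [schwartzDeriv_succ, SchwartzMap.derivCLM_apply]; rfl
    rw [conv, this]
    rfl
  rw [e0, e1]
  exact h

variable {C : ℝ} {κ n n1 n2 ℓ ℓ1 : ℝ → ℝ} {a b lam β T M : ℝ} {q : ℝ → ℝ →ᵇ ℂ} {j G : 𝓢(ℝ, ℂ)}
  {θ : ℝ → ℝ} {φ : ℕ → ℝ → ℝ → ℂ} {Φ Φt : ℕ → ℝ → L2}

/-- Integration by parts in a weighted pairing. -/
lemma integral_re_mul_conj_deriv (W : EnergyWeight C κ n n1 n2 ℓ ℓ1) {f f' g g' : ℝ → ℂ}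
    (hf : ∀ x, HasDerivAt f (f' x) x) (hg : ∀ x, HasDerivAt g (g' x) x)
    (mf : MemLp f 2 volume) (mf' : MemLp f' 2 volume) (mg : MemLp g 2 volume)
    (mg' : MemLp g' 2 volume) :
    ∫ x, (f' x * starRingEnd ℂ (g x)).re * κ x =
      (∫ x, (f x * starRingEnd ℂ (g x)).re * n x)
        - ∫ x, (f x * starRingEnd ℂ (g' x)).re * κ x := by
  obtain ⟨B, hB0, hκ, hn, -⟩ := W.exists_bound
  have i1 := integrable_re_mul_conj_mul mf' mg W.continuous_κ hκ
  have i2 := integrable_re_mul_conj_mul mf mg' W.continuous_κ hκ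
  have i3 := integrable_re_mul_conj_mul mf mg W.continuous_n hn
  have i0 := integrable_re_mul_conj_mul mf mg W.continuous_κ hκ
  have i12 : Integrable (fun x => (f' x * starRingEnd ℂ (g x)).re * κ x
    + (f x * starRingEnd ℂ (g' x)).re * κ x) := i1.add i2
  have i123 : Integrable (fun x => ((f' x * starRingEnd ℂ (g x)).re * κ x
    + (f x * starRingEnd ℂ (g' x)).re * κ x) - (f x * starRingEnd ℂ (g x)).re * n x) := i12.sub i3
  have h := integral_eq_zero_of_hasDerivAt_of_integrable
    (f := fun x => (f x * starRingEnd ℂ (g x)).re * κ x) (fun x => by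
      have hd : HasDerivAt (fun y => starRingEnd ℂ (g y)) (starRingEnd ℂ (g' x)) x :=
        ((Complex.conjCLE : ℂ →L[ℝ] ℂ).hasFDerivAt.comp_hasDerivAt x (hg x))
      refine ((hasDerivAt_re ((hf x).mul hd)).mul (W.hasDerivAt_κ x)).congr_deriv
        (g' := ((f' x * starRingEnd ℂ (g x)).re * κ x
          + (f x * starRingEnd ℂ (g' x)).re * κ x) - (f x * starRingEnd ℂ (g x)).re * n x) ?_
      rw [Complex.add_re]
      simp only [Pi.mul_apply]
      ring) i123 i0
  rw [integral_sub i12 i3, integral_add i1 i2] at h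
  linarith

lemma add_mul_le_mul_add {s e s0 : ℝ} (hC : 1 ≤ C) (hs : 0 ≤ s) (he : 0 ≤ e) (h : s0 ≤ e) :
    s + C * s0 ≤ C * (1 + C) * (s + e) := by
  have h1 : 1 ≤ C * (1 + C) := by nlinarith
  have h2 : C ≤ C * (1 + C) := by nlinarith
  have h3 : C * s0 ≤ C * e := by gcongr
  have h4 := mul_le_mul_of_nonneg_right h1 hs
  have h5 := mul_le_mul_of_nonneg_right h2 he
  linarith

lemma mul_le_of_sq_le {R e E0 E1 : ℝ} (hR : 0 ≤ R) (h0 : 0 ≤ E0) (h1 : 0 ≤ E1)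
    (h : e ^ 2 ≤ 2 * E0 + 2 * C ^ 2 * E1) :
    R * e ^ 2 ≤ R * (2 + 2 * C ^ 2) * E0 + R * (2 + 2 * C ^ 2) * E1 := by
  have h2 : e ^ 2 ≤ (2 + 2 * C ^ 2) * E0 + (2 + 2 * C ^ 2) * E1 := by
    nlinarith [mul_nonneg (sq_nonneg C) h0]
  calc R * e ^ 2 ≤ R * ((2 + 2 * C ^ 2) * E0 + (2 + 2 * C ^ 2) * E1) := by gcongr
    _ = _ := by ring

lemma mul_add_sq_le {e s E0 E1 S : ℝ} (h0 : 0 ≤ E0) (h1 : 0 ≤ E1) (hS : 0 ≤ S) (hs : s ^ 2 = S)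
    (h : e ^ 2 ≤ 2 * E0 + 2 * C ^ 2 * E1) :
    e * s + e ^ 2 ≤ (4 + 4 * C ^ 2) * (S + E1 + E0) := by
  have h2 : e * s + e ^ 2 ≤ S + 2 * e ^ 2 := by
    rw [← hs]
    nlinarith [sq_nonneg (e - s), sq_nonneg e, sq_nonneg s]
  nlinarith [mul_nonneg (sq_nonneg C) hS, mul_nonneg (sq_nonneg C) h0]

namespace IsDualSolution

lemma continuous_coeff_mul_zeta (S : IsDualSolution a b lam β T q j G θ φ Φ Φt) (t : ℝ) :
    Continuous fun y => q t y * zeta lam β φ t y :=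
  (q t).continuous.mul (S.continuous_zeta_slice t)

lemma supWeight_mul_norm_zeta_le (S : IsDualSolution a b lam β T q j G θ φ Φ Φt)
    (W : EnergyWeight C κ n n1 n2 ℓ ℓ1) {t e s : ℝ}
    (h0 : √(√(energy κ (φ 0 t)) * √(energy n (φ 1 t)) + √(energy κ (φ 0 t)) ^ 2)
      ≤ √(e * s + e ^ 2))
    (h1 : √(√(energy κ (φ 1 t)) * √(energy n (φ 2 t)) + √(energy κ (φ 1 t)) ^ 2)
      ≤ √(e * s + e ^ 2)) (x : ℝ) :
    supWeight n ℓ x * ‖zeta lam β φ t x‖ ≤ (2 * C * (C + 1) * (|β| + |lam|)) *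
      √(e * s + e ^ 2) := by
  have hC := W.one_le
  have k0 := W.supWeight_mul_norm_le (S.hasDerivAt_space 0 (by norm_num) t)
    (S.memLp 0 (by norm_num) t) (S.memLp 1 (by norm_num) t) (S.continuous_slice (by norm_num) t) x
  have k1 := W.supWeight_mul_norm_le (S.hasDerivAt_space 1 (by norm_num) t)
    (S.memLp 1 (by norm_num) t) (S.memLp 2 (by norm_num) t) (S.continuous_slice (by norm_num) t) x
  have h2 : ‖zeta lam β φ t x‖ ≤ |β| * ‖φ 1 t x‖ + |lam| * ‖φ 0 t x‖ := by
    refine (norm_add_le _ _).trans ?_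
    simp
  have hw : 0 ≤ supWeight n ℓ x := Real.sqrt_nonneg _
  calc supWeight n ℓ x * ‖zeta lam β φ t x‖
      ≤ |β| * (supWeight n ℓ x * ‖φ 1 t x‖) + |lam| * (supWeight n ℓ x * ‖φ 0 t x‖) := by
        refine (mul_le_mul_of_nonneg_left h2 hw).trans (le_of_eq (by ring))
    _ ≤ |β| * (2 * C * (C + 1) * √(e * s + e ^ 2)) + |lam| * (2 * C * (C + 1) * √(e * s + e ^ 2)) := by
        have hc : 0 ≤ 2 * C * (C + 1) := by positivity
        exact add_le_add
          (mul_le_mul_of_nonneg_left (k1.trans (mul_le_mul_of_nonneg_left h1 hc)) (abs_nonneg _))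
          (mul_le_mul_of_nonneg_left (k0.trans (mul_le_mul_of_nonneg_left h0 hc)) (abs_nonneg _))
    _ = _ := by ring

/-- The energy inequality in `L₂`. -/
lemma exists_energy_zero_ge (C M a b lam β : ℝ) (hC : 1 ≤ C) (hM : 0 ≤ M) :
    ∃ K, 0 ≤ K ∧ ∀ {κ n n1 n2 ℓ ℓ1 : ℝ → ℝ} {T : ℝ} {q : ℝ → ℝ →ᵇ ℂ} {j G : 𝓢(ℝ, ℂ)}
      {θ : ℝ → ℝ} {φ : ℕ → ℝ → ℝ → ℂ} {Φ Φt : ℕ → ℝ → L2},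
      EnergyWeight C κ n n1 n2 ℓ ℓ1 → IsMollifier j → (∀ t, IsCoeff C M κ n ℓ (q t)) →
      IsDualSolution a b lam β T q j G θ φ Φ Φt → ∀ t ∈ Icc 0 T, ∃ e',
      HasDerivAt (fun s => energy κ (φ 0 s)) e' t ∧
      energy n (φ 1 t) - K * energy κ (φ 0 t) - 2 * √(energy κ G) * |θ t| * √(energy κ (φ 0 t)) ≤
        e' := by
  set P := 2 * (C * Real.exp C ^ 3 * (2 * C * (C + 1)) * M * (2 * (|β| + |lam| * C))) with hP
  refine ⟨2 * (C ^ 2 + a ^ 2 * C + |b| * C) + (1 / 4 + 2 * P ^ 2 + 4 * P ^ 4), by positivity, ?_⟩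
  intro κ n n1 n2 ℓ ℓ1 T q j G θ φ Φ Φt W hj hq S t ht
  obtain ⟨B, hB0, hκ, hn, -⟩ := W.exists_bound
  refine ⟨_, S.hasDerivAt_energy W (by norm_num) ht, ?_⟩
  have m0 := S.memLp 0 (by norm_num) t
  have hE : 0 ≤ energy κ (φ 0 t) := energy_nonneg (fun x => (W.pos_κ x).le) _
  have hS : 0 ≤ energy n (φ 1 t) := energy_nonneg (fun x => (W.pos_n x).le) _
  have l1 := integral_linear_energy_ge W a b (S.hasDerivAt_space 0 (by norm_num) t)
    (S.hasDerivAt_space 1 (by norm_num) t) (S.hasDerivAt_space 2 (by norm_num) t)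
    m0 (S.memLp 1 (by norm_num) t) (S.memLp 2 (by norm_num) t) (S.memLp 3 (by norm_num) t)
  have l2 := abs_integral_conv_coeff_le W hM hj (hq t) (S.continuous_zeta_slice t) (S.memLp_zeta t)
    (by positivity) (W.supWeight_mul_norm_le (S.hasDerivAt_space 0 (by norm_num) t) m0
      (S.memLp 1 (by norm_num) t) (S.continuous_slice (by norm_num) t))
  have l3 := S.energy_zeta_le W t
  have l4 := abs_integral_re_mul_conj_le W.continuous_κ (fun x => (W.pos_κ x).le) hκ
    (G.memLp 2 volume) m0
  -- Young's inequality: the dissipation `∫ |φ_x|² n` occurs with total exponent `3/2` of its square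
  -- root and is absorbed.
  have l5 := mul_sqrt_mul_le (K := P) (Real.sqrt_nonneg (energy κ (φ 0 t)))
    (Real.sqrt_nonneg (energy n (φ 1 t)))
  change _ ≤ _ * √(energy n (zeta lam β φ t)) at l2
  change energy n (φ 1 t) - _ * energy κ (φ 0 t) ≤ _ at l1
  rw [Real.sq_sqrt hE, Real.sq_sqrt hS] at l5
  have l6 := l2.trans (mul_le_mul_of_nonneg_left l3 (by positivity))
  rw [Real.sq_sqrt hE] at l6
  change _ ≤ 2 * (∫ x, ((-φ 3 t x - Complex.I * a * φ 2 t x - b * φ 1 t x)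
          * starRingEnd ℂ (φ 0 t x)).re * κ x)
        - 2 * (∫ x, (conv j (fun y => q t y * zeta lam β φ t y) x
          * starRingEnd ℂ (φ 0 t x)).re * κ x)
        + 2 * θ t * ∫ x, (G x * starRingEnd ℂ (φ 0 t x)).re * κ x
  have l7 : -(|θ t| * (√(energy κ G) * √(energy κ (φ 0 t)))) ≤
      θ t * ∫ x, (G x * starRingEnd ℂ (φ 0 t x)).re * κ x := by
    refine (neg_le_neg ?_).trans (neg_abs_le _)
    rw [abs_mul]
    gcongr
  have l8 := (abs_le.1 l6).2
  set X := √(√(energy κ (φ 0 t)) * √(energy n (φ 1 t)) + energy κ (φ 0 t))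
  set Y := √(energy n (φ 1 t)) + √(energy κ (φ 0 t))
  have l9 : P * X * Y = 2 * (C * Real.exp C ^ 3 * (2 * C * (C + 1) * X) * M *
      ((2 * (|β| + |lam| * C)) * Y)) := by rw [hP]; ring
  linarith

set_option maxHeartbeats 1000000 in
/-- The energy inequality for the derivative. The derivative of the coefficient term is removed by
an integration by parts, so that no derivative falls on the coefficient. -/
lemma exists_energy_one_ge (C M a b lam β : ℝ) (hC : 1 ≤ C) (hM : 0 ≤ M) :
    ∃ K, 0 ≤ K ∧ ∀ {κ n n1 n2 ℓ ℓ1 : ℝ → ℝ} {T : ℝ} {q : ℝ → ℝ →ᵇ ℂ} {j G : 𝓢(ℝ, ℂ)}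
      {θ : ℝ → ℝ} {φ : ℕ → ℝ → ℝ → ℂ} {Φ Φt : ℕ → ℝ → L2},
      EnergyWeight C κ n n1 n2 ℓ ℓ1 → IsMollifier j → HasCompactSupport j →
      (∀ t, IsCoeff C M κ n ℓ (q t)) →
      IsDualSolution a b lam β T q j G θ φ Φ Φt → ∀ t ∈ Icc 0 T,
      (∃ e', HasDerivAt (fun s => energy κ (φ 1 s)) e' t ∧
      energy n (φ 2 t) - K * energy κ (φ 1 t) -
        (K * energy κ (φ 0 t) + θ t ^ 2 * energy κ (schwartzDeriv 1 G)) ≤ e') ∧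
      ∀ x, (supWeight n ℓ x * ‖zeta lam β φ t x‖) ^ 2 ≤
        K * (energy n (φ 2 t) + energy κ (φ 1 t) + energy κ (φ 0 t)) := by
  obtain ⟨Q, hQ⟩ : ∃ Q, Q = 2 * C * (C + 1) * (|β| + |lam|) := ⟨_, rfl⟩
  have hQ0 : 0 ≤ Q := by rw [hQ]; positivity
  obtain ⟨P, hP⟩ : ∃ P, P = 2 * ((C * Real.exp C ^ 3) * Q * M * C * (1 + C)) := ⟨_, rfl⟩
  obtain ⟨R, hR⟩ : ∃ R, R = 1 / 4 + 2 * P ^ 2 + 4 * P ^ 4 := ⟨_, rfl⟩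
  have hR0 : 0 ≤ R := by rw [hR]; positivity
  obtain ⟨K, hK⟩ : ∃ K, K = 2 * (C ^ 2 + a ^ 2 * C + |b| * C) + R * (2 + 2 * C ^ 2) + 1
    + Q ^ 2 * (4 + 4 * C ^ 2) := ⟨_, rfl⟩
  have hC0 : 0 ≤ C := by linarith
  have hL0 : 0 ≤ 2 * (C ^ 2 + a ^ 2 * C + |b| * C) := by positivity
  refine ⟨K, by rw [hK]; positivity, ?_⟩
  intro κ n n1 n2 ℓ ℓ1 T q j G θ φ Φ Φt W hj hjc hq S t ht
  obtain ⟨B, hB0, hκ, hn, -⟩ := W.exists_bound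
  have m0 := S.memLp 0 (by norm_num) t
  have m1 := S.memLp 1 (by norm_num) t
  have m2 := S.memLp 2 (by norm_num) t
  have hE : 0 ≤ energy κ (φ 0 t) := energy_nonneg (fun x => (W.pos_κ x).le) _
  have hE1 : 0 ≤ energy κ (φ 1 t) := energy_nonneg (fun x => (W.pos_κ x).le) _
  have hS : 0 ≤ energy n (φ 1 t) := energy_nonneg (fun x => (W.pos_n x).le) _
  have hS1 : 0 ≤ energy n (φ 2 t) := energy_nonneg (fun x => (W.pos_n x).le) _
  obtain ⟨e0, he0⟩ : ∃ e0, e0 = √(energy κ (φ 0 t)) := ⟨_, rfl⟩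
  obtain ⟨e1, he1⟩ : ∃ e1, e1 = √(energy κ (φ 1 t)) := ⟨_, rfl⟩
  obtain ⟨s0, hs0⟩ : ∃ s0, s0 = √(energy n (φ 1 t)) := ⟨_, rfl⟩
  obtain ⟨s, hs⟩ : ∃ s, s = √(energy n (φ 2 t)) := ⟨_, rfl⟩
  have e0n : 0 ≤ e0 := he0 ▸ Real.sqrt_nonneg _
  have e1n : 0 ≤ e1 := he1 ▸ Real.sqrt_nonneg _
  have s0n : 0 ≤ s0 := hs0 ▸ Real.sqrt_nonneg _
  have sn : 0 ≤ s := hs ▸ Real.sqrt_nonneg _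
  have e0q : e0 ^ 2 = energy κ (φ 0 t) := by rw [he0, Real.sq_sqrt hE]
  have e1q : e1 ^ 2 = energy κ (φ 1 t) := by rw [he1, Real.sq_sqrt hE1]
  have sq : s ^ 2 = energy n (φ 2 t) := by rw [hs, Real.sq_sqrt hS1]
  have s0e : s0 ≤ C * e1 := by
    rw [hs0]
    refine Real.sqrt_le_iff.2 ⟨by positivity, ?_⟩
    rw [mul_pow, e1q]
    refine (W.energy_n_le m1).trans ?_
    gcongr
    nlinarith
  obtain ⟨e, he⟩ : ∃ e, e = e0 + C * e1 := ⟨_, rfl⟩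
  have en : 0 ≤ e := by rw [he]; positivity
  have e1e : e1 ≤ e := by rw [he]; nlinarith
  have s0e' : s0 ≤ e := by rw [he]; linarith
  have eq : e ^ 2 ≤ 2 * energy κ (φ 0 t) + 2 * C ^ 2 * energy κ (φ 1 t) := by
    rw [← e0q, ← e1q, he]
    nlinarith [sq_nonneg (e0 - C * e1)]
  have hz := S.supWeight_mul_norm_zeta_le W (t := t) (e := e) (s := s)
    (by
      rw [← he0, ← hs0]
      refine Real.sqrt_le_sqrt ?_
      have h1 : e0 * s0 ≤ e0 * (C * e1) := by gcongr
      have h2 : 0 ≤ e * s := by positivity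
      have h3 : 0 ≤ e0 * (C * e1) := by positivity
      have h4 : e ^ 2 = e0 ^ 2 + 2 * (e0 * (C * e1)) + (C * e1) ^ 2 := by rw [he]; ring
      nlinarith [sq_nonneg (C * e1)])
    (by
      rw [← he1, ← hs]
      refine Real.sqrt_le_sqrt ?_
      gcongr)
  rw [← hQ] at hz
  have hX := mul_sqrt_mul_le (K := P) en sn
  have hX2 : √(e * s + e ^ 2) ^ 2 = e * s + e ^ 2 := Real.sq_sqrt (by positivity)
  obtain ⟨X, hXd⟩ : ∃ X, X = √(e * s + e ^ 2) := ⟨_, rfl⟩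
  have hX0 : 0 ≤ X := hXd ▸ Real.sqrt_nonneg _
  rw [← hXd] at hX hz hX2
  refine ⟨⟨_, S.hasDerivAt_energy W (by norm_num) ht, ?_⟩, fun x => ?_⟩
  · have l1 := integral_linear_energy_ge W a b (S.hasDerivAt_space 1 (by norm_num) t)
      (S.hasDerivAt_space 2 (by norm_num) t) (S.hasDerivAt_space 3 (by norm_num) t)
      m1 m2 (S.memLp 3 (by norm_num) t) (S.memLp 4 (by norm_num) t)
    change energy n (φ 2 t) - _ * energy κ (φ 1 t) ≤ _ at l1
    have l2 := abs_integral_conv_coeff_le' W hM hj (hq t) (S.continuous_slice (by norm_num) t) m2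
      (by positivity) hz zero_le_one
      (k := κ) (fun x => by rw [abs_of_pos (W.pos_κ x), one_mul])
    have l3 := abs_integral_conv_coeff_le' W hM hj (hq t) (S.continuous_slice (by norm_num) t) m1
      (by positivity) hz hC0
      (k := n) (fun x => by rw [abs_of_pos (W.pos_n x)]; exact W.n_le x)
    change _ ≤ _ * √(energy n (φ 2 t)) at l2
    change _ ≤ _ * √(energy n (φ 1 t)) at l3
    rw [← hs] at l2
    rw [← hs0] at l3
    have l4 := abs_integral_re_mul_conj_le W.continuous_κ (fun x => (W.pos_κ x).le) hκ
      ((schwartzDeriv 1 G).memLp 2 volume) m1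
    rw [← he1] at l4
    -- The derivative is moved from the convolution to `φ_x κ`, which produces the pairings with `φ_xx κ`
    -- and with `φ_x n` that `l2` and `l3` estimate.
    have l5 := integral_re_mul_conj_deriv W
      (hasDerivAt_conv hjc (S.continuous_coeff_mul_zeta t).locallyIntegrable)
      (S.hasDerivAt_space 1 (by norm_num) t) (S.memLp_conv (by norm_num) t)
      (S.memLp_conv (by norm_num) t) m1 m2
    change _ ≤ 2 * (∫ x, ((-φ 4 t x - Complex.I * a * φ 3 t x - b * φ 2 t x)
          * starRingEnd ℂ (φ 1 t x)).re * κ x)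
        - 2 * (∫ x, (conv (schwartzDeriv 1 j) (fun y => q t y * zeta lam β φ t y) x
          * starRingEnd ℂ (φ 1 t x)).re * κ x)
        + 2 * θ t * ∫ x, (schwartzDeriv 1 G x * starRingEnd ℂ (φ 1 t x)).re * κ x
    rw [l5]
    have l6 : -(θ t ^ 2 * energy κ (schwartzDeriv 1 G) + energy κ (φ 1 t)) ≤
        2 * θ t * ∫ x, (schwartzDeriv 1 G x * starRingEnd ℂ (φ 1 t x)).re * κ x := by
      have hg : 0 ≤ energy κ (schwartzDeriv 1 G) := energy_nonneg (fun x => (W.pos_κ x).le) _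
      obtain ⟨g, hg'⟩ : ∃ g, g = √(energy κ (schwartzDeriv 1 G)) := ⟨_, rfl⟩
      have hgq : g ^ 2 = energy κ (schwartzDeriv 1 G) := by rw [hg', Real.sq_sqrt hg]
      rw [← hg'] at l4
      rw [← hgq, ← e1q, mul_assoc]
      have : |θ t * ∫ x, (schwartzDeriv 1 G x * starRingEnd ℂ (φ 1 t x)).re * κ x| ≤
          |θ t| * (g * e1) := by rw [abs_mul]; gcongr
      have h2 := (abs_le.1 this).1
      rw [← sq_abs (θ t)]
      nlinarith [sq_nonneg (|θ t| * g - e1)]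
    have l7 := (abs_le.1 l2).1
    have l8 := (abs_le.1 l3).2
    change -_ ≤ ∫ x, (conv (schwartzDeriv 0 j) (fun y => q t y * zeta lam β φ t y) x
          * starRingEnd ℂ (φ 2 t x)).re * κ x at l7
    change (∫ x, (conv (schwartzDeriv 0 j) (fun y => q t y * zeta lam β φ t y) x
          * starRingEnd ℂ (φ 1 t x)).re * n x) ≤ _ at l8
    have l9 : 2 * (1 * (C * Real.exp C ^ 3) * (Q * X) * M * s)
        + 2 * (C * (C * Real.exp C ^ 3) * (Q * X) * M * s0) ≤ P * X * (s + e) := by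
      have h1 : s + C * s0 ≤ C * (1 + C) * (s + e) :=
        add_mul_le_mul_add hC sn en s0e'
      calc _ = 2 * ((C * Real.exp C ^ 3) * Q * M) * X * (s + C * s0) := by ring
        _ ≤ 2 * ((C * Real.exp C ^ 3) * Q * M) * X * (C * (1 + C) * (s + e)) := by gcongr
        _ = _ := by rw [hP]; ring
    have l10 := mul_le_of_sq_le hR0 hE hE1 eq
    have hQ2 : 0 ≤ Q ^ 2 * (4 + 4 * C ^ 2) := by positivity
    have l11 : (2 * (C ^ 2 + a ^ 2 * C + |b| * C) + R * (2 + 2 * C ^ 2) + 1) * energy κ (φ 1 t)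
        ≤ K * energy κ (φ 1 t) := by
      gcongr
      linarith
    have l12 : (R * (2 + 2 * C ^ 2)) * energy κ (φ 0 t) ≤ K * energy κ (φ 0 t) := by
      gcongr
      linarith
    rw [sq, ← hR] at hX
    linarith
  · have h0 : 0 ≤ supWeight n ℓ x * ‖zeta lam β φ t x‖ :=
      mul_nonneg (Real.sqrt_nonneg _) (norm_nonneg _)
    have hQK : Q ^ 2 * (4 + 4 * C ^ 2) ≤ K := by
      have : 0 ≤ R * (2 + 2 * C ^ 2) := by positivity
      linarith
    calc (supWeight n ℓ x * ‖zeta lam β φ t x‖) ^ 2 ≤ (Q * X) ^ 2 := pow_le_pow_left₀ h0 (hz x) 2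
      _ = Q ^ 2 * (e * s + e ^ 2) := by rw [mul_pow, hX2]
      _ ≤ Q ^ 2 * ((4 + 4 * C ^ 2) * (energy n (φ 2 t) + energy κ (φ 1 t) + energy κ (φ 0 t))) :=
          mul_le_mul_of_nonneg_left (mul_add_sq_le hE hE1 hS1 sq eq) (sq_nonneg Q)
      _ = Q ^ 2 * (4 + 4 * C ^ 2) * (energy n (φ 2 t) + energy κ (φ 1 t) + energy κ (φ 0 t)) := by
          ring
      _ ≤ _ := by gcongr

end IsDualSolution

end

section

namespace IsDualSolution

set_option maxHeartbeats 1000000 in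
/-- The a priori estimates of the regularized dual problem, uniform in the regularization: the
weighted energy is controlled by the source alone, and `β φ_x + i λ φ` is square integrable in time
with values in a weighted space of bounded functions. -/
lemma exists_bounds (C M a b lam β T : ℝ) (hC : 1 ≤ C) (hM : 0 ≤ M) (hT : 0 ≤ T) :
    ∃ D, 0 ≤ D ∧ ∀ {κ n n1 n2 ℓ ℓ1 : ℝ → ℝ} {q : ℝ → ℝ →ᵇ ℂ} {j G : 𝓢(ℝ, ℂ)}
      {θ : ℝ → ℝ} {φ : ℕ → ℝ → ℝ → ℂ} {Φ Φt : ℕ → ℝ → L2},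
      EnergyWeight C κ n n1 n2 ℓ ℓ1 → IsMollifier j → HasCompactSupport j →
      (∀ t, IsCoeff C M κ n ℓ (q t)) → Continuous θ →
      IsDualSolution a b lam β T q j G θ φ Φ Φt →
      (∀ t ∈ Icc 0 T, √(energy κ (φ 0 t)) ≤ D * √(energy κ G) * ∫ s in t..T, |θ s|) ∧
      ∀ ϑ, (∀ t ∈ Icc 0 T, |θ t| ≤ ϑ) →
        ∃ Z : ℝ → ℝ, Continuous Z ∧ (∀ t, 0 ≤ Z t) ∧
          (∀ t ∈ Icc 0 T, ∀ x, supWeight n ℓ x * ‖zeta lam β φ t x‖ ≤ Z t) ∧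
          ∫ t in 0..T, Z t ^ 2 ≤ D * ((energy κ G + energy κ (schwartzDeriv 1 G)) * ϑ ^ 2) := by
  obtain ⟨K0, hK0, h0⟩ := exists_energy_zero_ge C M a b lam β hC hM
  obtain ⟨K1, hK1, h1⟩ := exists_energy_one_ge C M a b lam β hC hM
  obtain ⟨x0, hx0⟩ : ∃ x0, x0 = Real.exp (K0 * T) := ⟨_, rfl⟩
  obtain ⟨x1, hx1⟩ : ∃ x1, x1 = Real.exp (K1 * T) := ⟨_, rfl⟩
  have x0n : 0 ≤ x0 := hx0 ▸ (Real.exp_pos _).le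
  have x1n : 0 ≤ x1 := hx1 ▸ (Real.exp_pos _).le
  obtain ⟨H, hH⟩ : ∃ H, H = K1 * (2 * x0 * T) ^ 2 + 1 := ⟨_, rfl⟩
  have hHn : 0 ≤ H := by rw [hH]; positivity
  obtain ⟨D1, hD1⟩ : ∃ D1, D1 = K1 * (x1 * (T * H) + T * (x1 * (T * H)) + T * (2 * x0 * T) ^ 2) :=
    ⟨_, rfl⟩
  have hD1n : 0 ≤ D1 := by rw [hD1]; positivity
  refine ⟨2 * x0 + D1, by positivity, ?_⟩
  intro κ n n1 n2 ℓ ℓ1 q j G θ φ Φ Φt W hj hjc hq hθ S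
  obtain ⟨B, hB0, hκ, hn, -⟩ := W.exists_bound
  have κn : ∀ x, 0 ≤ κ x := fun x => (W.pos_κ x).le
  have nn : ∀ x, 0 ≤ n x := fun x => (W.pos_n x).le
  have cE0 := S.continuous_energy (k := 0) (by norm_num) W.continuous_κ hκ
  have cE1 := S.continuous_energy (k := 1) (by norm_num) W.continuous_κ hκ
  have cS0 := S.continuous_energy (k := 1) (by norm_num) W.continuous_n hn
  have cS1 := S.continuous_energy (k := 2) (by norm_num) W.continuous_n hn
  choose! e0 he0 hd0 using h0 W hj hq S
  have hd1' := h1 W hj hjc hq S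
  choose! e1 he1 hd1 using fun t ht => (hd1' t ht).1
  obtain ⟨γ, hγ⟩ : ∃ γ, γ = √(energy κ G) := ⟨_, rfl⟩
  have γn : 0 ≤ γ := hγ ▸ Real.sqrt_nonneg _
  have γq : γ ^ 2 = energy κ G := by rw [hγ, Real.sq_sqrt (energy_nonneg κn _)]
  rw [← hγ] at hd0
  have cg : Continuous fun t => 2 * γ * |θ t| := by fun_prop
  have b0 : ∀ t ∈ Icc 0 T, √(energy κ (φ 0 t)) ≤ 2 * x0 * γ * ∫ s in t..T, |θ s| := by
    intro t ht
    have := sqrt_le_of_hasDerivAt_ge hK0 he0 cE0 (fun t => energy_nonneg κn _) cS0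
      (fun t => energy_nonneg nn _) cg (fun t => by positivity) hd0
      (S.energy_terminal (by norm_num) κ) ht
    rw [intervalIntegral.integral_const_mul, ← hx0] at this
    refine this.trans (le_of_eq (by ring))
  rw [← hγ]
  refine ⟨fun t ht => (b0 t ht).trans ?_, fun ϑ hϑ => ?_⟩
  · have : 0 ≤ ∫ s in t..T, |θ s| := intervalIntegral.integral_nonneg ht.2 fun r _ => abs_nonneg _
    gcongr
    linarith
  have hϑn : 0 ≤ ϑ := (abs_nonneg _).trans (hϑ 0 ⟨le_rfl, hT⟩)
  have hγ1 : 0 ≤ energy κ (schwartzDeriv 1 G) := energy_nonneg κn _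
  obtain ⟨R, hR⟩ : ∃ R, R = (energy κ G + energy κ (schwartzDeriv 1 G)) * ϑ ^ 2 := ⟨_, rfl⟩
  have hRn : 0 ≤ R := by rw [hR, ← γq]; positivity
  have hγR : γ ^ 2 * ϑ ^ 2 ≤ R := by rw [hR, ← γq]; gcongr; linarith
  have hγ1R : energy κ (schwartzDeriv 1 G) * ϑ ^ 2 ≤ R := by
    rw [hR, ← γq]; gcongr; nlinarith
  have bsup : ∀ t ∈ Icc 0 T, √(energy κ (φ 0 t)) ≤ 2 * x0 * T * (γ * ϑ) := by
    intro t ht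
    have h2 : ∫ s in t..T, |θ s| ≤ ∫ s in t..T, ϑ :=
      intervalIntegral.integral_mono_on ht.2 (hθ.abs.intervalIntegrable _ _)
        intervalIntegrable_const fun s hs => hϑ s ⟨ht.1.trans hs.1, hs.2⟩
    rw [intervalIntegral.integral_const, smul_eq_mul] at h2
    calc _ ≤ 2 * x0 * γ * ∫ s in t..T, |θ s| := b0 t ht
      _ ≤ 2 * x0 * γ * ((T - t) * ϑ) := by gcongr
      _ ≤ 2 * x0 * γ * (T * ϑ) := by gcongr; linarith [ht.1]
      _ = _ := by ring
  have bE0 : ∀ t ∈ Icc 0 T, energy κ (φ 0 t) ≤ (2 * x0 * T) ^ 2 * R := by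
    intro t ht
    calc energy κ (φ 0 t) = √(energy κ (φ 0 t)) ^ 2 := (Real.sq_sqrt (energy_nonneg κn _)).symm
      _ ≤ (2 * x0 * T * (γ * ϑ)) ^ 2 := pow_le_pow_left₀ (Real.sqrt_nonneg _) (bsup t ht) 2
      _ = (2 * x0 * T) ^ 2 * (γ ^ 2 * ϑ ^ 2) := by ring
      _ ≤ _ := by gcongr
  have const_le : ∀ (f : ℝ → ℝ) (c t : ℝ), Continuous f → t ∈ Icc 0 T → 0 ≤ c →
      (∀ s ∈ Icc 0 T, f s ≤ c) → ∫ s in t..T, f s ≤ T * c := by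
    intro f c t cf ht hc hf
    calc ∫ s in t..T, f s ≤ ∫ s in t..T, c :=
          intervalIntegral.integral_mono_on ht.2 (cf.intervalIntegrable _ _)
            intervalIntegrable_const fun s hs => hf s ⟨ht.1.trans hs.1, hs.2⟩
      _ = (T - t) * c := by rw [intervalIntegral.integral_const, smul_eq_mul]
      _ ≤ _ := by gcongr; linarith [ht.1]
  have T0 : (0 : ℝ) ∈ Icc 0 T := ⟨le_rfl, hT⟩
  have b1 : ∀ t ∈ Icc 0 T, energy κ (φ 1 t) + ∫ s in t..T, energy n (φ 2 s) ≤
      x1 * (T * (H * R)) := by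
    intro t ht
    have ch : Continuous fun t => K1 * energy κ (φ 0 t)
        + θ t ^ 2 * energy κ (schwartzDeriv 1 G) := by fun_prop
    have h2 := add_integral_le_of_hasDerivAt_ge hK1 he1 cS1
      (fun t => energy_nonneg nn _) ch
      (fun t => add_nonneg (mul_nonneg hK1 (energy_nonneg κn _)) (by positivity)) hd1
      (S.energy_terminal (by norm_num) κ) ht
    have h3 := const_le _ (H * R) t ch ht (by positivity) fun s hs => by
      have h4 := bE0 s hs
      have h5 : θ s ^ 2 ≤ ϑ ^ 2 := by
        rw [← sq_abs (θ s)]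
        exact pow_le_pow_left₀ (abs_nonneg _) (hϑ s hs) 2
      calc K1 * energy κ (φ 0 s) + θ s ^ 2 * energy κ (schwartzDeriv 1 G)
          ≤ K1 * ((2 * x0 * T) ^ 2 * R) + ϑ ^ 2 * energy κ (schwartzDeriv 1 G) := by gcongr
        _ ≤ K1 * ((2 * x0 * T) ^ 2 * R) + R := by rw [mul_comm (ϑ ^ 2)]; gcongr
        _ = _ := by rw [hH]; ring
    rw [← hx1] at h2
    exact h2.trans (mul_le_mul_of_nonneg_left h3 x1n)
  have iS1n : ∀ t ∈ Icc 0 T, 0 ≤ ∫ s in t..T, energy n (φ 2 s) := fun t ht =>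
    intervalIntegral.integral_nonneg ht.2 fun r _ => energy_nonneg nn _
  have cZ : Continuous fun t => K1 * (energy n (φ 2 t) + energy κ (φ 1 t) + energy κ (φ 0 t)) := by
    fun_prop
  have Zn : ∀ t, 0 ≤ K1 * (energy n (φ 2 t) + energy κ (φ 1 t) + energy κ (φ 0 t)) := fun t =>
    mul_nonneg hK1 (add_nonneg (add_nonneg (energy_nonneg nn _) (energy_nonneg κn _))
      (energy_nonneg κn _))
  rw [← hR]
  refine ⟨fun t => √(K1 * (energy n (φ 2 t) + energy κ (φ 1 t)
    + energy κ (φ 0 t))), Real.continuous_sqrt.comp cZ, fun t => Real.sqrt_nonneg _,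
    fun t ht x => Real.le_sqrt_of_sq_le ((hd1' t ht).2 x), ?_⟩
  simp_rw [fun t => Real.sq_sqrt (Zn t)]
  have c21 : Continuous fun t => energy n (φ 2 t) + energy κ (φ 1 t) := cS1.add cE1
  rw [intervalIntegral.integral_const_mul, intervalIntegral.integral_add
    (c21.intervalIntegrable _ _) (cE0.intervalIntegrable _ _), intervalIntegral.integral_add
    (cS1.intervalIntegrable _ _) (cE1.intervalIntegrable _ _)]
  have j1 : ∫ t in 0..T, energy n (φ 2 t) ≤ x1 * (T * (H * R)) := by
    have h2 : 0 ≤ energy κ (φ 1 0) := energy_nonneg κn _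
    linarith [b1 0 T0]
  have j2 := const_le _ _ 0 cE1 T0 (by positivity : 0 ≤ x1 * (T * (H * R))) fun s hs => by
    linarith [b1 s hs, iS1n s hs]
  have j3 := const_le _ _ 0 cE0 T0 (by positivity : 0 ≤ (2 * x0 * T) ^ 2 * R) bE0
  calc K1 * (_ + _ + _) ≤ K1 * (x1 * (T * (H * R)) + T * (x1 * (T * (H * R)))
        + T * ((2 * x0 * T) ^ 2 * R)) := by gcongr
    _ = D1 * R := by rw [hD1]; ring
    _ ≤ _ := by gcongr; linarith

end IsDualSolution

end

section

/-! ### The weights -/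

/-- The logistic function `eˣ / (1 + eˣ)`. -/
def logistic (x : ℝ) : ℝ := Real.exp x * (1 + Real.exp x)⁻¹

/-- The function `1 + log (1 + eˣ)`, a smooth replacement for `1 + x₊`. -/
def ell (x : ℝ) : ℝ := 1 + Real.log (1 + Real.exp x)

/-- The factor `1 / (e^(c x) + δ)`, which is `e^(-c x)` cut off at the level `1 / δ`. -/
def expPart (c δ x : ℝ) : ℝ := (Real.exp (c * x) + δ)⁻¹

/-- The fraction `e^(c x) / (e^(c x) + δ)`. -/
def expFrac (c δ x : ℝ) : ℝ := Real.exp (c * x) * expPart c δ x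

/-- The weight `ℓ^(-3/2)`. -/
def tailPart (x : ℝ) : ℝ := ell x ^ (-(3 / 2) : ℝ)

/-- The quotient `ℓ' / ℓ`. -/
def tailFrac (x : ℝ) : ℝ := logistic x * (ell x)⁻¹

/-- The weight of the dual problem. For `δ = 0` its inverse is comparable to the weights `ρ`; the
positive values of `δ` make it bounded. -/
def dualWeight (c δ x : ℝ) : ℝ := expPart c δ x + tailPart x

/-- The function `-κ'` for `κ = dualWeight c δ`. -/
def dualWeight1 (c δ x : ℝ) : ℝ :=
  c * (expFrac c δ x * expPart c δ x) + 3 / 2 * (tailFrac x * tailPart x)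

/-- The logarithmic derivative of `tailFrac * tailPart`. -/
def tailLog (x : ℝ) : ℝ := 1 - logistic x - 5 / 2 * tailFrac x

/-- The derivative of `dualWeight1`. -/
def dualWeight2 (c δ x : ℝ) : ℝ :=
  c * (c * (expFrac c δ x * expPart c δ x) * (1 - 2 * expFrac c δ x))
    + 3 / 2 * ((tailFrac x * tailPart x) * tailLog x)

/-- The second derivative of `dualWeight1`. -/
def dualWeight3 (c δ x : ℝ) : ℝ :=
  c * (c ^ 2 * (expFrac c δ x * expPart c δ x) *
      ((1 - 2 * expFrac c δ x) ^ 2 - 2 * (expFrac c δ x * (1 - expFrac c δ x))))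
    + 3 / 2 * ((tailFrac x * tailPart x) * (tailLog x ^ 2
      - logistic x * (1 - logistic x) - 5 / 2 * (tailFrac x * (1 - logistic x - tailFrac x))))

lemma logistic_pos (x : ℝ) : 0 < logistic x := by unfold logistic; positivity

lemma logistic_lt_one (x : ℝ) : logistic x < 1 := by
  have := Real.exp_pos x
  unfold logistic
  rw [← div_eq_mul_inv, div_lt_one (by positivity)]
  linarith

lemma one_half_le_logistic {x : ℝ} (hx : 0 ≤ x) : 1 / 2 ≤ logistic x := by
  have := Real.one_le_exp hx
  unfold logistic
  rw [← div_eq_mul_inv, le_div_iff₀ (by positivity)]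
  linarith

lemma one_le_ell (x : ℝ) : 1 ≤ ell x := by
  have := Real.log_nonneg (by linarith [Real.exp_pos x] : 1 ≤ 1 + Real.exp x)
  unfold ell
  linarith

lemma ell_pos (x : ℝ) : 0 < ell x := zero_lt_one.trans_le (one_le_ell x)

lemma one_add_max_le_ell (x : ℝ) : 1 + max x 0 ≤ ell x := by
  have : x ≤ Real.log (1 + Real.exp x) := by
    rw [Real.le_log_iff_exp_le (by positivity)]
    linarith
  have := Real.log_nonneg (by linarith [Real.exp_pos x] : 1 ≤ 1 + Real.exp x)
  unfold ell
  gcongr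
  exact max_le ‹_› ‹_›

lemma ell_le (x : ℝ) : ell x ≤ 2 + max x 0 := by
  have h : Real.log (1 + Real.exp x) ≤ 1 + max x 0 := by
    rw [Real.log_le_iff_le_exp (by positivity), Real.exp_add]
    have h1 : 2 ≤ Real.exp 1 := by linarith [Real.add_one_le_exp 1]
    have h2 : Real.exp x ≤ Real.exp (max x 0) := Real.exp_le_exp.2 (le_max_left _ _)
    have h3 : 1 ≤ Real.exp (max x 0) := Real.one_le_exp (le_max_right _ _)
    nlinarith
  unfold ell
  linarith

lemma tailFrac_pos (x : ℝ) : 0 < tailFrac x :=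
  mul_pos (logistic_pos x) (inv_pos.2 (ell_pos x))

lemma tailFrac_lt_one (x : ℝ) : tailFrac x < 1 := by
  unfold tailFrac
  have h := inv_le_one_of_one_le₀ (one_le_ell x)
  have h1 := inv_pos.2 (ell_pos x)
  have := logistic_lt_one x
  have := logistic_pos x
  nlinarith

lemma tailPart_pos (x : ℝ) : 0 < tailPart x := Real.rpow_pos_of_pos (ell_pos x) _

lemma tailPart_le_one (x : ℝ) : tailPart x ≤ 1 :=
  Real.rpow_le_one_of_one_le_of_nonpos (one_le_ell x) (by norm_num)

lemma hasDerivAt_logistic (x : ℝ) :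
    HasDerivAt logistic (logistic x * (1 - logistic x)) x := by
  have h := Real.hasDerivAt_exp x
  have h0 : (1 + Real.exp x) ≠ 0 := by positivity
  refine (h.mul ((h.const_add 1).inv h0)).congr_deriv ?_
  unfold logistic
  simp only [Pi.inv_apply]
  field_simp
  ring

lemma hasDerivAt_ell (x : ℝ) : HasDerivAt ell (logistic x) x := by
  have h := ((Real.hasDerivAt_exp x).const_add 1).log (by positivity)
  exact (h.const_add 1).congr_deriv (div_eq_mul_inv _ _)

lemma hasDerivAt_tailPart (x : ℝ) :
    HasDerivAt tailPart (-(3 / 2 * (tailFrac x * tailPart x))) x := by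
  refine ((hasDerivAt_ell x).rpow_const (p := -(3 / 2)) (Or.inl (ell_pos x).ne')).congr_deriv ?_
  rw [Real.rpow_sub_one (ell_pos x).ne', tailFrac, tailPart]
  ring

lemma hasDerivAt_tailFrac (x : ℝ) :
    HasDerivAt tailFrac (tailFrac x * (1 - logistic x - tailFrac x)) x := by
  refine ((hasDerivAt_logistic x).mul ((hasDerivAt_ell x).inv (ell_pos x).ne')).congr_deriv ?_
  have := (ell_pos x).ne'
  unfold tailFrac
  simp only [Pi.inv_apply]
  field_simp
  ring

lemma hasDerivAt_tailFrac_mul_tailPart (x : ℝ) :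
    HasDerivAt (fun x => tailFrac x * tailPart x) ((tailFrac x * tailPart x) * tailLog x) x := by
  refine ((hasDerivAt_tailFrac x).mul (hasDerivAt_tailPart x)).congr_deriv ?_
  unfold tailLog
  ring

lemma hasDerivAt_tailLog (x : ℝ) :
    HasDerivAt tailLog (-(logistic x * (1 - logistic x))
      - 5 / 2 * (tailFrac x * (1 - logistic x - tailFrac x))) x :=
  ((hasDerivAt_logistic x).const_sub 1).sub ((hasDerivAt_tailFrac x).const_mul (5 / 2))

variable {c δ : ℝ}

lemma expPart_pos (hδ : 0 ≤ δ) (x : ℝ) : 0 < expPart c δ x := by unfold expPart; positivity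

lemma expFrac_pos (hδ : 0 ≤ δ) (x : ℝ) : 0 < expFrac c δ x :=
  mul_pos (Real.exp_pos _) (expPart_pos hδ x)

lemma expFrac_le_one (hδ : 0 ≤ δ) (x : ℝ) : expFrac c δ x ≤ 1 := by
  unfold expFrac expPart
  rw [← div_eq_mul_inv, div_le_one (by positivity)]
  linarith

lemma hasDerivAt_exp_const_mul (c x : ℝ) :
    HasDerivAt (fun x => Real.exp (c * x)) (c * Real.exp (c * x)) x := by
  refine (((hasDerivAt_id x).const_mul c).exp).congr_deriv ?_
  simp [mul_comm]

lemma hasDerivAt_expPart (hδ : 0 ≤ δ) (x : ℝ) :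
    HasDerivAt (expPart c δ) (-(c * (expFrac c δ x * expPart c δ x))) x := by
  have h0 : Real.exp (c * x) + δ ≠ 0 := by positivity
  refine (((hasDerivAt_exp_const_mul c x).add_const δ).inv h0).congr_deriv ?_
  unfold expFrac expPart
  field_simp

lemma hasDerivAt_expFrac (hδ : 0 ≤ δ) (x : ℝ) :
    HasDerivAt (expFrac c δ) (c * (expFrac c δ x * (1 - expFrac c δ x))) x := by
  refine ((hasDerivAt_exp_const_mul c x).mul (hasDerivAt_expPart hδ x)).congr_deriv ?_
  unfold expFrac
  ring

lemma hasDerivAt_dualWeight (hδ : 0 ≤ δ) (x : ℝ) :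
    HasDerivAt (dualWeight c δ) (-dualWeight1 c δ x) x := by
  refine ((hasDerivAt_expPart hδ x).add (hasDerivAt_tailPart x)).congr_deriv ?_
  unfold dualWeight1
  ring

lemma hasDerivAt_dualWeight1 (hδ : 0 ≤ δ) (x : ℝ) :
    HasDerivAt (dualWeight1 c δ) (dualWeight2 c δ x) x := by
  refine ((((hasDerivAt_expFrac hδ x).mul (hasDerivAt_expPart hδ x)).const_mul c).add
    ((hasDerivAt_tailFrac_mul_tailPart x).const_mul (3 / 2))).congr_deriv ?_
  unfold dualWeight2
  ring

lemma hasDerivAt_dualWeight2 (hδ : 0 ≤ δ) (x : ℝ) :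
    HasDerivAt (dualWeight2 c δ) (dualWeight3 c δ x) x := by
  have h1 := ((hasDerivAt_expFrac (c := c) hδ x).mul (hasDerivAt_expPart (c := c) hδ x)).const_mul c
  have h2 := ((hasDerivAt_expFrac (c := c) hδ x).const_mul 2).const_sub 1
  have h3 := (hasDerivAt_tailFrac_mul_tailPart x).mul (hasDerivAt_tailLog x)
  refine (((h1.mul h2).const_mul c).add (h3.const_mul (3 / 2))).congr_deriv ?_
  unfold dualWeight3
  simp only [Pi.mul_apply]
  ring

lemma continuous_of_hasDerivAt {f f' : ℝ → ℝ} (h : ∀ x, HasDerivAt f (f' x) x) : Continuous f :=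
  continuous_iff_continuousAt.2 fun x => (h x).continuousAt

lemma continuous_logistic : Continuous logistic := continuous_of_hasDerivAt hasDerivAt_logistic
lemma continuous_ell : Continuous ell := continuous_of_hasDerivAt hasDerivAt_ell
lemma continuous_tailPart : Continuous tailPart := continuous_of_hasDerivAt hasDerivAt_tailPart

lemma continuous_dualWeight3 (hδ : 0 ≤ δ) : Continuous (dualWeight3 c δ) := by
  have h1 : Continuous (expFrac c δ) := continuous_of_hasDerivAt (hasDerivAt_expFrac hδ)
  have h2 : Continuous (expPart c δ) := continuous_of_hasDerivAt (hasDerivAt_expPart hδ)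
  have h3 : Continuous tailFrac := continuous_of_hasDerivAt hasDerivAt_tailFrac
  have h4 := continuous_tailPart
  have h5 := continuous_logistic
  have h6 : Continuous tailLog := continuous_of_hasDerivAt hasDerivAt_tailLog
  unfold dualWeight3
  fun_prop

lemma dualWeight_pos (hδ : 0 ≤ δ) (x : ℝ) : 0 < dualWeight c δ x :=
  add_pos (expPart_pos hδ x) (tailPart_pos x)

lemma dualWeight1_pos (hc : 0 < c) (hδ : 0 ≤ δ) (x : ℝ) : 0 < dualWeight1 c δ x := by
  have := expFrac_pos (c := c) hδ x
  have := expPart_pos (c := c) hδ x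
  have := tailFrac_pos x
  have := tailPart_pos x
  unfold dualWeight1
  positivity

lemma expPart_le (hδ : 0 ≤ δ) (x : ℝ) : expPart c δ x ≤ Real.exp (-(c * x)) := by
  unfold expPart
  rw [Real.exp_neg]
  gcongr
  linarith

lemma ell_mul_exp_le (hc : 0 < c) {x : ℝ} (hx : 0 ≤ x) :
    Real.exp (-(c * x)) * ell x ≤ (2 + 3 / c) ^ 3 * tailPart x := by
  have h1 : ell x ≤ (2 + 3 / c) * Real.exp (c * x / 3) := by
    have h2 := Real.add_one_le_exp (c * x / 3)
    have h3 : 1 ≤ Real.exp (c * x / 3) := Real.one_le_exp (by positivity)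
    have h4 := ell_le x
    rw [max_eq_left hx] at h4
    have h5 : x ≤ 3 / c * Real.exp (c * x / 3) := by
      rw [div_mul_eq_mul_div, le_div_iff₀ hc]
      linarith
    linarith
  have h2 : ell x ^ 3 ≤ (2 + 3 / c) ^ 3 * Real.exp (c * x) := by
    calc ell x ^ 3 ≤ ((2 + 3 / c) * Real.exp (c * x / 3)) ^ 3 :=
          pow_le_pow_left₀ (ell_pos x).le h1 3
      _ = (2 + 3 / c) ^ 3 * Real.exp (c * x) := by
          rw [mul_pow, ← Real.exp_nat_mul]
          push_cast
          ring_nf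
  have h3 : ell x ^ (-2 : ℝ) ≤ tailPart x :=
    Real.rpow_le_rpow_of_exponent_le (one_le_ell x) (by norm_num)
  have h4 : ell x ^ (-2 : ℝ) = (ell x ^ 2)⁻¹ := by
    rw [Real.rpow_neg (ell_pos x).le]; norm_cast
  have h5 := ell_pos x
  calc Real.exp (-(c * x)) * ell x = ell x ^ 3 * (Real.exp (c * x))⁻¹ * (ell x ^ 2)⁻¹ := by
        rw [Real.exp_neg]; field_simp
    _ ≤ ((2 + 3 / c) ^ 3 * Real.exp (c * x)) * (Real.exp (c * x))⁻¹ * (ell x ^ 2)⁻¹ := by gcongr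
    _ = (2 + 3 / c) ^ 3 * (ell x ^ 2)⁻¹ := by field_simp
    _ ≤ _ := by rw [← h4]; gcongr

/-- The constant of the weight estimates. -/
def weightConst (c : ℝ) : ℝ := 10 + 4 * c ^ 2 + c + c * (2 + (2 + 3 / c) ^ 3) + 6 / c

lemma one_le_weightConst (hc : 0 < c) : 1 ≤ weightConst c := by
  have : 0 ≤ 4 * c ^ 2 + c + c * (2 + (2 + 3 / c) ^ 3) + 6 / c := by positivity
  unfold weightConst
  linarith

lemma energyWeight_dualWeight (hc : 0 < c) (hδ : 0 < δ) :
    EnergyWeight (weightConst c) (dualWeight c δ) (dualWeight1 c δ) (dualWeight2 c δ)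
      (dualWeight3 c δ) ell logistic where
  hasDerivAt_κ := hasDerivAt_dualWeight hδ.le
  hasDerivAt_n := hasDerivAt_dualWeight1 hδ.le
  hasDerivAt_n1 := hasDerivAt_dualWeight2 hδ.le
  hasDerivAt_ℓ := hasDerivAt_ell
  continuous_n2 := continuous_dualWeight3 hδ.le
  continuous_ℓ1 := continuous_logistic
  pos_n := dualWeight1_pos hc hδ.le
  pos_κ := dualWeight_pos hδ.le
  bounded := ⟨δ⁻¹ + 1, fun x => add_le_add
    (inv_anti₀ hδ (by linarith [Real.exp_pos (c * x)])) (tailPart_le_one x)⟩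
  one_le := one_le_weightConst hc
  n1_le x := by
    have s0 := expFrac_pos (c := c) hδ.le x
    have s1 := expFrac_le_one (c := c) hδ.le x
    have A0 := expPart_pos (c := c) hδ.le x
    have p0 := tailFrac_pos x
    have p1 := tailFrac_lt_one x
    have S0 := logistic_pos x
    have S1 := logistic_lt_one x
    have B0 := tailPart_pos x
    have hC : 10 + c ≤ weightConst c := by
      have : 0 ≤ 4 * c ^ 2 + c * (2 + (2 + 3 / c) ^ 3) + 6 / c := by positivity
      unfold weightConst
      linarith
    have hg : |tailLog x| ≤ 10 := by
      unfold tailLog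
      exact abs_le.2 ⟨by linarith, by linarith⟩
    have hs : |1 - 2 * expFrac c δ x| ≤ 1 := abs_le.2 ⟨by linarith, by linarith⟩
    have hd := dualWeight1_pos hc hδ.le x
    have hsA := mul_pos s0 A0
    have hpB := mul_pos p0 B0
    refine le_trans ?_ (mul_le_mul_of_nonneg_right hC hd.le)
    unfold dualWeight1 dualWeight2
    generalize expFrac c δ x * expPart c δ x = u at *
    generalize tailFrac x * tailPart x = v at *
    calc _ ≤ |c * (c * u * (1 - 2 * expFrac c δ x))| + |3 / 2 * (v * tailLog x)| := abs_add_le _ _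
      _ = c * (c * u * |1 - 2 * expFrac c δ x|) + 3 / 2 * (v * |tailLog x|) := by
          rw [abs_mul, abs_mul, abs_mul, abs_mul, abs_mul, abs_of_pos hc, abs_of_pos hsA,
            abs_of_pos hpB, abs_of_pos (by norm_num : (0 : ℝ) < 3 / 2)]
      _ ≤ c * (c * u * 1) + 3 / 2 * (v * 10) := by gcongr
      _ ≤ _ := by
          have : 0 ≤ c * u := by positivity
          have : 0 ≤ c * v := by positivity
          nlinarith
  n2_le x := by
    have s0 := expFrac_pos (c := c) hδ.le x
    have s1 := expFrac_le_one (c := c) hδ.le x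
    have A0 := expPart_pos (c := c) hδ.le x
    have p0 := tailFrac_pos x
    have p1 := tailFrac_lt_one x
    have S0 := logistic_pos x
    have S1 := logistic_lt_one x
    have B0 := tailPart_pos x
    have hC : 10 + 4 * c ^ 2 ≤ weightConst c := by
      have : 0 ≤ c + c * (2 + (2 + 3 / c) ^ 3) + 6 / c := by positivity
      unfold weightConst
      linarith
    have hg : |tailLog x ^ 2 - logistic x * (1 - logistic x)
        - 5 / 2 * (tailFrac x * (1 - logistic x - tailFrac x))| ≤ 10 := by
      have h1 : |tailLog x| ≤ 5 / 2 := by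
        unfold tailLog
        by_cases h : tailFrac x ≤ logistic x
        · exact abs_le.2 ⟨by
            have : tailFrac x * 1 ≤ logistic x := by linarith
            nlinarith, by linarith⟩
        · exact absurd (by
            unfold tailFrac
            have := inv_le_one_of_one_le₀ (one_le_ell x)
            nlinarith) h
      have h2 : tailLog x ^ 2 ≤ 25 / 4 := by
        rw [← sq_abs]
        have := abs_nonneg (tailLog x)
        nlinarith
      have h3 := sq_nonneg (tailLog x)
      have h4 : 0 ≤ logistic x * (1 - logistic x) := mul_nonneg S0.le (by linarith)
      have h5 : logistic x * (1 - logistic x) ≤ 1 := by nlinarith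
      have h6 : |tailFrac x * (1 - logistic x - tailFrac x)| ≤ 1 := by
        rw [abs_mul, abs_of_pos p0]
        have : |1 - logistic x - tailFrac x| ≤ 1 := abs_le.2 ⟨by linarith, by linarith⟩
        have := abs_nonneg (1 - logistic x - tailFrac x)
        nlinarith
      have h7 := abs_le.1 h6
      exact abs_le.2 ⟨by linarith, by linarith⟩
    have hs : |(1 - 2 * expFrac c δ x) ^ 2 - 2 * (expFrac c δ x * (1 - expFrac c δ x))| ≤ 4 := by
      have : 0 ≤ expFrac c δ x * (1 - expFrac c δ x) := mul_nonneg s0.le (by linarith)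
      have : expFrac c δ x * (1 - expFrac c δ x) ≤ 1 := by nlinarith
      have e : (1 - 2 * expFrac c δ x) ^ 2 = 1 - 4 * (expFrac c δ x * (1 - expFrac c δ x)) := by
        ring
      rw [e]
      exact abs_le.2 ⟨by nlinarith [sq_nonneg (1 - 2 * expFrac c δ x)], by linarith⟩
    have hd := dualWeight1_pos hc hδ.le x
    have hsA := mul_pos s0 A0
    have hpB := mul_pos p0 B0
    refine le_trans ?_ (mul_le_mul_of_nonneg_right hC hd.le)
    unfold dualWeight1 dualWeight3
    generalize expFrac c δ x * expPart c δ x = u at *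
    generalize tailFrac x * tailPart x = v at *
    generalize (1 - 2 * expFrac c δ x) ^ 2 - 2 * (expFrac c δ x * (1 - expFrac c δ x)) = y at *
    generalize tailLog x ^ 2 - logistic x * (1 - logistic x)
        - 5 / 2 * (tailFrac x * (1 - logistic x - tailFrac x)) = z at *
    calc _ ≤ |c * (c ^ 2 * u * y)| + |3 / 2 * (v * z)| := abs_add_le _ _
      _ = c * (c ^ 2 * u * |y|) + 3 / 2 * (v * |z|) := by
          rw [abs_mul, abs_mul, abs_mul, abs_mul, abs_mul, abs_of_pos hc, abs_of_pos hsA,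
            abs_of_pos hpB, abs_of_pos (by norm_num : (0 : ℝ) < 3 / 2), abs_of_nonneg (sq_nonneg c)]
      _ ≤ c * (c ^ 2 * u * 4) + 3 / 2 * (v * 10) := by gcongr
      _ ≤ _ := by
          have : 0 ≤ c * u := by positivity
          have : 0 ≤ c ^ 2 * v := by positivity
          nlinarith
  n_mul_le x := by
    have s0 := expFrac_pos (c := c) hδ.le x
    have s1 := expFrac_le_one (c := c) hδ.le x
    have A0 := expPart_pos (c := c) hδ.le x
    have B0 := tailPart_pos x
    have l0 := ell_pos x
    have h1 : tailFrac x * tailPart x * ell x ≤ tailPart x := by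
      have : tailFrac x * tailPart x * ell x = logistic x * tailPart x := by
        unfold tailFrac; field_simp
      rw [this]
      have := logistic_lt_one x
      nlinarith
    have h2 : expFrac c δ x * expPart c δ x * ell x ≤
        (2 + (2 + 3 / c) ^ 3) * (expPart c δ x + tailPart x) := by
      have h3 : (0 : ℝ) ≤ (2 + 3 / c) ^ 3 := by positivity
      rcases le_total x 0 with hx | hx
      · have h4 := ell_le x
        rw [max_eq_right hx] at h4
        calc expFrac c δ x * expPart c δ x * ell x ≤ 1 * expPart c δ x * (2 + 0) := by gcongr
          _ ≤ _ := by nlinarith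
      · calc expFrac c δ x * expPart c δ x * ell x ≤ 1 * Real.exp (-(c * x)) * ell x := by
              gcongr
              exact expPart_le hδ.le x
          _ ≤ (2 + 3 / c) ^ 3 * tailPart x := by rw [one_mul]; exact ell_mul_exp_le hc hx
          _ ≤ _ := by nlinarith
    have hC : 3 / 2 + c * (2 + (2 + 3 / c) ^ 3) ≤ weightConst c := by
      have : 0 ≤ 4 * c ^ 2 + c + 6 / c := by positivity
      unfold weightConst
      linarith
    refine le_trans ?_ (mul_le_mul_of_nonneg_right hC (dualWeight_pos hδ.le x).le)
    unfold dualWeight1 dualWeight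
    have h4 := mul_le_mul_of_nonneg_left h2 hc.le
    nlinarith
  one_le_ℓ := one_le_ell
  ℓ1_le x := by
    rw [abs_of_pos (logistic_pos x)]
    exact (logistic_lt_one x).le

/-- The weight is comparable to `n ℓ` in the region where the cutoff is not active. -/
lemma dualWeight_le (hc : 0 < c) (hδ : 0 < δ) {x : ℝ} (hx : δ ≤ Real.exp (c * x)) :
    dualWeight c δ x ≤ weightConst c * (dualWeight1 c δ x * ell x) := by
  have l1 := one_le_ell x
  have A0 := expPart_pos (c := c) hδ.le x
  have B0 := tailPart_pos x
  have p0 := tailFrac_pos x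
  have s2 : 1 / 2 ≤ expFrac c δ x := by
    unfold expFrac expPart
    rw [← div_eq_mul_inv, le_div_iff₀ (by positivity)]
    linarith
  have hpB : 0 ≤ tailFrac x * tailPart x := by positivity
  have hsA : 0 ≤ expFrac c δ x * expPart c δ x := by positivity
  have n0 := dualWeight1_pos hc hδ.le x
  have nl : dualWeight1 c δ x ≤ dualWeight1 c δ x * ell x := le_mul_of_one_le_right n0.le l1
  have h1 : c * expPart c δ x ≤ 2 * (dualWeight1 c δ x * ell x) := by
    have : c * expPart c δ x ≤ 2 * dualWeight1 c δ x := by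
      unfold dualWeight1
      have := mul_le_mul_of_nonneg_right s2 (mul_pos hc A0).le
      nlinarith
    linarith
  have h2 : c * tailPart x ≤ (4 + 4 / 3 * c) * (dualWeight1 c δ x * ell x) := by
    rcases le_total x 0 with hx0 | hx0
    · have h3 : 1 ≤ 2 * expPart c δ x := by
        unfold expPart
        rw [← div_eq_mul_inv, le_div_iff₀ (by positivity)]
        have : Real.exp (c * x) ≤ 1 := Real.exp_le_one_iff.2 (mul_nonpos_of_nonneg_of_nonpos hc.le hx0)
        linarith
      have h4 := tailPart_le_one x
      have : c * tailPart x ≤ 2 * (c * expPart c δ x) := by nlinarith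
      have : 0 ≤ 4 / 3 * c * (dualWeight1 c δ x * ell x) := by positivity
      nlinarith
    · have h3 : tailFrac x * tailPart x * ell x = logistic x * tailPart x := by
        have := (ell_pos x).ne'
        unfold tailFrac; field_simp
      have h4 := one_half_le_logistic hx0
      have h5 : 3 / 4 * tailPart x ≤ dualWeight1 c δ x * ell x := by
        unfold dualWeight1
        rw [add_mul, mul_assoc (3 / 2), h3]
        have : 0 ≤ c * (expFrac c δ x * expPart c δ x) * ell x := by positivity
        nlinarith
      have h6 : 0 ≤ 4 * (dualWeight1 c δ x * ell x) := by positivity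
      nlinarith
  have hC : 6 / c + 4 / 3 ≤ weightConst c := by
    have : 0 ≤ 4 * c ^ 2 + c + c * (2 + (2 + 3 / c) ^ 3) := by positivity
    unfold weightConst
    linarith
  have h3 : dualWeight c δ x ≤ (6 / c + 4 / 3) * (dualWeight1 c δ x * ell x) := by
    have h4 : c * dualWeight c δ x ≤ c * ((6 / c + 4 / 3) * (dualWeight1 c δ x * ell x)) := by
      have : c * ((6 / c + 4 / 3) * (dualWeight1 c δ x * ell x))
          = (6 + 4 / 3 * c) * (dualWeight1 c δ x * ell x) := by field_simp
      rw [this]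
      unfold dualWeight
      linarith
    exact le_of_mul_le_mul_left h4 hc
  exact h3.trans (by gcongr)

lemma dualWeight_anti (hδ : 0 ≤ δ) (x : ℝ) : dualWeight c δ x ≤ dualWeight c 0 x := by
  unfold dualWeight expPart
  gcongr

lemma inv_dualWeight_le (hδ : 0 ≤ δ) (x : ℝ) :
    (dualWeight c δ x)⁻¹ ≤ (dualWeight c 0 x)⁻¹ + δ := by
  have h1 := Real.exp_pos (c * x)
  have h2 := tailPart_pos x
  unfold dualWeight expPart
  generalize Real.exp (c * x) = y at *
  generalize tailPart x = B at *
  have e1 : ((y + δ)⁻¹ + B)⁻¹ = (y + δ) / (1 + B * (y + δ)) := by field_simp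
  have e2 : ((y + 0)⁻¹ + B)⁻¹ = y / (1 + B * y) := by rw [add_zero]; field_simp
  rw [e1, e2, ← sub_le_iff_le_add', div_sub_div _ _ (by positivity) (by positivity),
    div_le_iff₀ (by positivity)]
  have h3 : 0 ≤ δ * (B * (y + δ)) := by positivity
  have h4 : 0 ≤ δ * (B * y) := by positivity
  have h5 : 0 ≤ δ * (B * (y + δ)) * (B * y) := by positivity
  nlinarith

end

section

variable {c δ : ℝ}

lemma coeffWeight_ell (x : ℝ) : coeffWeight ell x = ell x ^ (3 / 4 : ℝ) := by
  have h := ell_pos x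
  rw [coeffWeight, Real.sqrt_eq_rpow, Real.sqrt_eq_rpow, ← Real.rpow_mul h.le, ← Real.rpow_add h]
  norm_num

lemma coeffWeight_ell_sq (x : ℝ) : coeffWeight ell x ^ 2 = ell x ^ (3 / 2 : ℝ) := by
  rw [coeffWeight_ell, ← Real.rpow_mul_natCast (ell_pos x).le]
  norm_num

lemma one_le_coeffWeight_ell (x : ℝ) : 1 ≤ coeffWeight ell x := by
  rw [coeffWeight_ell]
  exact Real.one_le_rpow (one_le_ell x) (by norm_num)

lemma coeffWeight_ell_pos (x : ℝ) : 0 < coeffWeight ell x :=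
  zero_lt_one.trans_le (one_le_coeffWeight_ell x)

lemma continuous_coeffWeight_ell : Continuous (coeffWeight ell) := by
  have := continuous_ell
  unfold coeffWeight
  fun_prop

lemma tailPart_eq (x : ℝ) : tailPart x = (coeffWeight ell x ^ 2)⁻¹ := by
  rw [coeffWeight_ell_sq, tailPart, Real.rpow_neg (ell_pos x).le]

lemma inv_dualWeight_zero_le (x : ℝ) : (dualWeight c 0 x)⁻¹ ≤ coeffWeight ell x ^ 2 := by
  rw [← inv_inv (coeffWeight ell x ^ 2), ← tailPart_eq]
  refine inv_anti₀ (tailPart_pos x) ?_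
  have := expPart_pos (c := c) le_rfl x
  unfold dualWeight
  linarith

lemma coeffWeight_ell_le (x : ℝ) : coeffWeight ell x ≤ 2 * (1 + max x 0) ^ (3 / 4 : ℝ) := by
  have h0 : 0 ≤ max x 0 := le_max_right _ _
  have h1 : ell x ≤ 2 * (1 + max x 0) := by linarith [ell_le x]
  rw [coeffWeight_ell]
  calc ell x ^ (3 / 4 : ℝ) ≤ (2 * (1 + max x 0)) ^ (3 / 4 : ℝ) :=
        Real.rpow_le_rpow (ell_pos x).le h1 (by norm_num)
    _ = 2 ^ (3 / 4 : ℝ) * (1 + max x 0) ^ (3 / 4 : ℝ) := Real.mul_rpow (by norm_num) (by positivity)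
    _ ≤ 2 * (1 + max x 0) ^ (3 / 4 : ℝ) := by
        gcongr
        calc (2 : ℝ) ^ (3 / 4 : ℝ) ≤ 2 ^ (1 : ℝ) :=
              Real.rpow_le_rpow_of_exponent_le (by norm_num) (by norm_num)
          _ = 2 := Real.rpow_one 2

/-- In the region where the cutoff is not active, the sup-norm estimate of the dual solution may be
paired with two functions from `L₂^(3/4)`. -/
lemma one_le_supWeight_mul (hc : 0 < c) (hδ : 0 < δ) {x : ℝ} (hx : δ ≤ Real.exp (c * x)) :
    1 ≤ weightConst c * (supWeight (dualWeight1 c δ) ell x * coeffWeight ell x ^ 2) := by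
  have hC := one_le_weightConst hc
  have l1 := one_le_ell x
  have n0 := dualWeight1_pos hc hδ.le x
  have w1 := one_le_coeffWeight_ell x
  have h1 := dualWeight_le hc hδ hx
  have h2 : tailPart x ≤ dualWeight c δ x := by
    have := expPart_pos (c := c) hδ.le x
    unfold dualWeight
    linarith
  have h3 : 1 ≤ weightConst c * (dualWeight1 c δ x * ell x) * coeffWeight ell x ^ 2 := by
    have h4 := h2.trans h1
    rw [tailPart_eq, inv_le_iff_one_le_mul₀ (by positivity)] at h4
    exact h4
  have h4 : ell x ≤ √(ell x) * coeffWeight ell x ^ 2 := by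
    have h5 : coeffWeight ell x ^ 2 = ell x * √(ell x) := by
      unfold coeffWeight
      rw [mul_pow, Real.sq_sqrt (by linarith), Real.sq_sqrt (Real.sqrt_nonneg _)]
    rw [h5]
    have h6 : √(ell x) * √(ell x) = ell x := Real.mul_self_sqrt (by linarith)
    calc ell x ≤ ell x * ell x := by nlinarith
      _ = ell x * (√(ell x) * √(ell x)) := by rw [h6]
      _ = _ := by ring
  have hs : supWeight (dualWeight1 c δ) ell x ^ 2 = dualWeight1 c δ x * √(ell x) :=
    Real.sq_sqrt (by positivity)
  have h5 : 1 ≤ (weightConst c * (supWeight (dualWeight1 c δ) ell x * coeffWeight ell x ^ 2)) ^ 2 := by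
    calc 1 ≤ weightConst c * (dualWeight1 c δ x * ell x) * coeffWeight ell x ^ 2 := h3
      _ ≤ weightConst c * (dualWeight1 c δ x * (√(ell x) * coeffWeight ell x ^ 2))
          * coeffWeight ell x ^ 2 := by gcongr
      _ ≤ weightConst c ^ 2 * (dualWeight1 c δ x * (√(ell x) * coeffWeight ell x ^ 2))
          * coeffWeight ell x ^ 2 := by
          gcongr
          nlinarith
      _ = _ := by rw [mul_pow, mul_pow, hs]; ring
  have h6 : 0 ≤ weightConst c * (supWeight (dualWeight1 c δ) ell x * coeffWeight ell x ^ 2) := by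
    have : 0 ≤ supWeight (dualWeight1 c δ) ell x := Real.sqrt_nonneg _
    positivity
  by_contra! h
  nlinarith

/-- The weights `ρ` are comparable to the inverse of the weight of the dual problem, with a constant
that depends on `ε` only. -/
lemma exists_weight_equiv {ε : ℝ} (hε : 0 < ε) : ∃ K : ℝ, 0 < K ∧ ∀ ρ, IsWeight (3 / 4) ε ρ →
    ∀ x, ρ x ≤ K * (dualWeight (2 * ε) 0 x)⁻¹ ∧ (dualWeight (2 * ε) 0 x)⁻¹ ≤ K * ρ x := by
  have hc : 0 < 2 * ε := by positivity
  obtain ⟨c, hcd⟩ : ∃ c, c = 2 * ε := ⟨_, rfl⟩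
  rw [← hcd] at hc ⊢
  obtain ⟨C1, hC1⟩ : ∃ C1, C1 = (2 + 3 / c) ^ 3 := ⟨_, rfl⟩
  have hC1n : 0 ≤ C1 := by rw [hC1]; positivity
  refine ⟨2 * Real.exp c + (1 + C1) + 4, by positivity, fun ρ hρ x => ?_⟩
  have hκ := dualWeight_pos (c := c) le_rfl x
  have hB0 := tailPart_pos x
  have e0 : expPart c 0 x = Real.exp (-(c * x)) := by
    rw [expPart, add_zero, Real.exp_neg]
  rcases le_total x 0 with hx | hx
  · have hy : 1 ≤ Real.exp (-(c * x)) := Real.one_le_exp (by nlinarith)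
    have hy1 : Real.exp (-(c * x)) * Real.exp (c * x) = 1 := by
      rw [← Real.exp_add, neg_add_cancel, Real.exp_zero]
    have hy0 := Real.exp_pos (c * x)
    have hr1 : Real.exp (c * x) / 2 ≤ (dualWeight c 0 x)⁻¹ := by
      rw [le_inv_comm₀ (by positivity) hκ, inv_div]
      have := tailPart_le_one x
      unfold dualWeight
      rw [e0, le_div_iff₀ hy0]
      nlinarith
    have hr2 : (dualWeight c 0 x)⁻¹ ≤ Real.exp (c * x) := by
      rw [inv_le_comm₀ hκ hy0, ← Real.exp_neg]
      unfold dualWeight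
      rw [e0]
      linarith
    have hρ1 : ρ x ≤ Real.exp c * Real.exp (c * x) ∧ Real.exp (c * x) ≤ Real.exp c * ρ x := by
      rcases le_total x (-1) with h1 | h1
      · have h2 : 1 ≤ Real.exp c := Real.one_le_exp hc.le
        rw [hρ.eq_left x h1, ← hcd]
        constructor <;> nlinarith
      · have h2 := hρ.strictMono.monotone h1
        have h3 := hρ.strictMono.monotone hx
        rw [hρ.eq_left (-1) le_rfl, ← hcd] at h2
        rw [hρ.eq_right 0 le_rfl, add_zero, Real.one_rpow] at h3
        constructor
        · rw [← Real.exp_add]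
          exact h3.trans (Real.one_le_exp (by nlinarith))
        · calc Real.exp (c * x) ≤ 1 := Real.exp_le_one_iff.2 (by nlinarith)
            _ = Real.exp c * Real.exp (c * -1) := by
                rw [← Real.exp_add, mul_neg_one, add_neg_cancel, Real.exp_zero]
            _ ≤ _ := by gcongr
    have hρ0 : 0 < ρ x := by
      by_contra! h
      nlinarith [hρ1.2, Real.exp_pos c]
    have hr0 := inv_pos.2 hκ
    constructor
    · calc ρ x ≤ Real.exp c * (2 * (Real.exp (c * x) / 2)) := hρ1.1.trans (le_of_eq (by ring))
        _ ≤ Real.exp c * (2 * (dualWeight c 0 x)⁻¹) := by gcongr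
        _ = (2 * Real.exp c) * (dualWeight c 0 x)⁻¹ := by ring
        _ ≤ _ := by gcongr; linarith
    · refine (hr2.trans hρ1.2).trans ?_
      gcongr
      linarith [Real.exp_pos c]
  · have l1 := one_le_ell x
    have hAB : Real.exp (-(c * x)) ≤ C1 * tailPart x := by
      rw [hC1]
      exact (le_mul_of_one_le_right (Real.exp_pos _).le l1).trans (ell_mul_exp_le hc hx)
    have hρx : ρ x = (1 + x) ^ (3 / 2 : ℝ) := by
      rw [hρ.eq_right x hx]; norm_num
    have hl1 : (1 + x) ^ (3 / 2 : ℝ) ≤ coeffWeight ell x ^ 2 := by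
      rw [coeffWeight_ell_sq]
      have := one_add_max_le_ell x
      rw [max_eq_left hx] at this
      exact Real.rpow_le_rpow (by linarith) this (by norm_num)
    have hl2 : coeffWeight ell x ^ 2 ≤ 4 * (1 + x) ^ (3 / 2 : ℝ) := by
      have h1 := coeffWeight_ell_le x
      rw [max_eq_left hx] at h1
      calc coeffWeight ell x ^ 2 ≤ (2 * (1 + x) ^ (3 / 4 : ℝ)) ^ 2 :=
            pow_le_pow_left₀ (coeffWeight_ell_pos x).le h1 2
        _ = 4 * ((1 + x) ^ (3 / 4 : ℝ)) ^ 2 := by ring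
        _ = _ := by
            rw [← Real.rpow_mul_natCast (by linarith)]
            norm_num
    have hr1 : coeffWeight ell x ^ 2 ≤ (1 + C1) * (dualWeight c 0 x)⁻¹ := by
      have hw : coeffWeight ell x ^ 2 * tailPart x = 1 := by
        rw [tailPart_eq]
        have := coeffWeight_ell_pos x
        field_simp
      rw [← div_eq_mul_inv, le_div_iff₀ hκ]
      unfold dualWeight
      rw [e0]
      have := mul_le_mul_of_nonneg_left hAB (sq_nonneg (coeffWeight ell x))
      nlinarith
    have hr0 := inv_pos.2 hκ
    have hp : 0 < (1 + x) ^ (3 / 2 : ℝ) := Real.rpow_pos_of_pos (by linarith) _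
    have := Real.exp_pos c
    rw [hρx]
    constructor
    · exact (hl1.trans hr1).trans (mul_le_mul_of_nonneg_right (by linarith) hr0.le)
    · refine ((inv_dualWeight_zero_le x).trans hl2).trans ?_
      have : 4 ≤ 2 * Real.exp c + (1 + C1) + 4 := by linarith
      gcongr

end

section

/-! ### From tested inequalities to a Grönwall inequality -/

instance isFiniteMeasure_timeMeasure (T : ℝ) : IsFiniteMeasure (timeMeasure T) := by
  unfold timeMeasure
  infer_instance

/-- A function whose integrals against nonnegative continuous functions are nonnegative is
nonnegative almost everywhere. -/
lemma ae_nonneg_of_forall_integral_mul_nonneg {T : ℝ} {f : ℝ → ℝ} (hfm : Measurable f)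
    (hf : Integrable f (timeMeasure T))
    (h : ∀ θ : ℝ → ℝ, Continuous θ → (∀ t, 0 ≤ θ t) → 0 ≤ ∫ t, θ t * f t ∂timeMeasure T) :
    ∀ᵐ t ∂timeMeasure T, 0 ≤ f t := by
  have hK : ∀ K : Set ℝ, IsCompact K → 0 ≤ ∫ t in K, f t ∂timeMeasure T := by
    intro K hKc
    have hδ : ∀ n : ℕ, 0 < 1 / ((n : ℝ) + 1) := fun n => by positivity
    have hlim := thickenedIndicator_tendsto_indicator_closure hδ
      tendsto_one_div_add_atTop_nhds_zero_nat K
    rw [hKc.isClosed.closure_eq, tendsto_pi_nhds] at hlim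
    have key := tendsto_integral_of_dominated_convergence (μ := timeMeasure T)
      (F := fun n t => ((thickenedIndicator (hδ n) K t : ℝ≥0) : ℝ) * f t)
      (f := K.indicator f) (fun t => |f t|)
      (fun n => (((NNReal.continuous_coe.comp
        (thickenedIndicator (hδ n) K).continuous).measurable).mul hfm).aestronglyMeasurable)
      hf.abs (fun n => Eventually.of_forall fun t => by
        rw [norm_mul, Real.norm_eq_abs, Real.norm_eq_abs, NNReal.abs_eq]
        exact mul_le_of_le_one_left (abs_nonneg _)
          (by exact_mod_cast thickenedIndicator_le_one (hδ n) K t))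
      (Eventually.of_forall fun t => by
        have h1 := (NNReal.continuous_coe.tendsto _).comp (hlim t)
        have h2 := h1.mul_const (f t)
        refine h2.congr' (Eventually.of_forall fun n => rfl) |>.trans (le_of_eq ?_)
        by_cases ht : t ∈ K <;> simp [ht])
    rw [integral_indicator hKc.measurableSet] at key
    exact ge_of_tendsto' key fun n => h _ (NNReal.continuous_coe.comp
      (thickenedIndicator (hδ n) K).continuous) fun t => NNReal.coe_nonneg _
  have hA : MeasurableSet {t | f t < 0} := measurableSet_lt hfm measurable_const
  by_contra hne
  have hpos : 0 < timeMeasure T {t | f t < 0} := by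
    rw [pos_iff_ne_zero]
    intro h0
    refine hne ?_
    rw [ae_iff]
    simpa using h0
  obtain ⟨K, hKA, hKc, hKpos⟩ := hA.exists_lt_isCompact hpos
  have h1 : ∫ t in K, -f t ∂timeMeasure T = 0 := by
    refine le_antisymm ?_ (setIntegral_nonneg hKc.measurableSet fun t ht => ?_)
    · rw [integral_neg]
      linarith [hK K hKc]
    · have : f t < 0 := hKA ht
      linarith
  have hnn : 0 ≤ᵐ[(timeMeasure T).restrict K] fun t => -f t := by
    filter_upwards [ae_restrict_mem hKc.measurableSet] with t htK
    have : f t < 0 := hKA htK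
    simp only [Pi.zero_apply]
    linarith
  have h2 : ∀ᵐ t ∂(timeMeasure T).restrict K, False := by
    filter_upwards [(setIntegral_eq_zero_iff_of_nonneg_ae hnn hf.neg.integrableOn).1 h1,
      ae_restrict_mem hKc.measurableSet] with t ht htK
    have : f t < 0 := hKA htK
    simp only [Pi.zero_apply, neg_eq_zero] at ht
    linarith
  rw [eventually_false_iff_eq_bot, ae_eq_bot, Measure.restrict_eq_zero] at h2
  exact hKpos.ne' h2

/-- The functions `G √κ`, `G` smooth with compact support, form a subspace of `L₂`. -/
def weightedTest (κ : ℝ → ℝ) : Submodule ℂ L2 where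
  carrier := {F | ∃ G : 𝓢(ℝ, ℂ), HasCompactSupport G ∧ F =ᵐ[volume] fun x => G x * √(κ x)}
  add_mem' := by
    rintro F F' ⟨G, hG, h⟩ ⟨G', hG', h'⟩
    refine ⟨G + G', hG.add hG', ?_⟩
    filter_upwards [Lp.coeFn_add F F', h, h'] with x h1 h2 h3
    rw [h1, Pi.add_apply, h2, h3, _root_.add_apply, add_mul]
  zero_mem' := ⟨0, HasCompactSupport.zero, by
    filter_upwards [Lp.coeFn_zero ℂ 2 volume] with x hx
    rw [hx]
    simp⟩
  smul_mem' := by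
    rintro z F ⟨G, hG, h⟩
    refine ⟨z • G, hG.smul_left (f := fun _ => z), ?_⟩
    filter_upwards [Lp.coeFn_smul z F, h] with x h1 h2
    rw [h1, Pi.smul_apply, h2, _root_.smul_apply, smul_eq_mul, smul_eq_mul, mul_assoc]

lemma memLp_mul_sqrt_of_hasCompactSupport {κ : ℝ → ℝ} (hκ : Continuous κ) (G : 𝓢(ℝ, ℂ))
    (hG : HasCompactSupport G) : MemLp (fun x => G x * √(κ x)) 2 volume :=
  (G.continuous.mul (by fun_prop)).memLp_of_hasCompactSupport hG.mul_right

lemma topologicalClosure_weightedTest {κ : ℝ → ℝ} (hκ : Continuous κ) (hκ0 : ∀ x, 0 < κ x) :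
    (weightedTest κ).topologicalClosure = ⊤ := by
  rw [Submodule.topologicalClosure_eq_top_iff, Submodule.eq_bot_iff]
  intro V hV
  have hli : LocallyIntegrable (fun x => ((√(κ x) : ℝ) : ℂ) * V x) volume :=
    ((Lp.memLp V).locallyIntegrable (by norm_num)).continuous_smul (g := fun x => ((√(κ x) : ℝ) : ℂ))
      (by fun_prop)
  have h0 := ae_eq_zero_of_integral_contDiff_smul_eq_zero hli fun g hg hgc => by
    have hgs : HasCompactSupport fun x => ((g x : ℝ) : ℂ) := hgc.comp_left Complex.ofReal_zero
    set G : 𝓢(ℝ, ℂ) := hgs.toSchwartzMap (Complex.ofRealCLM.contDiff.comp hg) with hGd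
    have hG : ∀ x, G x = g x := fun x => rfl
    have hm := memLp_mul_sqrt_of_hasCompactSupport hκ G hgs
    have h1 : inner ℂ (hm.toLp _) V = 0 :=
      hV _ ⟨G, hgs, hm.coeFn_toLp⟩
    rw [L2.inner_def] at h1
    rw [← h1]
    refine integral_congr_ae ?_
    filter_upwards [hm.coeFn_toLp] with x hx
    rw [hx, RCLike.inner_apply, hG, map_mul, Complex.conj_ofReal, Complex.conj_ofReal,
      Complex.real_smul]
    ring
  refine Lp.ext ?_
  filter_upwards [h0, Lp.coeFn_zero ℂ 2 volume] with x hx hx0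
  rw [hx0]
  have : ((√(κ x) : ℝ) : ℂ) ≠ 0 := by
    exact_mod_cast (Real.sqrt_pos.2 (hκ0 x)).ne'
  simpa [this] using hx

/-- Duality between the weighted spaces with the weights `κ` and `κ⁻¹`; countably many test functions
suffice. -/
lemma exists_countable_norming {κ : ℝ → ℝ} (hκ : Continuous κ) (hκ0 : ∀ x, 0 < κ x) :
    ∃ 𝒟 : Set 𝓢(ℝ, ℂ), 𝒟.Countable ∧ (∀ G ∈ 𝒟, HasCompactSupport G) ∧
      ∀ w : ℝ → ℂ, MemLp (fun x => w x * √(κ x)⁻¹) 2 volume → ∀ b : ℝ, 0 ≤ b →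
        (∀ G ∈ 𝒟, (∫ x, w x * G x).re ≤ √(energy κ G) * b) →
        √(∫ x, ‖w x‖ ^ 2 * (κ x)⁻¹) ≤ b := by
  have : Fact ((2 : ℝ≥0∞) ≠ ⊤) := ⟨by norm_num⟩
  obtain ⟨t, htS, htc, hcl⟩ := (TopologicalSpace.IsSeparable.of_separableSpace
    (weightedTest κ : Set L2)).exists_countable_dense_subset
  have htS' : ∀ F : L2, F ∈ t → ∃ G : 𝓢(ℝ, ℂ), HasCompactSupport G ∧
      F =ᵐ[volume] fun x => G x * √(κ x) := fun F hF => htS hF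
  choose! G hGc hG using htS'
  refine ⟨G '' t, htc.image G, ?_, fun w hw b hb h => ?_⟩
  · rintro _ ⟨F, hF, rfl⟩
    exact hGc F hF
  have hκ1 : ∀ x, √(κ x)⁻¹ * √(κ x) = 1 := fun x => by
    rw [Real.sqrt_inv, inv_mul_cancel₀ (Real.sqrt_pos.2 (hκ0 x)).ne']
  have hwc : MemLp (fun x => starRingEnd ℂ (w x * √(κ x)⁻¹)) 2 volume := hw.star
  set V : L2 := hwc.toLp _ with hV
  have hclosed : IsClosed {F : L2 | (inner ℂ V F).re ≤ ‖F‖ * b} :=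
    isClosed_le (Complex.continuous_re.comp (continuous_const.inner continuous_id))
      (continuous_norm.mul continuous_const)
  have ht : t ⊆ {F : L2 | (inner ℂ V F).re ≤ ‖F‖ * b} := by
    intro F hF
    have h1 := h (G F) ⟨F, hF, rfl⟩
    have h2 : inner ℂ V F = ∫ x, w x * G F x := by
      rw [L2.inner_def]
      refine integral_congr_ae ?_
      filter_upwards [hwc.coeFn_toLp, hG F hF] with x hx1 hx2
      rw [hV, hx1, hx2, RCLike.inner_apply, Complex.conj_conj]
      have : ((√(κ x)⁻¹ : ℝ) : ℂ) * ((√(κ x) : ℝ) : ℂ) = 1 := by exact_mod_cast hκ1 x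
      linear_combination (w x * G F x) * this
    have h3 : ‖F‖ = √(energy κ (G F)) := by
      have h4 : ‖F‖ ^ 2 = energy κ (G F) := by
        rw [← inner_self_eq_norm_sq (𝕜 := ℂ) F, L2.inner_def, energy]
        have h5 := L2.integrable_inner (𝕜 := ℂ) F F
        change (∫ x, inner ℂ (F x) (F x)).re = _
        have h6 : (∫ x, inner ℂ (F x) (F x)).re = ∫ x, (inner ℂ (F x) (F x)).re :=
          (integral_re h5).symm
        rw [h6]
        refine integral_congr_ae ?_
        filter_upwards [hG F hF] with x hx
        rw [hx, RCLike.inner_apply, Complex.mul_conj, Complex.ofReal_re, Complex.normSq_eq_norm_sq,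
          norm_mul, Complex.norm_real, Real.norm_eq_abs, abs_of_nonneg (Real.sqrt_nonneg _), mul_pow,
          Real.sq_sqrt (hκ0 x).le]
      rw [← h4, Real.sqrt_sq (norm_nonneg _)]
    change (inner ℂ V F).re ≤ ‖F‖ * b
    rw [h2, h3]
    exact h1
  have hall : V ∈ {F : L2 | (inner ℂ V F).re ≤ ‖F‖ * b} := by
    have h1 : V ∈ closure ((weightedTest κ : Set L2)) := by
      rw [← Submodule.topologicalClosure_coe, topologicalClosure_weightedTest hκ hκ0]
      trivial
    exact closure_minimal (hcl.trans (closure_minimal ht hclosed)) hclosed h1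
  have h1 : ‖V‖ ^ 2 ≤ ‖V‖ * b := by
    rw [← inner_self_eq_norm_sq (𝕜 := ℂ) V]
    exact hall
  have h2 : ‖V‖ ≤ b := by
    rcases (norm_nonneg V).eq_or_lt with h0 | h0
    · rw [← h0]; exact hb
    · rw [sq] at h1
      exact le_of_mul_le_mul_left h1 h0
  refine le_trans (le_of_eq ?_) h2
  have h4 : ‖V‖ ^ 2 = ∫ x, ‖w x‖ ^ 2 * (κ x)⁻¹ := by
    rw [← inner_self_eq_norm_sq (𝕜 := ℂ) V, L2.inner_def]
    have h6 : (∫ x, inner ℂ (V x) (V x)).re = ∫ x, (inner ℂ (V x) (V x)).re :=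
      (integral_re (L2.integrable_inner (𝕜 := ℂ) V V)).symm
    change (∫ x, inner ℂ (V x) (V x)).re = _
    rw [h6]
    refine integral_congr_ae ?_
    filter_upwards [hwc.coeFn_toLp] with x hx
    rw [hV, hx, RCLike.inner_apply, Complex.mul_conj, Complex.ofReal_re, Complex.normSq_eq_norm_sq,
      RCLike.norm_conj, norm_mul, Complex.norm_real, Real.norm_eq_abs,
      abs_of_nonneg (Real.sqrt_nonneg _), mul_pow, Real.sq_sqrt (inv_pos.2 (hκ0 x)).le]
  rw [← h4, Real.sqrt_sq (norm_nonneg _)]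

/-- Grönwall's inequality for a bounded measurable function. -/
lemma ae_le_of_le_integral {T R D d h0 : ℝ} {h : ℝ → ℝ} (hm : Measurable h) (hD : 0 ≤ D)
    (hd : 0 ≤ d) (h00 : 0 ≤ h0) (hn : ∀ t, 0 ≤ h t) (hR : ∀ t, h t ≤ R)
    (hle : ∀ᵐ t ∂timeMeasure T, h t ≤ D * (h0 + d * ∫ s in 0..t, h s)) :
    ∀ᵐ t ∂timeMeasure T, h t ≤ 2 * (D * h0) * Real.exp ((2 * (D * d) + 1) * T) := by
  obtain ⟨K, hK⟩ : ∃ K, K = 2 * (D * d) + 1 := ⟨_, rfl⟩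
  have hDd : 0 ≤ D * d := by positivity
  have hK0 : 0 < K := by linarith
  have hmem : ∀ᵐ t ∂timeMeasure T, t ∈ Ioo 0 T := ae_restrict_mem measurableSet_Ioo
  have hint : ∀ t : ℝ, IntervalIntegrable h volume 0 t := fun t =>
    (intervalIntegrable_const (c := R)).mono_fun hm.aestronglyMeasurable
      (Eventually.of_forall fun s => by
        change ‖h s‖ ≤ ‖R‖
        rw [Real.norm_of_nonneg (hn s), Real.norm_eq_abs]
        exact (hR s).trans (le_abs_self R))
  have step : ∀ N, 0 ≤ N → (∀ᵐ t ∂timeMeasure T, h t ≤ N * Real.exp (K * t)) →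
      ∀ᵐ t ∂timeMeasure T, h t ≤ (D * h0 + N / 2) * Real.exp (K * t) := by
    intro N hN hNt
    filter_upwards [hle, hmem] with t ht htm
    have hexp : ∫ s in 0..t, N * Real.exp (K * s) ≤ N * (Real.exp (K * t) / K) := by
      rw [intervalIntegral.integral_const_mul, intervalIntegral.integral_comp_mul_left
        (fun s => Real.exp s) hK0.ne', integral_exp, smul_eq_mul, mul_zero, Real.exp_zero]
      gcongr
      rw [div_eq_inv_mul]
      gcongr
      linarith
    have hI : ∫ s in 0..t, h s ≤ ∫ s in 0..t, N * Real.exp (K * s) := by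
      refine intervalIntegral.integral_mono_ae_restrict htm.1.le (hint t)
        ((Continuous.intervalIntegrable (by fun_prop)) _ _) ?_
      have h1 : ∀ᵐ s ∂volume.restrict (Ioo 0 t), h s ≤ N * Real.exp (K * s) :=
        ae_restrict_of_ae_restrict_of_subset (Ioo_subset_Ioo_right htm.2.le) hNt
      rw [restrict_Ioo_eq_restrict_Icc] at h1
      exact h1
    have e1 : 1 ≤ Real.exp (K * t) := Real.one_le_exp (mul_nonneg hK0.le htm.1.le)
    have h2 : D * d / K ≤ 1 / 2 := by
      rw [div_le_div_iff₀ hK0 two_pos]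
      linarith
    calc h t ≤ D * (h0 + d * ∫ s in 0..t, h s) := ht
      _ ≤ D * (h0 + d * (N * (Real.exp (K * t) / K))) := by
          gcongr
          exact hI.trans hexp
      _ = D * h0 + D * d / K * (N * Real.exp (K * t)) := by ring
      _ ≤ D * h0 * Real.exp (K * t) + 1 / 2 * (N * Real.exp (K * t)) := by
          have h3 : D * h0 ≤ D * h0 * Real.exp (K * t) := le_mul_of_one_le_right (by positivity) e1
          gcongr
      _ = _ := by ring
  have hR0 : 0 ≤ R := (hn 0).trans (hR 0)
  have iter : ∀ k : ℕ, ∀ᵐ t ∂timeMeasure T,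
      h t ≤ (2 * (D * h0) + R / 2 ^ k) * Real.exp (K * t) := by
    intro k
    induction k with
    | zero =>
      filter_upwards [hmem] with t ht
      have e1 : 1 ≤ Real.exp (K * t) := Real.one_le_exp (mul_nonneg hK0.le ht.1.le)
      calc h t ≤ R := hR t
        _ ≤ R * Real.exp (K * t) := le_mul_of_one_le_right hR0 e1
        _ ≤ _ := by
          gcongr
          simp only [pow_zero, div_one, le_add_iff_nonneg_left]
          positivity
    | succ k ih =>
      filter_upwards [step _ (by positivity) ih] with t ht
      refine ht.trans (le_of_eq ?_)
      rw [pow_succ]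
      field_simp
      ring
  filter_upwards [ae_all_iff.2 iter, hmem] with t ht htm
  have hlim : Tendsto (fun k : ℕ => (2 * (D * h0) + R / 2 ^ k) * Real.exp (K * t)) atTop
      (𝓝 ((2 * (D * h0) + 0) * Real.exp (K * t))) := by
    refine (tendsto_const_nhds.add ?_).mul_const _
    exact tendsto_const_nhds.div_atTop (tendsto_pow_atTop_atTop_of_one_lt one_lt_two)
  refine (ge_of_tendsto' hlim ht).trans ?_
  rw [add_zero, ← hK]
  gcongr
  exact htm.2.le

/-- Interchange of the order of integration over the triangle `0 < t < s < T`. -/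
lemma integral_mul_integral_eq {T R : ℝ} {h θ : ℝ → ℝ} (hm : Measurable h)
    (hn : ∀ t, 0 ≤ h t) (hR : ∀ t, h t ≤ R) (hθ : Continuous θ) :
    ∫ t, h t * (∫ s in t..T, θ s) ∂timeMeasure T = ∫ s, θ s * (∫ t in 0..s, h t) ∂timeMeasure T := by
  have hmem : ∀ᵐ t ∂timeMeasure T, t ∈ Ioo 0 T := ae_restrict_mem measurableSet_Ioo
  set Δ : Set (ℝ × ℝ) := {p | p.1 < p.2} with hΔ
  have hΔm : MeasurableSet Δ := measurableSet_lt measurable_fst measurable_snd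
  have hθi : Integrable θ (timeMeasure T) := (hθ.integrableOn_Icc (a := 0) (b := T)).mono_set
    Ioo_subset_Icc_self
  have hhi : Integrable h (timeMeasure T) := Integrable.of_bound hm.aestronglyMeasurable R
    (Eventually.of_forall fun s => by rw [Real.norm_of_nonneg (hn s)]; exact hR s)
  have hI : Integrable (Function.uncurry fun t s => Δ.indicator (fun p => h p.1 * θ p.2) (t, s))
      ((timeMeasure T).prod (timeMeasure T)) := (hhi.mul_prod hθi).indicator hΔm
  have key := integral_integral_swap hI
  have e1 : ∫ t, h t * (∫ s in t..T, θ s) ∂timeMeasure T =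
      ∫ t, ∫ s, Δ.indicator (fun p => h p.1 * θ p.2) (t, s) ∂timeMeasure T ∂timeMeasure T := by
    refine integral_congr_ae ?_
    filter_upwards [hmem] with t ht
    rw [intervalIntegral.integral_of_le ht.2.le, ← integral_const_mul]
    have : ∀ s, Δ.indicator (fun p => h p.1 * θ p.2) (t, s)
        = (Ioi t).indicator (fun s => h t * θ s) s := fun s => by
      by_cases hs : t < s <;> simp [hΔ, hs]
    simp_rw [this]
    rw [integral_indicator measurableSet_Ioi, timeMeasure, Measure.restrict_restrict
      measurableSet_Ioi, inter_comm, Ioo_inter_Ioi, max_eq_right ht.1.le, ← integral_Ioc_eq_integral_Ioo]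
  have e2 : ∫ s, θ s * (∫ t in 0..s, h t) ∂timeMeasure T =
      ∫ s, ∫ t, Δ.indicator (fun p => h p.1 * θ p.2) (t, s) ∂timeMeasure T ∂timeMeasure T := by
    refine integral_congr_ae ?_
    filter_upwards [hmem] with s hs
    rw [intervalIntegral.integral_of_le hs.1.le, ← integral_const_mul]
    have : ∀ t, Δ.indicator (fun p => h p.1 * θ p.2) (t, s)
        = (Iio s).indicator (fun t => θ s * h t) t := fun t => by
      by_cases ht : t < s <;> simp [hΔ, ht, mul_comm]
    simp_rw [this]
    rw [integral_indicator measurableSet_Iio, timeMeasure, Measure.restrict_restrict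
      measurableSet_Iio, inter_comm, Ioo_inter_Iio, min_eq_right hs.2.le, ← integral_Ioc_eq_integral_Ioo]
  rw [e1, e2, key]

end

section

/-- The tested form of the estimate implies its pointwise form. -/
lemma ae_sqrt_integral_le_of_tested {T R D d h0 : ℝ} (hT : 0 ≤ T) {κ : ℝ → ℝ} (hκ : Continuous κ)
    (hκ0 : ∀ x, 0 < κ x) {w : ℝ → ℝ → ℂ} (hw : StronglyMeasurable (Function.uncurry w))
    (hwκ : ∀ t, MemLp (fun x => w t x * √(κ x)⁻¹) 2 volume)
    (hwR : ∀ t, √(∫ x, ‖w t x‖ ^ 2 * (κ x)⁻¹) ≤ R)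
    (hw2 : ∀ t, MemLp (w t) 2 volume) (hw2R : ∀ t, eLpNorm (w t) 2 volume ≤ ENNReal.ofReal R)
    (hD : 0 ≤ D) (hd : 0 ≤ d) (h00 : 0 ≤ h0)
    (h : ∀ G : 𝓢(ℝ, ℂ), HasCompactSupport G → ∀ θ : ℝ → ℝ, Continuous θ → (∀ t, 0 ≤ θ t) →
      (∫ t, θ t * (∫ x, w t x * G x) ∂timeMeasure T).re ≤ D * √(energy κ G) *
        (h0 * (∫ s in 0..T, θ s) +
          d * ∫ t, √(∫ x, ‖w t x‖ ^ 2 * (κ x)⁻¹) * (∫ s in t..T, θ s) ∂timeMeasure T)) :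
    ∀ᵐ t ∂timeMeasure T, √(∫ x, ‖w t x‖ ^ 2 * (κ x)⁻¹) ≤
      2 * (D * h0) * Real.exp ((2 * (D * d) + 1) * T) := by
  obtain ⟨𝒟, h𝒟, h𝒟c, hnorm⟩ := exists_countable_norming hκ hκ0
  obtain ⟨H, hH⟩ : ∃ H : ℝ → ℝ, ∀ t, H t = √(∫ x, ‖w t x‖ ^ 2 * (κ x)⁻¹) := ⟨_, fun _ => rfl⟩
  simp_rw [← hH] at h hwR ⊢
  have hHn : ∀ t, 0 ≤ H t := fun t => hH t ▸ Real.sqrt_nonneg _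
  have hHm : Measurable H := by
    have h1 : StronglyMeasurable (Function.uncurry fun t x => ‖w t x‖ ^ 2 * (κ x)⁻¹) :=
      (hw.norm.pow 2).mul (((hκ.measurable.comp measurable_snd).inv).stronglyMeasurable)
    have h2 := h1.integral_prod_right (ν := volume)
    have : H = fun t => √(∫ x, ‖w t x‖ ^ 2 * (κ x)⁻¹) := funext hH
    rw [this]
    exact h2.measurable.sqrt
  have hint : ∀ t : ℝ, IntervalIntegrable H volume 0 t := fun t =>
    (intervalIntegrable_const (c := R)).mono_fun hHm.aestronglyMeasurable
      (Eventually.of_forall fun s => by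
        change ‖H s‖ ≤ ‖R‖
        rw [Real.norm_of_nonneg (hHn s), Real.norm_eq_abs]
        exact (hwR s).trans (le_abs_self R))
  have hprim : Continuous fun t => ∫ s in 0..t, H s :=
    intervalIntegral.continuous_primitive (fun a b => (hint a).symm.trans (hint b)) 0
  have key : ∀ G ∈ 𝒟, ∀ᵐ t ∂timeMeasure T, (∫ x, w t x * G x).re ≤
      √(energy κ G) * (D * (h0 + d * ∫ s in 0..t, H s)) := by
    intro G hG
    have hgm : StronglyMeasurable fun t => ∫ x, w t x * G x :=
      StronglyMeasurable.integral_prod_right (f := fun t x => w t x * G x)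
        (hw.mul (G.continuous.comp continuous_snd).stronglyMeasurable)
    have hgb : ∀ t, ‖∫ x, w t x * G x‖ ≤ R * √(∫ x, ‖G x‖ ^ 2) := by
      intro t
      have h1 := integral_mul_le_sqrt_mul_sqrt (hw2 t).norm (G.memLp 2 volume).norm
      simp only [abs_norm] at h1
      have h2 : √(∫ x, ‖w t x‖ ^ 2) ≤ R := by
        have h3 := (hw2 t).eLpNorm_eq_integral_rpow_norm (by norm_num) (by norm_num)
        have h4 := hw2R t
        have hR : 0 ≤ R := (hHn t).trans (hwR t)
        rw [h3, ENNReal.ofReal_le_ofReal_iff hR] at h4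
        rw [Real.sqrt_eq_rpow]
        simpa using h4
      calc ‖∫ x, w t x * G x‖ ≤ ∫ x, ‖w t x‖ * ‖G x‖ := by
            refine (norm_integral_le_integral_norm _).trans (le_of_eq ?_)
            simp_rw [norm_mul]
        _ ≤ _ := h1.trans (by gcongr)
    have hgi : Integrable (fun t => ∫ x, w t x * G x) (timeMeasure T) :=
      Integrable.of_bound hgm.aestronglyMeasurable _ (Eventually.of_forall hgb)
    have hcont : Continuous fun t => √(energy κ G) * (D * (h0 + d * ∫ s in 0..t, H s)) := by
      fun_prop
    have hci : ∀ f : ℝ → ℝ, Continuous f → Integrable f (timeMeasure T) := fun f hf =>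
      (hf.integrableOn_Icc (a := 0) (b := T)).mono_set Ioo_subset_Icc_self
    have := ae_nonneg_of_forall_integral_mul_nonneg (T := T)
      (f := fun t => √(energy κ G) * (D * (h0 + d * ∫ s in 0..t, H s)) - (∫ x, w t x * G x).re)
      (hcont.measurable.sub (Complex.measurable_re.comp hgm.measurable))
      ((hci _ hcont).sub hgi.re) fun θ hθ hθ0 => by
        have h1 := h G (h𝒟c G hG) θ hθ hθ0
        obtain ⟨b, hb⟩ := (isCompact_Icc (a := 0) (b := T)).exists_bound_of_continuousOn
          hθ.continuousOn
        have i1 : Integrable (fun t => (θ t : ℂ) * ∫ x, w t x * G x) (timeMeasure T) :=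
          hgi.bdd_mul (c := b) (Complex.continuous_ofReal.comp hθ).aestronglyMeasurable (by
            filter_upwards [(ae_restrict_mem measurableSet_Ioo : ∀ᵐ t ∂timeMeasure T, t ∈ Ioo 0 T)]
              with t ht
            rw [Complex.norm_real]
            exact hb t (Ioo_subset_Icc_self ht))
        have h2 : (∫ t, (θ t : ℂ) * (∫ x, w t x * G x) ∂timeMeasure T).re =
            ∫ t, θ t * (∫ x, w t x * G x).re ∂timeMeasure T := by
          have h3 : (∫ t, (θ t : ℂ) * (∫ x, w t x * G x) ∂timeMeasure T).re =
            ∫ t, ((θ t : ℂ) * ∫ x, w t x * G x).re ∂timeMeasure T := (integral_re i1).symm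
          rw [h3]
          simp_rw [Complex.re_ofReal_mul]
        have i2 : Integrable (fun t => θ t * (∫ x, w t x * G x).re) (timeMeasure T) := by
          refine i1.re.congr (Eventually.of_forall fun t => ?_)
          exact Complex.re_ofReal_mul _ _
        -- Exchange of the order of integration moves the primitive from `θ` to `H`.
        rw [h2, integral_mul_integral_eq hHm hHn hwR hθ] at h1
        simp_rw [mul_sub]
        have i3 := hci _ (hθ.mul hcont)
        have i3' : Integrable (fun t => θ t * (√(energy κ G) * (D * (h0 + d * ∫ s in 0..t, H s))))
          (timeMeasure T) := i3
        rw [integral_sub i3' i2]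
        have h4 : ∫ t, θ t * (√(energy κ G) * (D * (h0 + d * ∫ s in 0..t, H s))) ∂timeMeasure T
            = D * √(energy κ G) * (h0 * (∫ s in 0..T, θ s) +
              d * ∫ t, θ t * (∫ s in 0..t, H s) ∂timeMeasure T) := by
          have h5 : ∫ s in 0..T, θ s = ∫ s, θ s ∂timeMeasure T := by
            rw [intervalIntegral.integral_of_le hT, integral_Ioc_eq_integral_Ioo]
            rfl
          have i4 := hci _ hθ
          have i5 := hci _ (hθ.mul hprim)
          have i5' : Integrable (fun t => θ t * ∫ s in 0..t, H s) (timeMeasure T) := i5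
          rw [h5, ← integral_const_mul, ← integral_const_mul, ← integral_add
            (i4.const_mul h0) (i5'.const_mul d), ← integral_const_mul]
          congr 1
          ext t
          ring
        linarith
    filter_upwards [this] with t ht
    linarith
  have hae := (ae_ball_iff h𝒟).2 key
  refine ae_le_of_le_integral (R := R) hHm hD hd h00 hHn hwR ?_
  filter_upwards [hae, (ae_restrict_mem measurableSet_Ioo : ∀ᵐ t ∂timeMeasure T, t ∈ Ioo 0 T)]
    with t ht htm
  rw [hH t]
  have hpos : 0 ≤ ∫ s in 0..t, H s := intervalIntegral.integral_nonneg htm.1.le fun s _ => hHn s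
  exact hnorm (w t) (hwκ t) _ (by positivity) ht

end

section

/-! ### Approximation of the coefficient -/

lemma lintegral_enorm_sq_eq {α : Type*} [MeasurableSpace α] {μ : Measure α} (f : α → ℂ) :
    ∫⁻ x, ‖f x‖ₑ ^ 2 ∂μ = eLpNorm f 2 μ ^ 2 := by
  rw [eLpNorm_eq_lintegral_rpow_enorm_toReal (by norm_num) (by norm_num), ENNReal.toReal_ofNat,
    ← ENNReal.rpow_natCast, ← ENNReal.rpow_mul]
  norm_num

lemma lintegral_enorm_coeFn_sq (f : L2) : ∫⁻ x, ‖f x‖ₑ ^ 2 = ENNReal.ofReal (‖f‖ ^ 2) := by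
  rw [lintegral_enorm_sq_eq, Lp.norm_def, ENNReal.ofReal_pow ENNReal.toReal_nonneg,
    ENNReal.ofReal_toReal (Lp.memLp f).2.ne]

/-- Projection to a ball is a quasi-optimal approximation of the points of the ball. -/
lemma norm_sub_smul_le {E : Type*} [NormedAddCommGroup E] [NormedSpace ℝ E] {M : ℝ} (hM : 0 < M)
    {f : E} (hf : ‖f‖ ≤ M) (p : E) :
    ‖f - (M / max M ‖p‖) • p‖ ≤ 2 * ‖f - p‖ ∧ ‖(M / max M ‖p‖) • p‖ ≤ M := by
  have hm : 0 < max M ‖p‖ := lt_max_of_lt_left hM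
  have hs0 : 0 ≤ M / max M ‖p‖ := by positivity
  have hs1 : M / max M ‖p‖ ≤ 1 := by
    rw [div_le_one hm]
    exact le_max_left _ _
  constructor
  · have h1 : ‖p - (M / max M ‖p‖) • p‖ ≤ ‖f - p‖ := by
      have : p - (M / max M ‖p‖) • p = (1 - M / max M ‖p‖) • p := by rw [sub_smul, one_smul]
      rw [this, norm_smul, Real.norm_of_nonneg (by linarith)]
      rcases le_total ‖p‖ M with h | h
      · rw [max_eq_left h, div_self hM.ne', sub_self, zero_mul]
        exact norm_nonneg _
      · have hp : 0 < ‖p‖ := hM.trans_le h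
        rw [max_eq_right h, sub_mul, one_mul, div_mul_cancel₀ _ hp.ne']
        have := norm_sub_norm_le p f
        rw [norm_sub_rev] at this
        linarith
    calc ‖f - (M / max M ‖p‖) • p‖ = ‖(f - p) + (p - (M / max M ‖p‖) • p)‖ := by
          rw [sub_add_sub_cancel]
      _ ≤ ‖f - p‖ + ‖p - (M / max M ‖p‖) • p‖ := norm_add_le _ _
      _ ≤ _ := by linarith
  · rw [norm_smul, Real.norm_of_nonneg hs0, div_mul_eq_mul_div, div_le_iff₀ hm]
    gcongr
    exact le_max_right _ _

/-- A jointly continuous function with compact support is a continuous curve in the space of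
bounded continuous functions. -/
lemma exists_curve_of_hasCompactSupport {P : ℝ × ℝ → ℂ} (hP : Continuous P)
    (hPc : HasCompactSupport P) :
    ∃ q : ℝ → ℝ →ᵇ ℂ, Continuous q ∧ ∀ t x, q t x = P (t, x) := by
  obtain ⟨B, hB⟩ := hPc.exists_bound_of_continuous hP
  refine ⟨fun t => BoundedContinuousFunction.ofNormedAddCommGroup (fun x => P (t, x))
    (hP.comp (Continuous.prodMk_right t)) B fun x => hB _, ?_, fun t x => rfl⟩
  have huc := hPc.uniformContinuous_of_continuous hP
  rw [Metric.continuous_iff]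
  intro t ε hε
  obtain ⟨δ, hδ, h⟩ := Metric.uniformContinuous_iff.1 huc (ε / 2) (half_pos hε)
  refine ⟨δ, hδ, fun s hs => ?_⟩
  refine ((BoundedContinuousFunction.dist_le (half_pos hε).le).2 fun x => ?_).trans_lt
    (half_lt_self hε)
  exact (h (by simpa [Prod.dist_eq] using hs)).le

lemma exists_support_bound {P : ℝ × ℝ → ℂ} (hPc : HasCompactSupport P) :
    ∃ R : ℝ, ∀ t x, R < |x| → P (t, x) = 0 := by
  obtain ⟨R, hR⟩ := hPc.isCompact.isBounded.exists_norm_le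
  refine ⟨R, fun t x hx => ?_⟩
  by_contra h
  have h1 := hR (t, x) (subset_tsupport _ h)
  have h2 : |x| ≤ ‖((t, x) : ℝ × ℝ)‖ := norm_snd_le (t, x)
  linarith

/-- A coefficient that is bounded in `L₂^(3/4)` is approximated by continuous, compactly supported
coefficients with the same bound. -/
lemma exists_coeff_approx {T M : ℝ} (hM : 0 < M) {Q : ℝ → ℝ → ℂ}
    (hQ : StronglyMeasurable (Function.uncurry Q))
    (hQL : ∀ t, MemLp (fun x => Q t x * coeffWeight ell x) 2 volume)
    (hQM : ∀ t, eLpNorm (fun x => Q t x * coeffWeight ell x) 2 volume ≤ ENNReal.ofReal M)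
    {η : ℝ} (hη : 0 < η) :
    ∃ q : ℝ → ℝ →ᵇ ℂ, Continuous q ∧ (∃ R : ℝ, ∀ t x, R < |x| → q t x = 0) ∧
      (∃ B : ℝ, ∀ t x, ‖q t x‖ ≤ B) ∧
      (∀ t, ∫ x, (‖q t x‖ * coeffWeight ell x) ^ 2 ≤ M ^ 2) ∧
      ∫⁻ t, ∫⁻ x, (‖Q t x - q t x‖ₑ * ENNReal.ofReal (coeffWeight ell x)) ^ 2 ∂volume
        ∂timeMeasure T ≤ ENNReal.ofReal (η ^ 2) := by
  have hcw := continuous_coeffWeight_ell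
  have hcw0 := coeffWeight_ell_pos
  obtain ⟨Qh, hQh⟩ : ∃ Qh : ℝ × ℝ → ℂ, ∀ z, Qh z = Q z.1 z.2 * coeffWeight ell z.2 :=
    ⟨_, fun _ => rfl⟩
  have hQhm : StronglyMeasurable Qh := by
    have : Qh = fun z => Function.uncurry Q z * (coeffWeight ell z.2 : ℂ) := funext hQh
    rw [this]
    exact hQ.mul (Complex.continuous_ofReal.comp (hcw.comp continuous_snd)).stronglyMeasurable
  have hslice : ∀ t, MemLp (fun x => Qh (t, x)) 2 volume := fun t => by
    simp_rw [hQh]; exact hQL t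
  have hQhL : MemLp Qh 2 (stripMeasure T) := by
    refine ⟨hQhm.aestronglyMeasurable, ?_⟩
    have h1 : ∫⁻ z, ‖Qh z‖ₑ ^ 2 ∂stripMeasure T ≤
        ENNReal.ofReal M ^ 2 * timeMeasure T univ := by
      rw [stripMeasure, lintegral_prod _ (by fun_prop), ← lintegral_const]
      refine lintegral_mono fun t => ?_
      rw [lintegral_enorm_sq_eq (fun x => Qh (t, x))]
      simp_rw [hQh]
      gcongr
      exact hQM t
    rw [lintegral_enorm_sq_eq] at h1
    have h2 : eLpNorm Qh 2 (stripMeasure T) ^ 2 < ⊤ := h1.trans_lt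
      (ENNReal.mul_lt_top (by simp) (measure_lt_top _ _))
    by_contra h
    rw [not_lt, top_le_iff] at h
    rw [h] at h2
    simp at h2
  have : IsLocallyFiniteMeasure (stripMeasure T) := by
    unfold stripMeasure timeMeasure
    infer_instance
  -- The approximation in `L₂` of the strip does not respect the bound at fixed times; it is restored by
  -- the projection of each slice to the ball of radius `M`.
  obtain ⟨P, hPc, hPη, hP, -⟩ := hQhL.exists_hasCompactSupport_eLpNorm_sub_le (by norm_num)
    (ε := ENNReal.ofReal (η / 2)) (by simpa using hη)
  have hPs : ∀ t, Continuous fun x => P (t, x) := fun t => hP.comp (Continuous.prodMk_right t)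
  obtain ⟨R, hR⟩ := exists_support_bound hPc
  have hPsc : ∀ t, HasCompactSupport fun x => P (t, x) := fun t =>
    HasCompactSupport.of_support_subset_isCompact (isCompact_Icc (a := -R) (b := R)) fun x hx => by
      by_contra h
      exact hx (hR t x (by
        by_contra! h'
        exact h (abs_le.1 h')))
  have hPL : ∀ t, MemLp (fun x => P (t, x)) 2 volume := fun t =>
    (hPs t).memLp_of_hasCompactSupport (hPsc t)
  obtain ⟨p, hp⟩ : ∃ p : ℝ → ℝ, ∀ t, p t = ‖(hPL t).toLp (fun x => P (t, x))‖ := ⟨_, fun _ => rfl⟩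
  have hpc : Continuous p := by
    have h1 : p = fun t => √(∫ x in Icc (-R) R, ‖P (t, x)‖ ^ 2) := by
      ext t
      have h2 : p t ^ 2 = ∫ x in Icc (-R) R, ‖P (t, x)‖ ^ 2 := by
        have h3 : ENNReal.ofReal (p t ^ 2) = ∫⁻ x, ‖P (t, x)‖ₑ ^ 2 := by
          rw [hp, ← lintegral_enorm_coeFn_sq]
          refine lintegral_congr_ae ?_
          filter_upwards [(hPL t).coeFn_toLp] with x hx
          rw [hx]
        have h4 : ∫ x in Icc (-R) R, ‖P (t, x)‖ ^ 2 = ∫ x, ‖P (t, x)‖ ^ 2 := by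
          refine setIntegral_eq_integral_of_forall_compl_eq_zero fun x hx => ?_
          rw [hR t x (by
            by_contra! h'
            exact hx (abs_le.1 h'))]
          simp
        rw [h4, ← ENNReal.ofReal_eq_ofReal_iff (sq_nonneg _) (integral_nonneg fun x => by positivity),
          h3, ofReal_integral_eq_lintegral_ofReal (hPL t).norm.integrable_sq
            (Eventually.of_forall fun x => by positivity)]
        refine lintegral_congr fun x => ?_
        rw [ENNReal.ofReal_pow (norm_nonneg _), ofReal_norm]
      rw [← h2, Real.sqrt_sq (by rw [hp]; exact norm_nonneg _)]
    rw [h1]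
    exact Real.continuous_sqrt.comp (continuous_parametric_integral_of_continuous
      (f := fun t x => ‖P (t, x)‖ ^ 2) (by
        have h5 : Continuous fun z => ‖P z‖ ^ 2 := by fun_prop
        exact h5)
      isCompact_Icc)
  obtain ⟨s, hs⟩ : ∃ s : ℝ → ℝ, ∀ t, s t = M / max M (p t) := ⟨_, fun _ => rfl⟩
  have hsc : Continuous s := by
    have : s = fun t => M / max M (p t) := funext hs
    rw [this]
    exact continuous_const.div (continuous_const.max hpc) fun t => (lt_max_of_lt_left hM).ne'
  have hP'c : Continuous fun z : ℝ × ℝ => ((s z.1 * (coeffWeight ell z.2)⁻¹ : ℝ) : ℂ) * P z := by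
    refine Continuous.mul (Complex.continuous_ofReal.comp ((hsc.comp continuous_fst).mul
      ((hcw.comp continuous_snd).inv₀ fun z => (hcw0 _).ne'))) hP
  have hP's : HasCompactSupport fun z : ℝ × ℝ =>
      ((s z.1 * (coeffWeight ell z.2)⁻¹ : ℝ) : ℂ) * P z := hPc.mul_left
  obtain ⟨q, hq, hqP⟩ := exists_curve_of_hasCompactSupport hP'c hP's
  have hqcw : ∀ t x, q t x * coeffWeight ell x = s t * P (t, x) := fun t x => by
    rw [hqP]
    have : (coeffWeight ell x : ℂ) ≠ 0 := by exact_mod_cast (hcw0 x).ne'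
    push_cast
    field_simp
  have hpt : ∀ t, ‖(hslice t).toLp _ - s t • (hPL t).toLp (fun x => P (t, x))‖ ≤
      2 * ‖(hslice t).toLp _ - (hPL t).toLp (fun x => P (t, x))‖ ∧
      ‖s t • (hPL t).toLp (fun x => P (t, x))‖ ≤ M := fun t => by
    rw [hs, hp]
    refine norm_sub_smul_le hM ?_ _
    rw [Lp.norm_toLp]
    refine ENNReal.toReal_le_of_le_ofReal hM.le ?_
    simp_rw [hQh]
    exact hQM t
  refine ⟨q, hq, ⟨R, fun t x hx => ?_⟩, ?_, fun t => ?_, ?_⟩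
  · rw [hqP, hR t x hx, mul_zero]
  · obtain ⟨B, hB⟩ := hP's.exists_bound_of_continuous hP'c
    exact ⟨B, fun t x => by rw [hqP]; exact hB (t, x)⟩
  · have h1 : ∀ x, (‖q t x‖ * coeffWeight ell x) ^ 2 = ‖(s t : ℂ) * P (t, x)‖ ^ 2 := fun x => by
      rw [← hqcw, norm_mul, Complex.norm_real, Real.norm_of_nonneg (hcw0 x).le]
    simp_rw [h1]
    have hL : MemLp (fun x => (s t : ℂ) * P (t, x)) 2 volume := (hPL t).const_mul _
    have h2 : ENNReal.ofReal (∫ x, ‖(s t : ℂ) * P (t, x)‖ ^ 2) =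
        ENNReal.ofReal (‖s t • (hPL t).toLp (fun x => P (t, x))‖ ^ 2) := by
      rw [ofReal_integral_eq_lintegral_ofReal hL.norm.integrable_sq
        (Eventually.of_forall fun x => by positivity), ← lintegral_enorm_coeFn_sq]
      refine lintegral_congr_ae ?_
      filter_upwards [(hPL t).coeFn_toLp, Lp.coeFn_smul (s t) ((hPL t).toLp (fun x => P (t, x)))]
        with x h1 h2
      rw [h2, Pi.smul_apply, h1, Complex.real_smul, ENNReal.ofReal_pow (norm_nonneg _), ofReal_norm]
    rw [ENNReal.ofReal_eq_ofReal_iff (integral_nonneg fun x => by positivity) (sq_nonneg _)] at h2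
    rw [h2]
    exact pow_le_pow_left₀ (norm_nonneg _) (hpt t).2 2
  · calc ∫⁻ t, ∫⁻ x, (‖Q t x - q t x‖ₑ * ENNReal.ofReal (coeffWeight ell x)) ^ 2 ∂volume
          ∂timeMeasure T
        ≤ ∫⁻ t, 4 * ∫⁻ x, ‖(Qh - P) (t, x)‖ₑ ^ 2 ∂volume ∂timeMeasure T := by
          refine lintegral_mono fun t => ?_
          have e1 : ∫⁻ x, (‖Q t x - q t x‖ₑ * ENNReal.ofReal (coeffWeight ell x)) ^ 2 =
              ∫⁻ x, ‖((hslice t).toLp _ - s t • (hPL t).toLp (fun x => P (t, x)) : L2) x‖ₑ ^ 2 := by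
            refine lintegral_congr_ae ?_
            filter_upwards [(hPL t).coeFn_toLp,
              Lp.coeFn_smul (s t) ((hPL t).toLp (fun x => P (t, x))), (hslice t).coeFn_toLp,
              Lp.coeFn_sub ((hslice t).toLp _) (s t • (hPL t).toLp (fun x => P (t, x)))]
              with x h1 h2 h3 h4
            rw [h4, Pi.sub_apply, h3, h2, Pi.smul_apply, h1, Complex.real_smul, ← hqcw, hQh,
              ← sub_mul, enorm_mul, ← ofReal_norm (coeffWeight ell x : ℂ), Complex.norm_real,
              Real.norm_of_nonneg (hcw0 x).le]
          have e2 : ∫⁻ x, ‖(Qh - P) (t, x)‖ₑ ^ 2 =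
              ∫⁻ x, ‖((hslice t).toLp _ - (hPL t).toLp (fun x => P (t, x)) : L2) x‖ₑ ^ 2 := by
            refine lintegral_congr_ae ?_
            filter_upwards [(hPL t).coeFn_toLp, (hslice t).coeFn_toLp,
              Lp.coeFn_sub ((hslice t).toLp _) ((hPL t).toLp (fun x => P (t, x)))]
              with x h1 h3 h4
            rw [h4, Pi.sub_apply, Pi.sub_apply, h3, h1]
          rw [e1, e2, lintegral_enorm_coeFn_sq, lintegral_enorm_coeFn_sq,
            show (4 : ℝ≥0∞) = ENNReal.ofReal 4 by simp, ← ENNReal.ofReal_mul (by norm_num)]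
          refine ENNReal.ofReal_le_ofReal ?_
          calc _ ≤ (2 * ‖(hslice t).toLp _ - (hPL t).toLp (fun x => P (t, x))‖) ^ 2 :=
                pow_le_pow_left₀ (norm_nonneg _) (hpt t).1 2
            _ = _ := by ring
      _ = 4 * ∫⁻ z, ‖(Qh - P) z‖ₑ ^ 2 ∂stripMeasure T := by
          have hm : Measurable (Qh - P) := hQhm.measurable.sub hP.measurable
          rw [lintegral_const_mul' _ _ (by norm_num), stripMeasure, lintegral_prod _ (by fun_prop)]
      _ ≤ 4 * ENNReal.ofReal (η / 2) ^ 2 := by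
          rw [lintegral_enorm_sq_eq]
          gcongr
      _ = _ := by
          rw [← ENNReal.ofReal_pow (by positivity), show (4 : ℝ≥0∞) = ENNReal.ofReal 4 by simp,
            ← ENNReal.ofReal_mul (by norm_num)]
          congr 1
          ring

end

section

/-! ### Removal of the mollifier -/

lemma exists_mollifier {μ : ℝ} (hμ : 0 < μ) (hμ1 : μ ≤ 1) :
    ∃ j : 𝓢(ℝ, ℂ), HasCompactSupport j ∧ IsMollifier j ∧ (∀ x, μ < |x| → j x = 0) ∧
      ∫ x, j x = 1 := by
  obtain ⟨g, hg⟩ : ∃ g : ContDiffBump (0 : ℝ), g.rOut = μ :=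
    ⟨⟨μ / 2, μ, half_pos hμ, half_lt_self hμ⟩, rfl⟩
  have hc : HasCompactSupport fun x => ((g.normed volume x : ℝ) : ℂ) :=
    g.hasCompactSupport_normed.comp_left Complex.ofReal_zero
  have hsupp : ∀ x, μ < |x| → g.normed volume x = 0 := fun x hx => by
    have h1 : x ∉ Function.support (g.normed volume) := by
      rw [g.support_normed_eq, hg, mem_ball_zero_iff, Real.norm_eq_abs]
      exact not_lt.2 hx.le
    simpa using h1
  refine ⟨hc.toSchwartzMap (Complex.ofRealCLM.contDiff.comp g.contDiff_normed), hc,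
    ⟨(SchwartzMap.continuous _), fun x hx => ?_, ?_⟩, fun x hx => ?_, ?_⟩
  · change ((g.normed volume x : ℝ) : ℂ) = 0
    rw [hsupp x (hμ1.trans_lt hx), Complex.ofReal_zero]
  · change ∫⁻ x, ‖((g.normed volume x : ℝ) : ℂ)‖ₑ ≤ 1
    have h1 : ∀ x, ‖((g.normed volume x : ℝ) : ℂ)‖ₑ = ENNReal.ofReal (g.normed volume x) := fun x => by
      rw [← ofReal_norm, Complex.norm_real, Real.norm_of_nonneg (g.nonneg_normed x)]
    simp_rw [h1]
    rw [← ofReal_integral_eq_lintegral_ofReal g.integrable_normed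
      (Eventually.of_forall g.nonneg_normed), g.integral_normed, ENNReal.ofReal_one]
  · change ((g.normed volume x : ℝ) : ℂ) = 0
    rw [hsupp x hx, Complex.ofReal_zero]
  · change ∫ x, ((g.normed volume x : ℝ) : ℂ) = 1
    rw [integral_complex_ofReal, g.integral_normed, Complex.ofReal_one]

instance isLocallyFiniteMeasure_stripMeasure (T : ℝ) : IsLocallyFiniteMeasure (stripMeasure T) := by
  unfold stripMeasure timeMeasure
  infer_instance

instance sFinite_stripMeasure (T : ℝ) : SFinite (stripMeasure T) := by
  unfold stripMeasure
  infer_instance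

/-- Translations in space act continuously on `L₂` of the strip. -/
lemma exists_translation_le {T : ℝ} {W : ℝ × ℝ → ℂ} (hW : MemLp W 2 (stripMeasure T)) {η : ℝ}
    (hη : 0 < η) : ∃ μ > 0, ∀ z, |z| ≤ μ →
      ∫⁻ p, ‖W p - W (p.1, p.2 + z)‖ₑ ^ 2 ∂stripMeasure T ≤ ENNReal.ofReal (η ^ 2) := by
  have hcont : Continuous fun p : ℝ × (ℝ × ℝ) => ((p.2.1, p.2.2 + p.1) : ℝ × ℝ) := by fun_prop
  obtain ⟨τ, hτc, hτ⟩ : ∃ τ : ℝ → C(ℝ × ℝ, ℝ × ℝ), Continuous τ ∧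
      ∀ z p, τ z p = (p.1, p.2 + z) :=
    ⟨_, (ContinuousMap.curry ⟨_, hcont⟩).continuous, fun _ _ => rfl⟩
  have hmp : ∀ z, MeasurePreserving (τ z) (stripMeasure T) (stripMeasure T) := fun z => by
    have h1 := (MeasurePreserving.id (timeMeasure T)).prod
      (measurePreserving_add_right (volume : Measure ℝ) z)
    have h2 : ⇑(τ z) = Prod.map id (fun x => x + z) := by
      ext p <;> rw [hτ] <;> rfl
    rw [h2]
    exact h1
  have hcurve := (continuous_const (y := hW.toLp W)).compMeasurePreservingLp hτc hmp (by norm_num)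
  obtain ⟨δ, hδ, h⟩ := Metric.continuousAt_iff.1 (hcurve.continuousAt (x := 0)) η hη
  refine ⟨δ / 2, half_pos hδ, fun z hz => ?_⟩
  have h1 := h (x := z) (by rw [dist_zero_right, Real.norm_eq_abs]; linarith)
  rw [dist_comm, Lp.toLp_compMeasurePreserving, Lp.toLp_compMeasurePreserving, dist_eq_norm,
    ← MemLp.toLp_sub, Lp.norm_toLp] at h1
  have h2 : ∀ p, W p - W (p.1, p.2 + z) = (W ∘ τ 0 - W ∘ τ z) p := fun p => by
    simp only [Pi.sub_apply, Function.comp, hτ, add_zero]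
  simp_rw [h2]
  rw [lintegral_enorm_sq_eq, ENNReal.ofReal_pow hη.le]
  gcongr
  have hfin : eLpNorm (W ∘ τ 0 - W ∘ τ z) 2 (stripMeasure T) ≠ ⊤ :=
    ((hW.comp_measurePreserving (hmp 0)).sub (hW.comp_measurePreserving (hmp z))).2.ne
  exact (ENNReal.le_ofReal_iff_toReal_le hfin hη.le).2 h1.le

/-- The pairing with a mollified function, in terms of translations. -/
lemma enorm_integral_sub_conv_le {j w f : ℝ → ℂ} (hj : Continuous j) (hjm : IsMollifier j)
    (hj2 : MemLp j 2 volume) (hj1 : ∫ x, j x = 1) (hw : MemLp w 2 volume) (hwm : Measurable w)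
    (hf : MemLp f 2 volume) (hfm : Measurable f) :
    ‖(∫ x, w x * f x) - ∫ x, w x * conv j f x‖ₑ ≤
      ∫⁻ y, ∫⁻ z, ‖j z‖ₑ * (‖w y - w (y + z)‖ₑ * ‖f y‖ₑ) := by
  have hji : Integrable j := by
    by_contra h
    rw [integral_undef h] at hj1
    exact zero_ne_one hj1
  have hjm' := hj.measurable
  have hI : Integrable (Function.uncurry fun x y => w x * (j (x - y) * f y))
      ((volume : Measure ℝ).prod (volume : Measure ℝ)) := by
    refine ⟨by fun_prop, ?_⟩
    have h1 := lintegral_lintegral_kernel_le (J := fun z => ‖j z‖ₑ) (p := fun y => ‖f y‖ₑ)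
      (r := fun x => ‖w x‖ₑ) (by fun_prop) (by fun_prop) (by fun_prop)
    rw [HasFiniteIntegral, lintegral_prod _ (by fun_prop)]
    have h2 : ∀ x y, ‖Function.uncurry (fun x y => w x * (j (x - y) * f y)) (x, y)‖ₑ
        = ‖j (x - y)‖ₑ * (‖f y‖ₑ * ‖w x‖ₑ) := fun x y => by
      simp only [Function.uncurry_apply_pair, enorm_mul]
      ring
    simp_rw [h2]
    refine h1.trans_lt (ENNReal.mul_lt_top (hjm.mass.trans_lt (by simp)) (ENNReal.mul_lt_top ?_ ?_))
    · rw [lintegral_enorm_sq_eq]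
      exact ENNReal.rpow_lt_top_of_nonneg (by norm_num) (ENNReal.pow_lt_top hf.2).ne
    · rw [lintegral_enorm_sq_eq]
      exact ENNReal.rpow_lt_top_of_nonneg (by norm_num) (ENNReal.pow_lt_top hw.2).ne
  have e1 : ∫ x, w x * conv j f x = ∫ y, ∫ z, j z * (w (y + z) * f y) := by
    unfold conv
    simp_rw [← integral_const_mul]
    rw [integral_integral_swap hI]
    refine integral_congr_ae (Eventually.of_forall fun y => ?_)
    simp only
    rw [← integral_add_right_eq_self (fun x => w x * (j (x - y) * f y)) y]
    refine integral_congr_ae (Eventually.of_forall fun z => ?_)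
    simp only
    rw [add_sub_cancel_right, add_comm z y]
    ring
  have hjw : ∀ y, Integrable fun z => j z * w (y + z) := fun y =>
    hj2.integrable_mul (hw.comp_measurePreserving (measurePreserving_add_left volume y))
  have hI2 : Integrable fun y => ∫ z, j z * (w (y + z) * f y) := by
    have h1 := hI.swap.integral_prod_left
    refine h1.congr (Eventually.of_forall fun y => ?_)
    simp only [Function.comp, Prod.swap_prod_mk, Function.uncurry_apply_pair]
    rw [← integral_add_right_eq_self (fun x => w x * (j (x - y) * f y)) y]
    refine integral_congr_ae (Eventually.of_forall fun z => ?_)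
    simp only
    rw [add_sub_cancel_right, add_comm z y]
    ring
  have hwf : Integrable fun x => w x * f x := hw.integrable_mul hf
  rw [e1, ← integral_sub hwf hI2]
  refine (enorm_integral_le_lintegral_enorm _).trans (lintegral_mono fun y => ?_)
  have e2 : w y * f y - ∫ z, j z * (w (y + z) * f y) =
      ∫ z, j z * ((w y - w (y + z)) * f y) := by
    have h1 : w y * f y = ∫ z, j z * (w y * f y) := by
      rw [integral_mul_const, hj1, one_mul]
    have i2 : Integrable fun z => j z * (w (y + z) * f y) := by
      simp_rw [← mul_assoc]
      exact (hjw y).mul_const _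
    rw [h1, ← integral_sub (hji.mul_const _) i2]
    refine integral_congr_ae (Eventually.of_forall fun z => ?_)
    simp only
    ring
  simp only
  rw [e2]
  refine (enorm_integral_le_lintegral_enorm _).trans (le_of_eq ?_)
  simp_rw [enorm_mul]

lemma lintegral_mul_enorm_le {α : Type*} [MeasurableSpace α] {μ : Measure α} {f g : α → ℝ≥0∞}
    (hf : Measurable f) (hg : Measurable g) :
    ∫⁻ a, f a * g a ∂μ ≤ (∫⁻ a, f a ^ 2 ∂μ) ^ (1 / 2 : ℝ) * (∫⁻ a, g a ^ 2 ∂μ) ^ (1 / 2 : ℝ) := by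
  have h := ENNReal.lintegral_mul_le_Lp_mul_Lq μ (p := 2) (q := 2)
    ⟨by norm_num, by norm_num, by norm_num⟩ hf.aemeasurable hg.aemeasurable
  simpa using h

/-- The error of mollification is small in the sense of distributions, uniformly on bounded subsets
of `L₂` of the strip. -/
lemma exists_mollify_le {T : ℝ} {w : ℝ → ℝ → ℂ} (hw : StronglyMeasurable (Function.uncurry w))
    (hw2 : ∀ t, MemLp (w t) 2 volume) (hW : MemLp (Function.uncurry w) 2 (stripMeasure T)) {η : ℝ}
    (hη : 0 < η) : ∃ μ, 0 < μ ∧ ∀ (j : 𝓢(ℝ, ℂ)), IsMollifier j → (∀ x, μ < |x| → j x = 0) →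
      ∫ x, j x = 1 → ∀ f : ℝ → ℝ → ℂ, Measurable (Function.uncurry f) →
      (∀ t, MemLp (f t) 2 volume) →
      ∫⁻ t, ‖(∫ x, w t x * f t x) - ∫ x, w t x * conv j (f t) x‖ₑ ∂timeMeasure T ≤
        ENNReal.ofReal η * (∫⁻ t, ∫⁻ x, ‖f t x‖ₑ ^ 2 ∂volume ∂timeMeasure T) ^ (1 / 2 : ℝ) := by
  obtain ⟨μ, hμ, htr⟩ := exists_translation_le hW hη
  refine ⟨μ, hμ, fun j hj hjs hj1 f hf hf2 => ?_⟩
  have hwm := hw.measurable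
  have hjm := j.continuous.measurable
  calc ∫⁻ t, ‖(∫ x, w t x * f t x) - ∫ x, w t x * conv j (f t) x‖ₑ ∂timeMeasure T
      ≤ ∫⁻ t, ∫⁻ y, ∫⁻ z, ‖j z‖ₑ * (‖w t y - w t (y + z)‖ₑ * ‖f t y‖ₑ) ∂volume ∂volume
          ∂timeMeasure T :=
        lintegral_mono fun t => enorm_integral_sub_conv_le j.continuous hj (j.memLp 2 volume) hj1
          (hw2 t) (hwm.comp measurable_prodMk_left) (hf2 t) (hf.comp measurable_prodMk_left)
    _ = ∫⁻ p, ∫⁻ z, ‖j z‖ₑ * (‖w p.1 p.2 - w p.1 (p.2 + z)‖ₑ * ‖f p.1 p.2‖ₑ)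
        ∂volume ∂stripMeasure T := by
        rw [stripMeasure, lintegral_prod]
        exact (Measurable.lintegral_prod_right' (f := fun r : (ℝ × ℝ) × ℝ =>
          ‖j r.2‖ₑ * (‖w r.1.1 r.1.2 - w r.1.1 (r.1.2 + r.2)‖ₑ * ‖f r.1.1 r.1.2‖ₑ))
          (by fun_prop)).aemeasurable
    _ = ∫⁻ z, ∫⁻ p, ‖j z‖ₑ * (‖w p.1 p.2 - w p.1 (p.2 + z)‖ₑ * ‖f p.1 p.2‖ₑ)
        ∂stripMeasure T ∂volume := lintegral_lintegral_swap (Measurable.aemeasurable (by fun_prop))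
    _ ≤ ∫⁻ z, ‖j z‖ₑ * (ENNReal.ofReal η *
        (∫⁻ t, ∫⁻ x, ‖f t x‖ₑ ^ 2 ∂volume ∂timeMeasure T) ^ (1 / 2 : ℝ)) := by
        refine lintegral_mono fun z => ?_
        rw [lintegral_const_mul' _ _ enorm_ne_top]
        by_cases hz : μ < |z|
        · rw [hjs z hz]; simp
        gcongr
        refine (lintegral_mul_enorm_le (by fun_prop) (by fun_prop)).trans ?_
        have h1 := htr z (not_lt.1 hz)
        have h2 : (∫⁻ p, ‖w p.1 p.2 - w p.1 (p.2 + z)‖ₑ ^ 2 ∂stripMeasure T) ^ (1 / 2 : ℝ) ≤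
            ENNReal.ofReal η := by
          calc _ ≤ (ENNReal.ofReal (η ^ 2)) ^ (1 / 2 : ℝ) := by gcongr; exact h1
            _ = _ := by
              rw [ENNReal.ofReal_rpow_of_nonneg (by positivity) (by norm_num), ← Real.sqrt_eq_rpow,
                Real.sqrt_sq hη.le]
        have h3 : ∫⁻ p, ‖f p.1 p.2‖ₑ ^ 2 ∂stripMeasure T =
            ∫⁻ t, ∫⁻ x, ‖f t x‖ₑ ^ 2 ∂volume ∂timeMeasure T := by
          rw [stripMeasure, lintegral_prod _ (Measurable.aemeasurable (by fun_prop))]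
        rw [h3]
        gcongr
    _ ≤ _ := by
        rw [lintegral_mul_const _ (by fun_prop)]
        exact mul_le_of_le_one_left' hj.mass

end

section

/-! ### The duality identity -/

/-- `u` is a measurable function on the plane, bounded by `M` in `L_∞(ℝ; L₂^(3/4))`, with a smooth
equivalent of the weight of `L₂^(3/4)`. -/
structure IsControlled (M : ℝ) (u : ℝ → ℝ → ℂ) : Prop where
  measurable : StronglyMeasurable (Function.uncurry u)
  memLp : ∀ t, MemLp (fun x => u t x * coeffWeight ell x) 2 volume
  le : ∀ t, eLpNorm (fun x => u t x * coeffWeight ell x) 2 volume ≤ ENNReal.ofReal M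

lemma IsControlled.memLp_two {M : ℝ} {u : ℝ → ℝ → ℂ} (hu : IsControlled M u) (t : ℝ) :
    MemLp (u t) 2 volume := by
  refine (hu.memLp t).mono (hu.measurable.measurable.comp measurable_prodMk_left).aestronglyMeasurable
    (Eventually.of_forall fun x => ?_)
  have h := one_le_coeffWeight_ell x
  rw [norm_mul, Complex.norm_real, Real.norm_of_nonneg (by linarith)]
  exact le_mul_of_one_le_right (norm_nonneg _) h

lemma IsControlled.le_two {M : ℝ} {u : ℝ → ℝ → ℂ} (hu : IsControlled M u) (t : ℝ) :
    eLpNorm (u t) 2 volume ≤ ENNReal.ofReal M := by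
  refine (eLpNorm_mono fun x => ?_).trans (hu.le t)
  have h := one_le_coeffWeight_ell x
  rw [norm_mul, Complex.norm_real, Real.norm_of_nonneg (by linarith)]
  exact le_mul_of_one_le_right (norm_nonneg _) h

lemma ae_mem_Ioo_timeMeasure (T : ℝ) : ∀ᵐ t ∂timeMeasure T, t ∈ Ioo 0 T :=
  ae_restrict_mem measurableSet_Ioo

lemma ae_mem_Ioo_stripMeasure (T : ℝ) : ∀ᵐ p ∂stripMeasure T, p.1 ∈ Ioo 0 T :=
  Measure.quasiMeasurePreserving_fst.ae (ae_mem_Ioo_timeMeasure T)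

lemma memLp_stripMeasure {T B : ℝ} {f : ℝ → ℝ → ℂ} (hf : StronglyMeasurable (Function.uncurry f))
    (hB : ∀ t ∈ Icc 0 T, eLpNorm (f t) 2 volume ≤ ENNReal.ofReal B) :
    MemLp (Function.uncurry f) 2 (stripMeasure T) := by
  refine ⟨hf.aestronglyMeasurable, ?_⟩
  have h1 : ∫⁻ z, ‖Function.uncurry f z‖ₑ ^ 2 ∂stripMeasure T ≤
      ENNReal.ofReal B ^ 2 * timeMeasure T univ := by
    rw [stripMeasure, lintegral_prod _ (by fun_prop), ← lintegral_const]
    refine lintegral_mono_ae ?_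
    filter_upwards [ae_mem_Ioo_timeMeasure T] with t ht
    simp only [Function.uncurry_apply_pair]
    rw [lintegral_enorm_sq_eq (fun x => f t x)]
    gcongr
    exact hB t (Ioo_subset_Icc_self ht)
  rw [lintegral_enorm_sq_eq] at h1
  have h2 : eLpNorm (Function.uncurry f) 2 (stripMeasure T) ^ 2 < ⊤ := h1.trans_lt
    (ENNReal.mul_lt_top (by simp) (measure_lt_top _ _))
  by_contra h
  rw [not_lt, top_le_iff] at h
  rw [h] at h2
  simp at h2

lemma IsControlled.memLp_strip {M : ℝ} {u : ℝ → ℝ → ℂ} (hu : IsControlled M u) (T : ℝ) :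
    MemLp (Function.uncurry u) 2 (stripMeasure T) :=
  memLp_stripMeasure hu.measurable fun t _ => hu.le_two t

lemma memLp_stripMeasure_of_curve {T : ℝ} {V : ℝ → L2} (hV : Continuous V) {f : ℝ → ℝ → ℂ}
    (hf : StronglyMeasurable (Function.uncurry f)) (h : ∀ t, V t =ᵐ[volume] f t) :
    MemLp (Function.uncurry f) 2 (stripMeasure T) := by
  obtain ⟨B, hB⟩ := (isCompact_Icc (a := 0) (b := T)).exists_bound_of_continuousOn hV.continuousOn
  refine memLp_stripMeasure (B := B) hf fun t ht => ?_
  rw [← eLpNorm_congr_ae (h t), ← Lp.enorm_def, ← ofReal_norm]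
  exact ENNReal.ofReal_le_ofReal (hB t ht)

lemma isWeakDeriv_of_hasDerivAt {f f' : ℝ → ℂ} (h : ∀ x, HasDerivAt f (f' x) x)
    (hf' : Continuous f') : IsWeakDeriv f f' := by
  intro η hη hηc
  have hf : Continuous f := continuous_iff_continuousAt.2 fun x => (h x).continuousAt
  have hη1 : Continuous (deriv η) := hη.continuous_deriv (by norm_num)
  have hsupp : HasCompactSupport fun x => ((η x : ℝ) : ℂ) := hηc.comp_left Complex.ofReal_zero
  have hsupp' : HasCompactSupport fun x => ((deriv η x : ℝ) : ℂ) :=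
    hηc.deriv.comp_left Complex.ofReal_zero
  have hηc' : Continuous fun x => ((η x : ℝ) : ℂ) := Complex.continuous_ofReal.comp hη.continuous
  have hηd' : Continuous fun x => ((deriv η x : ℝ) : ℂ) := Complex.continuous_ofReal.comp hη1
  have key := integral_mul_deriv_eq_deriv_mul_of_integrable (u := f) (u' := f')
    (v := fun x => ((η x : ℝ) : ℂ)) (v' := fun x => ((deriv η x : ℝ) : ℂ)) (fun x _ => h x)
    (fun x _ => ((hη.differentiable (by norm_num)) x).hasDerivAt.ofReal_comp)
    ((hf.mul hηd').integrable_of_hasCompactSupport hsupp'.mul_left)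
    ((hf'.mul hηc').integrable_of_hasCompactSupport hsupp.mul_left)
    ((hf.mul hηc').integrable_of_hasCompactSupport hsupp.mul_left)
  simp_rw [mul_comm _ (f _), mul_comm _ (f' _)]
  exact key

lemma IsWeakDeriv.congr {f f' g g' : ℝ → ℂ} (h : IsWeakDeriv f g) (hf : f' =ᵐ[volume] f)
    (hg : g' =ᵐ[volume] g) : IsWeakDeriv f' g' := by
  intro η hη hηc
  have e1 : ∫ x, ((deriv η x : ℝ) : ℂ) * f' x = ∫ x, ((deriv η x : ℝ) : ℂ) * f x :=
    integral_congr_ae (hf.mono fun x hx => by simp only [hx])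
  have e2 : ∫ x, ((η x : ℝ) : ℂ) * g' x = ∫ x, ((η x : ℝ) : ℂ) * g x :=
    integral_congr_ae (hg.mono fun x hx => by simp only [hx])
  rw [e1, e2, h η hη hηc]

lemma continuous_uncurry_coeff {q : ℝ → ℝ →ᵇ ℂ} (hq : Continuous q) :
    Continuous (Function.uncurry fun t x => q t x) := by
  have h : Continuous fun p : ℝ × ℝ => q p.1 p.2 := by fun_prop
  exact h

lemma memLp_source (T : ℝ) (G : 𝓢(ℝ, ℂ)) {θ : ℝ → ℝ} (hθ : Continuous θ) :
    MemLp (Function.uncurry fun t x => (θ t : ℂ) * G x) 2 (stripMeasure T) := by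
  have mG : MemLp G 2 volume := G.memLp 2 volume
  have hV : Continuous fun t => (θ t : ℂ) • mG.toLp G := by fun_prop
  refine memLp_stripMeasure_of_curve hV ?_ fun t => ?_
  · have hG := G.continuous
    have : Continuous fun p : ℝ × ℝ => (θ p.1 : ℂ) * G p.2 := by fun_prop
    exact this.stronglyMeasurable
  · filter_upwards [Lp.coeFn_smul (θ t : ℂ) (mG.toLp G), mG.coeFn_toLp] with x h1 h2
    rw [h1, Pi.smul_apply, h2, smul_eq_mul]

lemma ae_norm_le_of_memLp_top {d : ℝ → ℝ} (hd : MemLp d ⊤ volume) :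
    ∀ᵐ x, ‖d x‖ ≤ (eLpNorm d ⊤ volume).toReal := by
  filter_upwards [ae_le_eLpNormEssSup (f := d) (μ := volume)] with x hx
  rw [← eLpNorm_exponent_top] at hx
  rw [← toReal_enorm]
  exact ENNReal.toReal_mono hd.2.ne hx

/-- The coefficient term `j * (q (β φ_x + i λ φ))` of the dual problem. -/
def coeffTerm (lam β : ℝ) (q : ℝ → ℝ →ᵇ ℂ) (j : 𝓢(ℝ, ℂ)) (φ : ℕ → ℝ → ℝ → ℂ) (t x : ℝ) : ℂ :=
  conv j (fun y => q t y * zeta lam β φ t y) x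

namespace IsDualSolution

variable {a b lam β T M : ℝ} {q : ℝ → ℝ →ᵇ ℂ} {j G : 𝓢(ℝ, ℂ)} {θ : ℝ → ℝ} {φ : ℕ → ℝ → ℝ → ℂ}
  {Φ Φt : ℕ → ℝ → L2}

lemma isTestFunction (S : IsDualSolution a b lam β T q j G θ φ Φ Φt) :
    IsTestFunction T (Φ 0) (Φt 0) (Φ 1) (Φ 2) (Φ 3) := by
  have hw : ∀ k ≤ 4, ∀ t, IsWeakDeriv (Φ k t) (Φ (k + 1) t) := fun k hk t =>
    (isWeakDeriv_of_hasDerivAt (S.hasDerivAt_space k hk t)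
      (S.continuous_slice (by omega) t)).congr (S.coeFn k (by omega) t)
      (S.coeFn (k + 1) (by omega) t)
  exact ⟨fun t ht => (S.hasDerivAt_time 0 (by norm_num) t ht).hasDerivWithinAt,
    (S.continuous_deriv 0 (by norm_num)).continuousOn, fun t _ => hw 0 (by norm_num) t,
    fun t _ => hw 1 (by norm_num) t, fun t _ => hw 2 (by norm_num) t,
    (S.continuous_curve 1 (by norm_num)).continuousOn,
    (S.continuous_curve 2 (by norm_num)).continuousOn,
    (S.continuous_curve 3 (by norm_num)).continuousOn, S.terminal 0 (by norm_num)⟩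

lemma exists_bound (S : IsDualSolution a b lam β T q j G θ φ Φ Φt) {k : ℕ} (hk : k ≤ 4) :
    ∃ B, ∀ t ∈ Icc 0 T, ∀ x, ‖φ k t x‖ ≤ B := by
  have c1 : ∀ x : ℝ, |(1 : ℝ)| ≤ 1 := fun _ => by simp
  have hc : Continuous fun t => energy (fun _ => 1) (φ k t) + energy (fun _ => 1) (φ (k + 1) t) :=
    (S.continuous_energy (k := k) (by omega) continuous_const c1).add
      (S.continuous_energy (k := k + 1) (by omega) continuous_const c1)
  obtain ⟨B, hB⟩ := (isCompact_Icc (a := 0) (b := T)).exists_bound_of_continuousOn hc.continuousOn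
  refine ⟨√B, fun t ht x => Real.le_sqrt_of_sq_le ?_⟩
  have m0 := S.memLp k (by omega) t
  have m1 := S.memLp (k + 1) (by omega) t
  have i0 := integrable_norm_sq_mul m0 (k := fun _ => 1) continuous_const c1
  have i1 := integrable_norm_sq_mul m1 (k := fun _ => 1) continuous_const c1
  have hd := S.hasDerivAt_space k hk t
  have hd' : ∀ y, HasDerivAt (fun y => ‖φ k t y‖ ^ 2 * 1)
      (2 * ((φ k t y).re * (φ (k + 1) t y).re + (φ k t y).im * (φ (k + 1) t y).im)) y := fun y => by
    have h1 := hasDerivAt_re (hd y)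
    have h2 := hasDerivAt_im (hd y)
    have e : (fun y => ‖φ k t y‖ ^ 2 * 1) = fun y =>
        (φ k t y).re * (φ k t y).re + (φ k t y).im * (φ k t y).im := by
      ext z
      rw [mul_one, ← Complex.normSq_eq_norm_sq, Complex.normSq_apply]
    rw [e]
    refine ((h1.mul h1).add (h2.mul h2)).congr_deriv ?_
    ring
  have ck := S.continuous_slice (k := k) (by omega) t
  have ck1 := S.continuous_slice (k := k + 1) (by omega) t
  have h := le_integral_of_hasDerivAt_le hd' i0
    (by fun_prop) (i0.add i1) (fun y => by
      simp only [Pi.add_apply, mul_one]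
      rw [← Complex.normSq_eq_norm_sq, ← Complex.normSq_eq_norm_sq, Complex.normSq_apply,
        Complex.normSq_apply]
      exact abs_le.2 ⟨by
        nlinarith [sq_nonneg ((φ k t y).re + (φ (k + 1) t y).re),
          sq_nonneg ((φ k t y).im + (φ (k + 1) t y).im)], by
        nlinarith [sq_nonneg ((φ k t y).re - (φ (k + 1) t y).re),
          sq_nonneg ((φ k t y).im - (φ (k + 1) t y).im)]⟩) x
  simp only [Pi.add_apply] at h
  rw [integral_add i0 i1, mul_one] at h
  exact h.trans ((le_abs_self _).trans (hB t ht))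

lemma exists_zeta_bound (S : IsDualSolution a b lam β T q j G θ φ Φ Φt) :
    ∃ B, ∀ t ∈ Icc 0 T, ∀ x, ‖zeta lam β φ t x‖ ≤ B := by
  obtain ⟨B0, h0⟩ := S.exists_bound (k := 0) (by norm_num)
  obtain ⟨B1, h1⟩ := S.exists_bound (k := 1) (by norm_num)
  refine ⟨|β| * B1 + |lam| * B0, fun t ht x => ?_⟩
  have h2 : ‖zeta lam β φ t x‖ ≤ |β| * ‖φ 1 t x‖ + |lam| * ‖φ 0 t x‖ := by
    refine (norm_add_le _ _).trans ?_
    simp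
  have := h0 t ht x
  have := h1 t ht x
  exact h2.trans (by gcongr)

lemma stronglyMeasurable_coeffTerm (S : IsDualSolution a b lam β T q j G θ φ Φ Φt)
    (hq : Continuous q) : StronglyMeasurable (Function.uncurry (coeffTerm lam β q j φ)) := by
  have hz := S.continuous_zeta
  have hq' := continuous_uncurry_coeff hq
  have hj := j.continuous
  have hz' : Continuous fun r : (ℝ × ℝ) × ℝ => zeta lam β φ r.1.1 r.2 :=
    hz.comp (f := fun r : (ℝ × ℝ) × ℝ => (r.1.1, r.2)) (by fun_prop)
  have hq'' : Continuous fun r : (ℝ × ℝ) × ℝ => q r.1.1 r.2 :=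
    hq'.comp (f := fun r : (ℝ × ℝ) × ℝ => (r.1.1, r.2)) (by fun_prop)
  have hc : Continuous fun r : (ℝ × ℝ) × ℝ =>
      j (r.1.2 - r.2) * (q r.1.1 r.2 * zeta lam β φ r.1.1 r.2) := by fun_prop
  exact StronglyMeasurable.integral_prod_right (ν := volume)
    (f := fun (p : ℝ × ℝ) y => j (p.2 - y) * (q p.1 y * zeta lam β φ p.1 y)) hc.stronglyMeasurable

lemma memLp_coeffTerm (S : IsDualSolution a b lam β T q j G θ φ Φ Φt) (hq : Continuous q)
    (hθ : Continuous θ) : MemLp (Function.uncurry (coeffTerm lam β q j φ)) 2 (stripMeasure T) := by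
  have c1 := S.continuous_curve 1 (by norm_num)
  have c2 := S.continuous_curve 2 (by norm_num)
  have c3 := S.continuous_curve 3 (by norm_num)
  have ct := S.continuous_deriv 0 (by norm_num)
  have mG : MemLp G 2 volume := G.memLp 2 volume
  obtain ⟨g, hg⟩ : ∃ g : L2, g =ᵐ[volume] G := ⟨mG.toLp G, mG.coeFn_toLp⟩
  obtain ⟨V, hV⟩ : ∃ V : ℝ → L2, ∀ t, V t = -Φ 3 t - (Complex.I * a) • Φ 2 t - (b : ℂ) • Φ 1 t
      + (θ t : ℂ) • g - Φt 0 t := ⟨_, fun _ => rfl⟩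
  have hVc : Continuous V := by
    have : V = fun t => -Φ 3 t - (Complex.I * a) • Φ 2 t - (b : ℂ) • Φ 1 t
      + (θ t : ℂ) • g - Φt 0 t := funext hV
    rw [this]
    fun_prop
  refine memLp_stripMeasure_of_curve hVc (S.stronglyMeasurable_coeffTerm hq) fun t => ?_
  rw [hV]
  filter_upwards [Lp.coeFn_sub (-Φ 3 t - (Complex.I * a) • Φ 2 t - (b : ℂ) • Φ 1 t
      + (θ t : ℂ) • g) (Φt 0 t), Lp.coeFn_add (-Φ 3 t - (Complex.I * a) • Φ 2 t - (b : ℂ) • Φ 1 t)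
      ((θ t : ℂ) • g), Lp.coeFn_sub (-Φ 3 t - (Complex.I * a) • Φ 2 t) ((b : ℂ) • Φ 1 t),
      Lp.coeFn_sub (-Φ 3 t) ((Complex.I * a) • Φ 2 t), Lp.coeFn_neg (Φ 3 t),
      Lp.coeFn_smul (Complex.I * a) (Φ 2 t), Lp.coeFn_smul (b : ℂ) (Φ 1 t),
      Lp.coeFn_smul (θ t : ℂ) g, hg, S.deriv_eq 0 (by norm_num) t, S.coeFn 1 (by norm_num) t,
      S.coeFn 2 (by norm_num) t, S.coeFn 3 (by norm_num) t]
    with x h1 h2 h3 h4 h5 h6 h7 h8 h9 h10 h11 h12 h13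
  rw [h1, Pi.sub_apply, h2, Pi.add_apply, h3, Pi.sub_apply, h4, Pi.sub_apply, h5, Pi.neg_apply, h6,
    Pi.smul_apply, h7, Pi.smul_apply, h8, Pi.smul_apply, h9, h10, h11, h12, h13]
  simp only [smul_eq_mul]
  change _ = conv (schwartzDeriv 0 j) (fun y => q t y * zeta lam β φ t y) x
  have : schwartzDeriv 0 G x = G x := rfl
  rw [this]
  ring

lemma memLp_strip (S : IsDualSolution a b lam β T q j G θ φ Φ Φt) {k : ℕ} (hk : k ≤ 5) :
    MemLp (Function.uncurry (φ k)) 2 (stripMeasure T) :=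
  memLp_stripMeasure_of_curve (S.continuous_curve k hk) (S.continuous k hk).stronglyMeasurable
    (S.coeFn k hk)

lemma integrable_nonlinear (S : IsDualSolution a b lam β T q j G θ φ Φ Φt) {u : ℝ → ℝ → ℂ}
    (hu : IsControlled M u) : Integrable (Function.uncurry fun t x =>
      ((‖u t x‖ : ℝ) : ℂ) * u t x * zeta lam β φ t x) (stripMeasure T) := by
  obtain ⟨B, hB⟩ := S.exists_zeta_bound
  have h1 : MemLp (fun p => ((‖Function.uncurry u p‖ : ℝ) : ℂ)) 2 (stripMeasure T) :=
    (hu.memLp_strip T).norm.ofReal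
  exact (h1.integrable_mul (hu.memLp_strip T)).mul_bdd (c := B)
    S.continuous_zeta.aestronglyMeasurable (by
      filter_upwards [ae_mem_Ioo_stripMeasure T] with p hp
      exact hB p.1 (Ioo_subset_Icc_self hp) p.2)

lemma integrable_damping (S : IsDualSolution a b lam β T q j G θ φ Φ Φt) {u : ℝ → ℝ → ℂ}
    (hu : IsControlled M u) {d : ℝ → ℝ} (hd : MemLp d ⊤ volume) :
    Integrable (Function.uncurry fun t x => ((d x : ℝ) : ℂ) * (u t x * φ 0 t x))
      (stripMeasure T) := by
  refine Integrable.bdd_mul (c := (eLpNorm d ⊤ volume).toReal)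
    ((hu.memLp_strip T).integrable_mul (S.memLp_strip (k := 0) (by norm_num)))
    (f := fun p : ℝ × ℝ => ((d p.2 : ℝ) : ℂ))
    (Complex.continuous_ofReal.comp_aestronglyMeasurable
      (hd.1.comp_snd (μ := timeMeasure T))) ?_
  have := Measure.quasiMeasurePreserving_snd (μ := timeMeasure T) (ν := (volume : Measure ℝ))
    |>.ae (ae_norm_le_of_memLp_top hd)
  filter_upwards [this] with p hp
  rw [Complex.norm_real]
  exact hp

/-- The weak formulation, tested with a solution of the regularized dual problem. -/
lemma integral_dual_eq (S : IsDualSolution a b lam β T q j G θ φ Φ Φt) (hq : Continuous q)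
    (hθ : Continuous θ) {u : ℝ → ℝ → ℂ} (hu : IsControlled M u) {d : ℝ → ℝ}
    (hd : MemLp d ⊤ volume) {u₀ : ℝ → ℂ} (h : IsWeakSolution a b lam β d u₀ T u) :
    (∫ p, (u p.1 p.2 * ((θ p.1 : ℂ) * G p.2)) ∂stripMeasure T)
      - (∫ p, u p.1 p.2 * coeffTerm lam β q j φ p.1 p.2 ∂stripMeasure T)
      + (∫ p, ((‖u p.1 p.2‖ : ℝ) : ℂ) * u p.1 p.2 * zeta lam β φ p.1 p.2 ∂stripMeasure T)
      - (∫ p, ((d p.2 : ℝ) : ℂ) * (u p.1 p.2 * φ 0 p.1 p.2) ∂stripMeasure T)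
      + ∫ x, u₀ x * φ 0 0 x = 0 := by
  have hw := h.2 _ _ _ _ _ S.isTestFunction
  have i1 : Integrable (fun p : ℝ × ℝ => u p.1 p.2 * ((θ p.1 : ℂ) * G p.2)) (stripMeasure T) :=
    (hu.memLp_strip T).integrable_mul (memLp_source T G hθ)
  have i2 : Integrable (fun p : ℝ × ℝ => u p.1 p.2 * coeffTerm lam β q j φ p.1 p.2)
      (stripMeasure T) := (hu.memLp_strip T).integrable_mul (S.memLp_coeffTerm hq hθ)
  have i3 : Integrable (fun p : ℝ × ℝ => ((‖u p.1 p.2‖ : ℝ) : ℂ) * u p.1 p.2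
      * zeta lam β φ p.1 p.2) (stripMeasure T) := S.integrable_nonlinear hu
  have i4 : Integrable (fun p : ℝ × ℝ => ((d p.2 : ℝ) : ℂ) * (u p.1 p.2 * φ 0 p.1 p.2))
      (stripMeasure T) := S.integrable_damping hu hd
  have i12 : Integrable (fun p : ℝ × ℝ => u p.1 p.2 * ((θ p.1 : ℂ) * G p.2)
    - u p.1 p.2 * coeffTerm lam β q j φ p.1 p.2) (stripMeasure T) := i1.sub i2
  have i123 : Integrable (fun p : ℝ × ℝ => u p.1 p.2 * ((θ p.1 : ℂ) * G p.2)
    - u p.1 p.2 * coeffTerm lam β q j φ p.1 p.2 + ((‖u p.1 p.2‖ : ℝ) : ℂ) * u p.1 p.2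
      * zeta lam β φ p.1 p.2) (stripMeasure T) := i12.add i3
  have i1234 : Integrable (fun p : ℝ × ℝ => u p.1 p.2 * ((θ p.1 : ℂ) * G p.2)
    - u p.1 p.2 * coeffTerm lam β q j φ p.1 p.2 + ((‖u p.1 p.2‖ : ℝ) : ℂ) * u p.1 p.2
      * zeta lam β φ p.1 p.2 - ((d p.2 : ℝ) : ℂ) * (u p.1 p.2 * φ 0 p.1 p.2))
      (stripMeasure T) := i123.sub i4
  rw [← integral_sub i1 i2, ← integral_add i12 i3, ← integral_sub i123 i4]
  have e0 : ∫ x, u₀ x * (Φ 0 0) x = ∫ x, u₀ x * φ 0 0 x :=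
    integral_congr_ae ((S.coeFn 0 (by norm_num) 0).mono fun x hx => by simp only [hx])
  rw [e0] at hw
  have e1 := integral_prod _ i1234
  change ∫ p, _ ∂stripMeasure T = _ at e1
  rw [e1]
  have hmul : ∀ {z z' : ℂ}, Complex.I * z + Complex.I * z' = 0 → z + z' = 0 := by
    intro z z' hz
    rw [← mul_add] at hz
    exact (mul_eq_zero.1 hz).resolve_left Complex.I_ne_zero
  refine hmul ?_
  rw [← hw, ← integral_const_mul]
  congr 1
  refine integral_congr_ae ((ae_mem_Ioo_timeMeasure T).mono fun t ht => ?_)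
  simp only
  rw [← integral_const_mul]
  refine integral_congr_ae ?_
  filter_upwards [S.deriv_eq 0 (by norm_num) t, S.coeFn 0 (by norm_num) t,
    S.coeFn 1 (by norm_num) t, S.coeFn 2 (by norm_num) t, S.coeFn 3 (by norm_num) t]
    with x h1 h2 h3 h4 h5
  rw [h1, h2, h3, h4, h5]
  have e2 : schwartzDeriv 0 G x = G x := rfl
  have e3 : conv (schwartzDeriv 0 j) (fun y => q t y * zeta lam β φ t y) x
    = coeffTerm lam β q j φ t x := rfl
  rw [e2, e3]
  simp only [zeta]
  linear_combination ((a * u t x * φ 2 t x) + lam * ‖u t x‖ * u t x * φ 0 t x) * Complex.I_sq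

end IsDualSolution

end

section

/-! ### The difference of two weak solutions -/

lemma enorm_integral_stripMeasure_le {T : ℝ} {f : ℝ × ℝ → ℂ}
    (hf : AEStronglyMeasurable f (stripMeasure T)) : ‖∫ p, f p ∂stripMeasure T‖ₑ ≤
      ∫⁻ t, ∫⁻ x, ‖f (t, x)‖ₑ ∂volume ∂timeMeasure T := by
  refine (enorm_integral_le_lintegral_enorm f).trans_eq ?_
  exact lintegral_prod _ hf.enorm

namespace IsDualSolution

variable {a b lam β T M : ℝ} {q : ℝ → ℝ →ᵇ ℂ} {j G : 𝓢(ℝ, ℂ)} {θ : ℝ → ℝ} {φ : ℕ → ℝ → ℝ → ℂ}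
  {Φ Φt : ℕ → ℝ → L2}

lemma memLp_mul_zeta (S : IsDualSolution a b lam β T q j G θ φ Φ Φt) (hq : Continuous q) {B : ℝ}
    (hB : ∀ t x, ‖q t x‖ ≤ B) :
    MemLp (Function.uncurry fun t x => q t x * zeta lam β φ t x) 2 (stripMeasure T) := by
  have hz : MemLp (Function.uncurry (zeta lam β φ)) 2 (stripMeasure T) :=
    ((S.memLp_strip (k := 1) (by norm_num)).const_mul _).add
      ((S.memLp_strip (k := 0) (by norm_num)).const_mul _)
  have hc : Continuous (Function.uncurry fun t x => q t x * zeta lam β φ t x) :=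
    (continuous_uncurry_coeff hq).mul S.continuous_zeta
  refine (hz.const_mul (B : ℂ)).mono hc.aestronglyMeasurable (Eventually.of_forall fun p => ?_)
  rw [norm_mul, Complex.norm_real, Function.uncurry_def, norm_mul]
  exact mul_le_mul ((hB _ _).trans (le_abs_self B)) le_rfl (norm_nonneg _) (abs_nonneg B)

/-- The difference of two weak solutions, tested with `θ(t) G(x)`. The nonlinear terms enter
through the quotient `Q` of `|u|u - |v|v` and `u - v`, of which `q` is an approximation. -/
lemma enorm_integral_sub_le (S : IsDualSolution a b lam β T q j G θ φ Φ Φt) (hq : Continuous q)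
    {B : ℝ} (hB : ∀ t x, ‖q t x‖ ≤ B) (hθ : Continuous θ) {u v : ℝ → ℝ → ℂ}
    (hu : IsControlled M u) (hv : IsControlled M v) {d : ℝ → ℝ} (hd : MemLp d ⊤ volume)
    {u₀ v₀ : ℝ → ℂ} (hu₀ : MemLp u₀ 2 volume) (hv₀ : MemLp v₀ 2 volume)
    (hsu : IsWeakSolution a b lam β d u₀ T u) (hsv : IsWeakSolution a b lam β d v₀ T v)
    {Q : ℝ → ℝ → ℂ}
    (hQ : ∀ t x, Q t x * (u t x - v t x) = ‖u t x‖ * u t x - ‖v t x‖ * v t x) :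
    ‖∫ t, θ t * (∫ x, (u t x - v t x) * G x) ∂timeMeasure T‖ₑ ≤
      (∫⁻ t, ‖(∫ x, (u t x - v t x) * (q t x * zeta lam β φ t x))
        - ∫ x, (u t x - v t x) * conv j (fun y => q t y * zeta lam β φ t y) x‖ₑ ∂timeMeasure T)
      + (∫⁻ t, ∫⁻ x, ‖Q t x - q t x‖ₑ * (‖u t x - v t x‖ₑ * ‖zeta lam β φ t x‖ₑ) ∂volume
        ∂timeMeasure T)
      + (∫⁻ t, ∫⁻ x, ‖d x‖ₑ * (‖u t x - v t x‖ₑ * ‖φ 0 t x‖ₑ) ∂volume ∂timeMeasure T)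
      + ∫⁻ x, ‖u₀ x - v₀ x‖ₑ * ‖φ 0 0 x‖ₑ := by
  obtain ⟨w, hw⟩ : ∃ w : ℝ → ℝ → ℂ, ∀ t x, u t x - v t x = w t x := ⟨_, fun _ _ => rfl⟩
  have hw2 : MemLp (Function.uncurry w) 2 (stripMeasure T) := by
    have : Function.uncurry w = Function.uncurry u - Function.uncurry v :=
      funext fun p => (hw p.1 p.2).symm
    rw [this]
    exact (hu.memLp_strip T).sub (hv.memLp_strip T)
  have e1 := S.integral_dual_eq hq hθ hu hd hsu
  have e2 := S.integral_dual_eq hq hθ hv hd hsv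
  have iG : ∀ {f : ℝ → ℝ → ℂ}, MemLp (Function.uncurry f) 2 (stripMeasure T) →
      Integrable (fun p : ℝ × ℝ => f p.1 p.2 * ((θ p.1 : ℂ) * G p.2)) (stripMeasure T) :=
    fun hf => hf.integrable_mul (memLp_source T G hθ)
  have iC : ∀ {f : ℝ → ℝ → ℂ}, MemLp (Function.uncurry f) 2 (stripMeasure T) →
      Integrable (fun p : ℝ × ℝ => f p.1 p.2 * coeffTerm lam β q j φ p.1 p.2) (stripMeasure T) :=
    fun hf => hf.integrable_mul (S.memLp_coeffTerm hq hθ)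
  have iZ : Integrable (fun p : ℝ × ℝ => w p.1 p.2 * (q p.1 p.2 * zeta lam β φ p.1 p.2))
      (stripMeasure T) := hw2.integrable_mul (S.memLp_mul_zeta hq hB)
  have iNu : Integrable (fun p : ℝ × ℝ => ((‖u p.1 p.2‖ : ℝ) : ℂ) * u p.1 p.2
      * zeta lam β φ p.1 p.2) (stripMeasure T) := S.integrable_nonlinear hu
  have iNv : Integrable (fun p : ℝ × ℝ => ((‖v p.1 p.2‖ : ℝ) : ℂ) * v p.1 p.2
      * zeta lam β φ p.1 p.2) (stripMeasure T) := S.integrable_nonlinear hv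
  have iDu : Integrable (fun p : ℝ × ℝ => ((d p.2 : ℝ) : ℂ) * (u p.1 p.2 * φ 0 p.1 p.2))
      (stripMeasure T) := S.integrable_damping hu hd
  have iDv : Integrable (fun p : ℝ × ℝ => ((d p.2 : ℝ) : ℂ) * (v p.1 p.2 * φ 0 p.1 p.2))
      (stripMeasure T) := S.integrable_damping hv hd
  have i0 : ∀ {f : ℝ → ℂ}, MemLp f 2 volume → Integrable (fun x => f x * φ 0 0 x) :=
    fun hf => hf.integrable_mul (S.memLp 0 (by norm_num) 0)
  have f1 := integral_sub (iG (hu.memLp_strip T)) (iG (hv.memLp_strip T))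
  have f2 := integral_sub (iC (hu.memLp_strip T)) (iC (hv.memLp_strip T))
  have f3 := integral_sub iNu iNv
  have f4 := integral_sub iDu iDv
  have f5 := integral_sub (i0 hu₀) (i0 hv₀)
  have f6 := integral_sub iZ (iC hw2)
  have iN : Integrable (fun p : ℝ × ℝ => Q p.1 p.2 * w p.1 p.2 * zeta lam β φ p.1 p.2)
      (stripMeasure T) := by
    refine (iNu.sub iNv).congr (Eventually.of_forall fun p => ?_)
    simp only [Pi.sub_apply, ← hw, hQ]
    ring
  have f7 := integral_sub iN iZ
  have g1 : ∫ p, (u p.1 p.2 * ((θ p.1 : ℂ) * G p.2) - v p.1 p.2 * ((θ p.1 : ℂ) * G p.2))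
      ∂stripMeasure T = ∫ t, θ t * (∫ x, (u t x - v t x) * G x) ∂timeMeasure T := by
    have := integral_prod _ ((iG (hu.memLp_strip T)).sub (iG (hv.memLp_strip T)))
    refine Eq.trans this (integral_congr_ae (Eventually.of_forall fun t => ?_))
    simp only
    rw [← integral_const_mul]
    refine integral_congr_ae (Eventually.of_forall fun x => ?_)
    simp only [Pi.sub_apply]
    ring
  have g2 : ∫ p, (u p.1 p.2 * coeffTerm lam β q j φ p.1 p.2
      - v p.1 p.2 * coeffTerm lam β q j φ p.1 p.2) ∂stripMeasure T
      = ∫ p, w p.1 p.2 * coeffTerm lam β q j φ p.1 p.2 ∂stripMeasure T := by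
    simp_rw [← sub_mul, hw]
  have g3 : ∫ p, (((‖u p.1 p.2‖ : ℝ) : ℂ) * u p.1 p.2 * zeta lam β φ p.1 p.2
      - ((‖v p.1 p.2‖ : ℝ) : ℂ) * v p.1 p.2 * zeta lam β φ p.1 p.2) ∂stripMeasure T
      = ∫ p, Q p.1 p.2 * w p.1 p.2 * zeta lam β φ p.1 p.2 ∂stripMeasure T := by
    simp_rw [← sub_mul, ← hQ, hw]
  rw [g1] at f1
  rw [g2] at f2
  rw [g3] at f3
  have key : ∫ t, θ t * (∫ x, (u t x - v t x) * G x) ∂timeMeasure T =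
      -(∫ p, (w p.1 p.2 * (q p.1 p.2 * zeta lam β φ p.1 p.2)
        - w p.1 p.2 * coeffTerm lam β q j φ p.1 p.2) ∂stripMeasure T)
      - (∫ p, (Q p.1 p.2 * w p.1 p.2 * zeta lam β φ p.1 p.2
        - w p.1 p.2 * (q p.1 p.2 * zeta lam β φ p.1 p.2)) ∂stripMeasure T)
      + (∫ p, (((d p.2 : ℝ) : ℂ) * (u p.1 p.2 * φ 0 p.1 p.2)
        - ((d p.2 : ℝ) : ℂ) * (v p.1 p.2 * φ 0 p.1 p.2)) ∂stripMeasure T)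
      - ∫ x, (u₀ x * φ 0 0 x - v₀ x * φ 0 0 x) := by
    rw [f6, f7, f4, f5, f1, f2, f3]
    linear_combination e1 - e2
  rw [key]
  refine (enorm_sub_le).trans (add_le_add ((enorm_add_le _ _).trans (add_le_add
    ((enorm_sub_le).trans (add_le_add ?_ ?_)) ?_)) ?_)
  · have g4 : ∫ p, (w p.1 p.2 * (q p.1 p.2 * zeta lam β φ p.1 p.2)
        - w p.1 p.2 * coeffTerm lam β q j φ p.1 p.2) ∂stripMeasure T = _ :=
      integral_prod _ (iZ.sub (iC hw2))
    rw [enorm_neg, g4]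
    refine (enorm_integral_le_lintegral_enorm _).trans_eq (lintegral_congr_ae ?_)
    filter_upwards [iZ.prod_right_ae, (iC hw2).prod_right_ae] with t h1 h2
    rw [integral_sub h1 h2]
    simp only [hw]
    rfl
  · refine (enorm_integral_stripMeasure_le (iN.sub iZ).aestronglyMeasurable).trans_eq ?_
    refine lintegral_congr fun t => lintegral_congr fun x => ?_
    simp only [Pi.sub_apply]
    rw [hw, ← enorm_mul, ← enorm_mul]
    congr 1
    ring
  · refine (enorm_integral_stripMeasure_le (iDu.sub iDv).aestronglyMeasurable).trans_eq ?_
    refine lintegral_congr fun t => lintegral_congr fun x => ?_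
    have : ‖d x‖ₑ = ‖((d x : ℝ) : ℂ)‖ₑ := by
      rw [← ofReal_norm, ← ofReal_norm, Complex.norm_real]
    simp only [Pi.sub_apply]
    rw [this, ← enorm_mul, ← enorm_mul]
    congr 1
    ring
  · refine (enorm_integral_le_lintegral_enorm _).trans_eq (lintegral_congr fun x => ?_)
    rw [← enorm_mul, sub_mul]

end IsDualSolution

/-! ### Weighted pairings -/

lemma eLpNorm_mul_sqrt {f : ℝ → ℂ} {k : ℝ → ℝ} (hk : ∀ x, 0 ≤ k x)
    (h : MemLp (fun x => f x * √(k x)) 2 volume) :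
    eLpNorm (fun x => f x * √(k x)) 2 volume = ENNReal.ofReal √(∫ x, ‖f x‖ ^ 2 * k x) := by
  rw [MemLp.eLpNorm_eq_integral_rpow_norm (by norm_num) (by norm_num) h, Real.sqrt_eq_rpow]
  congr 1
  simp only [ENNReal.toReal_ofNat, one_div]
  congr 1
  refine integral_congr_ae (Eventually.of_forall fun x => ?_)
  simp only
  rw [norm_mul, Complex.norm_real, Real.norm_of_nonneg (Real.sqrt_nonneg _)]
  norm_num
  rw [mul_pow, Real.sq_sqrt (hk x)]

/-- Weighted duality, with a loss that vanishes with the truncation parameter `δ`. -/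
lemma lintegral_mul_le_dualWeight {c δ : ℝ} (hδ : 0 ≤ δ) {f g : ℝ → ℂ} (hf : MemLp f 2 volume)
    (hfκ : MemLp (fun x => f x * √(dualWeight c 0 x)⁻¹) 2 volume) (hg : MemLp g 2 volume)
    {B m : ℝ} (hm : 0 ≤ m) (hfm : eLpNorm f 2 volume ≤ ENNReal.ofReal m)
    (hB : ∀ x, |dualWeight c δ x| ≤ B) :
    ∫⁻ x, ‖f x‖ₑ * ‖g x‖ₑ ≤ ENNReal.ofReal
      ((√(∫ x, ‖f x‖ ^ 2 * (dualWeight c 0 x)⁻¹) + √δ * m) * √(energy (dualWeight c δ) g)) := by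
  have hκ : Continuous (dualWeight c δ) := continuous_of_hasDerivAt (hasDerivAt_dualWeight hδ)
  have hκ0 : Continuous (dualWeight c 0) := continuous_of_hasDerivAt (hasDerivAt_dualWeight le_rfl)
  have hp := dualWeight_pos (c := c) hδ
  have hp0 := dualWeight_pos (c := c) le_rfl
  have mg : MemLp (fun x => g x * √(dualWeight c δ x)) 2 volume := by
    refine (hg.const_mul (√B : ℂ)).mono (hg.1.mul
      (Complex.continuous_ofReal.comp hκ.sqrt).aestronglyMeasurable)
      (Eventually.of_forall fun x => ?_)
    rw [norm_mul, norm_mul, Complex.norm_real, Complex.norm_real, mul_comm,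
      Real.norm_of_nonneg (Real.sqrt_nonneg _), Real.norm_of_nonneg (Real.sqrt_nonneg _)]
    gcongr
    exact (le_abs_self _).trans (hB x)
  have mf : AEStronglyMeasurable (fun x => f x * √(dualWeight c δ x)⁻¹) volume := by
    refine hf.1.mul (Complex.continuous_ofReal.comp ?_).aestronglyMeasurable
    exact (hκ.inv₀ fun x => (hp x).ne').sqrt
  have h1 : ∫⁻ x, ‖f x‖ₑ * ‖g x‖ₑ ≤ eLpNorm (fun x => f x * √(dualWeight c δ x)⁻¹) 2 volume *
      eLpNorm (fun x => g x * √(dualWeight c δ x)) 2 volume := by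
    have h := eLpNorm_smul_le_mul_eLpNorm (p := 2) (q := 2) (r := 1) mg.1 mf
    rw [eLpNorm_one_eq_lintegral_enorm] at h
    refine le_trans (le_of_eq (lintegral_congr fun x => ?_)) h
    simp only [Pi.smul_apply', smul_eq_mul]
    rw [← enorm_mul]
    congr 1
    have h2 : (√(dualWeight c δ x) : ℂ) ≠ 0 :=
      Complex.ofReal_ne_zero.2 (Real.sqrt_ne_zero'.2 (hp x))
    rw [Real.sqrt_inv, Complex.ofReal_inv]
    field_simp
  have h2 : eLpNorm (fun x => f x * √(dualWeight c δ x)⁻¹) 2 volume ≤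
      ENNReal.ofReal (√(∫ x, ‖f x‖ ^ 2 * (dualWeight c 0 x)⁻¹) + √δ * m) := by
    rw [ENNReal.ofReal_add (Real.sqrt_nonneg _) (by positivity),
      ← eLpNorm_mul_sqrt (fun x => (inv_pos.2 (hp0 x)).le) hfκ, ENNReal.ofReal_mul (Real.sqrt_nonneg _)]
    have h3 : eLpNorm (fun x => f x * √(dualWeight c δ x)⁻¹) 2 volume ≤
        eLpNorm ((fun x => ‖f x * √(dualWeight c 0 x)⁻¹‖) + fun x => √δ * ‖f x‖) 2 volume := by
      refine eLpNorm_mono fun x => ?_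
      simp only [Pi.add_apply, norm_mul, Complex.norm_real,
        Real.norm_of_nonneg (Real.sqrt_nonneg _)]
      have h4 : √(dualWeight c δ x)⁻¹ ≤ √(dualWeight c 0 x)⁻¹ + √δ :=
        (Real.sqrt_le_sqrt (inv_dualWeight_le hδ x)).trans (by
          rw [Real.sqrt_le_left (by positivity)]
          nlinarith [Real.sq_sqrt (inv_pos.2 (hp0 x)).le, Real.sq_sqrt hδ,
            mul_nonneg (Real.sqrt_nonneg (dualWeight c 0 x)⁻¹) (Real.sqrt_nonneg δ)])
      refine le_trans ?_ (Real.le_norm_self _)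
      nlinarith [norm_nonneg (f x)]
    refine h3.trans ((eLpNorm_add_le hfκ.1.norm (hf.1.norm.const_mul _) (by norm_num)).trans ?_)
    rw [eLpNorm_norm]
    refine add_le_add le_rfl ?_
    have h5 : (fun x => √δ * ‖f x‖) = √δ • fun x => ‖f x‖ := rfl
    rw [h5, eLpNorm_const_smul, eLpNorm_norm, ← ofReal_norm,
      Real.norm_of_nonneg (Real.sqrt_nonneg _)]
    gcongr
  rw [ENNReal.ofReal_mul (by positivity)]
  refine h1.trans (mul_le_mul' h2 ?_)
  rw [eLpNorm_mul_sqrt (fun x => (hp x).le) mg]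
  rfl

end

section

/-! ### Bounds for the terms of the tested difference -/

lemma lintegral_timeMeasure_ofReal_sq {T : ℝ} (hT : 0 ≤ T) {Z : ℝ → ℝ} (hZ : Continuous Z) :
    ∫⁻ t, ENNReal.ofReal (Z t ^ 2) ∂timeMeasure T = ENNReal.ofReal (∫ t in 0..T, Z t ^ 2) := by
  have hi : IntegrableOn (fun t => Z t ^ 2) (Ioo 0 T) :=
    ((hZ.pow 2).integrableOn_Icc (a := 0) (b := T)).mono_set Ioo_subset_Icc_self
  rw [intervalIntegral.integral_of_le hT, integral_Ioc_eq_integral_Ioo,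
    ofReal_integral_eq_lintegral_ofReal hi (Eventually.of_forall fun t => sq_nonneg _)]
  rfl

/-- Where the truncation of the dual weight is not felt, the supremum bound for `z` and the weights
of `Q - q` and `w` combine to a bound of the trilinear form; elsewhere `q` vanishes. -/
lemma lintegral_coeff_error_le {T c δ η m A B : ℝ} (hT : 0 ≤ T) (hc : 0 < c) (hδ : 0 < δ)
    (hη : 0 ≤ η) (hm : 0 ≤ m)
    {Q q w z : ℝ → ℝ → ℂ} (hQ : Measurable (Function.uncurry Q))
    (hq : Measurable (Function.uncurry q)) (hw : Measurable (Function.uncurry w))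
    (hqs : ∀ t x, Real.exp (c * x) < δ → q t x = 0)
    (hQq : ∫⁻ t, ∫⁻ x, (‖Q t x - q t x‖ₑ * ENNReal.ofReal (coeffWeight ell x)) ^ 2 ∂volume
        ∂timeMeasure T ≤ ENNReal.ofReal (η ^ 2))
    (hwm : ∀ t, eLpNorm (fun x => w t x * coeffWeight ell x) 2 volume ≤ ENNReal.ofReal m)
    {Z : ℝ → ℝ} (hZ : Continuous Z) (hZ0 : ∀ t, 0 ≤ Z t)
    (hzZ : ∀ t ∈ Icc 0 T, ∀ x, supWeight (dualWeight1 c δ) ell x * ‖z t x‖ ≤ Z t)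
    (hZA : ∫ t in 0..T, Z t ^ 2 ≤ A) (hB : ∀ t ∈ Icc 0 T, ∀ x, ‖z t x‖ ≤ B) :
    ∫⁻ t, ∫⁻ x, ‖Q t x - q t x‖ₑ * (‖w t x‖ₑ * ‖z t x‖ₑ) ∂volume ∂timeMeasure T ≤
      ENNReal.ofReal (weightConst c * m * (√A * η)) + ENNReal.ofReal B *
        ∫⁻ t, ∫⁻ x, {x | Real.exp (c * x) < δ}.indicator (fun x => ‖Q t x * w t x‖ₑ) x ∂volume
          ∂timeMeasure T := by
  have hC := one_le_weightConst hc
  have hcw := continuous_coeffWeight_ell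
  have hcw0 := coeffWeight_ell_pos
  have hmx : MeasurableSet {x : ℝ | Real.exp (c * x) < δ} :=
    measurableSet_lt (by fun_prop) measurable_const
  have hmI : Measurable fun p : ℝ × ℝ =>
      {x | Real.exp (c * x) < δ}.indicator (fun x => ‖Q p.1 x * w p.1 x‖ₑ) p.2 := by
    have : (fun p : ℝ × ℝ => {x | Real.exp (c * x) < δ}.indicator (fun x => ‖Q p.1 x * w p.1 x‖ₑ) p.2)
        = (Prod.snd ⁻¹' {x : ℝ | Real.exp (c * x) < δ}).indicator
          (fun p : ℝ × ℝ => ‖Function.uncurry Q p * Function.uncurry w p‖ₑ) := by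
      ext p
      by_cases h : Real.exp (c * p.2) < δ <;> simp [Set.indicator, h, Function.uncurry_def]
    rw [this]
    exact ((hQ.mul hw).enorm).indicator (measurable_snd hmx)
  have hwi : ∀ t, Measurable (w t) := fun t => hw.comp measurable_prodMk_left
  have hQi : ∀ t, Measurable (Q t) := fun t => hQ.comp measurable_prodMk_left
  have hqi : ∀ t, Measurable (q t) := fun t => hq.comp measurable_prodMk_left
  have hcm := hcw.measurable
  have hma : Measurable fun p : ℝ × ℝ => (‖Q p.1 p.2 - q p.1 p.2‖ₑ
      * ENNReal.ofReal (coeffWeight ell p.2)) ^ 2 :=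
    (((hQ.sub hq).enorm).mul (hcm.comp measurable_snd).ennreal_ofReal).pow_const 2
  obtain ⟨a, ha⟩ : ∃ a : ℝ → ℝ≥0∞, ∀ t, a t = (∫⁻ x, (‖Q t x - q t x‖ₑ
      * ENNReal.ofReal (coeffWeight ell x)) ^ 2) ^ (1 / 2 : ℝ) := ⟨_, fun _ => rfl⟩
  have ham : Measurable a := by
    rw [funext ha]
    exact (hma.lintegral_prod_right' (ν := volume)).pow_const _
  have hpt : ∀ t ∈ Icc 0 T, ∀ x, ‖Q t x - q t x‖ₑ * (‖w t x‖ₑ * ‖z t x‖ₑ) ≤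
      ENNReal.ofReal (weightConst c) * ENNReal.ofReal (Z t) *
        ((‖Q t x - q t x‖ₑ * ENNReal.ofReal (coeffWeight ell x))
          * (‖w t x‖ₑ * ENNReal.ofReal (coeffWeight ell x))) + ENNReal.ofReal B *
        {x | Real.exp (c * x) < δ}.indicator (fun x => ‖Q t x * w t x‖ₑ) x := by
    intro t ht x
    -- Left of the truncation only the qualitative bound `B` of `z` is available.
    rcases lt_or_ge (Real.exp (c * x)) δ with h | h
    · rw [indicator_of_mem (by exact h), hqs t x h, sub_zero]
      refine le_trans ?_ le_add_self
      rw [enorm_mul, ← mul_assoc, mul_comm]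
      gcongr
      exact enorm_le_of_norm_le (hB t ht x)
    · refine le_trans ?_ le_self_add
      have h1 : ‖z t x‖ₑ ≤ ENNReal.ofReal (weightConst c) * ENNReal.ofReal (Z t)
          * (ENNReal.ofReal (coeffWeight ell x) * ENNReal.ofReal (coeffWeight ell x)) := by
        rw [← ENNReal.ofReal_mul (by positivity), ← ENNReal.ofReal_mul (hcw0 x).le,
          ← ENNReal.ofReal_mul (mul_nonneg (by positivity) (hZ0 t))]
        refine enorm_le_of_norm_le ?_
        have h2 := one_le_supWeight_mul hc hδ h
        calc ‖z t x‖ ≤ (weightConst c * (supWeight (dualWeight1 c δ) ell x * coeffWeight ell x ^ 2))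
              * ‖z t x‖ := le_mul_of_one_le_left (norm_nonneg _) h2
          _ = weightConst c * (supWeight (dualWeight1 c δ) ell x * ‖z t x‖)
              * coeffWeight ell x ^ 2 := by ring
          _ ≤ weightConst c * Z t * coeffWeight ell x ^ 2 := by
              have := hzZ t ht x
              gcongr
          _ = _ := by ring
      calc _ ≤ ‖Q t x - q t x‖ₑ * (‖w t x‖ₑ * (ENNReal.ofReal (weightConst c) * ENNReal.ofReal (Z t)
          * (ENNReal.ofReal (coeffWeight ell x) * ENNReal.ofReal (coeffWeight ell x)))) := by gcongr
        _ = _ := by ring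
  have hin : ∀ t ∈ Icc 0 T, ∫⁻ x, ‖Q t x - q t x‖ₑ * (‖w t x‖ₑ * ‖z t x‖ₑ) ≤
      ENNReal.ofReal (weightConst c * m) * (ENNReal.ofReal (Z t) * a t) + ENNReal.ofReal B *
        ∫⁻ x, {x | Real.exp (c * x) < δ}.indicator (fun x => ‖Q t x * w t x‖ₑ) x := by
    intro t ht
    have m1 : Measurable fun x => ‖Q t x - q t x‖ₑ * ENNReal.ofReal (coeffWeight ell x) :=
      ((hQi t).sub (hqi t)).enorm.mul hcm.ennreal_ofReal
    have m2 : Measurable fun x => ‖w t x‖ₑ * ENNReal.ofReal (coeffWeight ell x) :=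
      (hwi t).enorm.mul hcm.ennreal_ofReal
    have m12 : Measurable fun x => (‖Q t x - q t x‖ₑ * ENNReal.ofReal (coeffWeight ell x))
        * (‖w t x‖ₑ * ENNReal.ofReal (coeffWeight ell x)) := m1.mul m2
    have h3 : (∫⁻ x, (‖w t x‖ₑ * ENNReal.ofReal (coeffWeight ell x)) ^ 2) ^ (1 / 2 : ℝ) ≤
        ENNReal.ofReal m := by
      have e : ∫⁻ x, (‖w t x‖ₑ * ENNReal.ofReal (coeffWeight ell x)) ^ 2
          = eLpNorm (fun x => w t x * coeffWeight ell x) 2 volume ^ 2 := by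
        rw [← lintegral_enorm_sq_eq]
        refine lintegral_congr fun x => ?_
        rw [enorm_mul, ← ofReal_norm (coeffWeight ell x : ℂ), Complex.norm_real,
          Real.norm_of_nonneg (hcw0 x).le]
      rw [e, ← ENNReal.rpow_natCast, ← ENNReal.rpow_mul]
      norm_num
      exact hwm t
    refine (lintegral_mono (hpt t ht)).trans ?_
    rw [lintegral_add_left (m12.const_mul _), lintegral_const_mul _ m12,
      lintegral_const_mul' _ _ ENNReal.ofReal_ne_top]
    refine add_le_add ?_ le_rfl
    refine (mul_le_mul_right ((lintegral_mul_enorm_le m1 m2).trans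
      (mul_le_mul_right h3 _)) _).trans_eq ?_
    rw [← ha, ENNReal.ofReal_mul (by positivity)]
    ring
  calc _ ≤ ∫⁻ t, (ENNReal.ofReal (weightConst c * m) * (ENNReal.ofReal (Z t) * a t)
        + ENNReal.ofReal B * ∫⁻ x, {x | Real.exp (c * x) < δ}.indicator
          (fun x => ‖Q t x * w t x‖ₑ) x) ∂timeMeasure T := by
        refine lintegral_mono_ae ?_
        filter_upwards [ae_mem_Ioo_timeMeasure T] with t ht
        exact hin t (Ioo_subset_Icc_self ht)
    _ = ENNReal.ofReal (weightConst c * m) * (∫⁻ t, ENNReal.ofReal (Z t) * a t ∂timeMeasure T)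
        + ENNReal.ofReal B * ∫⁻ t, ∫⁻ x, {x | Real.exp (c * x) < δ}.indicator
          (fun x => ‖Q t x * w t x‖ₑ) x ∂volume ∂timeMeasure T := by
        have m3 : Measurable fun t => ENNReal.ofReal (Z t) * a t :=
          hZ.measurable.ennreal_ofReal.mul ham
        rw [lintegral_add_left (m3.const_mul _), lintegral_const_mul _ m3,
          lintegral_const_mul _ (hmI.lintegral_prod_right' (ν := volume))]
    _ ≤ _ := by
        refine add_le_add ?_ le_rfl
        rw [ENNReal.ofReal_mul (by positivity : 0 ≤ weightConst c * m)]
        refine mul_le_mul_right ((lintegral_mul_enorm_le hZ.measurable.ennreal_ofReal ham).trans ?_) _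
        have hA : 0 ≤ A := le_trans (intervalIntegral.integral_nonneg hT fun t _ => sq_nonneg _) hZA
        rw [ENNReal.ofReal_mul (Real.sqrt_nonneg _)]
        refine mul_le_mul' ?_ ?_
        · simp_rw [← ENNReal.ofReal_pow (hZ0 _)]
          rw [lintegral_timeMeasure_ofReal_sq hT hZ, Real.sqrt_eq_rpow,
            ← ENNReal.ofReal_rpow_of_nonneg hA (by norm_num)]
          gcongr
        · have e : ∀ t, a t ^ 2 = ∫⁻ x, (‖Q t x - q t x‖ₑ
              * ENNReal.ofReal (coeffWeight ell x)) ^ 2 := fun t => by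
            rw [ha, ← ENNReal.rpow_natCast, ← ENNReal.rpow_mul]
            norm_num
          simp_rw [e]
          refine (ENNReal.rpow_le_rpow hQq (by norm_num)).trans_eq ?_
          rw [ENNReal.ofReal_rpow_of_nonneg (sq_nonneg _) (by norm_num), ← Real.sqrt_eq_rpow,
            Real.sqrt_sq hη]

/-- The part of an integrable function that lives far to the left is negligible. -/
lemma tendsto_lintegral_indicator_exp_lt {T c : ℝ} {F : ℝ → ℝ → ℂ}
    (hFm : Measurable (Function.uncurry F)) (hF : Integrable (Function.uncurry F) (stripMeasure T)) :
    Tendsto (fun δ => ∫⁻ t, ∫⁻ x, {x | Real.exp (c * x) < δ}.indicator (fun x => ‖F t x‖ₑ) x ∂volume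
      ∂timeMeasure T) (𝓝[>] 0) (𝓝 0) := by
  have e : ∀ (δ : ℝ) (p : ℝ × ℝ), {x | Real.exp (c * x) < δ}.indicator (fun x => ‖F p.1 x‖ₑ) p.2
      = (Prod.snd ⁻¹' {x : ℝ | Real.exp (c * x) < δ}).indicator
          (fun p => ‖Function.uncurry F p‖ₑ) p := by
    intro δ p
    by_cases h : Real.exp (c * p.2) < δ <;> simp [Set.indicator, h, Function.uncurry_def]
  have hm : ∀ δ : ℝ, Measurable ((Prod.snd ⁻¹' {x : ℝ | Real.exp (c * x) < δ}).indicator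
      (fun p : ℝ × ℝ => ‖Function.uncurry F p‖ₑ)) := fun δ =>
    hFm.enorm.indicator (measurable_snd (measurableSet_lt (by fun_prop) measurable_const))
  have e2 : ∀ δ : ℝ, ∫⁻ t, ∫⁻ x, {x | Real.exp (c * x) < δ}.indicator (fun x => ‖F t x‖ₑ) x ∂volume
      ∂timeMeasure T = ∫⁻ p, (Prod.snd ⁻¹' {x : ℝ | Real.exp (c * x) < δ}).indicator
          (fun p => ‖Function.uncurry F p‖ₑ) p ∂stripMeasure T := fun δ => by
    rw [stripMeasure, lintegral_prod _ (hm δ).aemeasurable]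
    simp_rw [← e]
  simp_rw [e2]
  have h0 : ∫⁻ _, 0 ∂stripMeasure T = 0 := by simp
  rw [← h0]
  refine tendsto_lintegral_filter_of_dominated_convergence (fun p => ‖Function.uncurry F p‖ₑ)
    (Eventually.of_forall hm) (Eventually.of_forall fun δ => Eventually.of_forall fun p =>
      indicator_le_self _ _ _) hF.2.ne (Eventually.of_forall fun p => ?_)
  refine tendsto_const_nhds.congr' ?_
  have h1 : ∀ᶠ δ in 𝓝[>] (0 : ℝ), δ < Real.exp (c * p.2) :=
    nhdsWithin_le_nhds (gt_mem_nhds (Real.exp_pos _))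
  filter_upwards [h1] with δ hδ
  rw [indicator_of_notMem]
  exact fun h => lt_asymm hδ h

/-- On the support of `q` the supremum bound gives a bound of `q z` in `L₂` of the strip. -/
lemma lintegral_mul_sq_le {T c δ R B A s : ℝ} (hT : 0 ≤ T) (hs : 0 < s) (hB : 0 ≤ B)
    {q z : ℝ → ℝ → ℂ} (hqR : ∀ t x, R < |x| → q t x = 0) (hqB : ∀ t x, ‖q t x‖ ≤ B)
    (hsw : ∀ x, |x| ≤ R → s ≤ supWeight (dualWeight1 c δ) ell x)
    {Z : ℝ → ℝ} (hZ : Continuous Z) (hZ0 : ∀ t, 0 ≤ Z t)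
    (hzZ : ∀ t ∈ Icc 0 T, ∀ x, supWeight (dualWeight1 c δ) ell x * ‖z t x‖ ≤ Z t)
    (hZA : ∫ t in 0..T, Z t ^ 2 ≤ A) :
    ∫⁻ t, ∫⁻ x, ‖q t x * z t x‖ₑ ^ 2 ∂volume ∂timeMeasure T ≤
      ENNReal.ofReal ((B / s) ^ 2 * (2 * |R|) * A) := by
  have hpt : ∀ t ∈ Icc 0 T, ∀ x, ‖q t x * z t x‖ₑ ^ 2 ≤
      (Icc (-|R|) |R|).indicator (fun _ => ENNReal.ofReal ((B / s) ^ 2 * Z t ^ 2)) x := by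
    intro t ht x
    by_cases h : |x| ≤ R
    · have hx : x ∈ Icc (-|R|) |R| := abs_le.1 (h.trans (le_abs_self R))
      rw [indicator_of_mem hx]
      have h1 : s * ‖z t x‖ ≤ Z t :=
        (mul_le_mul_of_nonneg_right (hsw x h) (norm_nonneg _)).trans (hzZ t ht x)
      have h2 : ‖q t x * z t x‖ ≤ B / s * Z t := by
        rw [norm_mul]
        calc _ ≤ B * ‖z t x‖ := by gcongr; exact hqB t x
          _ = B / s * (s * ‖z t x‖) := by field_simp
          _ ≤ _ := by gcongr
      rw [← mul_pow, ENNReal.ofReal_pow (mul_nonneg (by positivity) (hZ0 t))]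
      gcongr
      exact enorm_le_of_norm_le h2
    · rw [hqR t x (not_le.1 h)]
      simp
  calc _ ≤ ∫⁻ t, ENNReal.ofReal ((B / s) ^ 2 * (2 * |R|)) * ENNReal.ofReal (Z t ^ 2)
        ∂timeMeasure T := by
        refine lintegral_mono_ae ?_
        filter_upwards [ae_mem_Ioo_timeMeasure T] with t ht
        refine (lintegral_mono (hpt t (Ioo_subset_Icc_self ht))).trans_eq ?_
        rw [lintegral_indicator measurableSet_Icc, setLIntegral_const, Real.volume_Icc,
          ← ENNReal.ofReal_mul (by positivity), ← ENNReal.ofReal_mul (by positivity)]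
        congr 1
        ring
    _ = ENNReal.ofReal ((B / s) ^ 2 * (2 * |R|)) * ENNReal.ofReal (∫ t in 0..T, Z t ^ 2) := by
        rw [lintegral_const_mul' _ _ ENNReal.ofReal_ne_top,
          lintegral_timeMeasure_ofReal_sq hT hZ]
    _ ≤ _ := by
        rw [ENNReal.ofReal_mul (by positivity : 0 ≤ (B / s) ^ 2 * (2 * |R|))]
        gcongr

/-- The damping term. -/
lemma lintegral_damping_le {T c δ m N : ℝ} (hδ : 0 < δ) (hm : 0 ≤ m) (hN : 0 ≤ N)
    {B : ℝ} (hB : ∀ x, |dualWeight c δ x| ≤ B)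
    {d : ℝ → ℝ} (hd : MemLp d ⊤ volume) {w φ : ℝ → ℝ → ℂ}
    (hw : StronglyMeasurable (Function.uncurry w)) (hw2 : ∀ t, MemLp (w t) 2 volume)
    (hwκ : ∀ t, MemLp (fun x => w t x * √(dualWeight c 0 x)⁻¹) 2 volume)
    (hwm : ∀ t, eLpNorm (w t) 2 volume ≤ ENNReal.ofReal m)
    (hwR : ∀ t, √(∫ x, ‖w t x‖ ^ 2 * (dualWeight c 0 x)⁻¹) ≤ m) (hφ : ∀ t, MemLp (φ t) 2 volume)
    {Θ : ℝ → ℝ} (hΘ : Continuous Θ) (hΘ0 : ∀ t ∈ Icc 0 T, 0 ≤ Θ t)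
    (h : ∀ t ∈ Icc 0 T, √(energy (dualWeight c δ) (φ t)) ≤ N * Θ t) :
    ∫⁻ t, ∫⁻ x, ‖d x‖ₑ * (‖w t x‖ₑ * ‖φ t x‖ₑ) ∂volume ∂timeMeasure T ≤
      ENNReal.ofReal (N * ((eLpNorm d ⊤ volume).toReal *
        (∫ t, √(∫ x, ‖w t x‖ ^ 2 * (dualWeight c 0 x)⁻¹) * Θ t ∂timeMeasure T))
        + √δ * (N * ((eLpNorm d ⊤ volume).toReal * m * ∫ t, Θ t ∂timeMeasure T))) := by
  obtain ⟨Y, hY⟩ : ∃ Y : ℝ → ℝ, ∀ t, Y t = √(∫ x, ‖w t x‖ ^ 2 * (dualWeight c 0 x)⁻¹) :=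
    ⟨_, fun _ => rfl⟩
  obtain ⟨N', hN'⟩ : ∃ N', N' = (eLpNorm d ⊤ volume).toReal := ⟨_, rfl⟩
  have hN'0 : 0 ≤ N' := hN' ▸ ENNReal.toReal_nonneg
  have hκ0 : Continuous (dualWeight c 0) := continuous_of_hasDerivAt (hasDerivAt_dualWeight le_rfl)
  have hYm : Measurable Y := by
    have h1 : StronglyMeasurable (Function.uncurry fun t x => ‖w t x‖ ^ 2 * (dualWeight c 0 x)⁻¹) :=
      (hw.norm.pow 2).mul (((hκ0.measurable.comp measurable_snd).inv).stronglyMeasurable)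
    rw [funext hY]
    exact (h1.integral_prod_right (ν := volume)).measurable.sqrt
  have hY0 : ∀ t, 0 ≤ Y t := fun t => hY t ▸ Real.sqrt_nonneg _
  simp_rw [← hY] at hwR ⊢
  rw [← hN']
  have iΘ : Integrable Θ (timeMeasure T) :=
    (hΘ.integrableOn_Icc (a := 0) (b := T)).mono_set Ioo_subset_Icc_self
  have iY : Integrable (fun t => Y t * Θ t) (timeMeasure T) :=
    iΘ.bdd_mul (c := m) hYm.aestronglyMeasurable (Eventually.of_forall fun t => by
      rw [Real.norm_of_nonneg (hY0 t)]; exact hwR t)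
  have hin : ∀ t ∈ Icc 0 T, ∫⁻ x, ‖d x‖ₑ * (‖w t x‖ₑ * ‖φ t x‖ₑ) ≤
      ENNReal.ofReal (N * (N' * (Y t * Θ t)) + √δ * (N * (N' * m * Θ t))) := by
    intro t ht
    calc ∫⁻ x, ‖d x‖ₑ * (‖w t x‖ₑ * ‖φ t x‖ₑ) ≤
        ∫⁻ x, ENNReal.ofReal N' * (‖w t x‖ₑ * ‖φ t x‖ₑ) := by
          refine lintegral_mono_ae ?_
          filter_upwards [ae_norm_le_of_memLp_top hd] with x hx
          gcongr
          rw [← ofReal_norm, hN']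
          exact ENNReal.ofReal_le_ofReal hx
      _ = ENNReal.ofReal N' * ∫⁻ x, ‖w t x‖ₑ * ‖φ t x‖ₑ :=
          lintegral_const_mul' _ _ ENNReal.ofReal_ne_top
      _ ≤ ENNReal.ofReal N' * ENNReal.ofReal ((Y t + √δ * m) * (N * Θ t)) := by
          have h1 := lintegral_mul_le_dualWeight hδ.le (hw2 t) (hwκ t) (hφ t) hm (hwm t) hB
          rw [← hY] at h1
          refine mul_le_mul_right (h1.trans (ENNReal.ofReal_le_ofReal ?_)) _
          have := hY0 t
          exact mul_le_mul_of_nonneg_left (h t ht) (by positivity)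
      _ = _ := by
          rw [← ENNReal.ofReal_mul hN'0]
          congr 1
          ring
  have i1 : Integrable (fun t => N * (N' * (Y t * Θ t)) + √δ * (N * (N' * m * Θ t)))
      (timeMeasure T) := ((iY.const_mul _).const_mul _).add (((iΘ.const_mul _).const_mul _).const_mul _)
  have e : N * (N' * ∫ t, Y t * Θ t ∂timeMeasure T) + √δ * (N * (N' * m * ∫ t, Θ t ∂timeMeasure T))
      = ∫ t, (N * (N' * (Y t * Θ t)) + √δ * (N * (N' * m * Θ t))) ∂timeMeasure T := by
    rw [integral_add ((iY.const_mul _).const_mul _) (((iΘ.const_mul _).const_mul _).const_mul _)]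
    simp_rw [integral_const_mul]
  rw [e, ofReal_integral_eq_lintegral_ofReal i1]
  · refine lintegral_mono_ae ?_
    filter_upwards [ae_mem_Ioo_timeMeasure T] with t ht
    exact hin t (Ioo_subset_Icc_self ht)
  · filter_upwards [ae_mem_Ioo_timeMeasure T] with t ht
    have h1 := hΘ0 t (Ioo_subset_Icc_self ht)
    have := hY0 t
    simp only [Pi.zero_apply]
    positivity

end

section

/-! ### The estimate by duality -/

lemma IsControlled.sub {M N : ℝ} (hM : 0 ≤ M) (hN : 0 ≤ N) {u v : ℝ → ℝ → ℂ}
    (hu : IsControlled M u) (hv : IsControlled N v) :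
    IsControlled (M + N) fun t x => u t x - v t x := by
  have e : ∀ t, (fun x => (u t x - v t x) * coeffWeight ell x)
      = (fun x => u t x * coeffWeight ell x) - fun x => v t x * coeffWeight ell x :=
    fun t => funext fun x => sub_mul _ _ _
  refine ⟨hu.measurable.sub hv.measurable, fun t => ?_, fun t => ?_⟩
  · rw [e]
    exact (hu.memLp t).sub (hv.memLp t)
  · rw [e, ENNReal.ofReal_add hM hN]
    exact (eLpNorm_sub_le (hu.memLp t).1 (hv.memLp t).1 (by norm_num)).trans
      (add_le_add (hu.le t) (hv.le t))

/-- The nonlinearity is Lipschitz with a controlled coefficient. -/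
lemma IsControlled.exists_quotient {M N : ℝ} (hM : 0 ≤ M) (hN : 0 ≤ N) {u v : ℝ → ℝ → ℂ}
    (hu : IsControlled M u) (hv : IsControlled N v) :
    ∃ Q, IsControlled (M + N) Q ∧
      ∀ t x, Q t x * (u t x - v t x) = ‖u t x‖ * u t x - ‖v t x‖ * v t x := by
  obtain ⟨Q, hQ⟩ : ∃ Q : ℝ → ℝ → ℂ, ∀ t x, Q t x =
      (‖u t x‖ * u t x - ‖v t x‖ * v t x) / (u t x - v t x) := ⟨_, fun _ _ => rfl⟩
  have hQm : Measurable (Function.uncurry Q) := by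
    have hum := hu.measurable.measurable
    have hvm := hv.measurable.measurable
    have : Function.uncurry Q = fun p => (‖Function.uncurry u p‖ * Function.uncurry u p
        - ‖Function.uncurry v p‖ * Function.uncurry v p)
          / (Function.uncurry u p - Function.uncurry v p) := funext fun p => hQ p.1 p.2
    rw [this]
    exact (((Complex.measurable_ofReal.comp hum.norm).mul hum).sub
      ((Complex.measurable_ofReal.comp hvm.norm).mul hvm)).div (hum.sub hvm)
  have hle : ∀ t x, ‖Q t x‖ ≤ ‖u t x‖ + ‖v t x‖ := by
    intro t x
    rw [hQ, norm_div]
    refine div_le_of_le_mul₀ (norm_nonneg _) (by positivity) ?_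
    have e : (‖u t x‖ * u t x - ‖v t x‖ * v t x : ℂ) = ‖u t x‖ * (u t x - v t x)
        + ((‖u t x‖ - ‖v t x‖ : ℝ) : ℂ) * v t x := by
      push_cast
      ring
    rw [e, add_mul]
    refine (norm_add_le _ _).trans (add_le_add ?_ ?_)
    · rw [norm_mul, Complex.norm_real, norm_norm]
    · rw [norm_mul, Complex.norm_real, mul_comm]
      gcongr
      exact abs_norm_sub_norm_le _ _
  have hdom : ∀ t x, ‖Q t x * coeffWeight ell x‖ ≤
      ‖((fun x => ‖u t x * coeffWeight ell x‖) + fun x => ‖v t x * coeffWeight ell x‖) x‖ := by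
    intro t x
    refine le_trans ?_ (Real.le_norm_self _)
    simp only [Pi.add_apply, norm_mul]
    rw [← add_mul]
    gcongr
    exact hle t x
  have hmc : ∀ t, AEStronglyMeasurable (fun x => Q t x * coeffWeight ell x) volume := fun t =>
    (hQm.comp measurable_prodMk_left).aestronglyMeasurable.mul
      (Complex.continuous_ofReal.comp continuous_coeffWeight_ell).aestronglyMeasurable
  refine ⟨Q, ⟨hQm.stronglyMeasurable, fun t => ?_, fun t => ?_⟩, fun t x => ?_⟩
  · exact ((hu.memLp t).norm.add (hv.memLp t).norm).mono (hmc t)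
      (Eventually.of_forall (hdom t))
  · refine (eLpNorm_mono (hdom t)).trans ?_
    rw [ENNReal.ofReal_add hM hN]
    refine (eLpNorm_add_le (hu.memLp t).1.norm (hv.memLp t).1.norm (by norm_num)).trans ?_
    rw [eLpNorm_norm, eLpNorm_norm]
    exact add_le_add (hu.le t) (hv.le t)
  · rw [hQ]
    rcases eq_or_ne (u t x) (v t x) with h | h
    · simp [h]
    · exact div_mul_cancel₀ _ (sub_ne_zero.2 h)

lemma isCoeff_dualWeight {c δ m R : ℝ} (hc : 0 < c) (hδ : 0 < δ)
    (hδR : δ ≤ Real.exp (-(c * (|R| + 1)))) {q : ℝ → ℂ} (hq : Continuous q)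
    (hqR : ∀ x, R < |x| → q x = 0) (hqm : ∫ x, (‖q x‖ * coeffWeight ell x) ^ 2 ≤ m ^ 2) :
    IsCoeff (weightConst c) m (dualWeight c δ) (dualWeight1 c δ) ell q := by
  refine ⟨hq, ?_, hqm, fun x y hxy hy => dualWeight_le hc hδ (hδR.trans (Real.exp_le_exp.2 ?_))⟩
  · refine Continuous.memLp_of_hasCompactSupport (hq.norm.mul continuous_coeffWeight_ell) ?_
    refine HasCompactSupport.intro (isCompact_closedBall (0 : ℝ) R) fun x hx => ?_
    rw [mem_closedBall_zero_iff, Real.norm_eq_abs, not_le] at hx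
    rw [hqR x hx, norm_zero, zero_mul]
  · have h1 : |y| ≤ R := by
      by_contra h
      exact hy (hqR y (not_le.1 h))
    have h2 : -(|R| + 1) ≤ x := by
      have := (abs_le.1 hxy).1
      have := (abs_le.1 (h1.trans (le_abs_self R))).1
      linarith
    nlinarith

lemma energy_dualWeight_le {c δ : ℝ} (hδ : 0 ≤ δ) {G : ℝ → ℂ} (hG : Continuous G)
    (hGc : HasCompactSupport G) : energy (dualWeight c δ) G ≤ energy (dualWeight c 0) G := by
  have hi : ∀ {δ : ℝ}, 0 ≤ δ → Integrable fun x => ‖G x‖ ^ 2 * dualWeight c δ x := fun hδ => by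
    refine Continuous.integrable_of_hasCompactSupport ((hG.norm.pow 2).mul
      (continuous_of_hasDerivAt (hasDerivAt_dualWeight hδ))) ?_
    exact HasCompactSupport.mul_right (hGc.comp_left (g := fun z : ℂ => ‖z‖ ^ 2) (by simp))
  refine integral_mono (hi hδ) (hi le_rfl) fun x => ?_
  have := dualWeight_anti (c := c) hδ x
  simp only
  gcongr

lemma hasCompactSupport_schwartzDeriv_one {G : 𝓢(ℝ, ℂ)} (hG : HasCompactSupport G) :
    HasCompactSupport (schwartzDeriv 1 G) := by
  have : (schwartzDeriv 1 G : ℝ → ℂ) = deriv G :=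
    funext fun x => (hasDerivAt_schwartzDeriv 0 G x).deriv.symm
  rw [this]
  exact hG.deriv

/-- The difference of two weak solutions, tested with `θ(t) G(x)`. The regularizations are removed
in a fixed order: the coefficient is approximated by one of compact support, then the scale of the
mollifier is chosen, which determines the dual solution, and the truncation `δ` of the weight, on
which the dual solution does not depend, is chosen last. -/
lemma exists_tested_le (a b lam β : ℝ) {T c M : ℝ} (hT : 0 ≤ T) (hc : 0 < c) (hM : 0 < M) :
    ∃ D, 0 ≤ D ∧ ∀ {d : ℝ → ℝ} {u v : ℝ → ℝ → ℂ} {u₀ v₀ : ℝ → ℂ}, MemLp d ⊤ volume →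
      IsControlled M u → IsControlled M v → MemLp u₀ 2 volume → MemLp v₀ 2 volume →
      MemLp (fun x => (u₀ x - v₀ x) * √(dualWeight c 0 x)⁻¹) 2 volume →
      (∀ t, MemLp (fun x => (u t x - v t x) * √(dualWeight c 0 x)⁻¹) 2 volume) →
      (∀ t, √(∫ x, ‖u t x - v t x‖ ^ 2 * (dualWeight c 0 x)⁻¹) ≤ 2 * M) →
      IsWeakSolution a b lam β d u₀ T u → IsWeakSolution a b lam β d v₀ T v →
      ∀ G : 𝓢(ℝ, ℂ), HasCompactSupport G → ∀ θ : ℝ → ℝ, Continuous θ → (∀ t, 0 ≤ θ t) →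
      ‖∫ t, θ t * (∫ x, (u t x - v t x) * G x) ∂timeMeasure T‖ ≤
        D * √(energy (dualWeight c 0) G) *
          (√(∫ x, ‖u₀ x - v₀ x‖ ^ 2 * (dualWeight c 0 x)⁻¹) * (∫ s in 0..T, θ s)
          + (eLpNorm d ⊤ volume).toReal * ∫ t, √(∫ x, ‖u t x - v t x‖ ^ 2 * (dualWeight c 0 x)⁻¹)
              * (∫ s in t..T, θ s) ∂timeMeasure T) := by
  obtain ⟨D, hD, hbd⟩ := IsDualSolution.exists_bounds (weightConst c) (2 * M) a b lam β T (one_le_weightConst hc)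
    (by positivity) hT
  refine ⟨D, hD, fun {d u v u₀ v₀} hd hu hv hu₀ hv₀ hw₀κ hwκ hwR hsu hsv G hG θ hθ hθ0 => ?_⟩
  have hC := one_le_weightConst hc
  obtain ⟨Q, hQ, hQw⟩ := hu.exists_quotient hM.le hM.le hv
  have hw := hu.sub hM.le hM.le hv
  rw [← two_mul] at hQ hw
  obtain ⟨m, hm⟩ : ∃ m, m = 2 * M := ⟨_, rfl⟩
  rw [← hm] at hQ hw hwR hbd
  have hm0 : 0 < m := by rw [hm]; positivity
  obtain ⟨m₀, hm₀⟩ : ∃ m₀, m₀ = (eLpNorm (fun x => u₀ x - v₀ x) 2 volume).toReal := ⟨_, rfl⟩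
  have hm₀0 : 0 ≤ m₀ := hm₀ ▸ ENNReal.toReal_nonneg
  have hw₀ : MemLp (fun x => u₀ x - v₀ x) 2 volume := hu₀.sub hv₀
  have hw₀m : eLpNorm (fun x => u₀ x - v₀ x) 2 volume ≤ ENNReal.ofReal m₀ := by
    rw [hm₀, ENNReal.ofReal_toReal hw₀.2.ne]
  obtain ⟨ϑ, hϑ⟩ := (isCompact_Icc (a := 0) (b := T)).exists_bound_of_continuousOn hθ.continuousOn
  obtain ⟨N, hN⟩ : ∃ N, N = D * √(energy (dualWeight c 0) G) := ⟨_, rfl⟩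
  have hN0 : 0 ≤ N := by rw [hN]; positivity
  obtain ⟨A, hA⟩ : ∃ A, A = D * ((energy (dualWeight c 0) G
    + energy (dualWeight c 0) (schwartzDeriv 1 G)) * ϑ ^ 2) := ⟨_, rfl⟩
  obtain ⟨Θ, hΘ⟩ : ∃ Θ : ℝ → ℝ, ∀ t, Θ t = ∫ s in t..T, θ s := ⟨_, fun _ => rfl⟩
  have hΘc : Continuous Θ := by
    rw [funext hΘ]
    have : Continuous fun t => -∫ s in T..t, θ s :=
      (intervalIntegral.continuous_primitive (fun _ _ => hθ.intervalIntegrable _ _) T).neg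
    exact this.congr fun t => (intervalIntegral.integral_symm _ _).symm
  have hΘ0 : ∀ t ∈ Icc 0 T, 0 ≤ Θ t := fun t ht => by
    rw [hΘ]
    exact intervalIntegral.integral_nonneg ht.2 fun s _ => hθ0 s
  simp_rw [← hΘ]
  rw [← hN]
  obtain ⟨N', hN'⟩ : ∃ N', N' = (eLpNorm d ⊤ volume).toReal := ⟨_, rfl⟩
  obtain ⟨Y, hY⟩ : ∃ Y : ℝ → ℝ, ∀ t, Y t = √(∫ x, ‖u t x - v t x‖ ^ 2 * (dualWeight c 0 x)⁻¹) :=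
    ⟨_, fun _ => rfl⟩
  obtain ⟨y₀, hy₀⟩ : ∃ y₀, y₀ = √(∫ x, ‖u₀ x - v₀ x‖ ^ 2 * (dualWeight c 0 x)⁻¹) := ⟨_, rfl⟩
  have hy₀0 : 0 ≤ y₀ := hy₀ ▸ Real.sqrt_nonneg _
  have hmain0 : 0 ≤ ∫ t, Y t * Θ t ∂timeMeasure T := integral_nonneg_of_ae (by
    filter_upwards [ae_mem_Ioo_timeMeasure T] with t ht
    exact mul_nonneg (hY t ▸ Real.sqrt_nonneg _) (hΘ0 t (Ioo_subset_Icc_self ht)))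
  have hN'0 : 0 ≤ N' := hN' ▸ ENNReal.toReal_nonneg
  have hΘ00 := hΘ0 0 ⟨le_rfl, hT⟩
  -- It suffices to prove the estimate up to an arbitrarily small error.
  have key : ∀ η : ℝ, 0 < η → ‖∫ t, θ t * (∫ x, (u t x - v t x) * G x) ∂timeMeasure T‖ ≤
      N * (y₀ * Θ 0 + N' * ∫ t, Y t * Θ t ∂timeMeasure T)
        + η * (3 + weightConst c * m * √A) := by
    intro η hη
    obtain ⟨q, hqc, ⟨R, hqR⟩, ⟨B, hqB⟩, hqm, hQq⟩ :=
      exists_coeff_approx (T := T) hm0 hQ.measurable hQ.memLp hQ.le hη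
    have hB0 : 0 ≤ B := (norm_nonneg _).trans (hqB 0 0)
    have hq2 : ∀ t, MemLp (q t) 2 volume := fun t => by
      refine (q t).continuous.memLp_of_hasCompactSupport
        (HasCompactSupport.intro (isCompact_closedBall (0 : ℝ) R) fun x hx => ?_)
      rw [mem_closedBall_zero_iff, Real.norm_eq_abs, not_le] at hx
      exact hqR t x hx
    obtain ⟨δ₀, hδ₀⟩ : ∃ δ₀, δ₀ = Real.exp (-(c * (|R| + 1))) := ⟨_, rfl⟩
    have hδ₀0 : 0 < δ₀ := hδ₀ ▸ Real.exp_pos _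
    have hcoeff : ∀ {δ}, 0 < δ → δ ≤ δ₀ → ∀ t,
        IsCoeff (weightConst c) m (dualWeight c δ) (dualWeight1 c δ) ell (q t) :=
      fun hδ hle t => isCoeff_dualWeight hc hδ (hδ₀ ▸ hle) (q t).continuous (hqR t) (hqm t)
    -- A lower bound of the supremum weight on the support of the coefficient.
    obtain ⟨s, hs, hsw⟩ : ∃ s, 0 < s ∧ ∀ x, |x| ≤ R → s ≤ supWeight (dualWeight1 c δ₀) ell x := by
      have W := energyWeight_dualWeight hc hδ₀0
      have hcs : Continuous (supWeight (dualWeight1 c δ₀) ell) :=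
        (W.continuous_n.mul continuous_ell.sqrt).sqrt
      have hps : ∀ x, 0 < supWeight (dualWeight1 c δ₀) ell x := fun x =>
        Real.sqrt_pos.2 (mul_pos (W.pos_n x) (Real.sqrt_pos.2 (W.pos_ℓ x)))
      rcases lt_or_ge R 0 with hR | hR
      · exact ⟨1, one_pos, fun x hx => absurd ((abs_nonneg x).trans hx) (not_le.2 hR)⟩
      · obtain ⟨x₀, -, hx₀⟩ := (isCompact_Icc (a := -R) (b := R)).exists_isMinOn
          ⟨0, neg_nonpos.2 hR, hR⟩ hcs.continuousOn
        exact ⟨_, hps x₀, fun x hx => hx₀ (abs_le.1 hx)⟩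
    obtain ⟨K, hK⟩ : ∃ K, K = (B / s) ^ 2 * (2 * |R|) * A := ⟨_, rfl⟩
    obtain ⟨μ, hμ, hmol⟩ := exists_mollify_le hw.measurable hw.memLp_two (hw.memLp_strip T)
      (η := η / (√K + 1)) (by positivity)
    obtain ⟨j, hjc, hj, hjs, hj1⟩ := exists_mollifier (lt_min hμ one_pos) (min_le_right μ 1)
    obtain ⟨φ, Φ, Φt, S⟩ := exists_dualSolution a b lam β hT hqc hq2 j G hθ
    have hA' : ∀ {δ}, 0 < δ → D * ((energy (dualWeight c δ) G
        + energy (dualWeight c δ) (schwartzDeriv 1 G)) * ϑ ^ 2) ≤ A := fun hδ => by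
      rw [hA]
      have h1 := energy_dualWeight_le (c := c) hδ.le G.continuous hG
      have h2 := energy_dualWeight_le (c := c) hδ.le (schwartzDeriv 1 G).continuous
        (hasCompactSupport_schwartzDeriv_one hG)
      gcongr
    have hφδ : ∀ {δ}, 0 < δ → δ ≤ δ₀ →
        ∀ t ∈ Icc 0 T, √(energy (dualWeight c δ) (φ 0 t)) ≤ N * Θ t := by
      intro δ hδ hle t ht
      refine ((hbd (energyWeight_dualWeight hc hδ) hj hjc (hcoeff hδ hle) hθ S).1 t ht).trans ?_
      have h1 : ∫ s in t..T, |θ s| = Θ t := by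
        rw [hΘ]
        exact intervalIntegral.integral_congr fun s _ => abs_of_nonneg (hθ0 s)
      rw [h1, hN]
      have h2 := energy_dualWeight_le (c := c) hδ.le G.continuous hG
      have := hΘ0 t ht
      gcongr
    have hZδ : ∀ {δ}, 0 < δ → δ ≤ δ₀ → ∃ Z : ℝ → ℝ, Continuous Z ∧ (∀ t, 0 ≤ Z t) ∧
        (∀ t ∈ Icc 0 T, ∀ x, supWeight (dualWeight1 c δ) ell x * ‖zeta lam β φ t x‖ ≤ Z t) ∧
        ∫ t in 0..T, Z t ^ 2 ≤ A := by
      intro δ hδ hle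
      obtain ⟨Z, h1, h2, h3, h4⟩ := ((hbd (energyWeight_dualWeight hc hδ) hj hjc (hcoeff hδ hle)
        hθ S).2 ϑ hϑ)
      exact ⟨Z, h1, h2, h3, h4.trans (hA' hδ)⟩
    have hmolw := hmol j hj (fun x hx => hjs x ((min_le_left _ _).trans_lt hx)) hj1
      (fun t x => q t x * zeta lam β φ t x)
      ((continuous_uncurry_coeff hqc).mul S.continuous_zeta).measurable
      (fun t => by
        refine (((S.memLp_zeta t).const_mul (B : ℂ))).mono ((q t).continuous.mul
          (S.continuous_zeta_slice t)).aestronglyMeasurable (Eventually.of_forall fun x => ?_)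
        rw [norm_mul, norm_mul, Complex.norm_real]
        exact mul_le_mul ((hqB _ _).trans (le_abs_self B)) le_rfl (norm_nonneg _) (abs_nonneg B))
    have hE1 : ∫⁻ t, ‖(∫ x, (u t x - v t x) * (q t x * zeta lam β φ t x))
        - ∫ x, (u t x - v t x) * conv j (fun y => q t y * zeta lam β φ t y) x‖ₑ ∂timeMeasure T
        ≤ ENNReal.ofReal η := by
      refine hmolw.trans ?_
      obtain ⟨Z, hZ, hZ0, hzZ, hZA⟩ := hZδ hδ₀0 le_rfl
      have h1 := lintegral_mul_sq_le hT hs hB0 hqR hqB hsw hZ hZ0 hzZ hZA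
      rw [← hK] at h1
      have hK0 : 0 ≤ K := by
        have : 0 ≤ A := le_trans (intervalIntegral.integral_nonneg hT fun t _ => sq_nonneg _) hZA
        rw [hK]
        positivity
      calc _ ≤ ENNReal.ofReal (η / (√K + 1)) * ENNReal.ofReal K ^ (1 / 2 : ℝ) := by gcongr
        _ = ENNReal.ofReal (η / (√K + 1) * √K) := by
          rw [ENNReal.ofReal_rpow_of_nonneg hK0 (by norm_num), ← Real.sqrt_eq_rpow,
            ENNReal.ofReal_mul (by positivity)]
        _ ≤ _ := by
          refine ENNReal.ofReal_le_ofReal ?_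
          rw [div_mul_eq_mul_div, div_le_iff₀ (by positivity)]
          nlinarith [Real.sqrt_nonneg K]
    obtain ⟨Bz, hBz⟩ := S.exists_zeta_bound
    have hF : Integrable (Function.uncurry fun t x => Q t x * (u t x - v t x)) (stripMeasure T) :=
      (hQ.memLp_strip T).integrable_mul (hw.memLp_strip T)
    have hFm : Measurable (Function.uncurry fun t x => Q t x * (u t x - v t x)) :=
      hQ.measurable.measurable.mul hw.measurable.measurable
    obtain ⟨L, hL⟩ : ∃ L, L = N * (N' * m * ∫ t, Θ t ∂timeMeasure T) + N * (m₀ * Θ 0) := ⟨_, rfl⟩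
    -- The truncation parameter is chosen after the solution of the dual problem.
    obtain ⟨δ, hδ, hδle, hδF, hδL⟩ : ∃ δ, 0 < δ ∧ δ ≤ δ₀ ∧ ENNReal.ofReal Bz *
        (∫⁻ t, ∫⁻ x, {x | Real.exp (c * x) < δ}.indicator (fun x => ‖Q t x * (u t x - v t x)‖ₑ) x
          ∂volume ∂timeMeasure T) ≤ ENNReal.ofReal η ∧ √δ * L ≤ η := by
      have l1 := ENNReal.Tendsto.const_mul (a := ENNReal.ofReal Bz)
        (tendsto_lintegral_indicator_exp_lt (c := c) hFm hF) (Or.inr ENNReal.ofReal_ne_top)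
      rw [mul_zero] at l1
      have l2 : Tendsto (fun δ : ℝ => √δ * L) (𝓝[>] 0) (𝓝 0) := by
        have : Tendsto (fun δ : ℝ => √δ * L) (𝓝 0) (𝓝 (√0 * L)) :=
          (Real.continuous_sqrt.mul continuous_const).tendsto 0
        rw [Real.sqrt_zero, zero_mul] at this
        exact this.mono_left nhdsWithin_le_nhds
      have l3 : ∀ᶠ δ in 𝓝[>] (0 : ℝ), δ < δ₀ := nhdsWithin_le_nhds (gt_mem_nhds hδ₀0)
      obtain ⟨δ, h1, h2, h3, h4⟩ := ((l1.eventually_lt_const (ENNReal.ofReal_pos.2 hη)).and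
        ((l2.eventually_lt_const hη).and (l3.and self_mem_nhdsWithin))).exists
      exact ⟨δ, h4, h3.le, h1.le, h2.le⟩
    have W := energyWeight_dualWeight hc hδ
    obtain ⟨Bκ, -, hBκ, -⟩ := W.exists_bound
    obtain ⟨Z, hZ, hZ0, hzZ, hZA⟩ := hZδ hδ hδle
    have hE2 := lintegral_coeff_error_le (Q := Q) (q := fun t x => q t x)
      (w := fun t x => u t x - v t x) (z := zeta lam β φ) hT hc hδ hη.le hm0.le
      hQ.measurable.measurable (continuous_uncurry_coeff hqc).measurable
      hw.measurable.measurable (fun t x hx => hqR t x (by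
        by_contra h
        have h1 := (abs_le.1 ((not_lt.1 h).trans (le_abs_self R))).1
        have h2 : Real.exp (-(c * (|R| + 1))) ≤ Real.exp (c * x) :=
          Real.exp_le_exp.2 (by nlinarith)
        rw [← hδ₀] at h2
        exact absurd (hδle.trans h2) (not_le.2 hx))) hQq hw.le hZ hZ0 hzZ hZA hBz
    have hE3 := lintegral_damping_le (w := fun t x => u t x - v t x) hδ hm0.le hN0 hBκ hd
      hw.measurable hw.memLp_two hwκ hw.le_two hwR (S.memLp 0 (by norm_num)) hΘc hΘ0
      (hφδ hδ hδle)
    have hE4 := lintegral_mul_le_dualWeight hδ.le hw₀ hw₀κ (S.memLp 0 (by norm_num) 0) hm₀0 hw₀m hBκ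
    simp_rw [← hY] at hE3
    rw [← hN'] at hE3
    rw [← hy₀] at hE4
    have hE4' := hE4.trans (ENNReal.ofReal_le_ofReal (mul_le_mul_of_nonneg_left
      (hφδ hδ hδle 0 ⟨le_rfl, hT⟩) (by positivity)))
    have hsum := S.enorm_integral_sub_le hqc hqB hθ hu hv hd hu₀ hv₀ hsu hsv hQw
    have hIΘ : 0 ≤ ∫ t, Θ t ∂timeMeasure T := integral_nonneg_of_ae (by
      filter_upwards [ae_mem_Ioo_timeMeasure T] with t ht
      exact hΘ0 t (Ioo_subset_Icc_self ht))
    have hsum2 := hsum.trans (add_le_add (add_le_add (add_le_add hE1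
      (hE2.trans (add_le_add le_rfl hδF))) hE3) hE4')
    rw [← ENNReal.ofReal_add (by positivity) hη.le, ← ENNReal.ofReal_add hη.le (by positivity),
      ← ENNReal.ofReal_add (by positivity) (by positivity),
      ← ENNReal.ofReal_add (by positivity) (by positivity), ← ofReal_norm,
      ENNReal.ofReal_le_ofReal_iff (by positivity)] at hsum2
    refine hsum2.trans ?_
    rw [hL] at hδL
    nlinarith
  rw [← hy₀]
  simp_rw [← hY]
  rw [← hN']
  refine le_of_forall_pos_le_add fun ε hε => ?_
  have hpos : 0 < 3 + weightConst c * m * √A := by positivity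
  have := key (ε / (3 + weightConst c * m * √A)) (by positivity)
  rwa [div_mul_cancel₀ _ hpos.ne'] at this

end

section

/-! ### Representatives and weights -/

lemma norm_mul_coeffWeight_le (f : ℝ → ℂ) (x : ℝ) :
    ‖f x * coeffWeight ell x‖ ≤ 2 * ‖weighted (3 / 4) f x‖ := by
  rw [weighted, norm_mul, norm_mul, Complex.norm_real, Complex.norm_real,
    Real.norm_of_nonneg (coeffWeight_ell_pos x).le, Real.norm_of_nonneg (by positivity)]
  have := coeffWeight_ell_le x
  calc _ ≤ ‖f x‖ * (2 * (1 + max x 0) ^ (3 / 4 : ℝ)) := by gcongr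
    _ = _ := by ring

lemma MemL2.memLp_mul_coeffWeight {f : ℝ → ℂ} (hf : MemL2 (3 / 4) f) :
    MemLp (fun x => f x * coeffWeight ell x) 2 volume := by
  have hp : ∀ x : ℝ, 0 < 1 + max x 0 := fun x => by positivity
  have hc : Continuous fun x : ℝ => (((1 + max x 0) ^ (3 / 4 : ℝ) : ℝ) : ℂ) :=
    Complex.continuous_ofReal.comp ((by fun_prop : Continuous fun x : ℝ => 1 + max x 0).rpow_const
      fun x => Or.inl (hp x).ne')
  have hne : ∀ x : ℝ, (((1 + max x 0) ^ (3 / 4 : ℝ) : ℝ) : ℂ) ≠ 0 := fun x =>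
    Complex.ofReal_ne_zero.2 (Real.rpow_pos_of_pos (hp x) _).ne'
  have hfm : AEStronglyMeasurable f volume := by
    refine ((hc.inv₀ hne).aestronglyMeasurable.mul hf.1).congr (Eventually.of_forall fun x => ?_)
    exact inv_mul_cancel_left₀ (hne x) (f x)
  refine (hf.norm.const_mul 2).mono (hfm.mul (Complex.continuous_ofReal.comp
    continuous_coeffWeight_ell).aestronglyMeasurable) (Eventually.of_forall fun x => ?_)
  exact (norm_mul_coeffWeight_le f x).trans (Real.le_norm_self _)

lemma memLp_of_mul_coeffWeight {f : ℝ → ℂ}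
    (hf : MemLp (fun x => f x * coeffWeight ell x) 2 volume) {k : ℝ → ℝ} (hk : Continuous k)
    (h : ∀ x, |k x| ≤ coeffWeight ell x) : MemLp (fun x => f x * k x) 2 volume := by
  have hne : ∀ x : ℝ, (coeffWeight ell x : ℂ) ≠ 0 := fun x =>
    Complex.ofReal_ne_zero.2 (coeffWeight_ell_pos x).ne'
  have hfm : AEStronglyMeasurable f volume := by
    refine (hf.1.mul ((Complex.continuous_ofReal.comp continuous_coeffWeight_ell).inv₀
      hne).aestronglyMeasurable).congr (Eventually.of_forall fun x => ?_)
    exact mul_inv_cancel_right₀ (hne x) (f x)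
  refine hf.mono (hfm.mul (Complex.continuous_ofReal.comp hk).aestronglyMeasurable)
    (Eventually.of_forall fun x => ?_)
  rw [norm_mul, norm_mul, Complex.norm_real, Complex.norm_real,
    Real.norm_of_nonneg (coeffWeight_ell_pos x).le]
  exact mul_le_mul_of_nonneg_left (h x) (norm_nonneg _)

lemma sqrt_inv_dualWeight_le (c x : ℝ) : √(dualWeight c 0 x)⁻¹ ≤ coeffWeight ell x :=
  Real.sqrt_le_iff.2 ⟨(coeffWeight_ell_pos x).le, inv_dualWeight_zero_le x⟩

lemma continuous_sqrt_inv_dualWeight (c : ℝ) : Continuous fun x => √(dualWeight c 0 x)⁻¹ :=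
  ((continuous_of_hasDerivAt (hasDerivAt_dualWeight le_rfl)).inv₀
    fun x => (dualWeight_pos le_rfl x).ne').sqrt

lemma memLp_mul_sqrt_inv_dualWeight (c : ℝ) {f : ℝ → ℂ}
    (hf : MemLp (fun x => f x * coeffWeight ell x) 2 volume) :
    MemLp (fun x => f x * √(dualWeight c 0 x)⁻¹) 2 volume :=
  memLp_of_mul_coeffWeight hf (continuous_sqrt_inv_dualWeight c) fun x => by
    rw [abs_of_nonneg (Real.sqrt_nonneg _)]
    exact sqrt_inv_dualWeight_le c x

lemma memLp_two_of_mul_coeffWeight {f : ℝ → ℂ}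
    (hf : MemLp (fun x => f x * coeffWeight ell x) 2 volume) : MemLp f 2 volume := by
  have := memLp_of_mul_coeffWeight hf (k := fun _ => 1) continuous_const fun x => by
    rw [abs_one]
    exact one_le_coeffWeight_ell x
  simpa using this

lemma sqrt_integral_inv_dualWeight_le (c : ℝ) {M : ℝ} (hM : 0 ≤ M) {f : ℝ → ℂ}
    (hf : MemLp (fun x => f x * coeffWeight ell x) 2 volume)
    (hfM : eLpNorm (fun x => f x * coeffWeight ell x) 2 volume ≤ ENNReal.ofReal M) :
    √(∫ x, ‖f x‖ ^ 2 * (dualWeight c 0 x)⁻¹) ≤ M := by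
  rw [← ENNReal.ofReal_le_ofReal_iff hM, ← eLpNorm_mul_sqrt
    (fun x => (inv_pos.2 (dualWeight_pos le_rfl x)).le) (memLp_mul_sqrt_inv_dualWeight c hf)]
  refine (eLpNorm_mono fun x => ?_).trans hfM
  rw [norm_mul, norm_mul, Complex.norm_real, Complex.norm_real,
    Real.norm_of_nonneg (coeffWeight_ell_pos x).le, Real.norm_of_nonneg (Real.sqrt_nonneg _)]
  exact mul_le_mul_of_nonneg_left (sqrt_inv_dualWeight_le c x) (norm_nonneg _)

lemma ae_slice_eq {T : ℝ} {u v : ℝ → ℝ → ℂ}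
    (h : Function.uncurry u =ᵐ[stripMeasure T] Function.uncurry v) :
    ∀ᵐ t ∂timeMeasure T, u t =ᵐ[volume] v t :=
  Measure.ae_ae_of_ae_prod h

/-- A function in `L_∞(0, T; L₂^(3/4))` has a measurable representative whose weighted norm is
bounded at all times. -/
lemma exists_isControlled {T M : ℝ} {u : ℝ → ℝ → ℂ} (hu : MemLinftyL2 T (3 / 4) u)
    (huM : linftyNorm T (3 / 4) u ≤ ENNReal.ofReal M) :
    ∃ v, IsControlled (2 * M) v ∧ Function.uncurry u =ᵐ[stripMeasure T] Function.uncurry v := by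
  obtain ⟨f, hf, hfu⟩ := hu.1
  obtain ⟨g, hg⟩ : ∃ g : ℝ → ℝ → ℂ, ∀ t x, g t x = f (t, x) := ⟨_, fun _ _ => rfl⟩
  have hgf : Function.uncurry g = f := funext fun p => hg p.1 p.2
  rw [← hgf] at hf hfu
  have hcw := continuous_coeffWeight_ell
  have hm : Measurable fun p : ℝ × ℝ => ‖g p.1 p.2 * coeffWeight ell p.2‖ₑ ^ 2 :=
    ((hf.measurable.mul (Complex.measurable_ofReal.comp
      (hcw.measurable.comp measurable_snd))).enorm).pow_const 2
  have hsq : ∀ t, ∫⁻ x, ‖g t x * coeffWeight ell x‖ₑ ^ 2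
      = eLpNorm (fun x => g t x * coeffWeight ell x) 2 volume ^ 2 := fun t =>
    lintegral_enorm_sq_eq _
  obtain ⟨S, hS⟩ : ∃ S : Set ℝ, S = {t | ∫⁻ x, ‖g t x * coeffWeight ell x‖ₑ ^ 2 ≤
      ENNReal.ofReal (2 * M) ^ 2} := ⟨_, rfl⟩
  have hSm : MeasurableSet S := by
    rw [hS]
    exact measurableSet_le (hm.lintegral_prod_right' (ν := volume)) measurable_const
  have hSle : ∀ t ∈ S, eLpNorm (fun x => g t x * coeffWeight ell x) 2 volume ≤
      ENNReal.ofReal (2 * M) := fun t ht => by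
    rw [hS, mem_ofPred_eq, hsq] at ht
    exact (ENNReal.pow_le_pow_left_iff two_ne_zero).1 ht
  have hSae : ∀ᵐ t ∂timeMeasure T, t ∈ S := by
    have hfu' : Function.uncurry u =ᵐ[stripMeasure T] Function.uncurry g := hfu
    filter_upwards [ae_slice_eq hfu', ENNReal.ae_le_essSup (μ := timeMeasure T)
      (fun t => weightedNorm (3 / 4) (u t))] with t h1 h2
    rw [hS, mem_ofPred_eq, hsq]
    gcongr
    have h3 : eLpNorm (fun x => g t x * coeffWeight ell x) 2 volume
        = eLpNorm (fun x => u t x * coeffWeight ell x) 2 volume :=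
      eLpNorm_congr_ae (h1.symm.mono fun x hx => by simp only [hx])
    rw [h3, ENNReal.ofReal_mul zero_le_two]
    refine (eLpNorm_le_mul_eLpNorm_of_ae_le_mul
      (Eventually.of_forall (norm_mul_coeffWeight_le (u t))) 2).trans ?_
    exact mul_le_mul_right (h2.trans huM) _
  have hv : ∀ t x, (S.indicator g t) x = (Prod.fst ⁻¹' S).indicator (Function.uncurry g) (t, x) := by
    intro t x
    by_cases h : t ∈ S <;> simp [Set.indicator, h]
  have hvm : StronglyMeasurable (Function.uncurry (S.indicator g)) := by
    have : Function.uncurry (S.indicator g) = (Prod.fst ⁻¹' S).indicator (Function.uncurry g) :=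
      funext fun p => hv p.1 p.2
    rw [this]
    exact hf.indicator (measurable_fst hSm)
  have hle : ∀ t, eLpNorm (fun x => S.indicator g t x * coeffWeight ell x) 2 volume ≤
      ENNReal.ofReal (2 * M) := by
    intro t
    by_cases h : t ∈ S
    · rw [indicator_of_mem h]
      exact hSle t h
    · rw [indicator_of_notMem h]
      simp
  refine ⟨S.indicator g, ⟨hvm, fun t => ⟨?_, (hle t).trans_lt ENNReal.ofReal_lt_top⟩, hle⟩, ?_⟩
  · exact (hvm.measurable.comp measurable_prodMk_left).aestronglyMeasurable.mul
      (Complex.continuous_ofReal.comp hcw).aestronglyMeasurable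
  · filter_upwards [hfu, Measure.quasiMeasurePreserving_fst.ae hSae] with p h1 h2
    rw [h1, Function.uncurry_def, Function.uncurry_def]
    simp only
    rw [indicator_of_mem h2]

lemma IsWeakSolution.congr {a b lam β T : ℝ} {d : ℝ → ℝ} {u₀ : ℝ → ℂ} {u v : ℝ → ℝ → ℂ}
    (h : IsWeakSolution a b lam β d u₀ T u)
    (huv : Function.uncurry u =ᵐ[stripMeasure T] Function.uncurry v) :
    IsWeakSolution a b lam β d u₀ T v := by
  have hs := ae_slice_eq huv
  refine ⟨⟨h.1.1.congr huv, ?_⟩, fun φ φt φ₁ φ₂ φ₃ hφ => ?_⟩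
  · have : linftyNorm T 0 v = linftyNorm T 0 u := by
      refine essSup_congr_ae (hs.mono fun t ht => ?_)
      exact eLpNorm_congr_ae (ht.mono fun x hx => by simp only [weighted, hx])
    rw [this]
    exact h.1.2
  · rw [← h.2 φ φt φ₁ φ₂ φ₃ hφ]
    congr 1
    refine integral_congr_ae ((show ∀ᵐ t ∂volume.restrict (Ioo 0 T), u t =ᵐ[volume] v t from
      hs).mono fun t ht => integral_congr_ae (ht.mono fun x hx => ?_))
    simp only [hx]

/-! ### The estimate in the weight of the dual problem -/

/-- Stability of weak solutions in `L₂` with the reciprocal of the dual weight. -/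
lemma exists_ae_sqrt_integral_sub_le (a b lam β : ℝ) {d : ℝ → ℝ} (hd : MemLp d ⊤ volume) {T c M : ℝ}
    (hT : 0 ≤ T) (hc : 0 < c) (hM : 0 < M) :
    ∃ K, 0 ≤ K ∧ ∀ {u v : ℝ → ℝ → ℂ} {u₀ v₀ : ℝ → ℂ}, IsControlled M u → IsControlled M v →
      MemL2 (3 / 4) u₀ → MemL2 (3 / 4) v₀ →
      IsWeakSolution a b lam β d u₀ T u → IsWeakSolution a b lam β d v₀ T v →
      ∀ᵐ t ∂timeMeasure T, √(∫ x, ‖u t x - v t x‖ ^ 2 * (dualWeight c 0 x)⁻¹) ≤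
        K * √(∫ x, ‖u₀ x - v₀ x‖ ^ 2 * (dualWeight c 0 x)⁻¹) := by
  obtain ⟨D, hD, h⟩ := exists_tested_le a b lam β hT hc hM
  refine ⟨2 * D * Real.exp ((2 * (D * (eLpNorm d ⊤ volume).toReal) + 1) * T), by positivity,
    fun {u v u₀ v₀} hu hv hu₀ hv₀ hsu hsv => ?_⟩
  have hw := hu.sub hM.le hM.le hv
  rw [← two_mul] at hw
  have hwκ := fun t => memLp_mul_sqrt_inv_dualWeight c (hw.memLp t)
  have hwR := fun t => sqrt_integral_inv_dualWeight_le c (by positivity) (hw.memLp t) (hw.le t)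
  have hw₀ : MemLp (fun x => (u₀ x - v₀ x) * coeffWeight ell x) 2 volume := by
    simp_rw [sub_mul]
    exact hu₀.memLp_mul_coeffWeight.sub hv₀.memLp_mul_coeffWeight
  have := ae_sqrt_integral_le_of_tested (R := 2 * M) hT
    (continuous_of_hasDerivAt (hasDerivAt_dualWeight (c := c) le_rfl)) (dualWeight_pos le_rfl)
    hw.measurable hwκ hwR hw.memLp_two hw.le_two hD
    (ENNReal.toReal_nonneg (a := eLpNorm d ⊤ volume))
    (Real.sqrt_nonneg (∫ x, ‖u₀ x - v₀ x‖ ^ 2 * (dualWeight c 0 x)⁻¹)) fun G hG θ hθ hθ0 =>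
      (Complex.re_le_norm _).trans (h hd hu hv
        (memLp_two_of_mul_coeffWeight hu₀.memLp_mul_coeffWeight)
        (memLp_two_of_mul_coeffWeight hv₀.memLp_mul_coeffWeight)
        (memLp_mul_sqrt_inv_dualWeight c hw₀) hwκ hwR hsu hsv G hG θ hθ hθ0)
  filter_upwards [this] with t ht
  refine ht.trans_eq ?_
  ring

lemma weightedMass_congr {ρ : ℝ → ℝ} {f g : ℝ → ℂ} (h : f =ᵐ[volume] g) :
    weightedMass ρ f = weightedMass ρ g :=
  lintegral_congr_ae (h.mono fun x hx => by simp only [hx])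

lemma weightedMass_le_mul {ρ σ : ℝ → ℝ} {K : ℝ} (hK : 0 ≤ K) (h : ∀ x, ρ x ≤ K * σ x) (f : ℝ → ℂ) :
    weightedMass ρ f ≤ ENNReal.ofReal K * weightedMass σ f := by
  rw [weightedMass, weightedMass, ← lintegral_const_mul' _ _ ENNReal.ofReal_ne_top]
  refine lintegral_mono fun x => ?_
  rw [← ENNReal.ofReal_mul hK]
  refine ENNReal.ofReal_le_ofReal ?_
  calc ‖f x‖ ^ 2 * ρ x ≤ ‖f x‖ ^ 2 * (K * σ x) := by
        have := h x
        gcongr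
    _ = _ := by ring

lemma weightedMass_inv_dualWeight (c : ℝ) {f : ℝ → ℂ}
    (hf : MemLp (fun x => f x * coeffWeight ell x) 2 volume) :
    weightedMass (fun x => (dualWeight c 0 x)⁻¹) f =
      ENNReal.ofReal (∫ x, ‖f x‖ ^ 2 * (dualWeight c 0 x)⁻¹) := by
  have hp : ∀ x, 0 ≤ (dualWeight c 0 x)⁻¹ := fun x => (inv_pos.2 (dualWeight_pos le_rfl x)).le
  have hi : Integrable fun x => ‖f x‖ ^ 2 * (dualWeight c 0 x)⁻¹ := by
    refine (memLp_mul_sqrt_inv_dualWeight c hf).norm.integrable_sq.congr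
      (Eventually.of_forall fun x => ?_)
    simp only
    rw [norm_mul, Complex.norm_real, Real.norm_of_nonneg (Real.sqrt_nonneg _), mul_pow,
      Real.sq_sqrt (hp x)]
  rw [ofReal_integral_eq_lintegral_ofReal hi (Eventually.of_forall fun x =>
    mul_nonneg (sq_nonneg _) (hp x))]
  rfl

/-- Stability of weak solutions in the weight of the statement. -/
lemma exists_essSup_weightedMass_le (a b lam β : ℝ) {d : ℝ → ℝ} (hd : MemLp d ⊤ volume) {T M ε : ℝ}
    (hT : 0 ≤ T) (hM : 0 < M) (hε : 0 < ε) :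
    ∃ C : ℝ≥0, ∀ ρ : ℝ → ℝ, IsWeight (3 / 4) ε ρ → ∀ u₀ v₀ : ℝ → ℂ, MemL2 (3 / 4) u₀ →
      MemL2 (3 / 4) v₀ → ∀ u v : ℝ → ℝ → ℂ, MemLinftyL2 T (3 / 4) u → MemLinftyL2 T (3 / 4) v →
      IsWeakSolution a b lam β d u₀ T u → IsWeakSolution a b lam β d v₀ T v →
      linftyNorm T (3 / 4) u ≤ ENNReal.ofReal M → linftyNorm T (3 / 4) v ≤ ENNReal.ofReal M →
      essSup (fun t => weightedMass ρ (fun x => u t x - v t x)) (timeMeasure T) ≤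
        (C : ℝ≥0∞) * weightedMass ρ (fun x => u₀ x - v₀ x) := by
  obtain ⟨K₁, hK₁, hρK⟩ := exists_weight_equiv hε
  obtain ⟨K, hK, h⟩ := exists_ae_sqrt_integral_sub_le a b lam β hd hT
    (c := 2 * ε) (by positivity) (M := 2 * M) (by positivity)
  refine ⟨(K₁ * (K ^ 2 * K₁)).toNNReal, fun ρ hρ u₀ v₀ hu₀ hv₀ u v hu hv hsu hsv huM hvM => ?_⟩
  obtain ⟨u', hu', huu⟩ := exists_isControlled hu huM
  obtain ⟨v', hv', hvv⟩ := exists_isControlled hv hvM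
  have hw := hu'.sub (by positivity) (by positivity) hv'
  have hw₀ : MemLp (fun x => (u₀ x - v₀ x) * coeffWeight ell x) 2 volume := by
    simp_rw [sub_mul]
    exact hu₀.memLp_mul_coeffWeight.sub hv₀.memLp_mul_coeffWeight
  refine essSup_le_of_ae_le _ ?_
  filter_upwards [h hu' hv' hu₀ hv₀ (hsu.congr huu) (hsv.congr hvv), ae_slice_eq huu,
    ae_slice_eq hvv] with t h1 h2 h3
  have e1 : weightedMass ρ (fun x => u t x - v t x) = weightedMass ρ (fun x => u' t x - v' t x) :=
    weightedMass_congr (by filter_upwards [h2, h3] with x h4 h5; rw [h4, h5])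
  have hi : ∀ f : ℝ → ℂ, 0 ≤ ∫ x, ‖f x‖ ^ 2 * (dualWeight (2 * ε) 0 x)⁻¹ := fun f =>
    integral_nonneg fun x => mul_nonneg (sq_nonneg _) (inv_pos.2 (dualWeight_pos le_rfl x)).le
  have h6 : ∫ x, ‖u' t x - v' t x‖ ^ 2 * (dualWeight (2 * ε) 0 x)⁻¹ ≤
      K ^ 2 * ∫ x, ‖u₀ x - v₀ x‖ ^ 2 * (dualWeight (2 * ε) 0 x)⁻¹ := by
    have h7 := pow_le_pow_left₀ (Real.sqrt_nonneg _) h1 2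
    rwa [mul_pow, Real.sq_sqrt (hi fun x => u' t x - v' t x),
      Real.sq_sqrt (hi fun x => u₀ x - v₀ x)] at h7
  calc weightedMass ρ (fun x => u t x - v t x)
      ≤ ENNReal.ofReal K₁ * weightedMass (fun x => (dualWeight (2 * ε) 0 x)⁻¹)
          (fun x => u' t x - v' t x) :=
        e1.trans_le (weightedMass_le_mul hK₁.le (fun x => (hρK ρ hρ x).1) _)
    _ ≤ ENNReal.ofReal K₁ * (ENNReal.ofReal (K ^ 2) *
          weightedMass (fun x => (dualWeight (2 * ε) 0 x)⁻¹) (fun x => u₀ x - v₀ x)) := by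
        rw [weightedMass_inv_dualWeight _ (hw.memLp t), weightedMass_inv_dualWeight _ hw₀,
          ← ENNReal.ofReal_mul (sq_nonneg K)]
        gcongr
    _ ≤ ENNReal.ofReal K₁ * (ENNReal.ofReal (K ^ 2) * (ENNReal.ofReal K₁ *
          weightedMass ρ (fun x => u₀ x - v₀ x))) := by
        gcongr
        exact weightedMass_le_mul hK₁.le (fun x => (hρK ρ hρ x).2) _
    _ = _ := by
        change _ = ENNReal.ofReal _ * _
        rw [ENNReal.ofReal_mul hK₁.le, ENNReal.ofReal_mul (sq_nonneg K)]
        ring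

/-- Uniqueness of weak solutions. -/
lemma uncurry_ae_eq_of_isWeakSolution {a b lam β : ℝ} {d : ℝ → ℝ} (hd : MemLp d ⊤ volume) {T : ℝ}
    (hT : 0 ≤ T) {u₀ : ℝ → ℂ} (hu₀ : MemL2 (3 / 4) u₀) {u v : ℝ → ℝ → ℂ}
    (hu : MemLinftyL2 T (3 / 4) u) (hv : MemLinftyL2 T (3 / 4) v)
    (hsu : IsWeakSolution a b lam β d u₀ T u) (hsv : IsWeakSolution a b lam β d u₀ T v) :
    Function.uncurry u =ᵐ[stripMeasure T] Function.uncurry v := by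
  obtain ⟨M, hM, huM, hvM⟩ : ∃ M : ℝ, 0 < M ∧ linftyNorm T (3 / 4) u ≤ ENNReal.ofReal M ∧
      linftyNorm T (3 / 4) v ≤ ENNReal.ofReal M := by
    refine ⟨(linftyNorm T (3 / 4) u).toReal + (linftyNorm T (3 / 4) v).toReal + 1, by positivity,
      ?_, ?_⟩
    · refine (ENNReal.ofReal_toReal hu.2.ne).symm.trans_le (ENNReal.ofReal_le_ofReal ?_)
      linarith [ENNReal.toReal_nonneg (a := linftyNorm T (3 / 4) v)]
    · refine (ENNReal.ofReal_toReal hv.2.ne).symm.trans_le (ENNReal.ofReal_le_ofReal ?_)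
      linarith [ENNReal.toReal_nonneg (a := linftyNorm T (3 / 4) u)]
  obtain ⟨K, -, h⟩ := exists_ae_sqrt_integral_sub_le a b lam β hd hT
    (c := 1) one_pos (M := 2 * M) (by positivity)
  obtain ⟨u', hu', huu⟩ := exists_isControlled hu huM
  obtain ⟨v', hv', hvv⟩ := exists_isControlled hv hvM
  have hw := hu'.sub (by positivity) (by positivity) hv'
  have key : ∀ᵐ t ∂timeMeasure T, ∀ᵐ x, u' t x = v' t x := by
    filter_upwards [h hu' hv' hu₀ hu₀ (hsu.congr huu) (hsv.congr hvv)] with t ht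
    have h0 : √(∫ x, ‖u' t x - v' t x‖ ^ 2 * (dualWeight 1 0 x)⁻¹) = 0 :=
      le_antisymm (ht.trans_eq (by simp)) (Real.sqrt_nonneg _)
    have hp : ∀ x, 0 ≤ (dualWeight 1 0 x)⁻¹ := fun x => (inv_pos.2 (dualWeight_pos le_rfl x)).le
    have hm := memLp_mul_sqrt_inv_dualWeight 1 (hw.memLp t)
    have h1 := eLpNorm_mul_sqrt hp hm
    rw [h0, ENNReal.ofReal_zero, eLpNorm_eq_zero_iff hm.1 two_ne_zero] at h1
    filter_upwards [h1] with x hx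
    have h2 : (√(dualWeight 1 0 x)⁻¹ : ℂ) ≠ 0 :=
      Complex.ofReal_ne_zero.2 (Real.sqrt_ne_zero'.2 (inv_pos.2 (dualWeight_pos le_rfl x)))
    exact sub_eq_zero.1 ((mul_eq_zero.1 hx).resolve_right h2)
  have hmeas : MeasurableSet {p : ℝ × ℝ | u' p.1 p.2 = v' p.1 p.2} :=
    measurableSet_eq_fun hu'.measurable.measurable hv'.measurable.measurable
  have h3 : ∀ᵐ p ∂stripMeasure T, u' p.1 p.2 = v' p.1 p.2 :=
    (Measure.ae_prod_iff_ae_ae hmeas).2 key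
  filter_upwards [huu, hvv, h3] with p h4 h5 h6
  rw [h4, h5]
  exact h6

end

end HNLS

end

theorem theorem4p1 (a b lam β : ℝ) (d : ℝ → ℝ) (hd : MemLp d ⊤ volume) (T : ℝ) (hT : 0 < T) :
    (∀ M : ℝ, 0 < M → ∀ ε : ℝ, 0 < ε → ∃ c : ℝ≥0, ∀ ρ : ℝ → ℝ, HNLS.IsWeight (3 / 4) ε ρ →
      ∀ u₀ v₀ : ℝ → ℂ, HNLS.MemL2 (3 / 4) u₀ → HNLS.MemL2 (3 / 4) v₀ →
      ∀ u v : ℝ → ℝ → ℂ,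
        HNLS.MemLinftyL2 T (3 / 4) u → HNLS.MemLinftyL2 T (3 / 4) v →
        HNLS.IsWeakSolution a b lam β d u₀ T u → HNLS.IsWeakSolution a b lam β d v₀ T v →
        HNLS.linftyNorm T (3 / 4) u ≤ ENNReal.ofReal M →
        HNLS.linftyNorm T (3 / 4) v ≤ ENNReal.ofReal M →
        essSup (fun t => HNLS.weightedMass ρ (fun x => u t x - v t x)) (HNLS.timeMeasure T) ≤
          (c : ℝ≥0∞) * HNLS.weightedMass ρ (fun x => u₀ x - v₀ x)) ∧
    (∀ u₀ : ℝ → ℂ, HNLS.MemL2 (3 / 4) u₀ →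
      ∀ u v : ℝ → ℝ → ℂ,
        HNLS.MemLinftyL2 T (3 / 4) u → HNLS.MemLinftyL2 T (3 / 4) v →
        HNLS.IsWeakSolution a b lam β d u₀ T u → HNLS.IsWeakSolution a b lam β d u₀ T v →
        Function.uncurry u =ᵐ[HNLS.stripMeasure T] Function.uncurry v) :=
  ⟨fun _ hM _ hε => HNLS.exists_essSup_weightedMass_le a b lam β hd hT.le hM hε,
    fun _ hu₀ _ _ hu hv hsu hsv =>
      HNLS.uncurry_ae_eq_of_isWeakSolution hd hT.le hu₀ hu hv hsu hsv⟩
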